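/- Write $(a\cdot\nabla)b=\sum_i a_i\partial_i b$, and for a vector field $u_0$ on $\mathbb R^2$ let $$e^{\Delta}u_0(y)=\int_{\mathbb R^2}\frac1{4\pi}e^{-|y-z|^2/4}\,u_0(z)\,dz .$$ Let $0<\beta\le 1$ and $A\ge 0$. There is a constant $C=C(A,\beta)$, depending only on $A$ and $\beta$, with the following property. Let $u_0$ be a vector field on $\mathbb R^2$ that is self-similar, i.e. $\lambda u_0(\lambda x)=u_0(x)$ for all $\lambda>0$ and $x\ne0$, that is divergence-free in the sense of distributions on $\mathbb R^2$, and that is Hölder continuous on the unit circle with $$\|u_0\|_{C^{0,\beta}(S^1)}=\sup_{S^1}|u_0|+\sup_{x\ne x'\in S^1}\frac{|u_0(x)-u_0(x')|}{|x-x'|^\beta}\le A .$$ Put $v_0=e^{\Delta}u_0$. Let $v_{\rm re}\in C^1(\mathbb R^2;\mathbb R^2)$ satisfy $$\sup_{x}(1+|x|^2)\bigl(|v_{\rm re}(x)|+|\nabla v_{\rm re}(x)|\bigr)<\infty ,$$ and suppose that, for some pressure $q\in L^1_{loc}(\mathbb R^2)$, it solves the perturbed Leray system $$-\Delta v_{\rm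 re}-\tfrac12 v_{\rm re}-\tfrac12\,y\cdot\nabla v_{\rm re}+v_0\cdot\nabla v_{\rm re}+v_{\rm re}\cdot\nabla v_0+v_{\rm re}\cdot\nabla v_{\rm re}+\nabla q=-v_0\cdot\nabla v_0,\qquad \operatorname{div}v_{\rm re}=0$$ in $\mathbb R^2$ in the sense of distributions (for instance, $v_{\rm re}=u(\cdot,1)-v_0$ for a self-similar solution $u(x,t)=t^{-1/2}v(x/\sqrt t)$ of the two-dimensional Navier–Stokes equations with initial data $u_0$ for which this difference has the stated regularity and decay). Then $v_{\rm re}$ and $\sqrt{1+|y|^2}\,v_{\rm re}$ belong to $H^2(\mathbb R^2)$, and $$\|v_{\rm re}\|_{H^2(\mathbb R^2)}\le C(A,\beta),\qquad \bigl\|\sqrt{1+|y|^2}\,v_{\rm re}\bigr\|_{H^2(\mathbb R^2)}\le C(A,\beta).$$ -/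

import Mathlib

open MeasureTheory
open scoped NNReal ContDiff

namespace PerturbedLeray

/-- The Euclidean plane. -/
abbrev Plane : Type := EuclideanSpace ℝ (Fin 2)

/-- The `i`-th standard basis vector of the plane. -/
noncomputable def e (i : Fin 2) : Plane := EuclideanSpace.single i (1 : ℝ)

/-- The classical divergence `∂₁ v₁ + ∂₂ v₂` of a vector field. -/
noncomputable def divergence (v : Plane → Plane) (x : Plane) : ℝ :=
  ∑ i : Fin 2, (fderiv ℝ v x (e i)) i

/-- The directional derivative `(a · ∇) b = ∑ i, aᵢ ∂ᵢ b` of a vector field `b` along `a`. -/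
noncomputable def convect (a b : Plane → Plane) (x : Plane) : Plane :=
  fderiv ℝ b x (a x)

/-- The contraction `∇v : ∇w = ∑ i, ∑ j, ∂ᵢ vⱼ ∂ᵢ wⱼ`. -/
noncomputable def gradInner (v w : Plane → Plane) (x : Plane) : ℝ :=
  ∑ i : Fin 2, inner ℝ (fderiv ℝ v x (e i)) (fderiv ℝ w x (e i))

/-! ### Initial data -/

/-- Self-similarity (homogeneity of degree `-1`): `lam * u₀ (lam x) = u₀ x` for all `lam > 0` and
all `x ≠ 0`. -/
def IsSelfSimilar (u₀ : Plane → Plane) : Prop :=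
  ∀ lam : ℝ, 0 < lam → ∀ x : Plane, x ≠ 0 → lam • u₀ (lam • x) = u₀ x

/-- `div u₀ = 0` in the sense of distributions on the whole plane. (For fields that are
homogeneous of degree `-1` and continuous away from the origin, this says that `u₀` is divergence
free away from the origin and has zero flux through the unit circle.) -/
def IsWeaklyDivFree (u₀ : Plane → Plane) : Prop :=
  ∀ ψ : Plane → ℝ, ContDiff ℝ ∞ ψ → HasCompactSupport ψ →
    ∫ x, fderiv ℝ ψ x (u₀ x) = 0

/-- The norm of `C^{0,β}(S¹)`: the supremum of `|u₀|` on the unit circle plus the `β`-Hölder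
seminorm of the restriction of `u₀` to the unit circle (infinite if `u₀` is not in the space). -/
noncomputable def circleHolderNorm (β : ℝ≥0) (u₀ : Plane → Plane) : ENNReal :=
  (⨆ x : Metric.sphere (0 : Plane) 1, ‖u₀ x‖ₑ) +
    eHolderNorm β (fun x : Metric.sphere (0 : Plane) 1 => u₀ x)

/-- The solution `e^{tΔ} u₀` of the heat equation on the plane. -/
noncomputable def heatFlow (t : ℝ) (u₀ : Plane → Plane) (x : Plane) : Plane :=
  ∫ z, (1 / (4 * Real.pi * t) * Real.exp (-(‖x - z‖ ^ 2) / (4 * t))) • u₀ z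

/-! ### The perturbed Leray system -/

/-- The space `X` of `C¹` divergence-free fields `v` with
`sup (1 + |x|²) |v| + sup (1 + |x|²) |∇v| < ∞`. -/
structure MemX (v : Plane → Plane) : Prop where
  contDiff : ContDiff ℝ 1 v
  div_eq_zero : ∀ x, divergence v x = 0
  bounded : ∃ M : ℝ, ∀ x,
    (1 + ‖x‖ ^ 2) * ‖v x‖ ≤ M ∧ (1 + ‖x‖ ^ 2) * ‖fderiv ℝ v x‖ ≤ M

/-- The pair `(v, q)` solves, in the sense of distributions on the plane, the momentum equation
`-Δv - v/2 - (y·∇v)/2 + v₀·∇v + v·∇v₀ + v·∇v + ∇q = - v₀·∇v₀`.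
It is meant for `C¹` fields `v`, `v₀`. -/
def SolvesMomentum (v₀ v : Plane → Plane) (q : Plane → ℝ) : Prop :=
  LocallyIntegrable q ∧
  ∀ φ : Plane → Plane, ContDiff ℝ ∞ φ → HasCompactSupport φ →
    ∫ y, (gradInner v φ y
        - (1 / 2) * inner ℝ (v y) (φ y)
        - (1 / 2) * inner ℝ (convect (fun z => z) v y) (φ y)
        + inner ℝ (convect v₀ v y + convect v v₀ y + convect v v y) (φ y)
        - q y * divergence φ y)
      = - ∫ y, inner ℝ (convect v₀ v₀ y) (φ y)

/-! ### The space `H²` -/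

/-- `g` is the weak partial derivative `∂ᵢ f`. It is meant for locally integrable `f`, `g`. -/
def IsWeakPartial (i : Fin 2) (f g : Plane → Plane) : Prop :=
  ∀ ψ : Plane → ℝ, ContDiff ℝ ∞ ψ → HasCompactSupport ψ →
    ∫ x, (fderiv ℝ ψ x (e i)) • f x = - ∫ x, ψ x • g x

/-- `f` belongs to `H²`, with weak first derivatives `∂ᵢ f = g i` and weak second derivatives
`∂ⱼ ∂ᵢ f = h i j`. -/
structure IsH2Jet (f : Plane → Plane) (g : Fin 2 → Plane → Plane)
    (h : Fin 2 → Fin 2 → Plane → Plane) : Prop where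
  memLp_zero : MemLp f 2
  memLp_one : ∀ i, MemLp (g i) 2
  memLp_two : ∀ i j, MemLp (h i j) 2
  weak_one : ∀ i, IsWeakPartial i f (g i)
  weak_two : ∀ i j, IsWeakPartial j (g i) (h i j)

/-- The `H²` norm `(‖f‖² + ∑ᵢ ‖∂ᵢ f‖² + ∑ᵢⱼ ‖∂ᵢ ∂ⱼ f‖²)^{1/2}` (norms of `L²`). The weak
derivatives being unique almost everywhere, the infimum is over one value if `f` is in `H²`; it is
over nothing, hence infinite, if `f` is not in `H²`. -/
noncomputable def eH2Norm (f : Plane → Plane) : ENNReal :=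
  ⨅ (g : Fin 2 → Plane → Plane) (h : Fin 2 → Fin 2 → Plane → Plane) (_ : IsH2Jet f g h),
    (eLpNorm f 2 volume ^ 2 + ∑ i, eLpNorm (g i) 2 volume ^ 2
      + ∑ i, ∑ j, eLpNorm (h i j) 2 volume ^ 2) ^ (1 / 2 : ℝ)

end PerturbedLeray

/-!
# `H²` bounds for self-similar perturbations of the heat flow in the plane

Write `b = e^Δ u₀`, `V = b + v` and `w = 1 + |x|²`. The perturbation `v` lies in a class with decay
`|v| + |∇v| ≤ M / w`, but `M` may enter the argument only qualitatively, to justify integrations by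
parts; the bounds have to depend on `b` alone.

**The background.** As `u₀` is homogeneous of degree `-1`, the integral `b = g * u₀` with the heat
kernel `g` converges absolutely, `b` decays like `|x|⁻¹`, and by `∫ ∇g = 0` and the Hölder continuity
of `u₀` its gradient decays like `|x|^{-1-β}`; it is therefore square integrable. Differentiating the
scaling relation of `b` gives `b + x · ∇b = -2 Δb`. This is `exists_isBackground`; from there on only
`IsBackground` is used.

**The energy estimate.** The whole of `V` solves a Leray system without a right-hand side. Testing it
with `V`, the cubic term drops out, and the equation for `b` turns the drift terms into gradients:
`∫ ∇v : (∇v + 2 ∇b) = 0`, that is, `‖∇V‖ = ‖∇b‖` (`l2_pd_le`). The pressure is needed in `L²` for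
this. `exists_pressure` constructs an `L²` pressure from
`‖D²η‖ ≤ ‖Δη‖` and the Riesz representation theorem, and identifies it with the given one up to a
function without gradient by Liouville's theorem.

**The weighted estimate.** Testing with `w^s v`, `s < 1`, the drift term produces
`(s/2) ∫ w^s |v|²` with a favourable sign. The remaining terms are quadratic in `(‖v‖, ‖w^{s/2} v‖)`
with a factor `‖v‖`, or linear in the weighted norm, because `‖v²‖ ≤ a ‖v‖` by Ladyzhenskaya's
inequality and the energy bound. The factor `‖v‖` is absorbed: at infinity by the weight, near the
origin by the `L⁴` bound. The constants do not depend on `s`, and `s → 1` gives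
`exists_weighted_bound`. The restriction `s < 1` makes all integrals finite a priori.

**The vorticity.** `ω = curl v` satisfies `Δω = div (curl V · V - (x/2) ω)`. The energy estimate for
its mollifications, localized by `θ ≈ √w`, bounds `√w ∇ω` in `L²`
(`exists_vorticity_gradient_bound`). As `-Δv` is the rotated gradient of `ω`, the Laplacians of `v`
and of `√w v` are bounded in `L²`, hence so are all their second derivatives (`exists_weak_hessian`,
`exists_h2_bound`).
-/

namespace PerturbedLeray

open Filter Topology

/-! ### Partial derivatives of scalar functions on the plane -/

/-- The partial derivative `∂ᵢ f` of a scalar function on the plane. -/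
noncomputable def pd (i : Fin 2) (f : Plane → ℝ) (x : Plane) : ℝ := fderiv ℝ f x (e i)

theorem pd_add {f g : Plane → ℝ} (hf : Differentiable ℝ f) (hg : Differentiable ℝ g) (i : Fin 2)
    (x : Plane) : pd i (fun y => f y + g y) x = pd i f x + pd i g x := by
  simp [pd, fderiv_fun_add (hf x) (hg x)]

theorem pd_sub {f g : Plane → ℝ} (hf : Differentiable ℝ f) (hg : Differentiable ℝ g) (i : Fin 2)
    (x : Plane) : pd i (fun y => f y - g y) x = pd i f x - pd i g x := by
  simp [pd, fderiv_fun_sub (hf x) (hg x)]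

theorem pd_mul {f g : Plane → ℝ} (hf : Differentiable ℝ f) (hg : Differentiable ℝ g) (i : Fin 2)
    (x : Plane) : pd i (fun y => f y * g y) x = pd i f x * g x + f x * pd i g x := by
  simp [pd, fderiv_fun_mul (hf x) (hg x)]; ring

theorem pd_pow_two {f : Plane → ℝ} (hf : Differentiable ℝ f) (i : Fin 2)
    (x : Plane) : pd i (fun y => f y ^ 2) x = 2 * f x * pd i f x := by
  simp only [pow_two, pd_mul hf hf]; ring

theorem pd_neg (f : Plane → ℝ) (i : Fin 2) (x : Plane) :
    pd i (fun y => -f y) x = -pd i f x := by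
  simp [pd, fderiv_fun_neg]

theorem pd_const_mul {f : Plane → ℝ} (hf : Differentiable ℝ f) (c : ℝ) (i : Fin 2)
    (x : Plane) : pd i (fun y => c * f y) x = c * pd i f x := by
  simp [pd, fderiv_const_mul (hf x)]

theorem pd_const (c : ℝ) (i : Fin 2) (x : Plane) : pd i (fun _ => c) x = 0 := by simp [pd]

theorem pd_coord (i j : Fin 2) (x : Plane) :
    pd i (fun y : Plane => y j) x = if i = j then 1 else 0 := by
  have : (fun y : Plane => y j) = ⇑(EuclideanSpace.proj j : Plane →L[ℝ] ℝ) := rfl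
  rw [pd, this, ContinuousLinearMap.fderiv]
  simp [e, eq_comm]

theorem differentiable_coord (j : Fin 2) : Differentiable ℝ (fun y : Plane => y j) :=
  (EuclideanSpace.proj j : Plane →L[ℝ] ℝ).differentiable

theorem contDiff_coord (j : Fin 2) {n : WithTop ℕ∞} : ContDiff ℝ n (fun y : Plane => y j) :=
  (EuclideanSpace.proj j : Plane →L[ℝ] ℝ).contDiff

theorem _root_.ContDiff.pd {f : Plane → ℝ} {m n : WithTop ℕ∞} (hf : ContDiff ℝ n f)
    (h : m + 1 ≤ n) (i : Fin 2) : ContDiff ℝ m (pd i f) :=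
  (hf.fderiv_right h).clm_apply contDiff_const

theorem contDiff_pd {f : Plane → ℝ} (hf : ContDiff ℝ ∞ f) (i : Fin 2) : ContDiff ℝ ∞ (pd i f) :=
  hf.pd (by simp) i

theorem continuous_pd {f : Plane → ℝ} (hf : ContDiff ℝ 1 f) (i : Fin 2) : Continuous (pd i f) :=
  (hf.pd (m := 0) (by simp) i).continuous

theorem _root_.HasCompactSupport.pd {f : Plane → ℝ} (hf : HasCompactSupport f) (i : Fin 2) :
    HasCompactSupport (pd i f) := hf.fderiv_apply ℝ (e i)

theorem pd_eq_zero_of_notMem {f : Plane → ℝ} {x : Plane} (hx : x ∉ tsupport f) (i : Fin 2) :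
    pd i f x = 0 := by
  by_contra h
  exact hx (tsupport_fderiv_subset ℝ (subset_tsupport _ fun h0 => h (by simp [pd, h0])))

theorem pd_comm {f : Plane → ℝ} (hf : ContDiff ℝ 2 f) (i j : Fin 2) (x : Plane) :
    pd i (pd j f) x = pd j (pd i f) x := by
  have hd : Differentiable ℝ (fderiv ℝ f) :=
    (hf.fderiv_right (m := 1) (by norm_num)).differentiable one_ne_zero
  have key : ∀ k l : Fin 2, pd k (pd l f) x = fderiv ℝ (fderiv ℝ f) x (e k) (e l) := by
    intro k l
    have : pd l f = fun y => fderiv ℝ f y (e l) := rfl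
    rw [this, pd, fderiv_clm_apply (hd x) (differentiableAt_const _)]
    simp
  rw [key, key]
  exact (hf.contDiffAt.isSymmSndFDerivAt (by simp)) _ _

theorem norm_e (i : Fin 2) : ‖e i‖ = 1 := by simp [e]

theorem decomp (x : Plane) : x = x 0 • e 0 + x 1 • e 1 := by
  ext i; fin_cases i <;> simp [e]

theorem fderiv_apply_eq (f : Plane → ℝ) (x y : Plane) :
    fderiv ℝ f x y = y 0 * pd 0 f x + y 1 * pd 1 f x := by
  conv_lhs => rw [decomp y]
  simp [pd]

theorem norm_fderiv_le (f : Plane → ℝ) (x : Plane) :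
    ‖fderiv ℝ f x‖ ≤ |pd 0 f x| + |pd 1 f x| := by
  refine ContinuousLinearMap.opNorm_le_bound _ (by positivity) fun y => ?_
  rw [fderiv_apply_eq, Real.norm_eq_abs]
  have h0 : |y 0| ≤ ‖y‖ := by simpa using PiLp.norm_apply_le y 0
  have h1 : |y 1| ≤ ‖y‖ := by simpa using PiLp.norm_apply_le y 1
  calc |y 0 * pd 0 f x + y 1 * pd 1 f x| ≤ |y 0| * |pd 0 f x| + |y 1| * |pd 1 f x| := by
        rw [← abs_mul, ← abs_mul]; exact abs_add_le _ _
    _ ≤ ‖y‖ * |pd 0 f x| + ‖y‖ * |pd 1 f x| := by gcongr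
    _ = _ := by ring

/-! ### The weight `1 + ‖x‖²` -/

/-- The weight `1 + ‖x‖²`. -/
noncomputable def wt (x : Plane) : ℝ := 1 + ‖x‖ ^ 2

theorem wt_eq (x : Plane) : wt x = 1 + (x 0 ^ 2 + x 1 ^ 2) := by
  simp [wt, EuclideanSpace.norm_sq_eq, Fin.sum_univ_two]

theorem one_le_wt (x : Plane) : 1 ≤ wt x := by simp [wt]

theorem wt_pos (x : Plane) : 0 < wt x := by linarith [one_le_wt x]

theorem contDiff_wt {n : WithTop ℕ∞} : ContDiff ℝ n wt := contDiff_const.add (contDiff_norm_sq ℝ)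

theorem continuous_wt : Continuous wt := (contDiff_wt (n := 0)).continuous

theorem pd_wt (i : Fin 2) (x : Plane) : pd i wt x = 2 * x i := by
  have h : wt = fun x : Plane => 1 + (x 0 ^ 2 + x 1 ^ 2) := funext wt_eq
  have d0 := differentiable_coord 0
  have d1 := differentiable_coord 1
  have e1 : pd i (fun x : Plane => 1 + (x 0 ^ 2 + x 1 ^ 2)) x
      = pd i (fun x : Plane => x 0 ^ 2 + x 1 ^ 2) x := by simp [pd]
  rw [h, e1, pd_add (f := fun y : Plane => y 0 ^ 2) (g := fun y : Plane => y 1 ^ 2) (d0.pow 2) (d1.pow 2),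
    pd_pow_two d0, pd_pow_two d1, pd_coord, pd_coord]
  fin_cases i <;> simp

theorem abs_coord_le (i : Fin 2) (x : Plane) : |x i| ≤ √(wt x) := by
  apply Real.abs_le_sqrt
  rw [wt_eq]
  fin_cases i <;> simp <;> nlinarith [sq_nonneg (x 0), sq_nonneg (x 1)]

theorem one_le_sqrt_wt (x : Plane) : 1 ≤ √(wt x) := Real.one_le_sqrt.2 (one_le_wt x)

theorem norm_le_sqrt_wt (x : Plane) : ‖x‖ ≤ √(wt x) := by
  apply Real.le_sqrt_of_sq_le; simp [wt]

theorem sqrt_wt_le (x : Plane) : √(wt x) ≤ 1 + ‖x‖ := by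
  rw [Real.sqrt_le_left (by positivity), wt]; nlinarith [norm_nonneg x]

theorem contDiff_sqrt_wt {n : WithTop ℕ∞} : ContDiff ℝ n (fun x => √(wt x)) :=
  contDiff_wt.sqrt fun x => (wt_pos x).ne'

theorem continuous_sqrt_wt : Continuous (fun x => √(wt x)) :=
  (contDiff_sqrt_wt (n := 0)).continuous

theorem pd_sqrt_wt (i : Fin 2) (x : Plane) : pd i (fun x => √(wt x)) x = x i / √(wt x) := by
  have hd : DifferentiableAt ℝ wt x := (contDiff_wt (n := 1)).differentiable one_ne_zero x
  have := (hd.hasFDerivAt.sqrt (wt_pos x).ne').fderiv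
  have h2 : fderiv ℝ wt x (e i) = 2 * x i := pd_wt i x
  have hs := (Real.sqrt_pos.2 (wt_pos x)).ne'
  rw [pd, this]
  simp [h2]
  field_simp

theorem integrable_wt_rpow {r : ℝ} (hr : r < -1) : Integrable (fun x : Plane => wt x ^ r) := by
  have := integrable_rpow_neg_one_add_norm_sq (E := Plane) (μ := volume) (r := -2 * r)
    (by simp; linarith)
  refine this.congr (Filter.Eventually.of_forall fun x => ?_)
  simp only [wt]
  congr 1; ring

theorem integrable_wt_inv_sq : Integrable (fun x : Plane => (wt x ^ 2)⁻¹) := by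
  refine (integrable_wt_rpow (r := -2) (by norm_num)).congr (Filter.Eventually.of_forall fun x => ?_)
  simp only
  rw [Real.rpow_neg (wt_pos x).le]; norm_num

/-! ### Integration by parts -/

theorem integrable_fun_add {f g : Plane → ℝ} (hf : Integrable f) (hg : Integrable g) :
    Integrable fun x => f x + g x := hf.add hg

theorem integrable_fun_sub {f g : Plane → ℝ} (hf : Integrable f) (hg : Integrable g) :
    Integrable fun x => f x - g x := hf.sub hg

/-- Continuous functions that vanish off a compact set are integrable. -/
theorem integrable_of_eq_zero_off {f : Plane → ℝ} (hf : Continuous f) {S : Set Plane}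
    (hS : IsCompact S) (h : ∀ x ∉ S, f x = 0) : Integrable f :=
  hf.integrable_of_hasCompactSupport (HasCompactSupport.intro hS h)

theorem integral_mul_pd_of_integrable {f g : Plane → ℝ} (i : Fin 2) (hf : Differentiable ℝ f)
    (hg : Differentiable ℝ g) (h1 : Integrable fun x => pd i f x * g x)
    (h2 : Integrable fun x => f x * pd i g x) (h3 : Integrable fun x => f x * g x) :
    ∫ x, f x * pd i g x = -∫ x, pd i f x * g x :=
  integral_mul_fderiv_eq_neg_fderiv_mul_of_integrable h1 h2 h3 (fun x _ => hf x) (fun x _ => hg x)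

theorem integral_mul_pd {f g : Plane → ℝ} (i : Fin 2) (hf : ContDiff ℝ 1 f)
    (hg : ContDiff ℝ 1 g) (hc : HasCompactSupport g) :
    ∫ x, f x * pd i g x = -∫ x, pd i f x * g x := by
  refine integral_mul_pd_of_integrable i (hf.differentiable one_ne_zero)
    (hg.differentiable one_ne_zero) ?_ ?_ ?_
  · exact ((continuous_pd hf i).mul hg.continuous).integrable_of_hasCompactSupport hc.mul_left
  · exact (hf.continuous.mul (continuous_pd hg i)).integrable_of_hasCompactSupport (hc.pd i).mul_left
  · exact (hf.continuous.mul hg.continuous).integrable_of_hasCompactSupport hc.mul_left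

theorem integral_pd_eq_zero {f : Plane → ℝ} (i : Fin 2) (hf : ContDiff ℝ 1 f)
    (hc : HasCompactSupport f) : ∫ x, pd i f x = 0 := by
  have := integral_mul_pd i (contDiff_const (c := (1 : ℝ))) hf hc
  simpa [pd] using this

/-- The divergence theorem in the form used for all integrations by parts: two integrands that
differ by the divergence of a compactly supported `C¹` field have the same integral. -/
theorem integral_eq_of_sub_eq_div {f g H₀ H₁ : Plane → ℝ} (hf : Integrable f) (hg : Integrable g)
    (h0 : ContDiff ℝ 1 H₀) (h1 : ContDiff ℝ 1 H₁) (c0 : HasCompactSupport H₀)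
    (c1 : HasCompactSupport H₁) (h : ∀ x, f x - g x = pd 0 H₀ x + pd 1 H₁ x) :
    ∫ x, f x = ∫ x, g x := by
  rw [← sub_eq_zero, ← integral_sub hf hg]
  simp_rw [h]
  rw [integral_add, integral_pd_eq_zero 0 h0 c0, integral_pd_eq_zero 1 h1 c1, add_zero]
  · exact (continuous_pd h0 0).integrable_of_hasCompactSupport (c0.pd 0)
  · exact (continuous_pd h1 1).integrable_of_hasCompactSupport (c1.pd 1)

/-! ### Cut-off functions -/

/-- A sequence of smooth cut-offs `χ n`, equal to one on the ball of radius `n + 1`, with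
`√(1 + ‖x‖²) |∇χ n|` bounded uniformly in `n`. -/
structure IsCutoff (c : ℝ) (χ : ℕ → Plane → ℝ) : Prop where
  contDiff : ∀ n, ContDiff ℝ ∞ (χ n)
  compact : ∀ n, HasCompactSupport (χ n)
  nonneg : ∀ n x, 0 ≤ χ n x
  le_one : ∀ n x, χ n x ≤ 1
  eq_one : ∀ (n : ℕ) x, ‖x‖ < n + 1 → χ n x = 1
  pd_eq_zero : ∀ (n : ℕ) i x, ‖x‖ < n + 1 → pd i (χ n) x = 0
  pd_le : ∀ n i x, |pd i (χ n) x| * √(wt x) ≤ c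

theorem exists_cutoff : ∃ c : ℝ, 0 ≤ c ∧ ∃ χ : ℕ → Plane → ℝ, IsCutoff c χ := by
  let b : ContDiffBump (0 : Plane) := ⟨1, 2, one_pos, one_lt_two⟩
  have hb : ContDiff ℝ ∞ b := b.contDiff
  have hc : HasCompactSupport b := b.hasCompactSupport
  have hs : tsupport b = Metric.closedBall 0 2 := b.tsupport_eq
  obtain ⟨B, hB⟩ : ∃ B, ∀ x, ‖fderiv ℝ b x‖ ≤ B :=
    (hb.continuous_fderiv (by simp)).bounded_above_of_compact_support (hc.fderiv ℝ)
  have hB0 : 0 ≤ B := (norm_nonneg _).trans (hB 0)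
  let χ : ℕ → Plane → ℝ := fun n x => b (((n : ℝ) + 1)⁻¹ • x)
  have hpos : ∀ n : ℕ, (0 : ℝ) < ((n : ℝ) + 1)⁻¹ := fun n => by positivity
  have hpd : ∀ n i x, pd i (χ n) x = ((n : ℝ) + 1)⁻¹ * fderiv ℝ b (((n : ℝ) + 1)⁻¹ • x) (e i) := by
    intro n i x
    have h1 : HasFDerivAt (fun y : Plane => ((n : ℝ) + 1)⁻¹ • y)
      (((n : ℝ) + 1)⁻¹ • ContinuousLinearMap.id ℝ Plane) x :=
      (((n : ℝ) + 1)⁻¹ • ContinuousLinearMap.id ℝ Plane).hasFDerivAt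
    have h2 := ((hb.differentiable (by simp) (((n : ℝ) + 1)⁻¹ • x)).hasFDerivAt.comp x h1).fderiv
    have h3 : fderiv ℝ (χ n) x = _ := h2
    rw [pd, h3]; simp
  have hn : ∀ (n : ℕ) (x : Plane), ‖((n : ℝ) + 1)⁻¹ • x‖ = ((n : ℝ) + 1)⁻¹ * ‖x‖ := by
    intro n x; rw [norm_smul, Real.norm_of_nonneg (hpos n).le]
  have hlt : ∀ (n : ℕ) (x : Plane), ‖x‖ < n + 1 → ‖((n : ℝ) + 1)⁻¹ • x‖ < 1 := by
    intro n x hx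
    rw [hn, inv_mul_lt_iff₀ (by positivity)]; linarith
  refine ⟨3 * B, by positivity, χ, ⟨fun n => hb.comp (contDiff_const_smul _), fun n => ?_,
    fun n x => b.nonneg, fun n x => b.le_one, fun n x hx => ?_, fun n i x hx => ?_,
    fun n i x => ?_⟩⟩
  · exact hc.comp_homeomorph (Homeomorph.smulOfNeZero ((n : ℝ) + 1)⁻¹ (hpos n).ne')
  · apply b.one_of_mem_closedBall
    rw [mem_closedBall_zero_iff]; exact (hlt n x hx).le
  · rw [hpd]
    have : (b : Plane → ℝ) =ᶠ[𝓝 (((n : ℝ) + 1)⁻¹ • x)] fun _ => 1 :=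
      b.eventuallyEq_one_of_mem_ball (by simpa [b] using hlt n x hx)
    rw [this.fderiv_eq]; simp
  · rw [hpd]
    by_cases hx : ((n : ℝ) + 1)⁻¹ • x ∈ tsupport b
    · rw [hs, mem_closedBall_zero_iff, hn, inv_mul_le_iff₀ (by positivity)] at hx
      have h1 : |fderiv ℝ b (((n : ℝ) + 1)⁻¹ • x) (e i)| ≤ B := by
        have := (fderiv ℝ b (((n : ℝ) + 1)⁻¹ • x)).le_opNorm (e i)
        rw [norm_e, mul_one] at this
        exact this.trans (hB _)
      have h2 : √(wt x) ≤ 3 * (n + 1) := by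
        refine (sqrt_wt_le x).trans ?_
        have : (0 : ℝ) ≤ n := Nat.cast_nonneg n
        linarith
      rw [abs_mul, abs_of_pos (hpos n)]
      calc ((n : ℝ) + 1)⁻¹ * |fderiv ℝ b (((n : ℝ) + 1)⁻¹ • x) (e i)| * √(wt x)
          ≤ ((n : ℝ) + 1)⁻¹ * B * (3 * (n + 1)) := by gcongr
        _ = 3 * B := by field_simp
    · have : fderiv ℝ b (((n : ℝ) + 1)⁻¹ • x) = 0 := by
        by_contra h
        exact hx (tsupport_fderiv_subset ℝ (subset_tsupport _ h))
      rw [this]; simp [hB0]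

theorem IsCutoff.tendsto_one {c : ℝ} {χ : ℕ → Plane → ℝ} (h : IsCutoff c χ) (x : Plane) :
    Tendsto (fun n => χ n x) atTop (𝓝 1) := by
  apply tendsto_const_nhds.congr'
  filter_upwards [eventually_ge_atTop ⌈‖x‖⌉₊] with n hn
  refine (h.eq_one n x ?_).symm
  have := Nat.ceil_le.1 hn
  linarith

theorem IsCutoff.tendsto_pd {c : ℝ} {χ : ℕ → Plane → ℝ} (h : IsCutoff c χ) (i : Fin 2) (x : Plane) :
    Tendsto (fun n => pd i (χ n) x) atTop (𝓝 0) := by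
  apply tendsto_const_nhds.congr'
  filter_upwards [eventually_ge_atTop ⌈‖x‖⌉₊] with n hn
  refine (h.pd_eq_zero n i x ?_).symm
  have := Nat.ceil_le.1 hn
  linarith

theorem IsCutoff.tendsto_integral {c : ℝ} {χ : ℕ → Plane → ℝ} (h : IsCutoff c χ) {g : Plane → ℝ}
    (hg : Integrable g) : Tendsto (fun n => ∫ x, χ n x * g x) atTop (𝓝 (∫ x, g x)) := by
  refine tendsto_integral_of_dominated_convergence (fun x => ‖g x‖) (fun n => ?_) hg.norm
    (fun n => Eventually.of_forall fun x => ?_) (Eventually.of_forall fun x => ?_)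
  · exact (h.contDiff n).continuous.aestronglyMeasurable.mul hg.aestronglyMeasurable
  · rw [norm_mul, Real.norm_of_nonneg (h.nonneg n x)]
    exact mul_le_of_le_one_left (norm_nonneg _) (h.le_one n x)
  · simpa using (h.tendsto_one x).mul_const (g x)

/-- The terms in which a derivative falls on the cut-off disappear in the limit. -/
theorem IsCutoff.tendsto_integral_pd {c : ℝ} {χ : ℕ → Plane → ℝ} (h : IsCutoff c χ)
    {g p : Plane → ℝ} (hg : Integrable g) (hp : AEStronglyMeasurable p)
    (hpg : ∀ᵐ x, |p x| ≤ √(wt x) * |g x|) (i : Fin 2) :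
    Tendsto (fun n => ∫ x, pd i (χ n) x * p x) atTop (𝓝 0) := by
  have := tendsto_integral_of_dominated_convergence (μ := (volume : Measure Plane))
    (F := fun n x => pd i (χ n) x * p x) (f := fun _ => (0 : ℝ)) (fun x => c * ‖g x‖) (fun n => ?_)
    (hg.norm.const_mul c) (fun n => ?_) (Eventually.of_forall fun x => ?_)
  · simpa using this
  · exact (continuous_pd ((h.contDiff n).of_le (by simp)) i).aestronglyMeasurable.mul hp
  · filter_upwards [hpg] with x hx
    rw [norm_mul, Real.norm_eq_abs, Real.norm_eq_abs, Real.norm_eq_abs]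
    calc |pd i (χ n) x| * |p x| ≤ |pd i (χ n) x| * (√(wt x) * |g x|) := by gcongr
      _ = (|pd i (χ n) x| * √(wt x)) * |g x| := by ring
      _ ≤ c * |g x| := by gcongr; exact h.pd_le n i x
  · simpa using (h.tendsto_pd i x).mul_const (p x)

/-! ### The `L²` norm -/

/-- The `L²` norm of a scalar function on the plane, as a real number. -/
noncomputable def l2 (f : Plane → ℝ) : ℝ := (eLpNorm f 2 volume).toReal

theorem l2_nonneg (f : Plane → ℝ) : 0 ≤ l2 f := ENNReal.toReal_nonneg

theorem ofReal_l2 {f : Plane → ℝ} (hf : MemLp f 2) : ENNReal.ofReal (l2 f) = eLpNorm f 2 volume :=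
  ENNReal.ofReal_toReal hf.eLpNorm_ne_top

theorem memLp_two_iff {f : Plane → ℝ} (hf : AEStronglyMeasurable f) :
    MemLp f 2 ↔ Integrable fun x => f x ^ 2 := memLp_two_iff_integrable_sq hf

theorem l2_sq {f : Plane → ℝ} (hf : MemLp f 2) : l2 f ^ 2 = ∫ x, f x ^ 2 := by
  have h0 : 0 ≤ ∫ x, f x ^ 2 := integral_nonneg fun x => sq_nonneg _
  rw [l2, hf.eLpNorm_eq_integral_rpow_norm (by simp) (by simp), ENNReal.toReal_ofReal (by positivity)]
  simp only [ENNReal.toReal_ofNat, Real.rpow_ofNat, Real.norm_eq_abs, sq_abs]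
  rw [← Real.rpow_natCast, ← Real.rpow_mul h0]
  norm_num

theorem l2_add_le {f g : Plane → ℝ} (hf : MemLp f 2) (hg : MemLp g 2) :
    l2 (fun x => f x + g x) ≤ l2 f + l2 g := by
  unfold l2
  rw [← ENNReal.toReal_add hf.eLpNorm_ne_top hg.eLpNorm_ne_top]
  exact ENNReal.toReal_mono (by simp [hf.eLpNorm_ne_top, hg.eLpNorm_ne_top])
    (eLpNorm_add_le hf.1 hg.1 (by norm_num))

theorem l2_const_mul (c : ℝ) (f : Plane → ℝ) : l2 (fun x => c * f x) = |c| * l2 f := by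
  have := eLpNorm_const_smul (μ := (volume : Measure Plane)) (p := 2) c f
  have h2 : (fun x => c * f x) = c • f := rfl
  rw [l2, h2, this, ENNReal.toReal_mul, l2]
  simp

theorem l2_neg (f : Plane → ℝ) : l2 (fun x => -f x) = l2 f := by
  have := l2_const_mul (-1) f
  simpa using this

theorem memLp_of_abs_le {f g : Plane → ℝ} (hg : MemLp g 2) (hf : AEStronglyMeasurable f)
    (h : ∀ x, |f x| ≤ |g x|) : MemLp f 2 :=
  hg.of_le hf (Eventually.of_forall h)

theorem l2_mono {f g : Plane → ℝ} (hg : MemLp g 2) (h : ∀ x, |f x| ≤ |g x|) : l2 f ≤ l2 g :=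
  ENNReal.toReal_mono hg.eLpNorm_ne_top (eLpNorm_mono h)

theorem memLp_bdd_mul {f g : Plane → ℝ} (hf : AEStronglyMeasurable f) (hg : MemLp g 2) {C : ℝ}
    (h : ∀ x, |f x| ≤ C) : MemLp (fun x => f x * g x) 2 := by
  refine memLp_of_abs_le (hg.const_mul C) (hf.mul hg.1) fun x => ?_
  rw [abs_mul, abs_mul]
  exact mul_le_mul_of_nonneg_right ((h x).trans (le_abs_self C)) (abs_nonneg _)

theorem l2_bdd_mul_le {f g : Plane → ℝ} (hg : MemLp g 2) {C : ℝ}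
    (h : ∀ x, |f x| ≤ C) : l2 (fun x => f x * g x) ≤ C * l2 g := by
  have hC : 0 ≤ C := (abs_nonneg _).trans (h 0)
  have := l2_mono (f := fun x => f x * g x) (hg.const_mul C) fun x => by
    rw [abs_mul, abs_mul, abs_of_nonneg hC]; gcongr; exact h x
  rwa [l2_const_mul, abs_of_nonneg hC] at this

theorem integrable_mul_of_memLp {f g : Plane → ℝ} (hf : MemLp f 2) (hg : MemLp g 2) :
    Integrable fun x => f x * g x := hf.integrable_mul hg

theorem abs_integral_mul_le {f g : Plane → ℝ} (hf : MemLp f 2) (hg : MemLp g 2) :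
    |∫ x, f x * g x| ≤ l2 f * l2 g := by
  have h := integral_mul_norm_le_Lp_mul_Lq (μ := (volume : Measure Plane))
    (p := 2) (q := 2) Real.HolderConjugate.two_two (f := f) (g := g)
    (by simpa using hf) (by simpa using hg)
  have key : ∀ k : Plane → ℝ, MemLp k 2 → (∫ a, ‖k a‖ ^ (2 : ℝ)) ^ (1 / (2 : ℝ)) = l2 k := by
    intro k hk
    have : ∀ a, ‖k a‖ ^ (2 : ℝ) = k a ^ 2 := fun a => by simp
    simp_rw [this, ← l2_sq hk]
    rw [← Real.sqrt_eq_rpow, Real.sqrt_sq (l2_nonneg _)]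
  rw [key f hf, key g hg] at h
  refine le_trans ?_ h
  rw [← Real.norm_eq_abs]
  refine (norm_integral_le_integral_norm _).trans_eq ?_
  simp

theorem memLp_of_compact {f : Plane → ℝ} (hf : Continuous f) (hc : HasCompactSupport f) :
    MemLp f 2 := hf.memLp_of_hasCompactSupport hc

/-- Fatou's lemma for the `L²` norm. -/
theorem memLp_of_tendsto {f : ℕ → Plane → ℝ} {g : Plane → ℝ} {C : ℝ} (hf : ∀ n, MemLp (f n) 2)
    (hC : ∀ n, l2 (f n) ≤ C) (h : ∀ᵐ x, Tendsto (fun n => f n x) atTop (𝓝 (g x))) :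
    MemLp g 2 ∧ l2 g ≤ C := by
  have h0 : 0 ≤ C := (l2_nonneg _).trans (hC 0)
  have h1 : eLpNorm g 2 volume ≤ ENNReal.ofReal C := by
    refine (Lp.eLpNorm_lim_le_liminf_eLpNorm (fun n => (hf n).1) g h).trans ?_
    refine Filter.liminf_le_of_le (by isBoundedDefault) fun b hb => ?_
    obtain ⟨n, hn⟩ := hb.exists
    refine hn.trans ?_
    rw [← ofReal_l2 (hf n)]
    exact ENNReal.ofReal_le_ofReal (hC n)
  refine ⟨⟨aestronglyMeasurable_of_tendsto_ae atTop (fun n => (hf n).1) h,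
    h1.trans_lt ENNReal.ofReal_lt_top⟩, ?_⟩
  exact ENNReal.toReal_le_of_le_ofReal h0 h1

/-! ### Test functions and representation of bounded functionals -/

/-- Smooth compactly supported functions. -/
structure IsTest (ψ : Plane → ℝ) : Prop where
  contDiff : ContDiff ℝ ∞ ψ
  compact : HasCompactSupport ψ

theorem IsTest.pd {ψ : Plane → ℝ} (h : IsTest ψ) (i : Fin 2) : IsTest (pd i ψ) :=
  ⟨contDiff_pd h.contDiff i, h.compact.pd i⟩

theorem IsTest.c1 {ψ : Plane → ℝ} (h : IsTest ψ) : ContDiff ℝ 1 ψ :=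
  h.contDiff.of_le (by simp)

theorem IsTest.differentiable {ψ : Plane → ℝ} (h : IsTest ψ) : Differentiable ℝ ψ :=
  h.c1.differentiable one_ne_zero

theorem IsTest.memLp {ψ : Plane → ℝ} (h : IsTest ψ) : MemLp ψ 2 :=
  memLp_of_compact h.contDiff.continuous h.compact

theorem IsTest.add {ψ φ : Plane → ℝ} (h : IsTest ψ) (h' : IsTest φ) :
    IsTest (fun x => ψ x + φ x) :=
  ⟨h.contDiff.add h'.contDiff, h.compact.add h'.compact⟩

theorem IsTest.const_mul {ψ : Plane → ℝ} (h : IsTest ψ) (c : ℝ) : IsTest (fun x => c * ψ x) :=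
  ⟨contDiff_const.mul h.contDiff, h.compact.mul_left⟩

/-- A linear functional on test functions that is bounded by the `L²` norm of a linear operator `D`
is represented, through `D`, by an `L²` function (Hahn–Banach and Riesz). -/
theorem exists_l2_repr (T : (Plane → ℝ) → ℝ) (D : (Plane → ℝ) → Plane → ℝ)
    (hT : ∀ ψ φ, IsTest ψ → IsTest φ → T (fun x => ψ x + φ x) = T ψ + T φ)
    (hT' : ∀ c ψ, IsTest ψ → T (fun x => c * ψ x) = c * T ψ)
    (hD : ∀ ψ φ, IsTest ψ → IsTest φ → D (fun x => ψ x + φ x) = fun x => D ψ x + D φ x)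
    (hD' : ∀ c ψ, IsTest ψ → D (fun x => c * ψ x) = fun x => c * D ψ x)
    (hm : ∀ ψ, IsTest ψ → MemLp (D ψ) 2) {M : ℝ} (hM : 0 ≤ M)
    (hb : ∀ ψ, IsTest ψ → |T ψ| ≤ M * l2 (D ψ)) :
    ∃ h : Plane → ℝ, MemLp h 2 ∧ l2 h ≤ M ∧ ∀ ψ, IsTest ψ → T ψ = ∫ x, h x * D ψ x := by
  let S : Submodule ℝ (Plane → ℝ) :=
    { carrier := {ψ | IsTest ψ}
      add_mem' := fun h h' => h.add h'
      zero_mem' := ⟨contDiff_const, HasCompactSupport.zero⟩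
      smul_mem' := fun c _ h => h.const_mul c }
  let J : S →ₗ[ℝ] Lp ℝ 2 (volume : Measure Plane) :=
    { toFun := fun ψ => (hm ψ.1 ψ.2).toLp _
      map_add' := fun ψ φ => by
        rw [← MemLp.toLp_add]
        exact MemLp.toLp_congr _ _ (Eventually.of_forall fun x => congrFun (hD ψ.1 φ.1 ψ.2 φ.2) x)
      map_smul' := fun c ψ => by
        rw [RingHom.id_apply, ← MemLp.toLp_const_smul]
        exact MemLp.toLp_congr _ _ (Eventually.of_forall fun x => congrFun (hD' c ψ.1 ψ.2) x) }
  let ℓ : S →ₗ[ℝ] ℝ :=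
    { toFun := fun ψ => T ψ.1
      map_add' := fun ψ φ => hT ψ.1 φ.1 ψ.2 φ.2
      map_smul' := fun c ψ => hT' c ψ.1 ψ.2 }
  have hJ : ∀ ψ : S, ‖J ψ‖ = l2 (D ψ.1) := fun ψ => Lp.norm_toLp (D ψ.1) (hm ψ.1 ψ.2)
  have hℓ : ∀ ψ : S, |ℓ ψ| ≤ M * ‖J ψ‖ := fun ψ => by rw [hJ]; exact hb ψ.1 ψ.2
  obtain ⟨s, hs⟩ := J.rangeRestrict.exists_rightInverse_of_surjective J.range_rangeRestrict
  have hs' : ∀ y : J.range, J (s y) = y := fun y => by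
    have := LinearMap.congr_fun hs y
    simpa using congrArg Subtype.val this
  let L : StrongDual ℝ J.range := (ℓ.comp s).mkContinuous M fun y => by
    have := hℓ (s y)
    rw [hs'] at this
    simpa using this
  obtain ⟨g, hg, hgn⟩ := exists_extension_norm_eq J.range L
  let u := (InnerProductSpace.toDual ℝ (Lp ℝ 2 (volume : Measure Plane))).symm g
  have hu : ‖u‖ ≤ M := by
    rw [LinearIsometryEquiv.norm_map, hgn]
    exact LinearMap.mkContinuous_norm_le _ hM _
  refine ⟨u, Lp.memLp u, ?_, fun ψ hψ => ?_⟩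
  · simpa [l2, Lp.norm_def] using hu
  · let ψ' : S := ⟨ψ, hψ⟩
    have h1 : ℓ ψ' = ℓ (s (J.rangeRestrict ψ')) := by
      have := hℓ (ψ' - s (J.rangeRestrict ψ'))
      have h0 : J (ψ' - s (J.rangeRestrict ψ')) = 0 := by
        rw [map_sub, hs']; simp
      rw [h0, norm_zero, mul_zero, abs_nonpos_iff, map_sub, sub_eq_zero] at this
      exact this
    have h2 : g (J ψ') = ℓ (s (J.rangeRestrict ψ')) := hg (J.rangeRestrict ψ')
    have h3 : g (J ψ') = inner ℝ u (J ψ') := by simp [u]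
    have h4 : T ψ = inner ℝ u (J ψ') := by
      rw [← h3, h2, ← h1]; rfl
    rw [h4, L2.inner_def]
    refine integral_congr_ae ?_
    filter_upwards [(hm ψ hψ).coeFn_toLp] with x hx
    have : (J ψ' : Plane → ℝ) x = D ψ x := hx
    rw [this]; simp [mul_comm]

/-! ### Convolution with smooth kernels -/

/-- The convolution of `f` with the kernel `K`. -/
noncomputable def conv (K f : Plane → ℝ) : Plane → ℝ :=
  convolution K f (ContinuousLinearMap.lsmul ℝ ℝ) volume

theorem conv_apply (K f : Plane → ℝ) (x : Plane) : conv K f x = ∫ z, K z * f (x - z) := rfl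

theorem conv_apply' (K f : Plane → ℝ) (x : Plane) : conv K f x = ∫ z, K (x - z) * f z := by
  rw [conv, convolution_eq_swap]; rfl

theorem contDiff_conv {K f : Plane → ℝ} (hK : IsTest K) (hf : LocallyIntegrable f) :
    ContDiff ℝ ∞ (conv K f) :=
  hK.compact.contDiff_convolution_left _ hK.contDiff hf

theorem integrable_conv {K f : Plane → ℝ} (hK : Continuous K) (hc : HasCompactSupport K)
    (hf : LocallyIntegrable f) (x : Plane) : Integrable fun z => K (x - z) * f z := by
  have h1 : HasCompactSupport fun z => K (x - z) := hc.comp_homeomorph (Homeomorph.subLeft x)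
  exact (hf.integrable_smul_left_of_hasCompactSupport (hK.comp (by fun_prop)) h1)

theorem pd_conv {K f : Plane → ℝ} (hK : IsTest K) (hf : LocallyIntegrable f) (i : Fin 2)
    (x : Plane) : pd i (conv K f) x = conv (pd i K) f x := by
  have h := (hK.compact.hasFDerivAt_convolution_left (ContinuousLinearMap.lsmul ℝ ℝ) hK.c1 hf x)
  rw [pd, conv, h.fderiv, convolution_eq_swap, conv_apply', ContinuousLinearMap.integral_apply]
  · simp [ContinuousLinearMap.precompL_apply, pd]
  · have h2 : HasCompactSupport fun z => fderiv ℝ K (x - z) :=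
      (hK.compact.fderiv ℝ).comp_homeomorph (Homeomorph.subLeft x)
    have h3 : Continuous fun z => fderiv ℝ K (x - z) :=
      (hK.c1.continuous_fderiv one_ne_zero).comp (by fun_prop)
    have h4 := hf.integrable_smul_right_of_hasCompactSupport h3 h2
    refine h4.congr (Eventually.of_forall fun z => ?_)
    ext w
    simp [ContinuousLinearMap.precompL_apply, mul_comm]

theorem isTest_reflect {K : Plane → ℝ} (hK : IsTest K) (x : Plane) :
    IsTest fun z => K (x - z) :=
  ⟨hK.contDiff.comp (by fun_prop), hK.compact.comp_homeomorph (Homeomorph.subLeft x)⟩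

theorem pd_reflect {K : Plane → ℝ} (hK : IsTest K) (x : Plane) (i : Fin 2) (z : Plane) :
    pd i (fun z => K (x - z)) z = -pd i K (x - z) := by
  have h1 : HasFDerivAt (fun y : Plane => x - y) (-ContinuousLinearMap.id ℝ Plane) z :=
    (hasFDerivAt_id z).const_sub x
  have h2 : fderiv ℝ (fun y => K (x - y)) z = _ :=
    ((hK.differentiable (x - z)).hasFDerivAt.comp z h1).fderiv
  rw [pd, h2]
  simp [pd]

theorem pd_conv_of_contDiff {K f : Plane → ℝ} (hK : IsTest K) (hf : ContDiff ℝ 1 f) (i : Fin 2)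
    (x : Plane) : pd i (conv K f) x = conv K (pd i f) x := by
  have hr := isTest_reflect hK x
  rw [pd_conv hK hf.continuous.locallyIntegrable, conv_apply', conv_apply']
  have := integral_mul_pd i hf hr.c1 hr.compact
  simp_rw [pd_reflect hK] at this
  rw [← neg_inj, ← integral_neg]
  simp_rw [mul_comm (K _)]
  rw [← this]
  congr 1; ext z; ring

theorem conv_sub {K f g : Plane → ℝ} (hK : IsTest K) (hf : LocallyIntegrable f)
    (hg : LocallyIntegrable g) (x : Plane) :
    conv K (fun z => f z - g z) x = conv K f x - conv K g x := by
  simp_rw [conv_apply']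
  rw [← integral_sub (integrable_conv hK.contDiff.continuous hK.compact hf x)
    (integrable_conv hK.contDiff.continuous hK.compact hg x)]
  congr 1; ext z; ring

/-- Young's inequality `‖K * f‖₂ ≤ ‖K‖₁ ‖f‖₂`. -/
theorem memLp_conv {K f : Plane → ℝ} (hK : Continuous K) (hc : HasCompactSupport K)
    (hf : MemLp f 2) : MemLp (conv K f) 2 ∧ l2 (conv K f) ≤ (∫ x, |K x|) * l2 f := by
  have hKi : Integrable K := hK.integrable_of_hasCompactSupport hc
  have hloc : LocallyIntegrable f := hf.locallyIntegrable (by norm_num)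
  have hcont : Continuous (conv K f) :=
    hc.continuous_convolution_left _ hK hloc
  set k : Plane → ENNReal := fun z => ‖K z‖ₑ with hk
  have hkm : Measurable k := hK.measurable.enorm
  set N : ENNReal := ∫⁻ z, k z with hN
  have hNtop : N ≠ ⊤ := hKi.2.ne
  have hNe : N = ENNReal.ofReal (∫ x, |K x|) := by
    rw [ofReal_integral_eq_lintegral_ofReal hKi.abs (Eventually.of_forall fun x => abs_nonneg _)]
    simp only [hN, hk]
    congr 1; ext z; rw [← Real.norm_eq_abs, ofReal_norm]
  -- pointwise bound by Cauchy-Schwarz with respect to the measure `|K| dz`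
  have h1 : ∀ x, ‖conv K f x‖ₑ ^ 2 ≤ N * ∫⁻ z, k (x - z) * ‖f z‖ₑ ^ 2 := by
    intro x
    have hfm : AEMeasurable (fun z => ‖f z‖ₑ) := hf.1.enorm
    have hkx : Measurable fun z => k (x - z) := hkm.comp (by fun_prop)
    have a1 : ‖conv K f x‖ₑ ≤ ∫⁻ z, (k (x - z)) ^ (1 / 2 : ℝ) * ((k (x - z)) ^ (1 / 2 : ℝ) * ‖f z‖ₑ) := by
      rw [conv_apply']
      refine (enorm_integral_le_lintegral_enorm _).trans_eq ?_
      congr 1; ext z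
      rw [← mul_assoc, ← ENNReal.rpow_add_of_nonneg _ _ (by norm_num) (by norm_num)]
      norm_num [hk]
    have a2 := ENNReal.lintegral_mul_le_Lp_mul_Lq volume Real.HolderConjugate.two_two
      (f := fun z => (k (x - z)) ^ (1 / 2 : ℝ)) (g := fun z => (k (x - z)) ^ (1 / 2 : ℝ) * ‖f z‖ₑ)
      (hkx.pow_const _).aemeasurable ((hkx.pow_const _).aemeasurable.mul hfm)
    have a3 := a1.trans a2
    have a4 : ‖conv K f x‖ₑ ^ 2 ≤ _ := pow_le_pow_left' a3 2
    refine a4.trans_eq ?_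
    rw [mul_pow]
    have sq : ∀ t : ENNReal, (t ^ (1 / 2 : ℝ)) ^ 2 = t := fun t => by
      rw [← ENNReal.rpow_natCast, ← ENNReal.rpow_mul]; norm_num
    rw [sq, sq]
    have e1 : ∫⁻ z, ((k (x - z)) ^ (1 / 2 : ℝ)) ^ (2 : ℝ) = N := by
      have : ∀ z, ((k (x - z)) ^ (1 / 2 : ℝ)) ^ (2 : ℝ) = k (x - z) := fun z => by
        rw [← ENNReal.rpow_mul]; norm_num
      simp_rw [this]
      exact lintegral_sub_left_eq_self k x
    have e2 : ∀ z, ((k (x - z)) ^ (1 / 2 : ℝ) * ‖f z‖ₑ) ^ (2 : ℝ) = k (x - z) * ‖f z‖ₑ ^ 2 := by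
      intro z
      rw [ENNReal.mul_rpow_of_nonneg _ _ (by norm_num), ← ENNReal.rpow_mul]; norm_num
    simp only [Pi.mul_apply] at *
    rw [e1]
    simp_rw [e2]
  have h2 : ∫⁻ x, ‖conv K f x‖ₑ ^ 2 ≤ N ^ 2 * ∫⁻ z, ‖f z‖ₑ ^ 2 := by
    have hm : AEMeasurable (Function.uncurry fun x z : Plane => k (x - z) * ‖f z‖ₑ ^ 2)
        ((volume : Measure Plane).prod volume) := by
      exact (hkm.comp (by fun_prop : Measurable fun p : Plane × Plane => p.1 - p.2)).aemeasurable.mul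
        ((hf.1.comp_snd.enorm).pow_const 2)
    calc ∫⁻ x, ‖conv K f x‖ₑ ^ 2 ≤ ∫⁻ x, N * ∫⁻ z, k (x - z) * ‖f z‖ₑ ^ 2 := lintegral_mono h1
      _ = N * ∫⁻ x, ∫⁻ z, k (x - z) * ‖f z‖ₑ ^ 2 := lintegral_const_mul' _ _ hNtop
      _ = N * ∫⁻ z, ∫⁻ x, k (x - z) * ‖f z‖ₑ ^ 2 := by rw [lintegral_lintegral_swap hm]
      _ = N * ∫⁻ z, N * ‖f z‖ₑ ^ 2 := by
          congr 2; ext z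
          rw [lintegral_mul_const' _ _ (by simp), lintegral_sub_right_eq_self k z]
      _ = N ^ 2 * ∫⁻ z, ‖f z‖ₑ ^ 2 := by rw [lintegral_const_mul' _ _ hNtop]; ring
  have key : ∀ u : Plane → ℝ, eLpNorm u 2 volume = (∫⁻ x, ‖u x‖ₑ ^ 2) ^ (1 / 2 : ℝ) := fun u => by
    rw [eLpNorm_eq_lintegral_rpow_enorm_toReal (by simp) (by simp)]; simp
  have h3 : eLpNorm (conv K f) 2 volume ≤ N * eLpNorm f 2 volume := by
    rw [key, key]
    refine (ENNReal.rpow_le_rpow h2 (by norm_num)).trans_eq ?_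
    rw [ENNReal.mul_rpow_of_nonneg _ _ (by norm_num), ← ENNReal.rpow_natCast, ← ENNReal.rpow_mul]
    norm_num
  refine ⟨⟨hcont.aestronglyMeasurable, h3.trans_lt (ENNReal.mul_lt_top hNtop.lt_top hf.2)⟩, ?_⟩
  have h0 : 0 ≤ ∫ x, |K x| := integral_nonneg fun x => abs_nonneg _
  unfold l2
  rw [← ENNReal.toReal_ofReal h0, ← hNe, ← ENNReal.toReal_mul]
  exact ENNReal.toReal_mono (ENNReal.mul_ne_top hNtop hf.eLpNorm_ne_top) h3

/-! ### Mollifiers -/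

/-- A bump of radius `1 / (n + 1)` around the origin. -/
noncomputable def bump (n : ℕ) : ContDiffBump (0 : Plane) :=
  ⟨1 / (2 * (n + 1)), 1 / (n + 1), by positivity, by
    apply one_div_lt_one_div_of_lt <;> [positivity; linarith [(Nat.cast_nonneg n : (0 : ℝ) ≤ n)]]⟩

/-- The standard mollifiers. -/
noncomputable def rho (n : ℕ) : Plane → ℝ := (bump n).normed volume

theorem isTest_rho (n : ℕ) : IsTest (rho n) :=
  ⟨(bump n).contDiff_normed, (bump n).hasCompactSupport_normed⟩

theorem rho_nonneg (n : ℕ) (x : Plane) : 0 ≤ rho n x := (bump n).nonneg_normed x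

theorem integral_rho (n : ℕ) : ∫ x, rho n x = 1 := (bump n).integral_normed

theorem integral_abs_rho (n : ℕ) : ∫ x, |rho n x| = 1 := by
  simp_rw [abs_of_nonneg (rho_nonneg n _)]; exact integral_rho n

theorem memLp_mollify {f : Plane → ℝ} (n : ℕ) (hf : MemLp f 2) :
    MemLp (conv (rho n) f) 2 ∧ l2 (conv (rho n) f) ≤ l2 f := by
  have := memLp_conv (isTest_rho n).contDiff.continuous (isTest_rho n).compact hf
  rwa [integral_abs_rho, one_mul] at this

theorem tendsto_mollify {f : Plane → ℝ} (hf : Continuous f) (x : Plane) :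
    Tendsto (fun n => conv (rho n) f x) atTop (𝓝 (f x)) := by
  refine ContDiffBump.convolution_tendsto_right_of_continuous (φ := bump) ?_ hf x
  exact tendsto_one_div_add_atTop_nhds_zero_nat

/-- All the mollifiers are supported in the unit ball. -/
theorem norm_le_of_rho_ne_zero {n : ℕ} {z : Plane} (hz : rho n z ≠ 0) : ‖z‖ ≤ 1 := by
  rw [← Function.mem_support, rho, ContDiffBump.support_normed_eq, mem_ball_zero_iff] at hz
  refine hz.le.trans ?_
  simp only [bump]
  rw [div_le_one (by positivity)]
  linarith [(Nat.cast_nonneg n : (0 : ℝ) ≤ n)]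

theorem abs_mollify_le_of_ball {f : Plane → ℝ} {B : ℝ} {x : Plane}
    (hB : ∀ y, ‖y - x‖ ≤ 1 → |f y| ≤ B) (n : ℕ) : |conv (rho n) f x| ≤ B := by
  have hi : Integrable (rho n) :=
    (isTest_rho n).contDiff.continuous.integrable_of_hasCompactSupport (isTest_rho n).compact
  rw [conv_apply, ← Real.norm_eq_abs]
  calc ‖∫ z, rho n z * f (x - z)‖ ≤ ∫ z, rho n z * B := by
        refine norm_integral_le_of_norm_le (hi.mul_const B) (Eventually.of_forall fun z => ?_)
        rw [norm_mul, Real.norm_of_nonneg (rho_nonneg n z), Real.norm_eq_abs]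
        by_cases hz : rho n z = 0
        · simp [hz]
        · exact mul_le_mul_of_nonneg_left
            (hB _ (by simpa using norm_le_of_rho_ne_zero hz)) (rho_nonneg n z)
    _ = B := by rw [integral_mul_const, integral_rho, one_mul]

theorem abs_mollify_le {f : Plane → ℝ} {B : ℝ} (hB : ∀ x, |f x| ≤ B) (n : ℕ)
    (x : Plane) : |conv (rho n) f x| ≤ B := abs_mollify_le_of_ball (fun y _ => hB y) n

theorem mollify_eq_zero {f : Plane → ℝ} {S : Set Plane} (hS : ∀ x ∉ S, f x = 0) (n : ℕ)
    {x : Plane} (hx : x ∉ Metric.cthickening 1 S) : conv (rho n) f x = 0 := by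
  rw [conv_apply]
  refine integral_eq_zero_of_ae (Eventually.of_forall fun z => ?_)
  by_cases hz : rho n z = 0
  · simp [hz]
  · have : x - z ∉ S := fun h => hx (Metric.mem_cthickening_of_dist_le x (x - z) 1 S h
      (by simpa using norm_le_of_rho_ne_zero hz))
    simp [hS _ this]

theorem contDiff_one {f : Plane → ℝ} (hf : ContDiff ℝ ∞ f) : ContDiff ℝ 1 f :=
  hf.of_le (by simp)

theorem contDiff_two {f : Plane → ℝ} (hf : ContDiff ℝ ∞ f) : ContDiff ℝ 2 f := by
  exact_mod_cast contDiff_infty.1 hf 2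

theorem contDiff_three {f : Plane → ℝ} (hf : ContDiff ℝ ∞ f) : ContDiff ℝ 3 f := by
  exact_mod_cast contDiff_infty.1 hf 3

/-! ### Two-dimensional inequalities -/

theorem IsCutoff.pd_le_div {c : ℝ} {χ : ℕ → Plane → ℝ} (h : IsCutoff c χ) (n : ℕ) (i : Fin 2)
    (x : Plane) : |pd i (χ n) x| ≤ c / (n + 1) := by
  have hn : (0 : ℝ) < n + 1 := by positivity
  by_cases hx : ‖x‖ < n + 1
  · rw [h.pd_eq_zero n i x hx, abs_zero]
    have := (mul_nonneg (abs_nonneg _) (Real.sqrt_nonneg _)).trans (h.pd_le n i x)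
    positivity
  · rw [le_div_iff₀ hn]
    refine le_trans ?_ (h.pd_le n i x)
    gcongr
    exact (not_lt.1 hx).trans (norm_le_sqrt_wt x)

/-- Ladyzhenskaya's inequality, from the Gagliardo–Nirenberg–Sobolev inequality
`‖u‖₂ ≤ C ‖∇u‖₁` for `u = f²`. -/
theorem exists_ladyzhenskaya : ∃ C : ℝ, 0 ≤ C ∧ ∀ f : Plane → ℝ, ContDiff ℝ 1 f → MemLp f 2 →
    (∀ i, MemLp (pd i f) 2) →
    MemLp (fun x => f x ^ 2) 2 ∧ l2 (fun x => f x ^ 2) ≤ C * l2 f * (l2 (pd 0 f) + l2 (pd 1 f)) := by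
  have hfr : Module.finrank ℝ Plane = 2 := by simp
  let K : ℝ≥0 := eLpNormLESNormFDerivOneConst (volume : Measure Plane) 2
  refine ⟨2 * K, by positivity, fun f hf hf2 hd => ?_⟩
  obtain ⟨c, hc0, χ, hχ⟩ := exists_cutoff
  have hdf := hf.differentiable one_ne_zero
  set G : ℝ := l2 f * (l2 (pd 0 f) + l2 (pd 1 f)) with hG
  have hG0 : 0 ≤ G := mul_nonneg (l2_nonneg _) (add_nonneg (l2_nonneg _) (l2_nonneg _))
  have hu1 : ∀ n, ContDiff ℝ 1 (fun x => χ n x * f x ^ 2) := fun n =>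
    ((hχ.contDiff n).of_le (by simp)).mul (hf.pow 2)
  have huc : ∀ n, HasCompactSupport (fun x => χ n x * f x ^ 2) := fun n => (hχ.compact n).mul_right
  have hint : ∀ i, Integrable fun x => |f x| * |pd i f x| := fun i => by
    simpa [abs_mul] using (integrable_mul_of_memLp hf2 (hd i)).abs
  have hsq : Integrable fun x => f x ^ 2 := (memLp_two_iff hf.continuous.aestronglyMeasurable).1 hf2
  have hcs : ∀ i, ∫ x, |f x| * |pd i f x| ≤ l2 f * l2 (pd i f) := fun i => by
    have := abs_integral_mul_le hf2.abs (hd i).abs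
    refine (le_abs_self _).trans (this.trans_eq ?_)
    rw [l2, l2, l2, l2, ← eLpNorm_norm f, ← eLpNorm_norm (pd i f)]; rfl
  have hbound : ∀ n, l2 (fun x => χ n x * f x ^ 2) ≤ 2 * K * G + 2 * K * c * l2 f ^ 2 / (n + 1) := by
    intro n
    have hχd := (hχ.contDiff n).differentiable (by simp)
    have h1 := eLpNorm_le_eLpNorm_fderiv_one (μ := (volume : Measure Plane)) (hu1 n) (huc n)
      (p := 2) (by rw [hfr]; exact_mod_cast NNReal.HolderConjugate.two_two)
    have hpt : ∀ x, ‖fderiv ℝ (fun x => χ n x * f x ^ 2) x‖ ≤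
        2 * (|f x| * |pd 0 f x|) + 2 * (|f x| * |pd 1 f x|) + 2 * (c / (n + 1)) * f x ^ 2 := by
      intro x
      have hi : ∀ i, |pd i (fun x => χ n x * f x ^ 2) x| ≤
          2 * (|f x| * |pd i f x|) + c / (n + 1) * f x ^ 2 := by
        intro i
        rw [pd_mul hχd (hdf.fun_pow 2), pd_pow_two hdf]
        refine (abs_add_le _ _).trans ?_
        rw [abs_mul, abs_mul, abs_mul, abs_mul, abs_of_nonneg (sq_nonneg (f x)), abs_of_nonneg (hχ.nonneg n x)]
        have h1 := hχ.pd_le_div n i x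
        have h2 := hχ.le_one n x
        have h3 : χ n x * (|2| * |f x| * |pd i f x|) ≤ 1 * (2 * (|f x| * |pd i f x|)) := by
          rw [abs_two]
          calc χ n x * (2 * |f x| * |pd i f x|) ≤ 1 * (2 * |f x| * |pd i f x|) := by gcongr
            _ = _ := by ring
        have h4 : |pd i (χ n) x| * f x ^ 2 ≤ c / (n + 1) * f x ^ 2 := by gcongr
        refine (add_le_add h4 h3).trans (le_of_eq ?_)
        ring
      refine (norm_fderiv_le _ x).trans ?_
      linarith [hi 0, hi 1]
    have hint2 : Integrable fun x => 2 * (|f x| * |pd 0 f x|) + 2 * (|f x| * |pd 1 f x|)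
        + 2 * (c / (n + 1)) * f x ^ 2 :=
      (((hint 0).const_mul 2).add ((hint 1).const_mul 2)).add (hsq.const_mul _)
    have h2 : eLpNorm (fderiv ℝ (fun x => χ n x * f x ^ 2)) 1 volume ≤
        ENNReal.ofReal (2 * G + 2 * (c / (n + 1)) * l2 f ^ 2) := by
      rw [eLpNorm_one_eq_lintegral_enorm]
      calc ∫⁻ x, ‖fderiv ℝ (fun x => χ n x * f x ^ 2) x‖ₑ
          ≤ ∫⁻ x, ENNReal.ofReal (2 * (|f x| * |pd 0 f x|) + 2 * (|f x| * |pd 1 f x|)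
            + 2 * (c / (n + 1)) * f x ^ 2) := by
            refine lintegral_mono fun x => ?_
            rw [← ofReal_norm]
            exact ENNReal.ofReal_le_ofReal (hpt x)
        _ = ENNReal.ofReal (∫ x, (2 * (|f x| * |pd 0 f x|) + 2 * (|f x| * |pd 1 f x|)
            + 2 * (c / (n + 1)) * f x ^ 2)) :=
            (ofReal_integral_eq_lintegral_ofReal hint2 (Eventually.of_forall fun x => by
              simp only [Pi.zero_apply]; positivity)).symm
        _ ≤ _ := by
            apply ENNReal.ofReal_le_ofReal
            rw [integral_add (integrable_fun_add ((hint 0).const_mul 2) ((hint 1).const_mul 2)) (hsq.const_mul _),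
              integral_add ((hint 0).const_mul 2) ((hint 1).const_mul 2), integral_const_mul,
              integral_const_mul, integral_const_mul, ← l2_sq hf2]
            have := hcs 0
            have := hcs 1
            rw [hG]
            linarith
    have hnn : 0 ≤ 2 * G + 2 * (c / (n + 1)) * l2 f ^ 2 := by positivity
    have h3 : l2 (fun x => χ n x * f x ^ 2) ≤ K * (2 * G + 2 * (c / (n + 1)) * l2 f ^ 2) := by
      unfold l2
      refine ENNReal.toReal_le_of_le_ofReal (by positivity) ?_
      refine (h1.trans (mul_le_mul_right h2 _)).trans_eq ?_
      rw [ENNReal.ofReal_mul (by positivity), ENNReal.ofReal_coe_nnreal]; rfl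
    refine h3.trans_eq ?_
    ring
  have hmem : ∀ n, MemLp (fun x => χ n x * f x ^ 2) 2 := fun n =>
    memLp_of_compact (hu1 n).continuous (huc n)
  have hlim : ∀ x, Tendsto (fun n => χ n x * f x ^ 2) atTop (𝓝 (f x ^ 2)) := fun x => by
    simpa using (hχ.tendsto_one x).mul_const (f x ^ 2)
  have hconst : (2 : ℝ) * K * l2 f * (l2 (pd 0 f) + l2 (pd 1 f)) = 2 * K * G := by rw [hG]; ring
  rw [hconst]
  have htail : ∀ ε : ℝ, 0 < ε → MemLp (fun x => f x ^ 2) 2 ∧ l2 (fun x => f x ^ 2) ≤ 2 * K * G + ε := by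
    intro ε hε
    obtain ⟨N, hN⟩ := exists_nat_gt (2 * K * c * l2 f ^ 2 / ε)
    refine memLp_of_tendsto (f := fun n x => χ (n + N) x * f x ^ 2) (fun n => hmem _) (fun n => ?_)
      (Eventually.of_forall fun x => (hlim x).comp (tendsto_add_atTop_nat N))
    refine (hbound _).trans ?_
    gcongr
    rw [div_le_iff₀ (by positivity)]
    rw [div_lt_iff₀ hε] at hN
    push_cast
    nlinarith [(Nat.cast_nonneg n : (0 : ℝ) ≤ n), (Nat.cast_nonneg N : (0 : ℝ) ≤ N)]
  exact ⟨(htail 1 one_pos).1, le_of_forall_pos_le_add fun ε hε => (htail ε hε).2⟩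

/-- The `L²` norms of the second derivatives are controlled by the `L²` norm of the Laplacian. -/
theorem l2_pd_pd_le {f : Plane → ℝ} (hf : ContDiff ℝ 3 f) (h1 : ∀ i, MemLp (pd i f) 2)
    (h2 : ∀ i j, MemLp (pd i (pd j f)) 2) (h3 : ∀ i j k, MemLp (pd i (pd j (pd k f))) 2)
    (i j : Fin 2) :
    l2 (pd i (pd j f)) ≤ l2 (fun x => pd 0 (pd 0 f) x + pd 1 (pd 1 f) x) := by
  have hL : MemLp (fun x => pd 0 (pd 0 f) x + pd 1 (pd 1 f) x) 2 := (h2 0 0).add (h2 1 1)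
  have c1 : ∀ k, ContDiff ℝ 2 (pd k f) := fun k => hf.pd (by norm_num) k
  have c2 : ∀ k l, ContDiff ℝ 1 (pd k (pd l f)) := fun k l => (c1 l).pd (by norm_num) k
  have d1 : ∀ k, Differentiable ℝ (pd k f) := fun k => (c1 k).differentiable (by simp)
  have d2 : ∀ k l, Differentiable ℝ (pd k (pd l f)) := fun k l => (c2 k l).differentiable (by simp)
  have hcomm : pd 1 (pd 0 f) = pd 0 (pd 1 f) := funext fun x => pd_comm (hf.of_le (by norm_num)) 1 0 x
  have hcomm3 : pd 1 (pd 0 (pd 1 f)) = pd 0 (pd 1 (pd 1 f)) := funext fun x => pd_comm (c1 1) 1 0 x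
  -- the mixed derivative is traded for the product of the pure ones
  have key : ∫ x, pd 0 (pd 1 f) x * pd 0 (pd 1 f) x = ∫ x, pd 0 (pd 0 f) x * pd 1 (pd 1 f) x := by
    have e1 := integral_mul_pd_of_integrable 1 (f := pd 0 (pd 1 f)) (g := pd 0 f) (d2 0 1) (d1 0)
      (integrable_mul_of_memLp (h3 1 0 1) (h1 0)) (integrable_mul_of_memLp (h2 0 1) (h2 1 0))
      (integrable_mul_of_memLp (h2 0 1) (h1 0))
    have e2 := integral_mul_pd_of_integrable 0 (f := pd 1 (pd 1 f)) (g := pd 0 f) (d2 1 1) (d1 0)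
      (integrable_mul_of_memLp (h3 0 1 1) (h1 0)) (integrable_mul_of_memLp (h2 1 1) (h2 0 0))
      (integrable_mul_of_memLp (h2 1 1) (h1 0))
    rw [hcomm, hcomm3] at e1
    rw [e1, ← e2]
    congr 1; ext x; ring
  have i00 := integrable_mul_of_memLp (h2 0 0) (h2 0 0)
  have i11 := integrable_mul_of_memLp (h2 1 1) (h2 1 1)
  have i01 := integrable_mul_of_memLp (h2 0 1) (h2 0 1)
  have ix := integrable_mul_of_memLp (h2 0 0) (h2 1 1)
  have expand : l2 (fun x => pd 0 (pd 0 f) x + pd 1 (pd 1 f) x) ^ 2 =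
      l2 (pd 0 (pd 0 f)) ^ 2 + l2 (pd 1 (pd 1 f)) ^ 2 + 2 * l2 (pd 0 (pd 1 f)) ^ 2 := by
    rw [l2_sq hL, l2_sq (h2 0 0), l2_sq (h2 1 1), l2_sq (h2 0 1)]
    have : ∀ x, (pd 0 (pd 0 f) x + pd 1 (pd 1 f) x) ^ 2 = (pd 0 (pd 0 f) x * pd 0 (pd 0 f) x
      + pd 1 (pd 1 f) x * pd 1 (pd 1 f) x) + 2 * (pd 0 (pd 0 f) x * pd 1 (pd 1 f) x) := fun x => by ring
    simp_rw [this]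
    rw [integral_add (integrable_fun_add i00 i11) (ix.const_mul 2), integral_add i00 i11, integral_const_mul, ← key]
    simp_rw [pow_two]
  have hn := l2_nonneg (fun x => pd 0 (pd 0 f) x + pd 1 (pd 1 f) x)
  have s0 := sq_nonneg (l2 (pd 0 (pd 0 f)))
  have s1 := sq_nonneg (l2 (pd 1 (pd 1 f)))
  have s2 := sq_nonneg (l2 (pd 0 (pd 1 f)))
  refine (sq_le_sq₀ (l2_nonneg _) hn).1 ?_
  rw [expand]
  fin_cases i <;> fin_cases j <;> simp only [Fin.zero_eta, Fin.mk_one, hcomm] <;> linarith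

/-! ### From smooth to `C¹` test functions -/

theorem isTest_mollify {f : Plane → ℝ} (hf : Continuous f) (hc : HasCompactSupport f) (n : ℕ) :
    IsTest (conv (rho n) f) :=
  ⟨contDiff_conv (isTest_rho n) hf.locallyIntegrable,
    (isTest_rho n).compact.convolution _ hc⟩

/-- A locally integrable function paired with mollifications of a compactly supported continuous
function. -/
theorem tendsto_integral_mollify {p f : Plane → ℝ} (hp : LocallyIntegrable p) (hf : Continuous f)
    (hc : HasCompactSupport f) :
    Tendsto (fun n => ∫ x, p x * conv (rho n) f x) atTop (𝓝 (∫ x, p x * f x)) := by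
  obtain ⟨B, hB⟩ := hf.bounded_above_of_compact_support hc
  have hS : IsCompact (Metric.cthickening 1 (tsupport f)) := hc.isCompact.cthickening
  have hi : Integrable ((Metric.cthickening 1 (tsupport f)).indicator fun x => B * ‖p x‖) := by
    rw [integrable_indicator_iff hS.measurableSet]
    exact ((hp.integrableOn_isCompact hS).norm.const_mul B)
  refine tendsto_integral_of_dominated_convergence _ (fun n => ?_) hi
    (fun n => Eventually.of_forall fun x => ?_) (Eventually.of_forall fun x => ?_)
  · exact hp.aestronglyMeasurable.mul
      (contDiff_conv (isTest_rho n) hf.locallyIntegrable).continuous.aestronglyMeasurable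
  · by_cases hx : x ∈ Metric.cthickening 1 (tsupport f)
    · rw [Set.indicator_of_mem hx, norm_mul, mul_comm]
      exact mul_le_mul_of_nonneg_right (abs_mollify_le hB n x) (norm_nonneg _)
    · rw [Set.indicator_of_notMem hx,
        mollify_eq_zero (S := tsupport f) (fun y hy => image_eq_zero_of_notMem_tsupport hy) n hx]
      simp
  · exact (tendsto_mollify hf x).const_mul _

/-- The mollifications of a continuous function paired with a compactly supported continuous
function. -/
theorem tendsto_integral_mollify_mul {f k : Plane → ℝ} (hf : Continuous f) (hk : Continuous k)
    (hc : HasCompactSupport k) :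
    Tendsto (fun n => ∫ x, conv (rho n) f x * k x) atTop (𝓝 (∫ x, f x * k x)) := by
  have hS : IsCompact (Metric.cthickening 1 (tsupport k)) := hc.isCompact.cthickening
  obtain ⟨B, hB⟩ := hS.exists_bound_of_continuousOn hf.continuousOn
  refine tendsto_integral_of_dominated_convergence (fun x => B * ‖k x‖) (fun n => ?_)
    ((hk.integrable_of_hasCompactSupport hc).norm.const_mul B)
    (fun n => Eventually.of_forall fun x => ?_) (Eventually.of_forall fun x => ?_)
  · exact ((contDiff_conv (isTest_rho n) hf.locallyIntegrable).continuous.mul hk).aestronglyMeasurable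
  · by_cases hx : x ∈ tsupport k
    · rw [norm_mul]
      refine mul_le_mul_of_nonneg_right (abs_mollify_le_of_ball (fun y hy => ?_) n) (norm_nonneg _)
      exact hB y (Metric.mem_cthickening_of_dist_le y x 1 _ hx (by rwa [dist_eq_norm]))
    · simp [image_eq_zero_of_notMem_tsupport hx]
  · exact (tendsto_mollify hf x).mul_const _

/-- A first-order identity that holds for smooth compactly supported test functions holds for those
of class `C¹`. -/
theorem weak_identity_of_contDiff_one {G₀ G₁ p : Plane → ℝ} (h0 : LocallyIntegrable G₀)
    (h1 : LocallyIntegrable G₁) (hp : LocallyIntegrable p)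
    (h : ∀ ψ, IsTest ψ → ∫ x, (G₀ x * pd 0 ψ x + G₁ x * pd 1 ψ x + p x * ψ x) = 0)
    {φ : Plane → ℝ} (hφ : ContDiff ℝ 1 φ) (hc : HasCompactSupport φ) :
    ∫ x, (G₀ x * pd 0 φ x + G₁ x * pd 1 φ x + p x * φ x) = 0 := by
  have int : ∀ {u k : Plane → ℝ}, LocallyIntegrable u → Continuous k → HasCompactSupport k →
      Integrable fun x => u x * k x := fun hu hk hkc =>
    hu.integrable_smul_right_of_hasCompactSupport hk hkc
  have split : ∀ φ : Plane → ℝ, ContDiff ℝ 1 φ → HasCompactSupport φ →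
      ∫ x, (G₀ x * pd 0 φ x + G₁ x * pd 1 φ x + p x * φ x) =
        (∫ x, G₀ x * pd 0 φ x) + (∫ x, G₁ x * pd 1 φ x) + ∫ x, p x * φ x := by
    intro φ hφ hc
    have a0 := int h0 (continuous_pd hφ 0) (hc.pd 0)
    have a1 := int h1 (continuous_pd hφ 1) (hc.pd 1)
    rw [integral_add (integrable_fun_add a0 a1) (int hp hφ.continuous hc), integral_add a0 a1]
  rw [split φ hφ hc]
  have l0 := tendsto_integral_mollify h0 (continuous_pd hφ 0) (hc.pd 0)
  have l1 := tendsto_integral_mollify h1 (continuous_pd hφ 1) (hc.pd 1)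
  have l2 := tendsto_integral_mollify hp hφ.continuous hc
  refine tendsto_nhds_unique ((l0.add l1).add l2) ?_
  refine tendsto_const_nhds.congr fun n => ?_
  have ht := isTest_mollify hφ.continuous hc n
  have := h _ ht
  rw [split _ ht.c1 ht.compact] at this
  rw [← this]
  simp_rw [pd_conv_of_contDiff (isTest_rho n) hφ]

/-! ### Second derivatives in `L²` from the Laplacian -/

theorem MemLp.locInt {f : Plane → ℝ} (hf : MemLp f 2) : LocallyIntegrable f :=
  hf.locallyIntegrable (by norm_num)

/-- If the Laplacian of a `C¹` function with square integrable gradient is, in the sense of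
distributions, bounded in `L²` by `M`, then so is each of its second derivatives. -/
theorem exists_weak_hessian {f : Plane → ℝ} (hf : ContDiff ℝ 1 f) (hd : ∀ i, MemLp (pd i f) 2)
    {M : ℝ} (hM : 0 ≤ M)
    (hb : ∀ ψ, IsTest ψ → |∫ x, (pd 0 f x * pd 0 ψ x + pd 1 f x * pd 1 ψ x)| ≤ M * l2 ψ)
    (i j : Fin 2) : ∃ h : Plane → ℝ, MemLp h 2 ∧ l2 h ≤ M ∧
      ∀ ψ, IsTest ψ → ∫ x, pd i f x * pd j ψ x = -∫ x, h x * ψ x := by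
  have int : ∀ k l ψ, IsTest ψ → Integrable fun x => pd k f x * pd l ψ x := fun k l ψ hψ =>
    integrable_mul_of_memLp (hd k) (hψ.pd l).memLp
  -- the distributional Laplacian is a square integrable function `L`
  obtain ⟨L, hL, hLM, hLr⟩ := exists_l2_repr
    (fun ψ => ∫ x, (pd 0 f x * pd 0 ψ x + pd 1 f x * pd 1 ψ x)) (fun ψ => ψ)
    (fun ψ φ hψ hφ => by
      rw [← integral_add (integrable_fun_add (int 0 0 ψ hψ) (int 1 1 ψ hψ))
        (integrable_fun_add (int 0 0 φ hφ) (int 1 1 φ hφ))]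
      congr 1; ext x
      rw [pd_add hψ.differentiable hφ.differentiable, pd_add hψ.differentiable hφ.differentiable]
      ring)
    (fun c ψ hψ => by
      rw [← integral_const_mul]
      congr 1; ext x
      rw [pd_const_mul hψ.differentiable, pd_const_mul hψ.differentiable]
      ring)
    (fun _ _ _ _ => rfl) (fun _ _ _ => rfl) (fun ψ hψ => hψ.memLp) hM hb
  have hfl := hf.continuous.locallyIntegrable (μ := (volume : Measure Plane))
  -- the inequality `‖D²u‖ ≤ ‖Δu‖` applies to the mollifications of `f`
  have hW : ∀ n, ContDiff ℝ ∞ (conv (rho n) f) := fun n => contDiff_conv (isTest_rho n) hfl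
  have hp1 : ∀ n k, pd k (conv (rho n) f) = conv (rho n) (pd k f) := fun n k =>
    funext fun x => pd_conv_of_contDiff (isTest_rho n) hf k x
  have hp2 : ∀ n k l, pd l (pd k (conv (rho n) f)) = conv (pd l (rho n)) (pd k f) := fun n k l => by
    rw [hp1]; exact funext fun x => pd_conv (isTest_rho n) (MemLp.locInt (hd k)) l x
  have hp3 : ∀ n k l m, pd m (pd l (pd k (conv (rho n) f))) = conv (pd m (pd l (rho n))) (pd k f) :=
    fun n k l m => by
      rw [hp2]; exact funext fun x => pd_conv ((isTest_rho n).pd l) (MemLp.locInt (hd k)) m x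
  have hlap : ∀ n, (fun x => pd 0 (pd 0 (conv (rho n) f)) x + pd 1 (pd 1 (conv (rho n) f)) x) =
      fun x => -conv (rho n) L x := by
    intro n; ext x
    have hr := isTest_reflect (isTest_rho n) x
    have := hLr _ hr
    rw [hp2, hp2, conv_apply', conv_apply', conv_apply', ← integral_add, ← integral_neg, ← neg_inj]
    · rw [← integral_neg, ← integral_neg]
      simp_rw [pd_reflect (isTest_rho n)] at this
      calc _ = _ := ?_
        _ = _ := this
        _ = _ := ?_
      all_goals congr 1; ext z; ring
    · exact integrable_conv ((isTest_rho n).pd 0).contDiff.continuous ((isTest_rho n).pd 0).compact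
        (MemLp.locInt (hd 0)) x
    · exact integrable_conv ((isTest_rho n).pd 1).contDiff.continuous ((isTest_rho n).pd 1).compact
        (MemLp.locInt (hd 1)) x
  have hess : ∀ n, MemLp (pd j (pd i (conv (rho n) f))) 2 ∧ l2 (pd j (pd i (conv (rho n) f))) ≤ M := by
    intro n
    have m2 : ∀ k l, MemLp (pd l (pd k (conv (rho n) f))) 2 := fun k l => by
      rw [hp2]
      exact (memLp_conv ((isTest_rho n).pd l).contDiff.continuous ((isTest_rho n).pd l).compact (hd k)).1
    refine ⟨m2 i j, ?_⟩
    refine (l2_pd_pd_le (contDiff_three (hW n)) (fun k => ?_) (fun l k => m2 k l)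
      (fun m l k => ?_) j i).trans ?_
    · rw [hp1]; exact (memLp_mollify n (hd k)).1
    · rw [hp3]
      exact (memLp_conv (((isTest_rho n).pd l).pd m).contDiff.continuous
        (((isTest_rho n).pd l).pd m).compact (hd k)).1
    · rw [hlap, l2_neg]
      exact (memLp_mollify n hL).2.trans hLM
  -- in weak form the bound passes to the limit, and represents the second derivative
  have hlim : ∀ ψ, IsTest ψ → |-∫ x, pd i f x * pd j ψ x| ≤ M * l2 ψ := by
    intro ψ hψ
    have ht := tendsto_integral_mollify_mul (continuous_pd hf i) (hψ.pd j).contDiff.continuous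
      (hψ.pd j).compact
    rw [abs_neg]
    refine le_of_tendsto ht.abs (Eventually.of_forall fun n => ?_)
    rw [← hp1, integral_mul_pd j (contDiff_one (contDiff_pd (hW n) i)) hψ.c1 hψ.compact, abs_neg]
    exact (abs_integral_mul_le (hess n).1 hψ.memLp).trans
      (mul_le_mul_of_nonneg_right (hess n).2 (l2_nonneg _))
  obtain ⟨h, hh, hhM, hhr⟩ := exists_l2_repr
    (fun ψ => -∫ x, pd i f x * pd j ψ x) (fun ψ => ψ)
    (fun ψ φ hψ hφ => by
      rw [← neg_add, ← integral_add (int i j ψ hψ) (int i j φ hφ)]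
      congr 2; ext x
      rw [pd_add hψ.differentiable hφ.differentiable]
      ring)
    (fun c ψ hψ => by
      rw [mul_neg, ← integral_const_mul]
      congr 2; ext x
      rw [pd_const_mul hψ.differentiable]
      ring)
    (fun _ _ _ _ => rfl) (fun _ _ _ => rfl) (fun ψ hψ => hψ.memLp) hM hlim
  exact ⟨h, hh, hhM, fun ψ hψ => by rw [← hhr ψ hψ, neg_neg]⟩

/-! ### The system in coordinates -/

/-- The properties of the background field `e^Δ u₀` on which the estimates depend. The constant `K`
is the only quantity that enters the final bounds. The last field is the weak form of
`b + x · ∇b = -2 Δb`. -/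
structure IsBackground (K : ℝ) (b : Fin 2 → Plane → ℝ) : Prop where
  contDiff : ∀ k, ContDiff ℝ 1 (b k)
  bound : ∀ k x, |b k x| * √(wt x) ≤ K
  pd_bound : ∀ i k x, |pd i (b k) x| * √(wt x) ≤ K
  pd_memLp : ∀ i k, MemLp (pd i (b k)) 2
  pd_l2 : ∀ i k, l2 (pd i (b k)) ≤ K
  div : ∀ x, pd 0 (b 0) x + pd 1 (b 1) x = 0
  heat : ∀ k φ, ContDiff ℝ 1 φ → HasCompactSupport φ →
    ∫ x, (b k x + (x 0 * pd 0 (b k) x + x 1 * pd 1 (b k) x)) * φ x =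
      2 * ∫ x, (pd 0 (b k) x * pd 0 φ x + pd 1 (b k) x * pd 1 φ x)

/-- The class of perturbations, with a (merely qualitative) bound `M`. -/
structure IsPerturbation (M : ℝ) (v : Fin 2 → Plane → ℝ) : Prop where
  contDiff : ∀ k, ContDiff ℝ 1 (v k)
  bound : ∀ k x, |v k x| * wt x ≤ M
  pd_bound : ∀ i k x, |pd i (v k) x| * wt x ≤ M
  div : ∀ x, pd 0 (v 0) x + pd 1 (v 1) x = 0

/-- The full velocity `b + v`. -/
def total (b v : Fin 2 → Plane → ℝ) (k : Fin 2) (x : Plane) : ℝ := b k x + v k x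

/-- The terms of order at most one in the momentum equation,
`-v/2 - (x · ∇v)/2 + (V · ∇)V` with `V = b + v`. -/
noncomputable def force (b v : Fin 2 → Plane → ℝ) (k : Fin 2) (x : Plane) : ℝ :=
  -(1 / 2) * v k x - (1 / 2) * (x 0 * pd 0 (v k) x + x 1 * pd 1 (v k) x)
    + (total b v 0 x * pd 0 (total b v k) x + total b v 1 x * pd 1 (total b v k) x)

/-- The weak form of the momentum equation, in components. -/
structure IsWeakSol (b v : Fin 2 → Plane → ℝ) (q : Plane → ℝ) : Prop where
  locInt : LocallyIntegrable q
  eq_zero : ∀ k ψ, IsTest ψ →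
    ∫ x, (pd 0 (v k) x * pd 0 ψ x + pd 1 (v k) x * pd 1 ψ x + force b v k x * ψ x - q x * pd k ψ x) = 0

section
variable {K M : ℝ} {b v : Fin 2 → Plane → ℝ}

theorem IsBackground.nonneg (h : IsBackground K b) : 0 ≤ K := (l2_nonneg _).trans (h.pd_l2 0 0)

theorem IsPerturbation.nonneg (h : IsPerturbation M v) : 0 ≤ M :=
  (mul_nonneg (abs_nonneg _) (wt_pos 0).le).trans (h.bound 0 0)

theorem sqrt_wt_pos (x : Plane) : 0 < √(wt x) := Real.sqrt_pos.2 (wt_pos x)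

theorem sqrt_wt_le_wt (x : Plane) : √(wt x) ≤ wt x := by
  have h1 := one_le_sqrt_wt x
  have h2 := Real.sq_sqrt (wt_pos x).le
  nlinarith

theorem IsBackground.abs_pd_le (h : IsBackground K b) (i k x) : |pd i (b k) x| ≤ K := by
  have := h.pd_bound i k x
  nlinarith [one_le_sqrt_wt x, abs_nonneg (pd i (b k) x)]

theorem IsPerturbation.bound_sqrt (h : IsPerturbation M v) (k x) : |v k x| * √(wt x) ≤ M :=
  (mul_le_mul_of_nonneg_left (sqrt_wt_le_wt x) (abs_nonneg _)).trans (h.bound k x)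

theorem IsPerturbation.pd_bound_sqrt (h : IsPerturbation M v) (i k x) :
    |pd i (v k) x| * √(wt x) ≤ M :=
  (mul_le_mul_of_nonneg_left (sqrt_wt_le_wt x) (abs_nonneg _)).trans (h.pd_bound i k x)

theorem IsPerturbation.abs_le (h : IsPerturbation M v) (k x) : |v k x| ≤ M := by
  have := h.bound k x
  nlinarith [one_le_wt x, abs_nonneg (v k x)]

theorem IsPerturbation.abs_pd_le (h : IsPerturbation M v) (i k x) : |pd i (v k) x| ≤ M := by
  have := h.pd_bound i k x
  nlinarith [one_le_wt x, abs_nonneg (pd i (v k) x)]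

theorem memLp_wt_inv : MemLp (fun x => (wt x)⁻¹) 2 := by
  have hc : Continuous fun x => (wt x)⁻¹ := continuous_wt.inv₀ fun x => (wt_pos x).ne'
  rw [memLp_two_iff hc.aestronglyMeasurable]
  simpa [inv_pow] using integrable_wt_inv_sq

theorem memLp_of_mul_wt_le {f : Plane → ℝ} (hf : Continuous f) {C : ℝ}
    (h : ∀ x, |f x| * wt x ≤ C) : MemLp f 2 := by
  refine memLp_of_abs_le (memLp_wt_inv.const_mul C) hf.aestronglyMeasurable fun x => ?_
  refine le_trans ?_ (le_abs_self _)
  rw [← div_eq_mul_inv, le_div_iff₀ (wt_pos x)]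
  exact h x

theorem IsPerturbation.memLp (h : IsPerturbation M v) (k) : MemLp (v k) 2 :=
  memLp_of_mul_wt_le (h.contDiff k).continuous (h.bound k)

theorem IsPerturbation.memLp_pd (h : IsPerturbation M v) (i k) : MemLp (pd i (v k)) 2 :=
  memLp_of_mul_wt_le (continuous_pd (h.contDiff k) i) (h.pd_bound i k)

theorem contDiff_total (hb : IsBackground K b) (hv : IsPerturbation M v) (k) :
    ContDiff ℝ 1 (total b v k) := (hb.contDiff k).add (hv.contDiff k)

theorem pd_total (hb : IsBackground K b) (hv : IsPerturbation M v) (i k) (x) :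
    pd i (total b v k) x = pd i (b k) x + pd i (v k) x :=
  pd_add ((hb.contDiff k).differentiable one_ne_zero) ((hv.contDiff k).differentiable one_ne_zero) i x

theorem div_total (hb : IsBackground K b) (hv : IsPerturbation M v) (x) :
    pd 0 (total b v 0) x + pd 1 (total b v 1) x = 0 := by
  rw [pd_total hb hv, pd_total hb hv]
  linarith [hb.div x, hv.div x]

theorem total_bound (hb : IsBackground K b) (hv : IsPerturbation M v) (k x) :
    |total b v k x| * √(wt x) ≤ K + M := by
  refine (mul_le_mul_of_nonneg_right (abs_add_le _ _) (Real.sqrt_nonneg _)).trans ?_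
  rw [add_mul]
  exact add_le_add (hb.bound k x) (hv.bound_sqrt k x)

theorem pd_total_bound (hb : IsBackground K b) (hv : IsPerturbation M v) (i k x) :
    |pd i (total b v k) x| * √(wt x) ≤ K + M := by
  rw [pd_total hb hv]
  refine (mul_le_mul_of_nonneg_right (abs_add_le _ _) (Real.sqrt_nonneg _)).trans ?_
  rw [add_mul]
  exact add_le_add (hb.pd_bound i k x) (hv.pd_bound_sqrt i k x)

theorem memLp_total_mul (hb : IsBackground K b) (hv : IsPerturbation M v) (j k) :
    MemLp (fun x => total b v j x * total b v k x) 2 := by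
  refine memLp_of_mul_wt_le (C := (K + M) * (K + M))
    ((contDiff_total hb hv j).continuous.mul (contDiff_total hb hv k).continuous) fun x => ?_
  rw [abs_mul]
  calc |total b v j x| * |total b v k x| * wt x
      = (|total b v j x| * √(wt x)) * (|total b v k x| * √(wt x)) := by
        rw [mul_mul_mul_comm, Real.mul_self_sqrt (wt_pos x).le]
    _ ≤ _ := by
      gcongr
      · exact add_nonneg hb.nonneg hv.nonneg
      · exact total_bound hb hv j x
      · exact total_bound hb hv k x

theorem continuous_force (hb : IsBackground K b) (hv : IsPerturbation M v) (k) :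
    Continuous (force b v k) := by
  have c1 := (hv.contDiff k).continuous
  have c2 := fun i => continuous_pd (hv.contDiff k) i
  have c3 := fun i => continuous_pd (contDiff_total hb hv k) i
  have c4 := fun i => (contDiff_total hb hv i).continuous
  have c20 := c2 0
  have c21 := c2 1
  have c30 := c3 0
  have c31 := c3 1
  have c40 := c4 0
  have c41 := c4 1
  have x0 := (contDiff_coord (n := 0) 0).continuous
  have x1 := (contDiff_coord (n := 0) 1).continuous
  unfold force
  fun_prop

/-- The lower-order terms decay like `|x|⁻¹`. -/
theorem force_bound (hb : IsBackground K b) (hv : IsPerturbation M v) (k x) :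
    |force b v k x| * √(wt x) ≤ M / 2 + M + 2 * (K + M) ^ 2 := by
  have hs := sqrt_wt_pos x
  have hKM : 0 ≤ K + M := add_nonneg hb.nonneg hv.nonneg
  have a1 := hv.bound_sqrt k x
  have a2 : ∀ i, |x i * pd i (v k) x| * √(wt x) ≤ M := fun i => by
    rw [abs_mul]
    calc |x i| * |pd i (v k) x| * √(wt x) ≤ √(wt x) * |pd i (v k) x| * √(wt x) := by
          gcongr; exact abs_coord_le i x
      _ = |pd i (v k) x| * (√(wt x) * √(wt x)) := by ring
      _ ≤ M := by rw [Real.mul_self_sqrt (wt_pos x).le]; exact hv.pd_bound i k x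
  have a3 : ∀ i, |total b v i x * pd i (total b v k) x| * √(wt x) ≤ (K + M) ^ 2 := fun i => by
    rw [abs_mul]
    have h1 : |total b v i x| ≤ K + M := by
      have := total_bound hb hv i x
      nlinarith [one_le_sqrt_wt x, abs_nonneg (total b v i x)]
    calc |total b v i x| * |pd i (total b v k) x| * √(wt x)
        = |total b v i x| * (|pd i (total b v k) x| * √(wt x)) := by ring
      _ ≤ (K + M) * (K + M) := by
          gcongr
          exact pd_total_bound hb hv i k x
      _ = _ := by ring
  have tri : |force b v k x| ≤ 1 / 2 * |v k x| + 1 / 2 * (|x 0 * pd 0 (v k) x| + |x 1 * pd 1 (v k) x|)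
      + (|total b v 0 x * pd 0 (total b v k) x| + |total b v 1 x * pd 1 (total b v k) x|) := by
    unfold force
    refine (abs_add_le _ _).trans (add_le_add ((abs_sub _ _).trans (add_le_add ?_ ?_)) (abs_add_le _ _))
    · rw [abs_mul]; norm_num
    · rw [abs_mul, abs_of_pos (by norm_num : (0 : ℝ) < 1 / 2)]
      gcongr
      exact abs_add_le _ _
  have := mul_le_mul_of_nonneg_right tri hs.le
  linarith [a2 0, a2 1, a3 0, a3 1]

/-! ### The pressure -/

theorem tsupport_pd_subset (f : Plane → ℝ) (i : Fin 2) : tsupport (pd i f) ⊆ tsupport f := by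
  refine closure_minimal (fun x hx => ?_) (isClosed_tsupport f)
  by_contra h
  exact hx (pd_eq_zero_of_notMem h i)

/-- The Laplacian. -/
noncomputable def lap (f : Plane → ℝ) (x : Plane) : ℝ := pd 0 (pd 0 f) x + pd 1 (pd 1 f) x

theorem IsTest.lap {η : Plane → ℝ} (h : IsTest η) : IsTest (lap η) :=
  ((h.pd 0).pd 0).add ((h.pd 1).pd 1)

set_option maxHeartbeats 1000000 in
/-- Testing the momentum equation with a gradient: the linear terms drop out. -/
theorem integral_pressure_lap (hb : IsBackground K b) (hv : IsPerturbation M v) {q : Plane → ℝ}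
    (hq : IsWeakSol b v q) {η : Plane → ℝ} (hη : IsTest η) :
    ∫ x, q x * lap η x = -∫ x, (total b v 0 x * total b v 0 x * pd 0 (pd 0 η) x
      + total b v 0 x * total b v 1 x * pd 0 (pd 1 η) x
      + total b v 1 x * total b v 0 x * pd 1 (pd 0 η) x
      + total b v 1 x * total b v 1 x * pd 1 (pd 1 η) x) := by
  have hVc := contDiff_total hb hv
  have hVdiv := div_total hb hv
  have hfc := continuous_force hb hv
  have e0 := hq.eq_zero 0 (pd 0 η) (hη.pd 0)
  have e1 := hq.eq_zero 1 (pd 1 η) (hη.pd 1)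
  have t1 := fun i => hη.pd i
  have t2 := fun i j => (hη.pd j).pd i
  have z1 : ∀ x ∉ tsupport η, ∀ i, pd i η x = 0 := fun x hx i => pd_eq_zero_of_notMem hx i
  have z2 : ∀ x ∉ tsupport η, ∀ i j, pd i (pd j η) x = 0 := fun x hx i j =>
    pd_eq_zero_of_notMem (fun h => hx (tsupport_pd_subset η j h)) i
  have intA : ∀ k, Integrable fun x => pd 0 (v k) x * pd 0 (pd k η) x + pd 1 (v k) x * pd 1 (pd k η) x
      + force b v k x * pd k η x := fun k => by
    refine integrable_of_eq_zero_off ?_ hη.compact fun x hx => by simp [z1 x hx, z2 x hx]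
    have := continuous_pd (hv.contDiff k) 0
    have := continuous_pd (hv.contDiff k) 1
    have := (t1 k).contDiff.continuous
    have := (t2 0 k).contDiff.continuous
    have := (t2 1 k).contDiff.continuous
    have := hfc k
    fun_prop
  have intq : ∀ k, Integrable fun x => q x * pd k (pd k η) x := fun k =>
    hq.locInt.integrable_smul_right_of_hasCompactSupport (t2 k k).contDiff.continuous (t2 k k).compact
  rw [integral_sub (intA 0) (intq 0), sub_eq_zero] at e0
  rw [integral_sub (intA 1) (intq 1), sub_eq_zero] at e1
  have hsum : ∫ x, q x * lap η x = ∫ x, q x * pd 0 (pd 0 η) x + q x * pd 1 (pd 1 η) x := by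
    congr 1; ext x; rw [lap]; ring
  rw [hsum, integral_add (intq 0) (intq 1), ← e0, ← e1, ← integral_add (intA 0) (intA 1), ← integral_neg]
  have cV := fun k => (hVc k).continuous
  have V0 := hVc 0
  have V1 := hVc 1
  have v0 := hv.contDiff 0
  have v1 := hv.contDiff 1
  have hdv := hv.div
  set V := total b v with hVdef
  have dV0 := V0.differentiable one_ne_zero
  have dV1 := V1.differentiable one_ne_zero
  have dv0 := v0.differentiable one_ne_zero
  have dv1 := v1.differentiable one_ne_zero
  have x0 := contDiff_coord (n := 1) 0
  have x1 := contDiff_coord (n := 1) 1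
  have dx0 := differentiable_coord 0
  have dx1 := differentiable_coord 1
  have c0 := (t1 0).c1
  have c1 := (t1 1).c1
  have c00 := (t2 0 0).c1
  have c01 := (t2 0 1).c1
  have c10 := (t2 1 0).c1
  have c11 := (t2 1 1).c1
  have d0 := (t1 0).differentiable
  have d1 := (t1 1).differentiable
  have d00 := (t2 0 0).differentiable
  have d01 := (t2 0 1).differentiable
  have d10 := (t2 1 0).differentiable
  have d11 := (t2 1 1).differentiable
  refine integral_eq_of_sub_eq_div
    (H₀ := fun x => v 0 x * pd 0 (pd 0 η) x + v 1 x * pd 0 (pd 1 η) x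
      - v 0 x * (pd 0 (pd 0 η) x + pd 1 (pd 1 η) x)
      - (1 / 2) * (x 0 * (v 0 x * pd 0 η x + v 1 x * pd 1 η x)
        - v 0 x * (x 0 * pd 0 η x + x 1 * pd 1 η x))
      + V 0 x * (V 0 x * pd 0 η x + V 1 x * pd 1 η x))
    (H₁ := fun x => v 0 x * pd 1 (pd 0 η) x + v 1 x * pd 1 (pd 1 η) x
      - v 1 x * (pd 0 (pd 0 η) x + pd 1 (pd 1 η) x)
      - (1 / 2) * (x 1 * (v 0 x * pd 0 η x + v 1 x * pd 1 η x)
        - v 1 x * (x 0 * pd 0 η x + x 1 * pd 1 η x))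
      + V 1 x * (V 0 x * pd 0 η x + V 1 x * pd 1 η x))
    (integrable_fun_add (intA 0) (intA 1)) ?_ (by fun_prop) (by fun_prop) ?_ ?_ ?_
  · refine integrable_of_eq_zero_off ?_ hη.compact fun x hx => by simp [z2 x hx]
    have := V0.continuous
    have := V1.continuous
    have := c00.continuous
    have := c01.continuous
    have := c10.continuous
    have := c11.continuous
    fun_prop
  · exact HasCompactSupport.intro hη.compact fun x hx => by simp [z1 x hx, z2 x hx]
  · exact HasCompactSupport.intro hη.compact fun x hx => by simp [z1 x hx, z2 x hx]
  · intro x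
    have s1 := pd_comm (contDiff_two hη.contDiff) 1 0 x
    have s2 := pd_comm (contDiff_two (t1 0).contDiff) 1 0 x
    have s3 := pd_comm (contDiff_two (t1 1).contDiff) 1 0 x
    have s4 : pd 1 (pd 0 η) = pd 0 (pd 1 η) := funext fun y => pd_comm (contDiff_two hη.contDiff) 1 0 y
    have hd := hdv x
    have hD := hVdiv x
    have p0 : pd 0 (v 0) x = -pd 1 (v 1) x := by linarith
    have p1 : pd 0 (V 0) x = -pd 1 (V 1) x := by linarith
    simp only [force, ← hVdef]
    rw [s4] at s2 ⊢
    simp (disch := fun_prop) only [pd_add, pd_sub, pd_mul, pd_const, pd_coord]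
    rw [s4, s2, s3, p0, p1]
    simp
    ring

end

/-- A harmonic function on the plane whose gradient vanishes at infinity has zero gradient:
`∂₀u - i ∂₁u` is an entire function. -/
theorem pd_eq_zero_of_harmonic {u : Plane → ℝ} (hu : ContDiff ℝ 2 u) (hl : ∀ x, lap u x = 0)
    (h : ∀ k, Tendsto (pd k u) (cocompact Plane) (𝓝 0)) (k : Fin 2) (x : Plane) : pd k u x = 0 := by
  let τ : ℂ ≃ₗᵢ[ℝ] Plane := Complex.orthonormalBasisOneI.repr
  have τ1 : τ 1 = e 0 := by
    ext i; fin_cases i <;> simp [τ, e]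
  have τI : τ Complex.I = e 1 := by
    ext i; fin_cases i <;> simp [τ, e]
  have hτ : Tendsto τ (cocompact ℂ) (cocompact Plane) :=
    τ.toHomeomorph.isClosedEmbedding.tendsto_cocompact
  have hd : ∀ k, Differentiable ℝ (pd k u) := fun k =>
    (hu.pd (m := 1) (by norm_num) k).differentiable one_ne_zero
  let g : ℂ → ℂ := fun z => (pd 0 u (τ z) : ℂ) - Complex.I * (pd 1 u (τ z) : ℂ)
  have hk : ∀ k z, HasFDerivAt (fun z => (pd k u (τ z) : ℂ))
      (Complex.ofRealCLM.comp ((fderiv ℝ (pd k u) (τ z)).comp (τ : ℂ →L[ℝ] Plane))) z := fun k z =>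
    Complex.ofRealCLM.hasFDerivAt.comp z
      ((hd k (τ z)).hasFDerivAt.comp z (τ : ℂ →L[ℝ] Plane).hasFDerivAt)
  have hg : ∀ z, HasFDerivAt g _ z := fun z => (hk 0 z).sub ((hk 1 z).const_mul Complex.I)
  have hG : Differentiable ℂ g := by
    intro z
    rw [differentiableAt_complex_iff_differentiableAt_real]
    refine ⟨(hg z).differentiableAt, ?_⟩
    rw [(hg z).fderiv]
    have key : ∀ i j, fderiv ℝ (pd i u) (τ z) (e j) = pd j (pd i u) (τ z) := fun _ _ => rfl
    have l := hl (τ z)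
    rw [lap] at l
    have c := pd_comm hu 1 0 (τ z)
    have l' : pd 1 (pd 1 u) (τ z) = -pd 0 (pd 0 u) (τ z) := by linarith
    simp [τ1, τI, key, c, l']
    ring_nf
    simp
  have hg0 : Tendsto g (cocompact ℂ) (𝓝 0) := by
    have t : ∀ k, Tendsto (fun z => (pd k u (τ z) : ℂ)) (cocompact ℂ) (𝓝 0) := fun k => by
      have := (Complex.continuous_ofReal.tendsto 0).comp ((h k).comp hτ)
      simpa using! this
    simpa using (t 0).sub ((t 1).const_mul Complex.I)
  have h0 := hG.apply_eq_of_tendsto_cocompact (τ.symm x) hg0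
  have hre := congrArg Complex.re h0
  have him := congrArg Complex.im h0
  simp [g] at hre him
  fin_cases k
  · exact hre
  · exact him

theorem tendsto_const_sub_cocompact (z : Plane) :
    Tendsto (fun x : Plane => x - z) (cocompact Plane) (cocompact Plane) :=
  (Homeomorph.subRight z).isClosedEmbedding.tendsto_cocompact

instance : (cocompact Plane).IsCountablyGenerated := by
  rw [← Metric.cobounded_eq_cocompact, ← comap_norm_atTop]; infer_instance

/-- Convolutions with a test function of a bounded function that vanishes at infinity vanish at
infinity. -/
theorem tendsto_conv_cocompact {κ g : Plane → ℝ} (hκ : IsTest κ) (hg : Continuous g) {C : ℝ}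
    (hC : ∀ x, |g x| ≤ C) (h : Tendsto g (cocompact Plane) (𝓝 0)) :
    Tendsto (conv κ g) (cocompact Plane) (𝓝 0) := by
  have hi : Integrable κ := hκ.contDiff.continuous.integrable_of_hasCompactSupport hκ.compact
  have := tendsto_integral_filter_of_dominated_convergence (μ := (volume : Measure Plane))
    (F := fun x z => κ z * g (x - z)) (f := fun _ => (0 : ℝ)) (l := cocompact Plane)
    (fun z => |κ z| * C) (Eventually.of_forall fun x => ?_)
    (Eventually.of_forall fun x => Eventually.of_forall fun z => ?_) (hi.abs.mul_const C)
    (Eventually.of_forall fun z => ?_)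
  · simpa using! this
  · exact (hκ.contDiff.continuous.mul (hg.comp (by fun_prop))).aestronglyMeasurable
  · rw [norm_mul, Real.norm_eq_abs, Real.norm_eq_abs]
    gcongr
    exact hC _
  · simpa using (h.comp (tendsto_const_sub_cocompact z)).const_mul (κ z)

/-- Convolutions with a test function of a square integrable function vanish at infinity. -/
theorem tendsto_conv_cocompact_of_memLp {κ g : Plane → ℝ} (hκ : IsTest κ) (hg : MemLp g 2) :
    Tendsto (conv κ g) (cocompact Plane) (𝓝 0) := by
  have hκc := hκ.contDiff.continuous
  have hi : Integrable κ := hκc.integrable_of_hasCompactSupport hκ.compact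
  have hsq : Integrable fun z => g z ^ 2 := (memLp_two_iff hg.1).1 hg
  obtain ⟨B, hB⟩ := hκc.bounded_above_of_compact_support hκ.compact
  set s : Plane → Plane → ℝ := fun x z => √|κ (x - z)| with hs
  have hsc : ∀ x, Continuous (s x) := fun x => by
    have : Continuous fun z => κ (x - z) := hκc.comp (by fun_prop)
    exact this.abs.sqrt
  have hss : ∀ x z, s x z * s x z = |κ (x - z)| := fun x z => Real.mul_self_sqrt (abs_nonneg _)
  have hs1 : ∀ x, MemLp (s x) 2 := fun x => by
    refine memLp_of_compact (hsc x) ?_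
    exact (isTest_reflect hκ x).compact.comp_left (g := fun t => √|t|) (by simp)
  have hs2 : ∀ x, MemLp (fun z => s x z * |g z|) 2 := fun x => by
    refine memLp_bdd_mul (hsc x).aestronglyMeasurable hg.abs (C := √B) fun z => ?_
    rw [abs_of_nonneg (Real.sqrt_nonneg _)]
    exact Real.sqrt_le_sqrt (hB _)
  have hl1 : ∀ x, l2 (s x) ^ 2 = ∫ z, |κ z| := fun x => by
    rw [l2_sq (hs1 x)]
    simp_rw [pow_two, hss]
    exact integral_sub_left_eq_self (fun z => |κ z|) volume x
  have hl2 : ∀ x, l2 (fun z => s x z * |g z|) ^ 2 = ∫ z, |κ (x - z)| * g z ^ 2 := fun x => by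
    rw [l2_sq (hs2 x)]
    congr 1; ext z
    rw [← hss, mul_pow, sq_abs]; ring
  have hle : ∀ x, conv κ g x ^ 2 ≤ (∫ z, |κ z|) * ∫ z, |κ (x - z)| * g z ^ 2 := by
    intro x
    have h1 : |conv κ g x| ≤ l2 (s x) * l2 (fun z => s x z * |g z|) := by
      refine le_trans ?_ ((le_abs_self _).trans (abs_integral_mul_le (hs1 x) (hs2 x)))
      rw [conv_apply', ← Real.norm_eq_abs]
      refine (norm_integral_le_integral_norm _).trans_eq ?_
      congr 1; ext z
      rw [← mul_assoc, hss, norm_mul]; rfl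
    rw [← hl1 x, ← hl2, ← mul_pow, ← sq_abs]
    exact pow_le_pow_left₀ (abs_nonneg _) h1 2
  have hz : Tendsto κ (cocompact Plane) (𝓝 0) := hκ.compact.is_zero_at_infty
  have hdom : Tendsto (fun x => ∫ z, |κ (x - z)| * g z ^ 2) (cocompact Plane) (𝓝 0) := by
    have := tendsto_integral_filter_of_dominated_convergence (μ := (volume : Measure Plane))
      (F := fun x z => |κ (x - z)| * g z ^ 2) (f := fun _ => (0 : ℝ)) (l := cocompact Plane)
      (fun z => B * g z ^ 2) (Eventually.of_forall fun x => ?_)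
      (Eventually.of_forall fun x => Eventually.of_forall fun z => ?_) (hsq.const_mul B)
      (Eventually.of_forall fun z => ?_)
    · simpa using! this
    · have : Continuous fun z => |κ (x - z)| := (hκc.comp (by fun_prop)).abs
      exact this.aestronglyMeasurable.mul hsq.1
    · rw [norm_mul, norm_pow, Real.norm_eq_abs, Real.norm_eq_abs, sq_abs, abs_abs]
      gcongr
      exact hB _
    · simpa using ((hz.comp (tendsto_const_sub_cocompact z)).abs).mul_const (g z ^ 2)
  have hsq0 : Tendsto (fun x => conv κ g x ^ 2) (cocompact Plane) (𝓝 0) := by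
    refine squeeze_zero (fun x => sq_nonneg _) hle ?_
    simpa using hdom.const_mul (∫ z, |κ z|)
  have := hsq0.sqrt
  simp only [Real.sqrt_sq_eq_abs, Real.sqrt_zero] at this
  exact (tendsto_zero_iff_abs_tendsto_zero _).2 this

section
variable {K M : ℝ} {b v : Fin 2 → Plane → ℝ}

theorem tendsto_inv_sqrt_wt : Tendsto (fun x => (√(wt x))⁻¹) (cocompact Plane) (𝓝 0) := by
  refine tendsto_inv_atTop_zero.comp ?_
  refine tendsto_atTop_mono norm_le_sqrt_wt ?_
  exact tendsto_norm_cocompact_atTop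

theorem tendsto_zero_of_mul_sqrt_wt_le {f : Plane → ℝ} {C : ℝ} (h : ∀ x, |f x| * √(wt x) ≤ C) :
    Tendsto f (cocompact Plane) (𝓝 0) := by
  refine squeeze_zero_norm (fun x => ?_) (by simpa using tendsto_inv_sqrt_wt.const_mul C)
  rw [Real.norm_eq_abs, ← div_eq_mul_inv, le_div_iff₀ (sqrt_wt_pos x)]
  exact h x

theorem le_of_mul_sqrt_wt_le {f : Plane → ℝ} {C : ℝ} (h : ∀ x, |f x| * √(wt x) ≤ C) (x : Plane) :
    |f x| ≤ C := by
  have := h x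
  nlinarith [one_le_sqrt_wt x, abs_nonneg (f x)]

/-- The pressure may be taken in `L²`. Testing with gradients and `‖D²η‖₂ ≤ ‖Δη‖₂` produces a
candidate `p`; the difference to the given pressure is harmonic, and by the equation its gradient
vanishes at infinity. -/
theorem exists_pressure (hb : IsBackground K b) (hv : IsPerturbation M v) {q : Plane → ℝ}
    (hq : IsWeakSol b v q) : ∃ p : Plane → ℝ, MemLp p 2 ∧ IsWeakSol b v p ∧
      l2 p ≤ l2 (fun x => total b v 0 x * total b v 0 x) + l2 (fun x => total b v 0 x * total b v 1 x)
        + l2 (fun x => total b v 1 x * total b v 0 x) + l2 (fun x => total b v 1 x * total b v 1 x) := by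
  set Q := l2 (fun x => total b v 0 x * total b v 0 x) + l2 (fun x => total b v 0 x * total b v 1 x)
        + l2 (fun x => total b v 1 x * total b v 0 x) + l2 (fun x => total b v 1 x * total b v 1 x)
    with hQ
  have hQ0 : 0 ≤ Q := by
    have := fun j k => l2_nonneg (fun x => total b v j x * total b v k x)
    linarith [this 0 0, this 0 1, this 1 0, this 1 1]
  have hm := memLp_total_mul hb hv
  have iq : ∀ ψ, IsTest ψ → Integrable fun x => q x * ψ x := fun ψ hψ =>
    hq.locInt.integrable_smul_right_of_hasCompactSupport hψ.contDiff.continuous hψ.compact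
  have lap_add : ∀ ψ φ, IsTest ψ → IsTest φ → lap (fun x => ψ x + φ x) = fun x => lap ψ x + lap φ x := by
    intro ψ φ hψ hφ
    have h1 : ∀ i, pd i (fun x => ψ x + φ x) = fun x => pd i ψ x + pd i φ x := fun i =>
      funext fun x => pd_add hψ.differentiable hφ.differentiable i x
    ext x
    rw [lap, h1, h1, pd_add (hψ.pd 0).differentiable (hφ.pd 0).differentiable,
      pd_add (hψ.pd 1).differentiable (hφ.pd 1).differentiable, lap, lap]
    ring
  have lap_smul : ∀ (c : ℝ) ψ, IsTest ψ → lap (fun x => c * ψ x) = fun x => c * lap ψ x := by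
    intro c ψ hψ
    have h1 : ∀ i, pd i (fun x => c * ψ x) = fun x => c * pd i ψ x := fun i =>
      funext fun x => pd_const_mul hψ.differentiable c i x
    ext x
    rw [lap, h1, h1, pd_const_mul (hψ.pd 0).differentiable, pd_const_mul (hψ.pd 1).differentiable, lap]
    ring
  obtain ⟨p, hp, hpQ, hpr⟩ := exists_l2_repr (fun η => ∫ x, q x * lap η x) lap
    (fun ψ φ hψ hφ => by
      simp only [lap_add ψ φ hψ hφ]
      rw [← integral_add (iq _ hψ.lap) (iq _ hφ.lap)]
      congr 1; ext x; ring)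
    (fun c ψ hψ => by
      simp only [lap_smul c ψ hψ]
      rw [← integral_const_mul]
      congr 1; ext x; ring)
    lap_add lap_smul (fun ψ hψ => hψ.lap.memLp) hQ0 (fun η hη => by
      have hh : ∀ i j, l2 (pd i (pd j η)) ≤ l2 (lap η) := fun i j =>
        l2_pd_pd_le (contDiff_three hη.contDiff) (fun i => (hη.pd i).memLp)
          (fun i j => ((hη.pd j).pd i).memLp) (fun i j k => (((hη.pd k).pd j).pd i).memLp) i j
      have hc : ∀ j k, |∫ x, total b v j x * total b v k x * pd j (pd k η) x|
          ≤ l2 (fun x => total b v j x * total b v k x) * l2 (lap η) := fun j k =>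
        (abs_integral_mul_le (hm j k) ((hη.pd k).pd j).memLp).trans
          (mul_le_mul_of_nonneg_left (hh j k) (l2_nonneg _))
      have hi : ∀ j k, Integrable fun x => total b v j x * total b v k x * pd j (pd k η) x :=
        fun j k => integrable_mul_of_memLp (hm j k) ((hη.pd k).pd j).memLp
      rw [integral_pressure_lap hb hv hq hη, abs_neg,
        integral_add (integrable_fun_add (integrable_fun_add (hi 0 0) (hi 0 1)) (hi 1 0)) (hi 1 1),
        integral_add (integrable_fun_add (hi 0 0) (hi 0 1)) (hi 1 0),
        integral_add (hi 0 0) (hi 0 1)]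
      refine (abs_add_le _ _).trans ((add_le_add ((abs_add_le _ _).trans
        (add_le_add (abs_add_le _ _) le_rfl)) le_rfl).trans ?_)
      rw [hQ]
      linarith [hc 0 0, hc 0 1, hc 1 0, hc 1 1])
  have hpl := MemLp.locInt hp
  have ip : ∀ ψ, IsTest ψ → Integrable fun x => p x * ψ x := fun ψ hψ =>
    hpl.integrable_smul_right_of_hasCompactSupport hψ.contDiff.continuous hψ.compact
  -- the convolutions of the pressure difference `D` with test functions are harmonic, and by the
  -- equation their gradients vanish at infinity
  set D : Plane → ℝ := fun x => q x - p x with hD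
  have hDl : LocallyIntegrable D := hq.locInt.sub hpl
  have hfc := continuous_force hb hv
  have c1 := fun i k => continuous_pd (hv.contDiff k) i
  have hA : ∀ k ψ, IsTest ψ → Integrable fun x =>
      pd 0 (v k) x * pd 0 ψ x + pd 1 (v k) x * pd 1 ψ x + force b v k x * ψ x := by
    intro k ψ hψ
    have a : ∀ i, Integrable fun x => pd i (v k) x * pd i ψ x := fun i =>
      ((c1 i k).mul (hψ.pd i).contDiff.continuous).integrable_of_hasCompactSupport (hψ.pd i).compact.mul_left
    exact integrable_fun_add (integrable_fun_add (a 0) (a 1))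
      (((hfc k).mul hψ.contDiff.continuous).integrable_of_hasCompactSupport hψ.compact.mul_left)
  have hgrad : ∀ k ψ, IsTest ψ → ∫ x, q x * pd k ψ x =
      ∫ x, (pd 0 (v k) x * pd 0 ψ x + pd 1 (v k) x * pd 1 ψ x + force b v k x * ψ x) := by
    intro k ψ hψ
    have := hq.eq_zero k ψ hψ
    rw [integral_sub (hA k ψ hψ) (iq _ (hψ.pd k)), sub_eq_zero] at this
    exact this.symm
  have hDzero : ∀ k ψ, IsTest ψ → ∫ x, D x * pd k ψ x = 0 := by
    intro k ψ hψ
    let κ : Plane → ℝ := fun z => ψ (0 - z)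
    have hκ : IsTest κ := isTest_reflect hψ 0
    have hu : ContDiff ℝ ∞ (conv κ D) := contDiff_conv hκ hDl
    have hp1 : ∀ i, pd i (conv κ D) = conv (pd i κ) D := fun i =>
      funext fun x => pd_conv hκ hDl i x
    have hp2 : ∀ i, pd i (pd i (conv κ D)) = conv (pd i (pd i κ)) D := fun i => by
      rw [hp1]; exact funext fun x => pd_conv (hκ.pd i) hDl i x
    have hharm : ∀ x, lap (conv κ D) x = 0 := by
      intro x
      have hr := isTest_reflect hκ x
      have e1 : ∀ i, pd i (fun z => κ (x - z)) = fun z => -pd i κ (x - z) := fun i =>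
        funext fun z => pd_reflect hκ x i z
      have e2 : ∀ i, pd i (pd i (fun z => κ (x - z))) = fun z => pd i (pd i κ) (x - z) := fun i => by
        funext z
        rw [e1, pd_neg, pd_reflect (hκ.pd i), neg_neg]
      have h1 := hpr _ hr
      have i1 : ∀ i, Integrable fun z => pd i (pd i κ) (x - z) * D z := fun i =>
        integrable_conv ((hκ.pd i).pd i).contDiff.continuous ((hκ.pd i).pd i).compact hDl x
      rw [lap, hp2, hp2, conv_apply', conv_apply', ← integral_add (i1 0) (i1 1)]
      rw [← sub_eq_zero, ← integral_sub (iq _ hr.lap) (ip _ hr.lap)] at h1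
      rw [← h1]
      congr 1; ext z
      rw [lap, e2, e2, hD]
      ring
    have hdecay : ∀ i, Tendsto (pd i (conv κ D)) (cocompact Plane) (𝓝 0) := by
      intro i
      have hx : ∀ x, pd i (conv κ D) x =
          (conv (pd 0 κ) (pd 0 (v i)) x + conv (pd 1 κ) (pd 1 (v i)) x) - conv κ (force b v i) x
            - conv (pd i κ) p x := by
        intro x
        have hr := isTest_reflect hκ x
        have h1 := hgrad i _ hr
        simp_rw [pd_reflect hκ] at h1
        have a : ∀ j, Integrable fun z => pd j κ (x - z) * pd j (v i) z := fun j =>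
          integrable_conv (hκ.pd j).contDiff.continuous (hκ.pd j).compact (c1 j i).locallyIntegrable x
        have af : Integrable fun z => κ (x - z) * force b v i z :=
          integrable_conv hκ.contDiff.continuous hκ.compact (hfc i).locallyIntegrable x
        have hDs : pd i (conv κ D) x = conv (pd i κ) q x - conv (pd i κ) p x := by
          rw [hp1]; exact conv_sub (hκ.pd i) hq.locInt hpl x
        rw [hDs]
        congr 1
        rw [conv_apply', conv_apply', conv_apply', conv_apply', ← integral_add (a 0) (a 1),
          ← integral_sub (integrable_fun_add (a 0) (a 1)) af, ← neg_inj, ← integral_neg, ← integral_neg]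
        calc _ = _ := ?_
          _ = _ := h1
          _ = _ := ?_
        all_goals congr 1; ext z; ring
      have tv : ∀ j, Tendsto (conv (pd j κ) (pd j (v i))) (cocompact Plane) (𝓝 0) := fun j =>
        tendsto_conv_cocompact (hκ.pd j) (c1 j i) (hv.abs_pd_le j i)
          (tendsto_zero_of_mul_sqrt_wt_le (hv.pd_bound_sqrt j i))
      have tf : Tendsto (conv κ (force b v i)) (cocompact Plane) (𝓝 0) :=
        tendsto_conv_cocompact hκ (hfc i) (le_of_mul_sqrt_wt_le (force_bound hb hv i))
          (tendsto_zero_of_mul_sqrt_wt_le (force_bound hb hv i))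
      have tp := tendsto_conv_cocompact_of_memLp (hκ.pd i) hp
      have := (((tv 0).add (tv 1)).sub tf).sub tp
      simp only [add_zero, sub_zero] at this
      exact this.congr fun x => (hx x).symm
    have h0 := pd_eq_zero_of_harmonic (contDiff_two hu) hharm hdecay k 0
    rw [hp1, conv_apply'] at h0
    rw [← neg_inj, neg_zero, ← h0, ← integral_neg]
    congr 1; ext z
    rw [show pd k κ (0 - z) = -pd k ψ z from ?_]
    · ring
    · rw [pd_reflect hψ]; simp
  refine ⟨p, hp, ⟨hpl, fun k ψ hψ => ?_⟩, hpQ⟩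
  rw [integral_sub (hA k ψ hψ) (ip _ (hψ.pd k)), ← hgrad k ψ hψ, ← integral_sub (iq _ (hψ.pd k))
    (ip _ (hψ.pd k)), ← hDzero k ψ hψ]
  congr 1; ext x; rw [hD]; ring

end

section
variable {K M : ℝ} {b v : Fin 2 → Plane → ℝ}

/-! ### The energy identity -/

theorem IsWeakSol.eq_of_contDiff_one {p : Plane → ℝ} (h : IsWeakSol b v p) (hb : IsBackground K b)
    (hv : IsPerturbation M v) (k : Fin 2) {φ : Plane → ℝ} (hφ : ContDiff ℝ 1 φ)
    (hc : HasCompactSupport φ) :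
    ∫ x, (pd 0 (v k) x * pd 0 φ x + pd 1 (v k) x * pd 1 φ x + force b v k x * φ x) =
      ∫ x, p x * pd k φ x := by
  have c : ∀ i, Continuous (pd i (v k)) := fun i => continuous_pd (hv.contDiff k) i
  have hf := continuous_force hb hv k
  have l : ∀ i, LocallyIntegrable fun x => pd i (v k) x - (if k = i then p x else 0) := by
    intro i
    refine (c i).locallyIntegrable.sub ?_
    split_ifs
    · exact h.locInt
    · exact locallyIntegrable_zero
  have key := weak_identity_of_contDiff_one (l 0) (l 1) hf.locallyIntegrable (fun ψ hψ => by
    refine Eq.trans ?_ (h.eq_zero k ψ hψ)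
    congr 1; ext x
    fin_cases k <;> simp <;> ring) hφ hc
  have i1 : Integrable fun x =>
      pd 0 (v k) x * pd 0 φ x + pd 1 (v k) x * pd 1 φ x + force b v k x * φ x := by
    have a : ∀ i, Integrable fun x => pd i (v k) x * pd i φ x := fun i =>
      ((c i).mul (continuous_pd hφ i)).integrable_of_hasCompactSupport (hc.pd i).mul_left
    exact integrable_fun_add (integrable_fun_add (a 0) (a 1))
      ((hf.mul hφ.continuous).integrable_of_hasCompactSupport hc.mul_left)
  have i2 : Integrable fun x => p x * pd k φ x :=
    h.locInt.integrable_smul_right_of_hasCompactSupport (continuous_pd hφ k) (hc.pd k)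
  rw [← sub_eq_zero, ← integral_sub i1 i2]
  refine Eq.trans ?_ key
  congr 1; ext x
  fin_cases k <;> simp <;> ring

/-- Passage to the limit in an identity with cut-offs. -/
theorem IsCutoff.integral_eq_zero {c : ℝ} {χ : ℕ → Plane → ℝ} (hχ : IsCutoff c χ) {E g : Plane → ℝ}
    {R : Fin 2 → Plane → ℝ} (hE : Integrable E) (hg : Integrable g)
    (hR : ∀ j, AEStronglyMeasurable (R j)) (hRg : ∀ j x, |R j x| ≤ √(wt x) * |g x|)
    (h : ∀ n, Integrable (fun x => χ n x * E x + (pd 0 (χ n) x * R 0 x + pd 1 (χ n) x * R 1 x)) →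
      ∫ x, (χ n x * E x + (pd 0 (χ n) x * R 0 x + pd 1 (χ n) x * R 1 x)) = 0) :
    ∫ x, E x = 0 := by
  have hχc : ∀ n j, Continuous (pd j (χ n)) := fun n j =>
    continuous_pd ((hχ.contDiff n).of_le (by simp)) j
  have i0 : ∀ n, Integrable fun x => χ n x * E x := fun n => by
    refine hE.bdd_mul (c := 1) (hχ.contDiff n).continuous.aestronglyMeasurable
      (Eventually.of_forall fun x => ?_)
    rw [Real.norm_of_nonneg (hχ.nonneg n x)]; exact hχ.le_one n x
  have iR : ∀ n j, Integrable fun x => pd j (χ n) x * R j x := fun n j => by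
    refine (hg.norm.const_mul c).mono' ((hχc n j).aestronglyMeasurable.mul (hR j))
      (Eventually.of_forall fun x => ?_)
    rw [Real.norm_eq_abs, Real.norm_eq_abs, abs_mul]
    calc |pd j (χ n) x| * |R j x| ≤ |pd j (χ n) x| * (√(wt x) * |g x|) := by
          gcongr; exact hRg j x
      _ = |pd j (χ n) x| * √(wt x) * |g x| := by ring
      _ ≤ c * |g x| := by gcongr; exact hχ.pd_le n j x
  have lim := (hχ.tendsto_integral hE).add ((hχ.tendsto_integral_pd hg (hR 0)
    (Eventually.of_forall (hRg 0)) 0).add (hχ.tendsto_integral_pd hg (hR 1)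
    (Eventually.of_forall (hRg 1)) 1))
  have hz : ∀ n, (∫ x, χ n x * E x) + ((∫ x, pd 0 (χ n) x * R 0 x) + ∫ x, pd 1 (χ n) x * R 1 x) = 0 := by
    intro n
    have i1 := integrable_fun_add (iR n 0) (iR n 1)
    rw [← integral_add (iR n 0) (iR n 1), ← integral_add (i0 n) i1]
    exact h n (integrable_fun_add (i0 n) i1)
  have h2 := tendsto_nhds_unique lim (tendsto_const_nhds.congr fun n => (hz n).symm)
  simpa using h2

theorem integrable_wt_sqrt_inv : Integrable fun x => (wt x * √(wt x))⁻¹ := by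
  refine (integrable_wt_rpow (r := -(3 / 2)) (by norm_num)).congr (Eventually.of_forall fun x => ?_)
  simp only
  rw [Real.rpow_neg (wt_pos x).le, Real.sqrt_eq_rpow]
  congr 1
  nth_rewrite 2 [← Real.rpow_one (wt x)]
  rw [← Real.rpow_add (wt_pos x)]
  norm_num

set_option maxHeartbeats 1000000 in
/-- Testing with the cut-off full velocity `χ V`. The cubic term is a divergence, and the equation
for `b` turns the drift terms into `∫ ∇b : ∇(χ v)`. -/
theorem cutoff_energy (hb : IsBackground K b) (hv : IsPerturbation M v) {p : Plane → ℝ}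
    (hp : IsWeakSol b v p) {χ : Plane → ℝ} (hχ : IsTest χ) :
    ∫ x, (χ x * (pd 0 (v 0) x * (pd 0 (v 0) x + 2 * pd 0 (b 0) x)
        + pd 0 (v 1) x * (pd 0 (v 1) x + 2 * pd 0 (b 1) x)
        + pd 1 (v 0) x * (pd 1 (v 0) x + 2 * pd 1 (b 0) x)
        + pd 1 (v 1) x * (pd 1 (v 1) x + 2 * pd 1 (b 1) x))
      + (pd 0 χ x * (total b v 0 x * pd 0 (v 0) x + total b v 1 x * pd 0 (v 1) x
          + (1 / 4) * x 0 * (v 0 x ^ 2 + v 1 x ^ 2) + (1 / 2) * x 0 * (v 0 x * b 0 x + v 1 x * b 1 x)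
          - (1 / 2) * total b v 0 x * (total b v 0 x ^ 2 + total b v 1 x ^ 2)
          + (v 0 x * pd 0 (b 0) x + v 1 x * pd 0 (b 1) x))
        + pd 1 χ x * (total b v 0 x * pd 1 (v 0) x + total b v 1 x * pd 1 (v 1) x
          + (1 / 4) * x 1 * (v 0 x ^ 2 + v 1 x ^ 2) + (1 / 2) * x 1 * (v 0 x * b 0 x + v 1 x * b 1 x)
          - (1 / 2) * total b v 1 x * (total b v 0 x ^ 2 + total b v 1 x ^ 2)
          + (v 0 x * pd 1 (b 0) x + v 1 x * pd 1 (b 1) x))))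
      = ∫ x, p x * (pd 0 χ x * total b v 0 x + pd 1 χ x * total b v 1 x) := by
  have hVc := contDiff_total hb hv
  have hVdiv := div_total hb hv
  have hVpd := pd_total hb hv
  have hfc := continuous_force hb hv
  have hcχ : ∀ k, HasCompactSupport fun x => χ x * total b v k x := fun k => hχ.compact.mul_right
  have hcv : ∀ k, HasCompactSupport fun x => χ x * v k x := fun k => hχ.compact.mul_right
  have h1χ : ∀ k, ContDiff ℝ 1 fun x => χ x * total b v k x := fun k => hχ.c1.mul (hVc k)
  have h1v : ∀ k, ContDiff ℝ 1 fun x => χ x * v k x := fun k => hχ.c1.mul (hv.contDiff k)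
  have t0 := hp.eq_of_contDiff_one hb hv 0 (h1χ 0) (hcχ 0)
  have t1 := hp.eq_of_contDiff_one hb hv 1 (h1χ 1) (hcχ 1)
  have g0 := hb.heat 0 _ (h1v 0) (hcv 0)
  have g1 := hb.heat 1 _ (h1v 1) (hcv 1)
  have z0 : ∀ x ∉ tsupport χ, χ x = 0 := fun x hx => image_eq_zero_of_notMem_tsupport hx
  have z1 : ∀ x ∉ tsupport χ, ∀ i, pd i χ x = 0 := fun x hx i => pd_eq_zero_of_notMem hx i
  -- the regularity of all factors, for `fun_prop`
  have V0 := hVc 0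
  have V1 := hVc 1
  have v0 := hv.contDiff 0
  have v1 := hv.contDiff 1
  have b0 := hb.contDiff 0
  have b1 := hb.contDiff 1
  have hdχ := hχ.differentiable
  have dV0 := V0.differentiable one_ne_zero
  have dV1 := V1.differentiable one_ne_zero
  have dv0 := v0.differentiable one_ne_zero
  have dv1 := v1.differentiable one_ne_zero
  have db0 := b0.differentiable one_ne_zero
  have db1 := b1.differentiable one_ne_zero
  have dx0 := differentiable_coord 0
  have dx1 := differentiable_coord 1
  have cx0 := contDiff_coord (n := 1) 0
  have cx1 := contDiff_coord (n := 1) 1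
  have c1χ := hχ.c1
  have k1 := c1χ.continuous
  have k2 := continuous_pd c1χ 0
  have k3 := continuous_pd c1χ 1
  have k4 := V0.continuous
  have k5 := V1.continuous
  have k6 := v0.continuous
  have k7 := v1.continuous
  have k8 := b0.continuous
  have k9 := b1.continuous
  have l1 := continuous_pd v0 0
  have l2 := continuous_pd v0 1
  have l3 := continuous_pd v1 0
  have l4 := continuous_pd v1 1
  have l5 := continuous_pd b0 0
  have l6 := continuous_pd b0 1
  have l7 := continuous_pd b1 0
  have l8 := continuous_pd b1 1
  have m1 := hfc 0
  have m2 := hfc 1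
  have pχV : ∀ i k x, pd i (fun x => χ x * total b v k x) x
      = pd i χ x * total b v k x + χ x * (pd i (b k) x + pd i (v k) x) := fun i k x => by
    rw [pd_mul hdχ ((hVc k).differentiable one_ne_zero), hVpd]
  have pχv : ∀ i k x, pd i (fun x => χ x * v k x) x
      = pd i χ x * v k x + χ x * pd i (v k) x := fun i k x =>
    pd_mul hdχ ((hv.contDiff k).differentiable one_ne_zero) i x
  simp_rw [pχV] at t0 t1
  simp_rw [pχv] at g0 g1
  have intp : ∀ k, Integrable fun x =>
      p x * (pd k χ x * total b v k x + χ x * (pd k (b k) x + pd k (v k) x)) := fun k => by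
    refine hp.locInt.integrable_smul_right_of_hasCompactSupport ?_
      (HasCompactSupport.intro hχ.compact fun x hx => by simp [z0 x hx, z1 x hx])
    have := continuous_pd c1χ k
    have := (hVc k).continuous
    have := continuous_pd (hb.contDiff k) k
    have := continuous_pd (hv.contDiff k) k
    fun_prop
  have hpsum : ∫ x, p x * (pd 0 χ x * total b v 0 x + pd 1 χ x * total b v 1 x) =
      (∫ x, p x * (pd 0 χ x * total b v 0 x + χ x * (pd 0 (b 0) x + pd 0 (v 0) x)))
      + ∫ x, p x * (pd 1 χ x * total b v 1 x + χ x * (pd 1 (b 1) x + pd 1 (v 1) x)) := by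
    rw [← integral_add (intp 0) (intp 1)]
    congr 1; ext x
    have := hVdiv x
    rw [hVpd, hVpd] at this
    linear_combination (p x * χ x) * (-this)
  have it0 : Integrable fun x => pd 0 (v 0) x * (pd 0 χ x * total b v 0 x + χ x * (pd 0 (b 0) x + pd 0 (v 0) x))
      + pd 1 (v 0) x * (pd 1 χ x * total b v 0 x + χ x * (pd 1 (b 0) x + pd 1 (v 0) x))
      + force b v 0 x * (χ x * total b v 0 x) :=
    integrable_of_eq_zero_off (by fun_prop) hχ.compact fun x hx => by simp [z0 x hx, z1 x hx]
  have it1 : Integrable fun x => pd 0 (v 1) x * (pd 0 χ x * total b v 1 x + χ x * (pd 0 (b 1) x + pd 0 (v 1) x))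
      + pd 1 (v 1) x * (pd 1 χ x * total b v 1 x + χ x * (pd 1 (b 1) x + pd 1 (v 1) x))
      + force b v 1 x * (χ x * total b v 1 x) :=
    integrable_of_eq_zero_off (by fun_prop) hχ.compact fun x hx => by simp [z0 x hx, z1 x hx]
  have ig0 : Integrable fun x => (b 0 x + (x 0 * pd 0 (b 0) x + x 1 * pd 1 (b 0) x)) * (χ x * v 0 x) :=
    integrable_of_eq_zero_off (by fun_prop) hχ.compact fun x hx => by simp [z0 x hx]
  have ig1 : Integrable fun x => (b 1 x + (x 0 * pd 0 (b 1) x + x 1 * pd 1 (b 1) x)) * (χ x * v 1 x) :=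
    integrable_of_eq_zero_off (by fun_prop) hχ.compact fun x hx => by simp [z0 x hx]
  have ih0 : Integrable fun x => pd 0 (b 0) x * (pd 0 χ x * v 0 x + χ x * pd 0 (v 0) x)
      + pd 1 (b 0) x * (pd 1 χ x * v 0 x + χ x * pd 1 (v 0) x) :=
    integrable_of_eq_zero_off (by fun_prop) hχ.compact fun x hx => by simp [z0 x hx, z1 x hx]
  have ih1 : Integrable fun x => pd 0 (b 1) x * (pd 0 χ x * v 1 x + χ x * pd 0 (v 1) x)
      + pd 1 (b 1) x * (pd 1 χ x * v 1 x + χ x * pd 1 (v 1) x) :=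
    integrable_of_eq_zero_off (by fun_prop) hχ.compact fun x hx => by simp [z0 x hx, z1 x hx]
  -- the tested equations for `v` and `b`, collected in one integral: its difference to the left side
  -- is the divergence of `(H₀, H₁)` below
  have total_eq : ∫ x, p x * (pd 0 χ x * total b v 0 x + pd 1 χ x * total b v 1 x) =
      ∫ x, ((((pd 0 (v 0) x * (pd 0 χ x * total b v 0 x + χ x * (pd 0 (b 0) x + pd 0 (v 0) x))
      + pd 1 (v 0) x * (pd 1 χ x * total b v 0 x + χ x * (pd 1 (b 0) x + pd 1 (v 0) x))
      + force b v 0 x * (χ x * total b v 0 x))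
      + (pd 0 (v 1) x * (pd 0 χ x * total b v 1 x + χ x * (pd 0 (b 1) x + pd 0 (v 1) x))
      + pd 1 (v 1) x * (pd 1 χ x * total b v 1 x + χ x * (pd 1 (b 1) x + pd 1 (v 1) x))
      + force b v 1 x * (χ x * total b v 1 x)))
      + ((pd 0 (b 0) x * (pd 0 χ x * v 0 x + χ x * pd 0 (v 0) x)
      + pd 1 (b 0) x * (pd 1 χ x * v 0 x + χ x * pd 1 (v 0) x))
      + (pd 0 (b 1) x * (pd 0 χ x * v 1 x + χ x * pd 0 (v 1) x)
      + pd 1 (b 1) x * (pd 1 χ x * v 1 x + χ x * pd 1 (v 1) x))))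
      - (1 / 2) * ((b 0 x + (x 0 * pd 0 (b 0) x + x 1 * pd 1 (b 0) x)) * (χ x * v 0 x)
        + (b 1 x + (x 0 * pd 0 (b 1) x + x 1 * pd 1 (b 1) x)) * (χ x * v 1 x))) := by
    rw [integral_sub (integrable_fun_add (integrable_fun_add it0 it1) (integrable_fun_add ih0 ih1))
      ((integrable_fun_add ig0 ig1).const_mul _), integral_const_mul, integral_add ig0 ig1,
      integral_add (integrable_fun_add it0 it1) (integrable_fun_add ih0 ih1), integral_add it0 it1,
      integral_add ih0 ih1, hpsum, t0, t1, g0, g1]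
    ring
  rw [total_eq]
  refine (integral_eq_of_sub_eq_div
    (H₀ := fun x => -(1 / 4) * (x 0 * (χ x * (v 0 x * v 0 x + v 1 x * v 1 x)))
      - (1 / 2) * (x 0 * (χ x * (v 0 x * b 0 x + v 1 x * b 1 x)))
      + (1 / 2) * (χ x * (total b v 0 x * (total b v 0 x * total b v 0 x + total b v 1 x * total b v 1 x))))
    (H₁ := fun x => -(1 / 4) * (x 1 * (χ x * (v 0 x * v 0 x + v 1 x * v 1 x)))
      - (1 / 2) * (x 1 * (χ x * (v 0 x * b 0 x + v 1 x * b 1 x)))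
      + (1 / 2) * (χ x * (total b v 1 x * (total b v 0 x * total b v 0 x + total b v 1 x * total b v 1 x))))
    ?_ ?_ (by fun_prop) (by fun_prop) ?_ ?_ ?_).symm
  · exact integrable_fun_sub (integrable_fun_add (integrable_fun_add it0 it1) (integrable_fun_add ih0 ih1))
      ((integrable_fun_add ig0 ig1).const_mul _)
  · exact integrable_of_eq_zero_off (by fun_prop) hχ.compact fun x hx => by simp [z0 x hx, z1 x hx]
  · exact HasCompactSupport.intro hχ.compact fun x hx => by simp [z0 x hx]
  · exact HasCompactSupport.intro hχ.compact fun x hx => by simp [z0 x hx]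
  · intro x
    have hd := hVdiv x
    rw [hVpd, hVpd] at hd
    have p0 : pd 0 (v 0) x = -pd 1 (v 1) x - pd 0 (b 0) x - pd 1 (b 1) x := by linarith
    simp only [force, hVpd]
    simp (disch := fun_prop) only [pd_add, pd_sub, pd_mul, pd_const, pd_coord, hVpd]
    rw [p0]
    simp only [total]
    simp
    ring

theorem one_div_bound {t C a : ℝ} (ha : 0 < a) (h : t * a ^ 2 ≤ C) : t ≤ C * (a ^ 2)⁻¹ := by
  rw [← div_eq_mul_inv, le_div_iff₀ (by positivity)]; exact h

/-- The energy bound: `‖∇(b + v)‖ ≤ ‖∇b‖ ≤ 2 K`, so each derivative of `v` is at most `3 K`. -/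
theorem l2_pd_le (hb : IsBackground K b) (hv : IsPerturbation M v) {p : Plane → ℝ}
    (hp : IsWeakSol b v p) (hp2 : MemLp p 2) (i k : Fin 2) : l2 (pd i (v k)) ≤ 3 * K := by
  obtain ⟨c, hc0, χ, hχ⟩ := exists_cutoff
  have hVc := contDiff_total hb hv
  have mv := hv.memLp_pd
  have mb := hb.pd_memLp
  set L := K + M with hL
  have hK := hb.nonneg
  have hM := hv.nonneg
  have hL0 : 0 ≤ L := by linarith
  set E : Plane → ℝ := fun x => pd 0 (v 0) x * (pd 0 (v 0) x + 2 * pd 0 (b 0) x)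
        + pd 0 (v 1) x * (pd 0 (v 1) x + 2 * pd 0 (b 1) x)
        + pd 1 (v 0) x * (pd 1 (v 0) x + 2 * pd 1 (b 0) x)
        + pd 1 (v 1) x * (pd 1 (v 1) x + 2 * pd 1 (b 1) x) with hE
  set R : Fin 2 → Plane → ℝ := fun j x => total b v 0 x * pd j (v 0) x + total b v 1 x * pd j (v 1) x
          + (1 / 4) * x j * (v 0 x ^ 2 + v 1 x ^ 2) + (1 / 2) * x j * (v 0 x * b 0 x + v 1 x * b 1 x)
          - (1 / 2) * total b v j x * (total b v 0 x ^ 2 + total b v 1 x ^ 2)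
          + (v 0 x * pd j (b 0) x + v 1 x * pd j (b 1) x) - p x * total b v j x with hR
  have mE : ∀ j k, MemLp (fun x => pd j (v k) x + 2 * pd j (b k) x) 2 := fun j k =>
    (mv j k).add ((mb j k).const_mul 2)
  have iE1 : ∀ j k, Integrable fun x => pd j (v k) x * (pd j (v k) x + 2 * pd j (b k) x) := fun j k =>
    integrable_mul_of_memLp (mv j k) (mE j k)
  have iE : Integrable E := integrable_fun_add (integrable_fun_add (integrable_fun_add (iE1 0 0) (iE1 0 1))
    (iE1 1 0)) (iE1 1 1)
  -- the terms multiplying `∇χ`, of size `|x|⁻¹`, are `O(√w g)` with an integrable `g`, so that they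
  -- disappear in the limit
  set C := 4 * L ^ 2 + 2 * L ^ 2 + 4 * L ^ 2 + 4 * L ^ 3 + 4 * L ^ 2 with hC
  set g : Plane → ℝ := fun x => C * (wt x * √(wt x))⁻¹ + L * (|p x| * (wt x)⁻¹) with hg
  have ig : Integrable g := integrable_fun_add (integrable_wt_sqrt_inv.const_mul C)
    ((integrable_mul_of_memLp hp2.abs memLp_wt_inv).const_mul L)
  have hRb : ∀ j x, |R j x| ≤ √(wt x) * |g x| := by
    intro j x
    have ha := sqrt_wt_pos x
    have ha1 := one_le_sqrt_wt x
    have hw : wt x = √(wt x) ^ 2 := (Real.sq_sqrt (wt_pos x).le).symm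
    have hx := abs_coord_le j x
    have bV : ∀ k, |total b v k x| * √(wt x) ≤ L := fun k => total_bound hb hv k x
    have bV' : ∀ k, |total b v k x| ≤ L := fun k => le_of_mul_sqrt_wt_le (total_bound hb hv k) x
    have bv : ∀ k, |v k x| * √(wt x) ^ 2 ≤ L := fun k => by
      rw [← hw]; exact (hv.bound k x).trans (by linarith)
    have bv' : ∀ k, |v k x| * √(wt x) ≤ L := fun k => (hv.bound_sqrt k x).trans (by linarith)
    have bdv : ∀ k, |pd j (v k) x| * √(wt x) ^ 2 ≤ L := fun k => by
      rw [← hw]; exact (hv.pd_bound j k x).trans (by linarith)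
    have bb : ∀ k, |b k x| * √(wt x) ≤ L := fun k => (hb.bound k x).trans (by linarith)
    have bdb : ∀ k, |pd j (b k) x| ≤ L := fun k => (hb.abs_pd_le j k x).trans (by linarith)
    set a := √(wt x) with hadef
    have q1 : ∀ k, |total b v k x * pd j (v k) x| * a ^ 2 ≤ L ^ 2 := fun k => by
      rw [abs_mul, mul_assoc, pow_two L]
      exact mul_le_mul (bV' k) (bdv k) (by positivity) hL0
    have q2 : ∀ k, |x j * v k x ^ 2| * a ^ 2 ≤ L ^ 2 := fun k => by
      rw [abs_mul, abs_pow]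
      calc |x j| * |v k x| ^ 2 * a ^ 2 ≤ a * |v k x| ^ 2 * a ^ 2 := by gcongr
        _ = (|v k x| * a) * (|v k x| * a ^ 2) := by ring
        _ ≤ L * L := mul_le_mul (bv' k) (bv k) (by positivity) hL0
        _ = _ := by ring
    have q3 : ∀ k, |x j * (v k x * b k x)| * a ^ 2 ≤ L ^ 2 := fun k => by
      rw [abs_mul, abs_mul]
      calc |x j| * (|v k x| * |b k x|) * a ^ 2 ≤ a * (|v k x| * |b k x|) * a ^ 2 := by gcongr
        _ = (|b k x| * a) * (|v k x| * a ^ 2) := by ring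
        _ ≤ L * L := mul_le_mul (bb k) (bv k) (by positivity) hL0
        _ = _ := by ring
    have q4 : ∀ k, |total b v j x * total b v k x ^ 2| * a ^ 2 ≤ L ^ 3 := fun k => by
      rw [abs_mul, abs_pow]
      calc |total b v j x| * |total b v k x| ^ 2 * a ^ 2
          = |total b v j x| * ((|total b v k x| * a) * (|total b v k x| * a)) := by ring
        _ ≤ L * (L * L) := mul_le_mul (bV' j) (mul_le_mul (bV k) (bV k) (by positivity) hL0)
            (by positivity) hL0
        _ = _ := by ring
    have q5 : ∀ k, |v k x * pd j (b k) x| * a ^ 2 ≤ L ^ 2 := fun k => by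
      rw [abs_mul]
      calc |v k x| * |pd j (b k) x| * a ^ 2 = (|v k x| * a ^ 2) * |pd j (b k) x| := by ring
        _ ≤ L * L := mul_le_mul (bv k) (bdb k) (abs_nonneg _) hL0
        _ = _ := by ring
    have q6 : |p x * total b v j x| * a ^ 2 ≤ L * (|p x| * a) := by
      rw [abs_mul]
      calc |p x| * |total b v j x| * a ^ 2 = (|total b v j x| * a) * (|p x| * a) := by ring
        _ ≤ L * (|p x| * a) := mul_le_mul_of_nonneg_right (bV j) (by positivity)
    have tri : |R j x| ≤ |total b v 0 x * pd j (v 0) x| + |total b v 1 x * pd j (v 1) x|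
        + (|x j * v 0 x ^ 2| + |x j * v 1 x ^ 2|) + (|x j * (v 0 x * b 0 x)| + |x j * (v 1 x * b 1 x)|)
        + (|total b v j x * total b v 0 x ^ 2| + |total b v j x * total b v 1 x ^ 2|)
        + (|v 0 x * pd j (b 0) x| + |v 1 x * pd j (b 1) x|) + |p x * total b v j x| := by
      rw [hR]
      simp only
      rw [abs_le]
      constructor <;>
      linarith [neg_abs_le (total b v 0 x * pd j (v 0) x), neg_abs_le (total b v 1 x * pd j (v 1) x),
        neg_abs_le (x j * v 0 x ^ 2), neg_abs_le (x j * v 1 x ^ 2), neg_abs_le (x j * (v 0 x * b 0 x)),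
        neg_abs_le (x j * (v 1 x * b 1 x)), neg_abs_le (total b v j x * total b v 0 x ^ 2),
        neg_abs_le (total b v j x * total b v 1 x ^ 2), neg_abs_le (v 0 x * pd j (b 0) x),
        neg_abs_le (v 1 x * pd j (b 1) x), neg_abs_le (p x * total b v j x),
        le_abs_self (total b v 0 x * pd j (v 0) x), le_abs_self (total b v 1 x * pd j (v 1) x),
        le_abs_self (x j * v 0 x ^ 2), le_abs_self (x j * v 1 x ^ 2), le_abs_self (x j * (v 0 x * b 0 x)),
        le_abs_self (x j * (v 1 x * b 1 x)), le_abs_self (total b v j x * total b v 0 x ^ 2),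
        le_abs_self (total b v j x * total b v 1 x ^ 2), le_abs_self (v 0 x * pd j (b 0) x),
        le_abs_self (v 1 x * pd j (b 1) x), le_abs_self (p x * total b v j x)]
    have hfin : |R j x| * a ^ 2 ≤ C + L * (|p x| * a) := by
      have := mul_le_mul_of_nonneg_right tri (sq_nonneg a)
      have hL2 : 0 ≤ L ^ 2 := by positivity
      have hL3 : 0 ≤ L ^ 3 := by positivity
      rw [hC]
      linarith [q1 0, q1 1, q2 0, q2 1, q3 0, q3 1, q4 0, q4 1, q5 0, q5 1]
    have hgx : a * g x = (C + L * (|p x| * a)) * (a ^ 2)⁻¹ := by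
      rw [hg]; simp only
      rw [← hadef, hw]
      field_simp
    calc |R j x| ≤ (C + L * (|p x| * a)) * (a ^ 2)⁻¹ := one_div_bound ha hfin
      _ = a * g x := hgx.symm
      _ ≤ a * |g x| := by gcongr; exact le_abs_self _
  have hRm : ∀ j, AEStronglyMeasurable (R j) := by
    intro j
    have k4 := (hVc 0).continuous
    have k5 := (hVc 1).continuous
    have k5' := (hVc j).continuous
    have k6 := (hv.contDiff 0).continuous
    have k7 := (hv.contDiff 1).continuous
    have k8 := (hb.contDiff 0).continuous
    have k9 := (hb.contDiff 1).continuous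
    have l1 := continuous_pd (hv.contDiff 0) j
    have l2 := continuous_pd (hv.contDiff 1) j
    have l5 := continuous_pd (hb.contDiff 0) j
    have l6 := continuous_pd (hb.contDiff 1) j
    refine AEStronglyMeasurable.sub ?_ (hp2.1.mul k5'.aestronglyMeasurable)
    refine Continuous.aestronglyMeasurable ?_
    fun_prop
  have hE0 : ∫ x, E x = 0 := by
    refine hχ.integral_eq_zero iE ig hRm hRb fun n hi => ?_
    have ht : IsTest (χ n) := ⟨hχ.contDiff n, hχ.compact n⟩
    have ip : Integrable fun x => p x * (pd 0 (χ n) x * total b v 0 x + pd 1 (χ n) x * total b v 1 x) := by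
      refine hp.locInt.integrable_smul_right_of_hasCompactSupport ?_
        (((ht.compact.pd 0).mul_right).add ((ht.compact.pd 1).mul_right))
      have := (hVc 0).continuous
      have := (hVc 1).continuous
      have := (ht.pd 0).contDiff.continuous
      have := (ht.pd 1).contDiff.continuous
      fun_prop
    have h := cutoff_energy hb hv hp ht
    rw [← sub_eq_zero, ← integral_sub _ ip] at h
    · refine Eq.trans ?_ h
      congr 1; ext x
      simp only [hE, hR]
      ring
    · refine (integrable_fun_add hi ip).congr (Eventually.of_forall fun x => ?_)
      simp only [hE, hR]
      ring
  have hI : ∀ j k, ∫ x, pd j (v k) x * (pd j (v k) x + 2 * pd j (b k) x) =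
      l2 (pd j (v k)) ^ 2 + 2 * ∫ x, pd j (v k) x * pd j (b k) x := by
    intro j k
    rw [l2_sq (mv j k), ← integral_const_mul, ← integral_add]
    · congr 1; ext x; ring
    · simpa [pow_two] using integrable_mul_of_memLp (mv j k) (mv j k)
    · exact (integrable_mul_of_memLp (mv j k) (mb j k)).const_mul 2
  have hcs : ∀ j k, -(l2 (pd j (v k)) * K) ≤ ∫ x, pd j (v k) x * pd j (b k) x := by
    intro j k
    have h1 := abs_integral_mul_le (mv j k) (mb j k)
    have h2 := mul_le_mul_of_nonneg_left (hb.pd_l2 j k) (l2_nonneg (pd j (v k)))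
    linarith [neg_abs_le (∫ x, pd j (v k) x * pd j (b k) x)]
  rw [hE, integral_add (integrable_fun_add (integrable_fun_add (iE1 0 0) (iE1 0 1)) (iE1 1 0)) (iE1 1 1),
    integral_add (integrable_fun_add (iE1 0 0) (iE1 0 1)) (iE1 1 0), integral_add (iE1 0 0) (iE1 0 1),
    hI, hI, hI, hI] at hE0
  have hsum : (l2 (pd 0 (v 0)) - K) ^ 2 + (l2 (pd 0 (v 1)) - K) ^ 2 + (l2 (pd 1 (v 0)) - K) ^ 2
      + (l2 (pd 1 (v 1)) - K) ^ 2 ≤ (2 * K) ^ 2 := by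
    nlinarith [hcs 0 0, hcs 0 1, hcs 1 0, hcs 1 1]
  have hsq : (l2 (pd i (v k)) - K) ^ 2 ≤ (2 * K) ^ 2 := by
    refine le_trans ?_ hsum
    have n1 := sq_nonneg (l2 (pd 0 (v 0)) - K)
    have n2 := sq_nonneg (l2 (pd 0 (v 1)) - K)
    have n3 := sq_nonneg (l2 (pd 1 (v 0)) - K)
    have n4 := sq_nonneg (l2 (pd 1 (v 1)) - K)
    fin_cases i <;> fin_cases k <;> simp only [Fin.zero_eta, Fin.mk_one] <;> linarith
  have := abs_le_of_sq_le_sq hsq (by positivity)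
  linarith [le_abs_self (l2 (pd i (v k)) - K)]

end

/-! ### The weighted energy estimate -/

theorem l2_abs (f : Plane → ℝ) : l2 (fun x => |f x|) = l2 f := by
  unfold l2
  congr 1
  exact eLpNorm_norm f

theorem contDiff_wt_rpow (s : ℝ) {n : WithTop ℕ∞} : ContDiff ℝ n fun x => wt x ^ s :=
  contDiff_wt.rpow_const_of_ne fun x => (wt_pos x).ne'

theorem pd_wt_rpow (s : ℝ) (j : Fin 2) (x : Plane) :
    pd j (fun x => wt x ^ s) x = 2 * s * x j * wt x ^ (s - 1) := by
  have hd : DifferentiableAt ℝ wt x := (contDiff_wt (n := 1)).differentiable one_ne_zero x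
  have h := hd.hasFDerivAt.rpow_const (p := s) (Or.inl (wt_pos x).ne')
  have h2 := pd_wt j x
  unfold pd at h2 ⊢
  rw [h.fderiv]
  simp [h2]
  ring

/-- Interpolation between the weights `√w` and `w⁻¹`: the first wins far from the origin, the second
near it. -/
theorem one_le_eps_sqrt_wt {ε : ℝ} (hε : 0 < ε) (x : Plane) :
    1 ≤ ε * √(wt x) + (ε ^ 2)⁻¹ * (wt x)⁻¹ := by
  have ha := sqrt_wt_pos x
  have hw : wt x = √(wt x) ^ 2 := (Real.sq_sqrt (wt_pos x).le).symm
  rw [hw, Real.sqrt_sq ha.le, ← mul_inv, ← mul_pow]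
  set t := ε * √(wt x)
  have ht : 0 < t := by positivity
  rcases le_total 1 t with h | h
  · have : 0 ≤ (t ^ 2)⁻¹ := by positivity
    linarith
  · have : 1 ≤ (t ^ 2)⁻¹ := (one_le_inv₀ (by positivity)).2 (by nlinarith)
    linarith

section
variable {K M : ℝ} {b v : Fin 2 → Plane → ℝ}

set_option maxHeartbeats 1000000 in
/-- Testing the momentum equation with `η v`. -/
theorem weighted_energy_identity (hb : IsBackground K b) (hv : IsPerturbation M v) {p : Plane → ℝ}
    (hp : IsWeakSol b v p) {η : Plane → ℝ} (hη : ContDiff ℝ 1 η) (hc : HasCompactSupport η) :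
    ∫ x, (η x * (pd 0 (v 0) x * pd 0 (v 0) x + pd 1 (v 0) x * pd 1 (v 0) x
          + (pd 0 (v 1) x * pd 0 (v 1) x + pd 1 (v 1) x * pd 1 (v 1) x))
      + (pd 0 η x * (v 0 x * pd 0 (v 0) x + v 1 x * pd 0 (v 1) x
          + (1 / 4) * x 0 * (v 0 x * v 0 x + v 1 x * v 1 x)
          - (1 / 2) * total b v 0 x * (v 0 x * v 0 x + v 1 x * v 1 x))
        + pd 1 η x * (v 0 x * pd 1 (v 0) x + v 1 x * pd 1 (v 1) x
          + (1 / 4) * x 1 * (v 0 x * v 0 x + v 1 x * v 1 x)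
          - (1 / 2) * total b v 1 x * (v 0 x * v 0 x + v 1 x * v 1 x)))
      + η x * (total b v 0 x * pd 0 (b 0) x * v 0 x + total b v 1 x * pd 1 (b 0) x * v 0 x
          + (total b v 0 x * pd 0 (b 1) x * v 1 x + total b v 1 x * pd 1 (b 1) x * v 1 x)))
      = ∫ x, p x * (pd 0 η x * v 0 x + pd 1 η x * v 1 x) := by
  have hVc := contDiff_total hb hv
  have hVdiv := div_total hb hv
  have hVpd := pd_total hb hv
  have hfc := continuous_force hb hv
  have h1v : ∀ k, ContDiff ℝ 1 fun x => η x * v k x := fun k => hη.mul (hv.contDiff k)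
  have t0 := hp.eq_of_contDiff_one hb hv 0 (h1v 0) hc.mul_right
  have t1 := hp.eq_of_contDiff_one hb hv 1 (h1v 1) hc.mul_right
  have z0 : ∀ x ∉ tsupport η, η x = 0 := fun x hx => image_eq_zero_of_notMem_tsupport hx
  have z1 : ∀ x ∉ tsupport η, ∀ i, pd i η x = 0 := fun x hx i => pd_eq_zero_of_notMem hx i
  have V0 := hVc 0
  have V1 := hVc 1
  have v0 := hv.contDiff 0
  have v1 := hv.contDiff 1
  have b0 := hb.contDiff 0
  have b1 := hb.contDiff 1
  have hdη := hη.differentiable one_ne_zero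
  have dV0 := V0.differentiable one_ne_zero
  have dV1 := V1.differentiable one_ne_zero
  have dv0 := v0.differentiable one_ne_zero
  have dv1 := v1.differentiable one_ne_zero
  have dx0 := differentiable_coord 0
  have dx1 := differentiable_coord 1
  have cx0 := contDiff_coord (n := 1) 0
  have cx1 := contDiff_coord (n := 1) 1
  have k1 := hη.continuous
  have k2 := continuous_pd hη 0
  have k3 := continuous_pd hη 1
  have k4 := V0.continuous
  have k5 := V1.continuous
  have k6 := v0.continuous
  have k7 := v1.continuous
  have l1 := continuous_pd v0 0
  have l2 := continuous_pd v0 1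
  have l3 := continuous_pd v1 0
  have l4 := continuous_pd v1 1
  have l5 := continuous_pd b0 0
  have l6 := continuous_pd b0 1
  have l7 := continuous_pd b1 0
  have l8 := continuous_pd b1 1
  have m1 := hfc 0
  have m2 := hfc 1
  have pηv : ∀ i k x, pd i (fun x => η x * v k x) x
      = pd i η x * v k x + η x * pd i (v k) x := fun i k x =>
    pd_mul hdη ((hv.contDiff k).differentiable one_ne_zero) i x
  simp_rw [pηv] at t0 t1
  have intp : ∀ k, Integrable fun x =>
      p x * (pd k η x * v k x + η x * pd k (v k) x) := fun k => by
    refine hp.locInt.integrable_smul_right_of_hasCompactSupport ?_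
      (HasCompactSupport.intro hc fun x hx => by simp [z0 x hx, z1 x hx])
    have := continuous_pd hη k
    have := (hv.contDiff k).continuous
    have := continuous_pd (hv.contDiff k) k
    fun_prop
  have hpsum : ∫ x, p x * (pd 0 η x * v 0 x + pd 1 η x * v 1 x) =
      (∫ x, p x * (pd 0 η x * v 0 x + η x * pd 0 (v 0) x))
      + ∫ x, p x * (pd 1 η x * v 1 x + η x * pd 1 (v 1) x) := by
    rw [← integral_add (intp 0) (intp 1)]
    congr 1; ext x
    have := hv.div x
    linear_combination (p x * η x) * (-this)
  have it0 : Integrable fun x => pd 0 (v 0) x * (pd 0 η x * v 0 x + η x * pd 0 (v 0) x)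
      + pd 1 (v 0) x * (pd 1 η x * v 0 x + η x * pd 1 (v 0) x)
      + force b v 0 x * (η x * v 0 x) :=
    integrable_of_eq_zero_off (by fun_prop) hc fun x hx => by simp [z0 x hx, z1 x hx]
  have it1 : Integrable fun x => pd 0 (v 1) x * (pd 0 η x * v 1 x + η x * pd 0 (v 1) x)
      + pd 1 (v 1) x * (pd 1 η x * v 1 x + η x * pd 1 (v 1) x)
      + force b v 1 x * (η x * v 1 x) :=
    integrable_of_eq_zero_off (by fun_prop) hc fun x hx => by simp [z0 x hx, z1 x hx]
  rw [hpsum, ← t0, ← t1, ← integral_add it0 it1]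
  refine (integral_eq_of_sub_eq_div
    (H₀ := fun x => -(1 / 4) * (x 0 * (η x * (v 0 x * v 0 x + v 1 x * v 1 x)))
      + (1 / 2) * (η x * (total b v 0 x * (v 0 x * v 0 x + v 1 x * v 1 x))))
    (H₁ := fun x => -(1 / 4) * (x 1 * (η x * (v 0 x * v 0 x + v 1 x * v 1 x)))
      + (1 / 2) * (η x * (total b v 1 x * (v 0 x * v 0 x + v 1 x * v 1 x))))
    (integrable_fun_add it0 it1) ?_ (by fun_prop) (by fun_prop) ?_ ?_ ?_).symm
  · exact integrable_of_eq_zero_off (by fun_prop) hc fun x hx => by simp [z0 x hx, z1 x hx]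
  · exact HasCompactSupport.intro hc fun x hx => by simp [z0 x hx]
  · exact HasCompactSupport.intro hc fun x hx => by simp [z0 x hx]
  · intro x
    have hd := hVdiv x
    rw [hVpd, hVpd] at hd
    have p0 : pd 0 (v 0) x = -pd 1 (v 1) x - pd 0 (b 0) x - pd 1 (b 1) x := by linarith
    have hbd := hb.div x
    have q0 : pd 0 (b 0) x = - pd 1 (b 1) x := by linarith
    simp only [force, hVpd]
    simp (disch := fun_prop) only [pd_add, pd_mul, pd_const, pd_coord, hVpd]
    rw [p0, q0]
    simp only [total]
    simp
    ring

/-- The integrand of the weighted energy identity with the weight `w = (1 + |x|²)^s`. -/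
noncomputable def weightedEnergy (s : ℝ) (b v : Fin 2 → Plane → ℝ) (p : Plane → ℝ) (x : Plane) : ℝ :=
  wt x ^ s * (pd 0 (v 0) x * pd 0 (v 0) x + pd 1 (v 0) x * pd 1 (v 0) x
          + (pd 0 (v 1) x * pd 0 (v 1) x + pd 1 (v 1) x * pd 1 (v 1) x))
      + (2 * s * x 0 * wt x ^ (s - 1) * (v 0 x * pd 0 (v 0) x + v 1 x * pd 0 (v 1) x
          + (1 / 4) * x 0 * (v 0 x * v 0 x + v 1 x * v 1 x)
          - (1 / 2) * total b v 0 x * (v 0 x * v 0 x + v 1 x * v 1 x))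
        + 2 * s * x 1 * wt x ^ (s - 1) * (v 0 x * pd 1 (v 0) x + v 1 x * pd 1 (v 1) x
          + (1 / 4) * x 1 * (v 0 x * v 0 x + v 1 x * v 1 x)
          - (1 / 2) * total b v 1 x * (v 0 x * v 0 x + v 1 x * v 1 x)))
      + wt x ^ s * (total b v 0 x * pd 0 (b 0) x * v 0 x + total b v 1 x * pd 1 (b 0) x * v 0 x
          + (total b v 0 x * pd 0 (b 1) x * v 1 x + total b v 1 x * pd 1 (b 1) x * v 1 x))
      - p x * (2 * s * x 0 * wt x ^ (s - 1) * v 0 x + 2 * s * x 1 * wt x ^ (s - 1) * v 1 x)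

/-- The terms that remain on the right of the weighted energy estimate; `σ` is the square root of
the weight. -/
noncomputable def energyRemainder (K : ℝ) (σ : Plane → ℝ) (b v : Fin 2 → Plane → ℝ) (p : Plane → ℝ)
    (x : Plane) : ℝ :=
  (9 / 2 + 2 * K) * ∑ k, |v k x| * |v k x|
    + ∑ j, ∑ k, |σ x * v j x| * |v k x ^ 2|
    + K * ∑ j, ∑ k, |σ x * v k x| * |pd j (b k) x|
    + K * ∑ j, ∑ k, |σ x * v j x| * |v k x|
    + 2 * ∑ j, |σ x * v j x| * |p x|

/-- The term `∇w · ∇v v` of the weighted energy identity is absorbed by half of the Dirichlet integral;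
here `d` is a derivative of the weight `w`, `σ = √w` and `r = √(1 + |x|²)`. -/
theorem abs_energy_gradient_term {w r σ d v D : ℝ} (hσ : 0 ≤ σ) (hr : 1 ≤ r) (hw : w = σ ^ 2) (hσr : σ ≤ r)
    (hd : |d| * r ≤ 2 * w) : |d * (v * D)| ≤ (1 / 2) * (w * D ^ 2) + 2 * v ^ 2 := by
  have hr0 : 0 < r := by linarith
  have h1 : |d| ≤ 2 * σ * (σ / r) := by
    rw [← mul_div_assoc, le_div_iff₀ hr0]; linarith [sq σ]
  have h2 : σ / r ≤ 1 := (div_le_one hr0).2 hσr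
  have h3 : 0 ≤ σ / r := by positivity
  rw [abs_mul, abs_mul]
  calc |d| * (|v| * |D|) ≤ 2 * σ * (σ / r) * (|v| * |D|) := by gcongr
    _ ≤ 2 * σ * 1 * (|v| * |D|) := by gcongr
    _ ≤ (1 / 2) * (w * D ^ 2) + 2 * v ^ 2 := by
      rw [hw, ← sq_abs D, ← sq_abs v]; nlinarith [sq_nonneg (σ * |D| - 2 * |v|)]

/-- The integrand of the weighted energy identity is its leading part `w |∇v|² + (s/2) w |v|²` up to
half of the gradient term and the remainder. The leading `|v|²` comes from the drift. -/
theorem weightedEnergy_bound (hb : IsBackground K b) {p : Plane → ℝ} {s : ℝ} (hs0 : 0 ≤ s)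
    (hs1 : s ≤ 1) (x : Plane) :
    |weightedEnergy s b v p x - ((∑ j, ∑ k, (wt x ^ (s / 2) * pd j (v k) x) ^ 2)
        + s / 2 * ∑ k, (wt x ^ (s / 2) * v k x) ^ 2)| ≤
      (1 / 2) * (∑ j, ∑ k, (wt x ^ (s / 2) * pd j (v k) x) ^ 2)
        + energyRemainder K (fun x => wt x ^ (s / 2)) b v p x := by
  have hK := hb.nonneg
  have hr1 := one_le_sqrt_wt x
  have hr0 : 0 < √(wt x) := by linarith
  have hwt : wt x = √(wt x) ^ 2 := (Real.sq_sqrt (wt_pos x).le).symm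
  have hσ0 : 0 ≤ wt x ^ (s / 2) := Real.rpow_nonneg (wt_pos x).le _
  have hσr : wt x ^ (s / 2) ≤ √(wt x) := by
    rw [Real.sqrt_eq_rpow]
    exact Real.rpow_le_rpow_of_exponent_le (one_le_wt x) (by linarith)
  have hw : wt x ^ s = (wt x ^ (s / 2)) ^ 2 := by
    rw [← Real.rpow_natCast, ← Real.rpow_mul (wt_pos x).le]; norm_num
  have hw1 : wt x ^ (s - 1) = wt x ^ s / wt x := by
    rw [Real.rpow_sub (wt_pos x), Real.rpow_one]
  have hw2 : wt x ^ (s - 1) ≤ 1 := Real.rpow_le_one_of_one_le_of_nonpos (one_le_wt x) (by linarith)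
  have hw3 : 0 ≤ wt x ^ (s - 1) := Real.rpow_nonneg (wt_pos x).le _
  have hxx : x 0 * x 0 + x 1 * x 1 = wt x - 1 := by rw [wt_eq]; ring
  have hww : wt x ^ (s - 1) * wt x = wt x ^ s := by
    rw [hw1]; exact div_mul_cancel₀ _ (wt_pos x).ne'
  have hdw : ∀ j, |2 * s * x j * wt x ^ (s - 1)| * √(wt x) ≤ 2 * wt x ^ s := by
    intro j
    rw [abs_mul, abs_mul, abs_of_nonneg hw3, abs_of_nonneg (by linarith : 0 ≤ 2 * s)]
    calc 2 * s * |x j| * wt x ^ (s - 1) * √(wt x)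
        ≤ 2 * 1 * √(wt x) * wt x ^ (s - 1) * √(wt x) := by
          gcongr; exact abs_coord_le j x
      _ = 2 * (wt x ^ (s - 1) * √(wt x) ^ 2) := by ring
      _ = _ := by rw [← hwt, hww]
  have hb1 := fun k => hb.bound k x
  have hb2 := fun i k => hb.pd_bound i k x
  unfold weightedEnergy energyRemainder
  simp only [Fin.sum_univ_two]
  set W := wt x ^ (s - 1)
  set w := wt x ^ s
  set σ := wt x ^ (s / 2)
  set r := √(wt x)
  have hdr : ∀ j, |2 * s * x j * W| ≤ 2 * σ * (σ / r) := fun j => by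
    rw [← mul_div_assoc, le_div_iff₀ hr0]; linarith [hdw j, sq σ]
  have hd1 : ∀ j, |2 * s * x j * W| ≤ 2 * σ := fun j => (hdr j).trans (by
    have : σ / r ≤ 1 := (div_le_one hr0).2 hσr
    nlinarith)
  have hd2 : ∀ j, |2 * s * x j * W| ≤ 2 * r := fun j => (hd1 j).trans (by linarith)
  -- `A1`: the derivative of the weight against `v ∇v`; `A3`: against the transport of `|v|²` by `V`;
  -- `A4`: the stretching of `b`; `A5`: the pressure; `A2`: the drift, which is explicit up to `O(|v|²)`
  have A1 : ∀ j k, |2 * s * x j * W * (v k x * pd j (v k) x)| ≤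
      (1 / 2) * (w * pd j (v k) x ^ 2) + 2 * v k x ^ 2 := fun j k =>
    abs_energy_gradient_term hσ0 hr1 hw hσr (hdw j)
  have A3 : ∀ j k, |2 * s * x j * W * (total b v j x * (v k x) ^ 2)| ≤
      2 * K * v k x ^ 2 + 2 * (|σ * v j x| * |v k x ^ 2|) := by
    intro j k
    have h1 : |2 * s * x j * W| * |total b v j x| ≤ 2 * K + 2 * |σ * v j x| := by
      calc _ ≤ |2 * s * x j * W| * (|b j x| + |v j x|) := by gcongr; exact abs_add_le _ _
        _ = |2 * s * x j * W| * |b j x| + |2 * s * x j * W| * |v j x| := by ring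
        _ ≤ 2 * r * |b j x| + 2 * σ * |v j x| := by
          gcongr
          · exact hd2 j
          · exact hd1 j
        _ ≤ _ := by rw [abs_mul, abs_of_nonneg hσ0]; linarith [hb1 j]
    rw [← mul_assoc, abs_mul, abs_mul, abs_of_nonneg (sq_nonneg (v k x))]
    nlinarith [mul_le_mul_of_nonneg_right h1 (sq_nonneg (v k x))]
  have A4 : ∀ j k, |w * (total b v j x * pd j (b k) x * v k x)| ≤
      K * (|σ * v k x| * |pd j (b k) x|) + K * (|σ * v j x| * |v k x|) := by
    intro j k
    have h0 : |w * (total b v j x * pd j (b k) x * v k x)| ≤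
        σ ^ 2 * ((|b j x| + |v j x|) * |pd j (b k) x| * |v k x|) := by
      rw [abs_mul, abs_mul, abs_mul, hw, abs_of_nonneg (sq_nonneg σ)]
      gcongr; exact abs_add_le _ _
    have h1 : σ * |b j x| ≤ K := by nlinarith [hb1 j, abs_nonneg (b j x)]
    have h2 : σ * |pd j (b k) x| ≤ K := by nlinarith [hb2 j k, abs_nonneg (pd j (b k) x)]
    have h3 : 0 ≤ σ * |v k x| * |pd j (b k) x| := by positivity
    have h4 : 0 ≤ σ * |v j x| * |v k x| := by positivity
    rw [abs_mul σ, abs_mul σ, abs_of_nonneg hσ0]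
    nlinarith [mul_le_mul_of_nonneg_right h1 h3, mul_le_mul_of_nonneg_right h2 h4]
  have A5 : ∀ j, |p x * (2 * s * x j * W * v j x)| ≤ 2 * (|σ * v j x| * |p x|) := by
    intro j
    rw [abs_mul, abs_mul, abs_mul σ, abs_of_nonneg hσ0]
    have : 0 ≤ |p x| * |v j x| := by positivity
    nlinarith [mul_le_mul_of_nonneg_right (hd1 j) this]
  have A2 : (2 * s * x 0 * W * ((1 / 4) * x 0 * (v 0 x * v 0 x + v 1 x * v 1 x))
      + 2 * s * x 1 * W * ((1 / 4) * x 1 * (v 0 x * v 0 x + v 1 x * v 1 x)))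
      = s / 2 * (w * v 0 x ^ 2 + w * v 1 x ^ 2) - s / 2 * W * (v 0 x ^ 2 + v 1 x ^ 2) := by
    rw [← hww]
    linear_combination (s / 2 * W * (v 0 x ^ 2 + v 1 x ^ 2)) * hxx
  have A2' : |s / 2 * W * (v 0 x ^ 2 + v 1 x ^ 2)| ≤ (1 / 2) * (v 0 x ^ 2 + v 1 x ^ 2) := by
    rw [abs_of_nonneg (by positivity)]
    have : s / 2 * W ≤ 1 / 2 * 1 := by gcongr
    nlinarith [sq_nonneg (v 0 x), sq_nonneg (v 1 x)]
  have e1 : ∀ y, (σ * y) ^ 2 = w * y ^ 2 := fun y => by rw [hw]; ring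
  simp only [e1, abs_mul_abs_self]
  have a11 := abs_le.1 (A1 0 0)
  have a12 := abs_le.1 (A1 0 1)
  have a13 := abs_le.1 (A1 1 0)
  have a14 := abs_le.1 (A1 1 1)
  have a31 := abs_le.1 (A3 0 0)
  have a32 := abs_le.1 (A3 0 1)
  have a33 := abs_le.1 (A3 1 0)
  have a34 := abs_le.1 (A3 1 1)
  have a41 := abs_le.1 (A4 0 0)
  have a42 := abs_le.1 (A4 0 1)
  have a43 := abs_le.1 (A4 1 0)
  have a44 := abs_le.1 (A4 1 1)
  have a51 := abs_le.1 (A5 0)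
  have a52 := abs_le.1 (A5 1)
  have a2 := abs_le.1 A2'
  clear_value W w σ r
  clear A1 A3 A4 A5 A2' hd1 hd2 hdr hdw hb1 hb2
  rw [abs_le]
  constructor <;> linarith

end

section
variable {K M : ℝ} {b v : Fin 2 → Plane → ℝ}

theorem memLp_wt_rpow {r : ℝ} (hr : r < -(1 / 2)) : MemLp (fun x => wt x ^ r) 2 := by
  rw [memLp_two_iff (contDiff_wt_rpow r (n := 1)).continuous.aestronglyMeasurable]
  refine (integrable_wt_rpow (r := r * 2) (by linarith)).congr (Eventually.of_forall fun x => ?_)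
  simp only
  rw [Real.rpow_mul (wt_pos x).le]; norm_num

theorem memLp_wt_rpow_mul {f : Plane → ℝ} (hf : Continuous f) {C : ℝ}
    (h : ∀ x, |f x| * wt x ≤ C) {s : ℝ} (hs : s < 1) : MemLp (fun x => wt x ^ (s / 2) * f x) 2 := by
  have hc : Continuous fun x => wt x ^ (s / 2) := (contDiff_wt_rpow (s / 2) (n := 1)).continuous
  refine memLp_of_abs_le ((memLp_wt_rpow (r := s / 2 - 1) (by linarith)).const_mul C)
    (hc.mul hf).aestronglyMeasurable fun x => ?_
  have h0 : 0 ≤ wt x ^ (s / 2) := Real.rpow_nonneg (wt_pos x).le _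
  refine le_trans ?_ (le_abs_self _)
  rw [abs_mul, abs_of_nonneg h0, Real.rpow_sub (wt_pos x), Real.rpow_one, ← mul_div_assoc,
    le_div_iff₀ (wt_pos x)]
  nlinarith [mul_le_mul_of_nonneg_right (h x) h0]

theorem memLp_sq (hv : IsPerturbation M v) (k) : MemLp (fun x => v k x ^ 2) 2 := by
  have := memLp_bdd_mul (C := M) (hv.contDiff k).continuous.aestronglyMeasurable (hv.memLp k)
    (hv.abs_le k)
  simpa [pow_two] using this

theorem integrable_energyRemainder (hb : IsBackground K b) (hv : IsPerturbation M v) {p : Plane → ℝ}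
    (hp2 : MemLp p 2) {s : ℝ} (hs : s < 1) :
    Integrable (energyRemainder K (fun x => wt x ^ (s / 2)) b v p) := by
  have hσ : ∀ k, MemLp (fun x => |wt x ^ (s / 2) * v k x|) 2 := fun k =>
    (memLp_wt_rpow_mul (hv.contDiff k).continuous (hv.bound k) hs).abs
  have hvk := fun k => (hv.memLp k).abs
  unfold energyRemainder
  refine integrable_fun_add (integrable_fun_add (integrable_fun_add (integrable_fun_add ?_ ?_) ?_) ?_) ?_
  · exact (integrable_finsetSum _ fun k _ => integrable_mul_of_memLp (hvk k) (hvk k)).const_mul _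
  · exact integrable_finsetSum _ fun j _ => integrable_finsetSum _ fun k _ =>
      integrable_mul_of_memLp (hσ j) (memLp_sq hv k).abs
  · exact (integrable_finsetSum _ fun j _ => integrable_finsetSum _ fun k _ =>
      integrable_mul_of_memLp (hσ k) (hb.pd_memLp j k).abs).const_mul _
  · exact (integrable_finsetSum _ fun j _ => integrable_finsetSum _ fun k _ =>
      integrable_mul_of_memLp (hσ j) (hvk k)).const_mul _
  · exact (integrable_finsetSum _ fun j _ => integrable_mul_of_memLp (hσ j) hp2.abs).const_mul _

theorem integral_energyRemainder_le (hb : IsBackground K b) (hv : IsPerturbation M v) {p : Plane → ℝ}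
    (hp2 : MemLp p 2) {s : ℝ} (hs : s < 1) :
    ∫ x, energyRemainder K (fun x => wt x ^ (s / 2)) b v p x ≤
      (9 / 2 + 2 * K) * ∑ k, l2 (v k) * l2 (v k)
        + ∑ j, ∑ k, l2 (fun x => wt x ^ (s / 2) * v j x) * l2 (fun x => v k x ^ 2)
        + K * ∑ j, ∑ k, l2 (fun x => wt x ^ (s / 2) * v k x) * l2 (pd j (b k))
        + K * ∑ j, ∑ k, l2 (fun x => wt x ^ (s / 2) * v j x) * l2 (v k)
        + 2 * ∑ j, l2 (fun x => wt x ^ (s / 2) * v j x) * l2 p := by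
  have hK := hb.nonneg
  have hσ : ∀ k, MemLp (fun x => |wt x ^ (s / 2) * v k x|) 2 := fun k =>
    (memLp_wt_rpow_mul (hv.contDiff k).continuous (hv.bound k) hs).abs
  have hvk := fun k => (hv.memLp k).abs
  have cs : ∀ {f g : Plane → ℝ}, MemLp (fun x => |f x|) 2 → MemLp (fun x => |g x|) 2 →
      ∫ x, |f x| * |g x| ≤ l2 f * l2 g := by
    intro f g hf hg
    rw [← l2_abs f, ← l2_abs g]
    exact (le_abs_self _).trans (abs_integral_mul_le hf hg)
  have i1 : ∀ k, Integrable fun x => |v k x| * |v k x| := fun k => integrable_mul_of_memLp (hvk k) (hvk k)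
  have i2 : ∀ j k, Integrable fun x => |wt x ^ (s / 2) * v j x| * |v k x ^ 2| := fun j k =>
    integrable_mul_of_memLp (hσ j) (memLp_sq hv k).abs
  have i3 : ∀ j k, Integrable fun x => |wt x ^ (s / 2) * v k x| * |pd j (b k) x| := fun j k =>
    integrable_mul_of_memLp (hσ k) (hb.pd_memLp j k).abs
  have i4 : ∀ j k, Integrable fun x => |wt x ^ (s / 2) * v j x| * |v k x| := fun j k =>
    integrable_mul_of_memLp (hσ j) (hvk k)
  have i5 : ∀ j, Integrable fun x => |wt x ^ (s / 2) * v j x| * |p x| := fun j =>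
    integrable_mul_of_memLp (hσ j) hp2.abs
  have s2 := integrable_finsetSum Finset.univ fun j _ => integrable_finsetSum Finset.univ fun k _ => i2 j k
  have s3 := integrable_finsetSum Finset.univ fun j _ => integrable_finsetSum Finset.univ fun k _ => i3 j k
  have s4 := integrable_finsetSum Finset.univ fun j _ => integrable_finsetSum Finset.univ fun k _ => i4 j k
  have s1 := integrable_finsetSum Finset.univ fun k _ => i1 k
  have s5 := integrable_finsetSum Finset.univ fun k _ => i5 k
  unfold energyRemainder
  rw [integral_add (integrable_fun_add (integrable_fun_add (integrable_fun_add (s1.const_mul _) s2)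
      (s3.const_mul _)) (s4.const_mul _)) (s5.const_mul _),
    integral_add (integrable_fun_add (integrable_fun_add (s1.const_mul _) s2)
      (s3.const_mul _)) (s4.const_mul _),
    integral_add (integrable_fun_add (s1.const_mul _) s2) (s3.const_mul _),
    integral_add (s1.const_mul _) s2]
  simp only [integral_const_mul]
  rw [integral_finsetSum _ fun k _ => i1 k, integral_finsetSum _ fun k _ => i5 k,
    integral_finsetSum _ fun j _ => integrable_finsetSum Finset.univ fun k _ => i2 j k,
    integral_finsetSum _ fun j _ => integrable_finsetSum Finset.univ fun k _ => i3 j k,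
    integral_finsetSum _ fun j _ => integrable_finsetSum Finset.univ fun k _ => i4 j k]
  simp_rw [fun j => integral_finsetSum Finset.univ fun k _ => i2 j k,
    fun j => integral_finsetSum Finset.univ fun k _ => i3 j k,
    fun j => integral_finsetSum Finset.univ fun k _ => i4 j k]
  gcongr with k _ j _ k _ j _ k _ j _ k _ j _
  · exact cs (hvk k) (hvk k)
  · exact cs (hσ j) (memLp_sq hv k).abs
  · exact cs (hσ k) (hb.pd_memLp j k).abs
  · exact cs (hσ j) (hvk k)
  · exact cs (hσ j) hp2.abs

set_option maxHeartbeats 1000000 in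
/-- Letting the cut-off tend to one in the weighted energy identity. For `s < 1` the boundary terms are
integrable by the qualitative decay of `v`. -/
theorem integral_weightedEnergy (hb : IsBackground K b) (hv : IsPerturbation M v) {p : Plane → ℝ}
    (hp : IsWeakSol b v p) (hp2 : MemLp p 2) {s : ℝ} (hs1 : s < 1)
    (hE : Integrable (weightedEnergy s b v p)) : ∫ x, weightedEnergy s b v p x = 0 := by
  obtain ⟨c, hc0, χ, hχ⟩ := exists_cutoff
  have hVc := contDiff_total hb hv
  have hK := hb.nonneg
  have hM := hv.nonneg
  set L := K + M with hL
  have hL0 : 0 ≤ L := by linarith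
  have hwc : ContDiff ℝ 1 fun x => wt x ^ s := contDiff_wt_rpow s
  set R : Fin 2 → Plane → ℝ := fun j x => wt x ^ s * (v 0 x * pd j (v 0) x + v 1 x * pd j (v 1) x
          + (1 / 4) * x j * (v 0 x * v 0 x + v 1 x * v 1 x)
          - (1 / 2) * total b v j x * (v 0 x * v 0 x + v 1 x * v 1 x))
          - p x * (wt x ^ s * v j x) with hR
  set C := 2 * L ^ 2 + L ^ 2 + L ^ 3 with hC
  set g : Plane → ℝ := fun x => C * wt x ^ (s - 2) + L * (|p x| * wt x ^ (s - 3 / 2)) with hg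
  have ig : Integrable g := integrable_fun_add ((integrable_wt_rpow (by linarith)).const_mul C)
    ((integrable_mul_of_memLp hp2.abs (memLp_wt_rpow (by linarith))).const_mul L)
  have hRb : ∀ j x, |R j x| ≤ √(wt x) * |g x| := by
    intro j x
    have ha := sqrt_wt_pos x
    have ha1 := one_le_sqrt_wt x
    have hw : wt x = √(wt x) ^ 2 := (Real.sq_sqrt (wt_pos x).le).symm
    have hx := abs_coord_le j x
    have hws : 0 ≤ wt x ^ s := Real.rpow_nonneg (wt_pos x).le _
    have e1 : wt x ^ (s - 2) = wt x ^ s / √(wt x) ^ 4 := by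
      rw [Real.rpow_sub (wt_pos x)]
      congr 1
      nth_rewrite 1 [hw]
      rw [← Real.rpow_natCast, ← Real.rpow_natCast, ← Real.rpow_mul ha.le]; norm_num
    have e2 : wt x ^ (s - 3 / 2) = wt x ^ s / √(wt x) ^ 3 := by
      rw [Real.rpow_sub (wt_pos x)]
      congr 1
      nth_rewrite 1 [hw]
      rw [← Real.rpow_natCast, ← Real.rpow_natCast, ← Real.rpow_mul ha.le]; norm_num
    have bV : ∀ k, |total b v k x| ≤ L := fun k => le_of_mul_sqrt_wt_le (total_bound hb hv k) x
    have bv : ∀ k, |v k x| * √(wt x) ^ 2 ≤ L := fun k => by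
      rw [← hw]; exact (hv.bound k x).trans (by linarith)
    have bv' : ∀ k, |v k x| * √(wt x) ≤ L := fun k => (hv.bound_sqrt k x).trans (by linarith)
    have bdv : ∀ k, |pd j (v k) x| * √(wt x) ≤ L := fun k =>
      (hv.pd_bound_sqrt j k x).trans (by linarith)
    set a := √(wt x) with hadef
    have q1 : ∀ k, |v k x * pd j (v k) x| * a ^ 3 ≤ L ^ 2 := fun k => by
      rw [abs_mul]
      calc |v k x| * |pd j (v k) x| * a ^ 3 = (|v k x| * a ^ 2) * (|pd j (v k) x| * a) := by ring
        _ ≤ L * L := mul_le_mul (bv k) (bdv k) (by positivity) hL0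
        _ = _ := by ring
    have q2 : ∀ k, |x j * (v k x * v k x)| * a ^ 3 ≤ L ^ 2 := fun k => by
      rw [abs_mul, abs_mul]
      calc |x j| * (|v k x| * |v k x|) * a ^ 3 ≤ a * (|v k x| * |v k x|) * a ^ 3 := by gcongr
        _ = (|v k x| * a ^ 2) * (|v k x| * a ^ 2) := by ring
        _ ≤ L * L := mul_le_mul (bv k) (bv k) (by positivity) hL0
        _ = _ := by ring
    have q4 : ∀ k, |total b v j x * (v k x * v k x)| * a ^ 3 ≤ L ^ 3 := fun k => by
      rw [abs_mul, abs_mul]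
      calc |total b v j x| * (|v k x| * |v k x|) * a ^ 3
          = |total b v j x| * ((|v k x| * a) * (|v k x| * a ^ 2)) := by ring
        _ ≤ L * (L * L) := mul_le_mul (bV j) (mul_le_mul (bv' k) (bv k) (by positivity) hL0)
            (by positivity) hL0
        _ = _ := by ring
    have hfin : |v 0 x * pd j (v 0) x + v 1 x * pd j (v 1) x
          + (1 / 4) * x j * (v 0 x * v 0 x + v 1 x * v 1 x)
          - (1 / 2) * total b v j x * (v 0 x * v 0 x + v 1 x * v 1 x)| * a ^ 3 ≤ C := by
      have hL2 : 0 ≤ L ^ 2 := by positivity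
      have hL3 : 0 ≤ L ^ 3 := by positivity
      have ha3 : 0 < a ^ 3 := by positivity
      have f1 : ∀ y B : ℝ, |y| * a ^ 3 ≤ B → y * a ^ 3 ≤ B ∧ -B ≤ y * a ^ 3 := fun y B h => by
        rw [← abs_of_pos ha3, ← abs_mul, abs_le] at h
        exact ⟨h.2, h.1⟩
      have g1 := f1 _ _ (q1 0)
      have g2 := f1 _ _ (q1 1)
      have g3 := f1 _ _ (q2 0)
      have g4 := f1 _ _ (q2 1)
      have g5 := f1 _ _ (q4 0)
      have g6 := f1 _ _ (q4 1)
      nth_rewrite 1 [← abs_of_pos ha3]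
      rw [← abs_mul, abs_le]
      constructor <;> linarith [g1.1, g1.2, g2.1, g2.2, g3.1, g3.2, g4.1, g4.2, g5.1, g5.2, g6.1, g6.2]
    have hgx : a * g x = wt x ^ s * (C / a ^ 3) + |p x| * (wt x ^ s * (L / a ^ 2)) := by
      rw [hg]; simp only
      rw [e1, e2]
      field_simp
    calc |R j x| ≤ wt x ^ s * (C / a ^ 3) + |p x| * (wt x ^ s * (L / a ^ 2)) := by
          refine (abs_sub _ _).trans ?_
          rw [abs_mul, abs_mul (p x), abs_mul (wt x ^ s), abs_of_nonneg hws]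
          gcongr
          · rw [le_div_iff₀ (by positivity)]; exact hfin
          · rw [le_div_iff₀ (by positivity)]; exact bv j
      _ = a * g x := hgx.symm
      _ ≤ a * |g x| := by gcongr; exact le_abs_self _
  have k4 := (hVc 0).continuous
  have k5 := (hVc 1).continuous
  have k6 := (hv.contDiff 0).continuous
  have k7 := (hv.contDiff 1).continuous
  have hRm : ∀ j, AEStronglyMeasurable (R j) := by
    intro j
    have k5' := (hVc j).continuous
    have k7' := (hv.contDiff j).continuous
    have l1 := continuous_pd (hv.contDiff 0) j
    have l2 := continuous_pd (hv.contDiff 1) j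
    have l5 := hwc.continuous
    refine AEStronglyMeasurable.sub ?_ (hp2.1.mul (l5.mul k7').aestronglyMeasurable)
    refine Continuous.aestronglyMeasurable ?_
    fun_prop
  refine hχ.integral_eq_zero hE ig hRm hRb fun n hi => ?_
  have ht : IsTest (χ n) := ⟨hχ.contDiff n, hχ.compact n⟩
  have hη : ContDiff ℝ 1 fun x => χ n x * wt x ^ s := ht.c1.mul hwc
  have hηc : HasCompactSupport fun x => χ n x * wt x ^ s := ht.compact.mul_right
  have ip : Integrable fun x => p x * (pd 0 (fun x => χ n x * wt x ^ s) x * v 0 x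
      + pd 1 (fun x => χ n x * wt x ^ s) x * v 1 x) := by
    refine hp.locInt.integrable_smul_right_of_hasCompactSupport ?_
      (((hηc.pd 0).mul_right).add ((hηc.pd 1).mul_right))
    have := continuous_pd hη 0
    have := continuous_pd hη 1
    fun_prop
  have h := weighted_energy_identity hb hv hp hη hηc
  have hpd : ∀ j x, pd j (fun x => χ n x * wt x ^ s) x
      = pd j (χ n) x * wt x ^ s + χ n x * (2 * s * x j * wt x ^ (s - 1)) := fun j x => by
    rw [pd_mul ht.differentiable (hwc.differentiable one_ne_zero), pd_wt_rpow]
  rw [← sub_eq_zero, ← integral_sub _ ip] at h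
  · refine Eq.trans ?_ h
    congr 1; ext x
    simp only [hpd, hR, weightedEnergy]
    ring
  · refine (integrable_fun_add hi ip).congr (Eventually.of_forall fun x => ?_)
    simp only [hpd, hR, weightedEnergy]
    ring

/-- The weighted energy estimate for the weight `(1 + |x|²)^s`, `s < 1`. -/
theorem weighted_energy_le (hb : IsBackground K b) (hv : IsPerturbation M v) {p : Plane → ℝ}
    (hp : IsWeakSol b v p) (hp2 : MemLp p 2) {s : ℝ} (hs0 : 0 ≤ s) (hs1 : s < 1) :
    (1 / 2) * (∑ j, ∑ k, l2 (fun x => wt x ^ (s / 2) * pd j (v k) x) ^ 2)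
      + s / 2 * ∑ k, l2 (fun x => wt x ^ (s / 2) * v k x) ^ 2 ≤
    (9 / 2 + 2 * K) * ∑ k, l2 (v k) * l2 (v k)
        + ∑ j, ∑ k, l2 (fun x => wt x ^ (s / 2) * v j x) * l2 (fun x => v k x ^ 2)
        + K * ∑ j, ∑ k, l2 (fun x => wt x ^ (s / 2) * v k x) * l2 (pd j (b k))
        + K * ∑ j, ∑ k, l2 (fun x => wt x ^ (s / 2) * v j x) * l2 (v k)
        + 2 * ∑ j, l2 (fun x => wt x ^ (s / 2) * v j x) * l2 p := by
  have mv : ∀ k, MemLp (fun x => wt x ^ (s / 2) * v k x) 2 := fun k =>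
    memLp_wt_rpow_mul (hv.contDiff k).continuous (hv.bound k) hs1
  have md : ∀ j k, MemLp (fun x => wt x ^ (s / 2) * pd j (v k) x) 2 := fun j k =>
    memLp_wt_rpow_mul (continuous_pd (hv.contDiff k) j) (hv.pd_bound j k) hs1
  have iv : ∀ k, Integrable fun x => (wt x ^ (s / 2) * v k x) ^ 2 := fun k => (mv k).integrable_sq
  have id : ∀ j k, Integrable fun x => (wt x ^ (s / 2) * pd j (v k) x) ^ 2 := fun j k =>
    (md j k).integrable_sq
  have sv := integrable_finsetSum Finset.univ fun k _ => iv k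
  have sd := integrable_finsetSum Finset.univ fun j _ => integrable_finsetSum Finset.univ fun k _ => id j k
  have iB := integrable_energyRemainder hb hv hp2 hs1
  have hbd := fun x => weightedEnergy_bound (v := v) hb (p := p) hs0 hs1.le x
  have hmeas : AEStronglyMeasurable (weightedEnergy s b v p) := by
    have k4 := (contDiff_total hb hv 0).continuous
    have k5 := (contDiff_total hb hv 1).continuous
    have k6 := (hv.contDiff 0).continuous
    have k7 := (hv.contDiff 1).continuous
    have l1 := continuous_pd (hv.contDiff 0) 0
    have l2 := continuous_pd (hv.contDiff 0) 1
    have l3 := continuous_pd (hv.contDiff 1) 0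
    have l4 := continuous_pd (hv.contDiff 1) 1
    have l5 := continuous_pd (hb.contDiff 0) 0
    have l6 := continuous_pd (hb.contDiff 0) 1
    have l7 := continuous_pd (hb.contDiff 1) 0
    have l8 := continuous_pd (hb.contDiff 1) 1
    have w1 := (contDiff_wt_rpow s (n := 1)).continuous
    have w2 := (contDiff_wt_rpow (s - 1) (n := 1)).continuous
    unfold weightedEnergy
    refine AEStronglyMeasurable.sub ?_ (hp2.1.mul ?_)
    · refine Continuous.aestronglyMeasurable ?_
      fun_prop
    · refine Continuous.aestronglyMeasurable ?_
      fun_prop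
  have iE : Integrable (weightedEnergy s b v p) := by
    refine (integrable_fun_add (integrable_fun_add (sd.const_mul (3 / 2)) (sv.const_mul (s / 2))) iB).mono'
      hmeas (Eventually.of_forall fun x => ?_)
    rw [Real.norm_eq_abs]
    have h1 : 0 ≤ ∑ j, ∑ k, (wt x ^ (s / 2) * pd j (v k) x) ^ 2 := by positivity
    have h2 : 0 ≤ s / 2 * ∑ k, (wt x ^ (s / 2) * v k x) ^ 2 := by positivity
    have := abs_le.1 (hbd x)
    rw [abs_le]
    constructor <;> linarith
  have hz := integral_weightedEnergy hb hv hp hp2 hs1 iE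
  have key : (∫ x, (1 / 2) * (∑ j, ∑ k, (wt x ^ (s / 2) * pd j (v k) x) ^ 2)
      + s / 2 * ∑ k, (wt x ^ (s / 2) * v k x) ^ 2) ≤
      ∫ x, (weightedEnergy s b v p x + energyRemainder K (fun x => wt x ^ (s / 2)) b v p x) := by
    refine integral_mono (integrable_fun_add (sd.const_mul _) (sv.const_mul _))
      (integrable_fun_add iE iB) fun x => ?_
    have := abs_le.1 (hbd x)
    simp only
    linarith
  rw [integral_add iE iB, hz, zero_add, integral_add (sd.const_mul _) (sv.const_mul _),
    integral_const_mul, integral_const_mul, integral_finsetSum _ fun k _ => iv k,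
    integral_finsetSum _ fun j _ => integrable_finsetSum Finset.univ fun k _ => id j k] at key
  simp_rw [fun j => integral_finsetSum Finset.univ fun k _ => id j k] at key
  simp_rw [l2_sq (md _ _), l2_sq (mv _)]
  exact key.trans (integral_energyRemainder_le hb hv hp2 hs1)

end

theorem le_add_of_sq_le {N Y T : ℝ} (hY : 0 ≤ Y) (hT : 0 ≤ T)
    (h : N ^ 2 ≤ Y ^ 2 + T * N) : N ≤ Y + T := by
  by_contra! hc
  have hN : 0 < N := by linarith
  nlinarith [mul_pos hN (sub_pos.2 hc), mul_nonneg hY (by linarith : 0 ≤ N - Y)]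

theorem le_add_one_of_sq_le {y C : ℝ} (hC : 0 ≤ C) (h : y ^ 2 ≤ C) : y ≤ C + 1 := by
  nlinarith [sq_nonneg (y - 1)]

/-- The absorption argument behind the weighted bound: `X` is the weighted and `N` the plain norm. -/
theorem le_of_absorb {X N C T δ : ℝ} (hX : 0 ≤ X) (hN : 0 ≤ N) (hC : 0 ≤ C) (hT : 0 ≤ T)
    (hδ : δ = (6 * (C + 1))⁻¹) (h1 : N ≤ δ * X + T) (h2 : X ^ 2 ≤ C * (N ^ 2 + N * X + X)) :
    X ≤ 2 * C * (2 * T ^ 2 + T + 1) + 1 := by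
  have hδ0 : 0 < δ := by rw [hδ]; positivity
  have hCδ : C * δ ≤ 1 / 6 := by
    rw [hδ, ← div_eq_mul_inv, div_le_iff₀ (by positivity)]; linarith
  have hδ1 : δ ≤ 1 := by
    rw [hδ]; exact inv_le_one_of_one_le₀ (by linarith)
  have h3 : N ^ 2 ≤ 2 * (δ * X) ^ 2 + 2 * T ^ 2 := by
    nlinarith [sq_nonneg (δ * X - T)]
  have h4 : N * X ≤ (δ * X + T) * X := mul_le_mul_of_nonneg_right h1 hX
  have h5 : C * (δ * X) ^ 2 ≤ 1 / 6 * X ^ 2 := by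
    calc C * (δ * X) ^ 2 = (C * δ) * δ * X ^ 2 := by ring
      _ ≤ 1 / 6 * 1 * X ^ 2 := by gcongr
      _ = _ := by ring
  have h6 : C * (δ * X * X) ≤ 1 / 6 * X ^ 2 := by
    calc C * (δ * X * X) = (C * δ) * X ^ 2 := by ring
      _ ≤ _ := by gcongr
  have h7 : X ^ 2 ≤ 2 * C * (2 * T ^ 2 + (T + 1) * X) := by
    have := mul_le_mul_of_nonneg_left h3 hC
    have := mul_le_mul_of_nonneg_left h4 hC
    nlinarith
  by_contra! hc
  have hX1 : 1 ≤ X := by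
    have : 0 ≤ 2 * C * (2 * T ^ 2 + T + 1) := by positivity
    linarith
  have h8 : 2 * C * (2 * T ^ 2 + (T + 1) * X) ≤ 2 * C * (2 * T ^ 2 + T + 1) * X := by
    have : 0 ≤ 2 * C * (2 * T ^ 2) := by positivity
    nlinarith
  nlinarith

section
variable {K M : ℝ} {b v : Fin 2 → Plane → ℝ}

/-- Constants depending on `K` only: the Ladyzhenskaya inequality combined with the energy bound. -/
theorem exists_l2_sq_le (K : ℝ) (hK : 0 ≤ K) : ∃ a : ℝ, 0 ≤ a ∧
    ∀ (M : ℝ) (b v : Fin 2 → Plane → ℝ) (p : Plane → ℝ), IsBackground K b → IsPerturbation M v →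
      IsWeakSol b v p → MemLp p 2 → ∀ k, l2 (fun x => v k x ^ 2) ≤ a * l2 (v k) := by
  obtain ⟨C, hC, h⟩ := exists_ladyzhenskaya
  refine ⟨C * (6 * K), by positivity, fun M b v p hb hv hp hp2 k => ?_⟩
  refine (h (v k) (hv.contDiff k) (hv.memLp k) fun i => hv.memLp_pd i k).2.trans ?_
  have h0 := l2_pd_le hb hv hp hp2 0 k
  have h1 := l2_pd_le hb hv hp hp2 1 k
  have h2 := mul_nonneg hC (l2_nonneg (v k))
  nlinarith [mul_le_mul_of_nonneg_left (add_le_add h0 h1) h2]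

/-- The products `V_i V_j` are bounded in `L²` in terms of `‖v‖`; they control the pressure. -/
theorem l2_total_mul_le (hb : IsBackground K b) (hv : IsPerturbation M v) {a : ℝ}
    (ha : ∀ k, l2 (fun x => v k x ^ 2) ≤ a * l2 (v k)) (i j : Fin 2) :
    l2 (fun x => total b v i x * total b v j x) ≤
      4 * K ^ 2 * l2 (fun x => (wt x)⁻¹) + 2 * a * (l2 (v 0) + l2 (v 1)) := by
  have hK := hb.nonneg
  have m0 := memLp_sq hv 0
  have m1 := memLp_sq hv 1
  have mw := memLp_wt_inv.const_mul (4 * K ^ 2)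
  have hle : l2 (fun x => total b v i x * total b v j x) ≤
      l2 (fun x => 4 * K ^ 2 * (wt x)⁻¹ + (2 * v 0 x ^ 2 + 2 * v 1 x ^ 2)) := by
    refine l2_mono (mw.add ((m0.const_mul 2).add (m1.const_mul 2))) fun x => ?_
    have hw : 0 < wt x := wt_pos x
    have hb2 : ∀ k, b k x ^ 2 ≤ K ^ 2 * (wt x)⁻¹ := fun k => by
      rw [← div_eq_mul_inv, le_div_iff₀ hw, ← sq_abs, ← Real.sq_sqrt hw.le, ← mul_pow]
      exact pow_le_pow_left₀ (by positivity) (hb.bound k x) 2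
    have key : ∀ k l, total b v k x * total b v l x ≤
        b k x ^ 2 + v k x ^ 2 + (b l x ^ 2 + v l x ^ 2) ∧
        -(b k x ^ 2 + v k x ^ 2 + (b l x ^ 2 + v l x ^ 2)) ≤ total b v k x * total b v l x := fun k l => by
      unfold total
      constructor <;> nlinarith [sq_nonneg (b k x - v k x), sq_nonneg (b l x - v l x),
        sq_nonneg (b k x + v k x - (b l x + v l x)), sq_nonneg (b k x + v k x + (b l x + v l x))]
    refine le_trans ?_ (le_abs_self _)
    have n0 := sq_nonneg (v 0 x)
    have n1 := sq_nonneg (v 1 x)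
    have n2 := hb2 0
    have n3 := hb2 1
    have n4 := sq_nonneg (b 0 x)
    have n5 := sq_nonneg (b 1 x)
    have kk := key i j
    rw [abs_le]
    fin_cases i <;> fin_cases j <;> simp only [Fin.zero_eta, Fin.mk_one] at kk ⊢ <;>
      constructor <;> linarith [kk.1, kk.2]
  have msum : MemLp (fun x => 2 * v 0 x ^ 2 + 2 * v 1 x ^ 2) 2 :=
    (m0.const_mul 2).add (m1.const_mul 2)
  refine hle.trans ((l2_add_le mw msum).trans ?_)
  have h1 := l2_add_le (m0.const_mul 2) (m1.const_mul 2)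
  rw [l2_const_mul, l2_const_mul] at h1
  rw [l2_const_mul, abs_of_nonneg (by positivity)]
  rw [abs_of_pos (by norm_num)] at h1
  linarith [ha 0, ha 1]

/-- `‖v_k‖ ≤ δ ‖w^{1/2} v_k‖ + C_δ`: the `L²` norm near the origin is controlled by the `L⁴` norm. -/
theorem l2_le_weighted (hv : IsPerturbation M v) {a : ℝ} (ha0 : 0 ≤ a)
    (ha : ∀ k, l2 (fun x => v k x ^ 2) ≤ a * l2 (v k)) {s δ : ℝ} (hs : 1 / 2 ≤ s) (hs1 : s < 1)
    (hδ : 0 < δ) (k : Fin 2) :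
    l2 (v k) ≤ δ * l2 (fun x => wt x ^ (s / 2) * v k x)
      + (δ ^ 4)⁻¹ * l2 (fun x => (wt x)⁻¹) * a := by
  have mX := memLp_wt_rpow_mul (hv.contDiff k).continuous (hv.bound k) hs1
  have mq := memLp_sq hv k
  have mw := memLp_wt_inv
  refine le_add_of_sq_le (mul_nonneg hδ.le (l2_nonneg _))
    (mul_nonneg (mul_nonneg (by positivity) (l2_nonneg _)) ha0) ?_
  have h1 : ∫ x, v k x ^ 2 ≤ ∫ x, (δ ^ 2 * (wt x ^ (s / 2) * v k x) ^ 2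
      + (δ ^ 4)⁻¹ * ((wt x)⁻¹ * v k x ^ 2)) := by
    refine integral_mono (hv.memLp k).integrable_sq (integrable_fun_add (mX.integrable_sq.const_mul _)
      ((integrable_mul_of_memLp mw mq).const_mul _)) fun x => ?_
    have h2 := one_le_eps_sqrt_wt (pow_pos hδ 2) x
    have h3 : √(wt x) ≤ (wt x ^ (s / 2)) ^ 2 := by
      rw [← Real.rpow_natCast, ← Real.rpow_mul (wt_pos x).le, Real.sqrt_eq_rpow]
      exact Real.rpow_le_rpow_of_exponent_le (one_le_wt x) (by push_cast; linarith)
    have h4 : 1 ≤ δ ^ 2 * (wt x ^ (s / 2)) ^ 2 + (δ ^ 4)⁻¹ * (wt x)⁻¹ := by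
      have := mul_le_mul_of_nonneg_left h3 (sq_nonneg δ)
      rw [← pow_mul] at h2
      linarith
    have := mul_le_mul_of_nonneg_right h4 (sq_nonneg (v k x))
    simp only
    linarith
  rw [integral_add (mX.integrable_sq.const_mul _) ((integrable_mul_of_memLp mw mq).const_mul _),
    integral_const_mul, integral_const_mul, ← l2_sq (hv.memLp k), ← l2_sq mX] at h1
  have h5 := (le_abs_self _).trans (abs_integral_mul_le mw mq)
  have h6 := mul_le_mul_of_nonneg_left (ha k) (l2_nonneg fun x => (wt x)⁻¹)
  have h7 := mul_le_mul_of_nonneg_left (h5.trans h6) (by positivity : 0 ≤ (δ ^ 4)⁻¹)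
  rw [mul_pow]
  linarith

set_option maxHeartbeats 400000 in
/-- The weighted estimate with a constant that depends neither on `s` nor on the qualitative bound
`M`. -/
theorem exists_uniform_weighted_bound (K : ℝ) (hK : 0 ≤ K) : ∃ C : ℝ,
    ∀ (M : ℝ) (b v : Fin 2 → Plane → ℝ) (q : Plane → ℝ), IsBackground K b → IsPerturbation M v →
      IsWeakSol b v q → ∀ s : ℝ, 1 / 2 ≤ s → s < 1 →
        (∀ k, l2 (fun x => wt x ^ (s / 2) * v k x) ≤ C) ∧
        ∀ j k, l2 (fun x => wt x ^ (s / 2) * pd j (v k) x) ≤ C := by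
  obtain ⟨a, ha0, ha⟩ := exists_l2_sq_le K hK
  set c := l2 (fun x : Plane => (wt x)⁻¹) with hc
  have hc0 : 0 ≤ c := l2_nonneg _
  -- `C₁` collects the coefficients of the weighted estimate, `δ` and `T` are the constants with
  -- `N ≤ δ X + T` for which absorption works, `C₂` bounds `X` and `C₃` the squared gradient norms
  set C₁ : ℝ := 8 * (9 / 2 + 2 * K + a + K + 2 * K ^ 2 + 32 * K ^ 2 * c + 16 * a) with hC₁
  have hC₁0 : 0 ≤ C₁ := by positivity
  set δ : ℝ := (6 * (C₁ + 1))⁻¹ with hδ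
  have hδ0 : 0 < δ := by positivity
  set T : ℝ := 2 * ((δ ^ 4)⁻¹ * c * a) with hT
  have hT0 : 0 ≤ T := by positivity
  set C₂ : ℝ := 2 * C₁ * (2 * T ^ 2 + T + 1) + 1 with hC₂
  have hC₂0 : 0 ≤ C₂ := by positivity
  set C₃ : ℝ := C₁ * ((δ * C₂ + T) ^ 2 + (δ * C₂ + T) * C₂ + C₂) with hC₃
  have hC₃0 : 0 ≤ C₃ := by positivity
  clear_value c C₁ δ T C₂ C₃
  refine ⟨C₂ + (C₃ + 1), fun M b v q hb hv hq s hs hs1 => ?_⟩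
  obtain ⟨p, hp2, hp, hpl⟩ := exists_pressure hb hv hq
  have ha' := ha M b v p hb hv hp hp2
  have hNk := fun k => l2_le_weighted hv ha0 ha' hs hs1 hδ0 k
  have hV := fun i j => l2_total_mul_le hb hv ha' i j
  have key := weighted_energy_le hb hv hp hp2 (by linarith : 0 ≤ s) hs1
  simp only [Fin.sum_univ_two] at key
  rw [← hc] at hV hNk
  have hp3 : l2 p ≤ 16 * K ^ 2 * c + 8 * a * (l2 (v 0) + l2 (v 1)) := by
    linarith only [hpl, hV 0 0, hV 0 1, hV 1 0, hV 1 1]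
  have hbl := hb.pd_l2
  have x0 := l2_nonneg fun x => wt x ^ (s / 2) * v 0 x
  have x1 := l2_nonneg fun x => wt x ^ (s / 2) * v 1 x
  have n0 := l2_nonneg (v 0)
  have n1 := l2_nonneg (v 1)
  have la := ha' 0
  have lb := ha' 1
  have hN0 := hNk 0
  have hN1 := hNk 1
  have d : ∀ j k, 0 ≤ l2 (fun x => wt x ^ (s / 2) * pd j (v k) x) := fun j k => l2_nonneg _
  set X0 := l2 fun x => wt x ^ (s / 2) * v 0 x with hX0
  set X1 := l2 fun x => wt x ^ (s / 2) * v 1 x with hX1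
  set N0 := l2 (v 0)
  set N1 := l2 (v 1)
  set D : Fin 2 → Fin 2 → ℝ := fun j k => l2 (fun x => wt x ^ (s / 2) * pd j (v k) x) with hD
  set L0 := l2 fun x => v 0 x ^ 2
  set L1 := l2 fun x => v 1 x ^ 2
  set P := l2 p
  clear_value X0 X1 N0 N1 D L0 L1 P
  have hNX : N0 + N1 ≤ δ * (X0 + X1) + T := by rw [hT]; linarith only [hN0, hN1]
  have key2 : (1 / 2) * (D 0 0 ^ 2 + D 0 1 ^ 2 + (D 1 0 ^ 2 + D 1 1 ^ 2)) + 1 / 8 * (X0 + X1) ^ 2 ≤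
      C₁ / 8 * ((N0 + N1) ^ 2 + (N0 + N1) * (X0 + X1) + (X0 + X1)) := by
    have e1 : N0 * N0 + N1 * N1 ≤ (N0 + N1) ^ 2 := by linarith only [mul_nonneg n0 n1]
    have e2 : X0 * L0 + X0 * L1 + (X1 * L0 + X1 * L1) ≤ a * ((N0 + N1) * (X0 + X1)) := by
      calc _ = (X0 + X1) * (L0 + L1) := by ring
        _ ≤ (X0 + X1) * (a * N0 + a * N1) := by gcongr
        _ = _ := by ring
    have e3 : X0 * l2 (pd 0 (b 0)) + X1 * l2 (pd 0 (b 1)) + (X0 * l2 (pd 1 (b 0)) + X1 * l2 (pd 1 (b 1)))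
        ≤ 2 * K * (X0 + X1) := by
      calc _ ≤ X0 * K + X1 * K + (X0 * K + X1 * K) := by
            gcongr
            exacts [hbl 0 0, hbl 0 1, hbl 1 0, hbl 1 1]
        _ = _ := by ring
    have e5 : X0 * P + X1 * P ≤ 16 * K ^ 2 * c * (X0 + X1) + 8 * a * ((N0 + N1) * (X0 + X1)) := by
      calc _ = (X0 + X1) * P := by ring
        _ ≤ (X0 + X1) * (16 * K ^ 2 * c + 8 * a * (N0 + N1)) := by gcongr
        _ = _ := by ring
    have e6 : 1 / 8 * (X0 + X1) ^ 2 ≤ s / 2 * (X0 ^ 2 + X1 ^ 2) := by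
      have := mul_le_mul_of_nonneg_right hs (add_nonneg (sq_nonneg X0) (sq_nonneg X1))
      linarith only [sq_nonneg (X0 - X1), this]
    have m1 := mul_le_mul_of_nonneg_left e1 (by positivity : 0 ≤ 9 / 2 + 2 * K)
    have m3 := mul_le_mul_of_nonneg_left e3 hK
    have z1 : 0 ≤ (N0 + N1) ^ 2 := sq_nonneg _
    have z2 : 0 ≤ (N0 + N1) * (X0 + X1) := by positivity
    have z3 : 0 ≤ X0 + X1 := by positivity
    have f1 : 0 ≤ (a + K + 2 * K ^ 2 + 32 * K ^ 2 * c + 16 * a) * (N0 + N1) ^ 2 := by positivity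
    have f2 : 0 ≤ (9 / 2 + 2 * K + 2 * K ^ 2 + 32 * K ^ 2 * c) * ((N0 + N1) * (X0 + X1)) := by positivity
    have f3 : 0 ≤ (9 / 2 + 2 * K + a + K + 16 * a) * (X0 + X1) := by positivity
    rw [hC₁]
    rw [hD]
    beta_reduce
    linarith only [key, m1, m3, e2, e5, e6, z1, z2, z3, f1, f2, f3]
  have hX2 : (X0 + X1) ^ 2 ≤ C₁ * ((N0 + N1) ^ 2 + (N0 + N1) * (X0 + X1) + (X0 + X1)) := by
    linarith only [key2, sq_nonneg (D 0 0), sq_nonneg (D 0 1), sq_nonneg (D 1 0), sq_nonneg (D 1 1)]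
  have hX : X0 + X1 ≤ C₂ := by
    rw [hC₂]; exact le_of_absorb (add_nonneg x0 x1) (add_nonneg n0 n1) hC₁0 hT0 hδ hNX hX2
  have hN : N0 + N1 ≤ δ * C₂ + T := hNX.trans (by gcongr)
  have hR : C₁ / 8 * ((N0 + N1) ^ 2 + (N0 + N1) * (X0 + X1) + (X0 + X1)) ≤ C₃ / 8 := by
    calc _ ≤ C₁ / 8 * ((δ * C₂ + T) ^ 2 + (δ * C₂ + T) * C₂ + C₂) := by gcongr
      _ = C₃ / 8 := by rw [hC₃]; ring
  have hDb : ∀ j k, D j k ≤ C₃ + 1 := by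
    have hsum : D 0 0 ^ 2 + D 0 1 ^ 2 + (D 1 0 ^ 2 + D 1 1 ^ 2) ≤ C₃ := by
      linarith only [key2, hR, sq_nonneg (X0 + X1), hC₃0]
    have hjk : ∀ j k, D j k ^ 2 ≤ C₃ := by
      have n1 := sq_nonneg (D 0 0)
      have n2 := sq_nonneg (D 0 1)
      have n3 := sq_nonneg (D 1 0)
      have n4 := sq_nonneg (D 1 1)
      intro j k
      fin_cases j <;> fin_cases k <;> simp only [Fin.zero_eta, Fin.mk_one] <;>
        linarith only [hsum, n1, n2, n3, n4]
    intro j k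
    have := hjk j k
    exact le_add_one_of_sq_le hC₃0 this
  refine ⟨Fin.forall_fin_two.2 ⟨?_, ?_⟩, fun j k => ?_⟩
  · rw [← hX0]; linarith only [hX, x0, x1, hC₃0]
  · rw [← hX1]; linarith only [hX, x0, x1, hC₃0]
  · have := hDb j k
    rw [hD] at this
    exact this.trans (by linarith only [hC₂0])

/-- The weighted `H¹` bound: `√(1+|x|²) v` and `√(1+|x|²) ∇v` are bounded in `L²` in terms of `K`
only. -/
theorem exists_weighted_bound (K : ℝ) (hK : 0 ≤ K) : ∃ C : ℝ, 0 ≤ C ∧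
    ∀ (M : ℝ) (b v : Fin 2 → Plane → ℝ) (q : Plane → ℝ), IsBackground K b → IsPerturbation M v →
      IsWeakSol b v q →
        (∀ k, MemLp (fun x => √(wt x) * v k x) 2 ∧ l2 (fun x => √(wt x) * v k x) ≤ C) ∧
        ∀ j k, MemLp (fun x => √(wt x) * pd j (v k) x) 2 ∧
          l2 (fun x => √(wt x) * pd j (v k) x) ≤ C := by
  obtain ⟨C, hC⟩ := exists_uniform_weighted_bound K hK
  refine ⟨|C|, abs_nonneg C, fun M b v q hb hv hq => ?_⟩
  -- exponents in `[1/2, 1)` that tend to one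
  set s : ℕ → ℝ := fun n => 1 - 1 / ((n : ℝ) + 2) with hs
  have hs0 : ∀ n, 1 / 2 ≤ s n := fun n => by
    have : 1 / ((n : ℝ) + 2) ≤ 1 / 2 := by gcongr; linarith [Nat.cast_nonneg (α := ℝ) n]
    simp only [hs]; linarith
  have hs1 : ∀ n, s n < 1 := fun n => by
    have : 0 < 1 / ((n : ℝ) + 2) := by positivity
    simp only [hs]; linarith
  have hlim : Tendsto s atTop (𝓝 1) := by
    have h1 : Tendsto (fun n : ℕ => 1 / ((n : ℝ) + 2)) atTop (𝓝 0) := by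
      have := (tendsto_const_div_atTop_nhds_zero_nat (1 : ℝ)).comp (tendsto_add_atTop_nat 2)
      refine this.congr fun n => by simp
    simpa [hs] using h1.const_sub 1
  have hpt : ∀ (f : Plane → ℝ) x, Tendsto (fun n => wt x ^ (s n / 2) * f x) atTop (𝓝 (√(wt x) * f x)) := by
    intro f x
    refine Tendsto.mul_const _ ?_
    rw [Real.sqrt_eq_rpow]
    exact tendsto_const_nhds.rpow (hlim.div_const 2) (Or.inl (wt_pos x).ne')
  constructor
  · intro k
    exact memLp_of_tendsto (fun n => memLp_wt_rpow_mul (hv.contDiff k).continuous (hv.bound k) (hs1 n))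
      (fun n => ((hC M b v q hb hv hq (s n) (hs0 n) (hs1 n)).1 k).trans (le_abs_self C))
      (Eventually.of_forall (hpt (v k)))
  · intro j k
    exact memLp_of_tendsto (fun n => memLp_wt_rpow_mul (continuous_pd (hv.contDiff k) j) (hv.pd_bound j k) (hs1 n))
      (fun n => ((hC M b v q hb hv hq (s n) (hs0 n) (hs1 n)).2 j k).trans (le_abs_self C))
      (Eventually.of_forall (hpt (pd j (v k))))

end

/-! ### The vorticity equation -/

/-- The scalar curl `∂₀ v₁ - ∂₁ v₀`. -/
noncomputable def curl (v : Fin 2 → Plane → ℝ) (x : Plane) : ℝ := pd 0 (v 1) x - pd 1 (v 0) x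

/-- The flux `(curl V) V - (x/2) curl v` in the vorticity equation `Δ (curl v) = div F`. -/
noncomputable def vortFlux (b v : Fin 2 → Plane → ℝ) (j : Fin 2) (x : Plane) : ℝ :=
  (curl v x + curl b x) * total b v j x - (1 / 2) * (x j * curl v x)

section
variable {K M : ℝ} {b v : Fin 2 → Plane → ℝ}

set_option maxHeartbeats 1000000 in
/-- The weak form of the vorticity equation, obtained by testing the momentum equation with the
rotated gradient of `ζ`. -/
theorem vorticity_equation (hb : IsBackground K b) (hv : IsPerturbation M v) {q : Plane → ℝ}
    (hq : IsWeakSol b v q) {ζ : Plane → ℝ} (hζ : IsTest ζ) :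
    ∫ x, (curl v x * (pd 0 (pd 0 ζ) x + pd 1 (pd 1 ζ) x)
      + (vortFlux b v 0 x * pd 0 ζ x + vortFlux b v 1 x * pd 1 ζ x)) = 0 := by
  have hVc := contDiff_total hb hv
  have hVpd := pd_total hb hv
  have hfc := continuous_force hb hv
  have hA := hζ.pd 0
  have hB := hζ.pd 1
  have e0 := hq.eq_of_contDiff_one hb hv 0 hB.c1 hB.compact
  have e1 := hq.eq_of_contDiff_one hb hv 1 hA.c1 hA.compact
  have h1 : pd 0 (pd 1 ζ) = pd 1 (pd 0 ζ) := funext fun x =>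
    pd_comm (contDiff_infty.1 hζ.contDiff 2) 0 1 x
  rw [h1] at e0
  have h2 : ∀ x, pd 0 (pd 1 (pd 0 ζ)) x = pd 1 (pd 0 (pd 0 ζ)) x := fun x =>
    pd_comm (contDiff_infty.1 hA.contDiff 2) 0 1 x
  have h3 : ∀ x, pd 0 (pd 1 (pd 1 ζ)) x = pd 1 (pd 1 (pd 0 ζ)) x := fun x => by
    rw [pd_comm (contDiff_infty.1 hB.contDiff 2) 0 1 x, h1]
  set A := pd 0 ζ
  set B := pd 1 ζ
  have hA0 := hA.pd 0
  have hA1 := hA.pd 1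
  have hB1 := hB.pd 1
  have V0 := hVc 0
  have V1 := hVc 1
  have v0 := hv.contDiff 0
  have v1 := hv.contDiff 1
  have dV0 := V0.differentiable one_ne_zero
  have dV1 := V1.differentiable one_ne_zero
  have dv0 := v0.differentiable one_ne_zero
  have dv1 := v1.differentiable one_ne_zero
  have dx0 := differentiable_coord 0
  have dx1 := differentiable_coord 1
  have cx0 := contDiff_coord (n := 1) 0
  have cx1 := contDiff_coord (n := 1) 1
  have dA := hA.differentiable
  have dB := hB.differentiable
  have dA0 := hA0.differentiable
  have dA1 := hA1.differentiable
  have dB1 := hB1.differentiable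
  have cA := hA.c1
  have cB := hB.c1
  have cA0 := hA0.c1
  have cA1 := hA1.c1
  have cB1 := hB1.c1
  have k1 := cA.continuous
  have k2 := cB.continuous
  have k3 := cA0.continuous
  have k4 := cA1.continuous
  have k5 := cB1.continuous
  have k6 := v0.continuous
  have k7 := v1.continuous
  have k8 := V0.continuous
  have k9 := V1.continuous
  have l1 := continuous_pd v0 0
  have l2 := continuous_pd v0 1
  have l3 := continuous_pd v1 0
  have l4 := continuous_pd v1 1
  have l5 := continuous_pd (hb.contDiff 0) 0
  have l6 := continuous_pd (hb.contDiff 0) 1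
  have l7 := continuous_pd (hb.contDiff 1) 0
  have l8 := continuous_pd (hb.contDiff 1) 1
  have m1 := hfc 0
  have m2 := hfc 1
  have zA : ∀ x ∉ tsupport ζ, A x = 0 := fun x hx => pd_eq_zero_of_notMem hx 0
  have zB : ∀ x ∉ tsupport ζ, B x = 0 := fun x hx => pd_eq_zero_of_notMem hx 1
  have zA' : ∀ i, ∀ x ∉ tsupport ζ, pd i A x = 0 := fun i x hx =>
    pd_eq_zero_of_notMem (fun h => hx (tsupport_pd_subset ζ 0 h)) i
  have zB' : ∀ i, ∀ x ∉ tsupport ζ, pd i B x = 0 := fun i x hx =>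
    pd_eq_zero_of_notMem (fun h => hx (tsupport_pd_subset ζ 1 h)) i
  have i0 : Integrable fun x => pd 0 (v 0) x * pd 1 A x + pd 1 (v 0) x * pd 1 B x + force b v 0 x * B x :=
    integrable_of_eq_zero_off (by fun_prop) hζ.compact fun x hx => by simp [zA' 1 x hx, zB' 1 x hx, zB x hx]
  have i1 : Integrable fun x => pd 0 (v 1) x * pd 0 A x + pd 1 (v 1) x * pd 1 A x + force b v 1 x * A x :=
    integrable_of_eq_zero_off (by fun_prop) hζ.compact fun x hx => by simp [zA' 0 x hx, zA' 1 x hx, zA x hx]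
  have hsum : ∫ x, ((pd 0 (v 1) x * pd 0 A x + pd 1 (v 1) x * pd 1 A x + force b v 1 x * A x)
      - (pd 0 (v 0) x * pd 1 A x + pd 1 (v 0) x * pd 1 B x + force b v 0 x * B x)) = 0 := by
    rw [integral_sub i1 i0, e0, e1, sub_self]
  refine Eq.trans ?_ hsum
  refine (integral_eq_of_sub_eq_div
    (H₀ := fun x => -(v 0 x * pd 1 A x) - v 1 x * pd 1 B x
      - (1 / 2) * ((total b v 0 x * total b v 0 x + total b v 1 x * total b v 1 x) * B x)
      + (1 / 2) * ((x 0 * v 0 x + x 1 * v 1 x) * B x))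
    (H₁ := fun x => v 1 x * pd 1 A x + v 0 x * pd 0 A x
      + (1 / 2) * ((total b v 0 x * total b v 0 x + total b v 1 x * total b v 1 x) * A x)
      - (1 / 2) * ((x 0 * v 0 x + x 1 * v 1 x) * A x))
    (integrable_fun_sub i1 i0) ?_ (by fun_prop) (by fun_prop) ?_ ?_ ?_).symm
  · refine integrable_of_eq_zero_off ?_ hζ.compact fun x hx => by
      simp [zA' 0 x hx, zB' 1 x hx, zA x hx, zB x hx]
    unfold vortFlux curl
    fun_prop
  · exact HasCompactSupport.intro hζ.compact fun x hx => by
      simp [zA' 1 x hx, zB' 1 x hx, zB x hx]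
  · exact HasCompactSupport.intro hζ.compact fun x hx => by
      simp [zA' 1 x hx, zA' 0 x hx, zA x hx]
  · intro x
    simp only [force, vortFlux, curl, hVpd]
    simp (disch := fun_prop) only [pd_add, pd_sub, pd_neg, pd_mul, pd_const, pd_coord, hVpd, h2, h3, h1]
    simp only [total]
    simp
    ring

theorem continuous_curl (hv : ∀ k, ContDiff ℝ 1 (v k)) : Continuous (curl v) :=
  (continuous_pd (hv 1) 0).sub (continuous_pd (hv 0) 1)

theorem continuous_vortFlux (hb : IsBackground K b) (hv : IsPerturbation M v) (j) :
    Continuous (vortFlux b v j) := by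
  have h1 := continuous_curl hv.contDiff
  have h2 := continuous_curl hb.contDiff
  have h3 := (contDiff_total hb hv j).continuous
  have h4 := (contDiff_coord (n := 1) j).continuous
  unfold vortFlux
  fun_prop

end

/-! ### The weighted gradient estimate for the vorticity -/

set_option maxHeartbeats 1000000 in
/-- The energy identity for `ΔW = div F` with the test function `θ² W`; the parts `W V` and
`-(x/2) W` of the flux have been integrated by parts. -/
theorem localized_energy_identity {W θ : Plane → ℝ} {F V : Fin 2 → Plane → ℝ} (hW : ContDiff ℝ ∞ W)
    (hθ : IsTest θ) (hF : ∀ j, ContDiff ℝ 1 (F j)) (hV : ∀ j, ContDiff ℝ 1 (V j))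
    (hdiv : ∀ x, pd 0 (V 0) x + pd 1 (V 1) x = 0)
    (heq : ∀ x, pd 0 (pd 0 W) x + pd 1 (pd 1 W) x = pd 0 (F 0) x + pd 1 (F 1) x) :
    ∫ x, ((θ x * pd 0 W x) ^ 2 + (θ x * pd 1 W x) ^ 2) =
    ∫ x, ((-(2 * (W x * pd 0 θ x * (θ x * pd 0 W x))) + θ x * W x ^ 2 * V 0 x * pd 0 θ x
        - (1 / 2) * (θ x * W x ^ 2 * (x 0 * pd 0 θ x))
        + (F 0 x - W x * V 0 x + (1 / 2) * (x 0 * W x)) * (θ x * (θ x * pd 0 W x) + 2 * (θ x * W x * pd 0 θ x)))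
      + (-(2 * (W x * pd 1 θ x * (θ x * pd 1 W x))) + θ x * W x ^ 2 * V 1 x * pd 1 θ x
        - (1 / 2) * (θ x * W x ^ 2 * (x 1 * pd 1 θ x))
        + (F 1 x - W x * V 1 x + (1 / 2) * (x 1 * W x)) * (θ x * (θ x * pd 1 W x) + 2 * (θ x * W x * pd 1 θ x)))
      + (1 / 2) * (θ x * W x) ^ 2) := by
  have z0 : ∀ x ∉ tsupport θ, θ x = 0 := fun x hx => image_eq_zero_of_notMem_tsupport hx
  have W0 : ContDiff ℝ ∞ (pd 0 W) := contDiff_pd hW 0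
  have W1 : ContDiff ℝ ∞ (pd 1 W) := contDiff_pd hW 1
  have c1 : ContDiff ℝ 1 W := contDiff_infty.1 hW 1
  have c2 : ContDiff ℝ 1 (pd 0 W) := contDiff_infty.1 W0 1
  have c3 : ContDiff ℝ 1 (pd 1 W) := contDiff_infty.1 W1 1
  have c4 := hθ.c1
  have c5 := hF 0
  have c6 := hF 1
  have c7 := hV 0
  have c8 := hV 1
  have cx0 := contDiff_coord (n := 1) 0
  have cx1 := contDiff_coord (n := 1) 1
  have d1 := c1.differentiable one_ne_zero
  have d2 := c2.differentiable one_ne_zero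
  have d3 := c3.differentiable one_ne_zero
  have d4 := c4.differentiable one_ne_zero
  have d5 := c5.differentiable one_ne_zero
  have d6 := c6.differentiable one_ne_zero
  have d7 := c7.differentiable one_ne_zero
  have d8 := c8.differentiable one_ne_zero
  have dx0 := differentiable_coord 0
  have dx1 := differentiable_coord 1
  have k1 := c1.continuous
  have k2 := c2.continuous
  have k3 := c3.continuous
  have k4 := c4.continuous
  have k5 := c5.continuous
  have k6 := c6.continuous
  have k7 := c7.continuous
  have k8 := c8.continuous
  have l1 := (hθ.pd 0).contDiff.continuous
  have l2 := (hθ.pd 1).contDiff.continuous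
  have z1 : ∀ x ∉ tsupport θ, ∀ i, pd i θ x = 0 := fun x hx i => pd_eq_zero_of_notMem hx i
  refine integral_eq_of_sub_eq_div
    (H₀ := fun x => θ x * θ x * (W x * (pd 0 W x - F 0 x)) + (1 / 2) * (θ x * θ x * (W x * W x) * V 0 x)
      - (1 / 4) * (θ x * θ x * (W x * W x) * x 0))
    (H₁ := fun x => θ x * θ x * (W x * (pd 1 W x - F 1 x)) + (1 / 2) * (θ x * θ x * (W x * W x) * V 1 x)
      - (1 / 4) * (θ x * θ x * (W x * W x) * x 1)) ?_ ?_ (by fun_prop) (by fun_prop) ?_ ?_ ?_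
  · exact integrable_of_eq_zero_off (by fun_prop) hθ.compact fun x hx => by simp [z0 x hx]
  · exact integrable_of_eq_zero_off (by fun_prop) hθ.compact fun x hx => by simp [z0 x hx, z1 x hx]
  · exact HasCompactSupport.intro hθ.compact fun x hx => by simp [z0 x hx]
  · exact HasCompactSupport.intro hθ.compact fun x hx => by simp [z0 x hx]
  · intro x
    have h1 := hdiv x
    have h2 := heq x
    have p0 : pd 0 (V 0) x = -pd 1 (V 1) x := by linarith
    have p1 : pd 0 (pd 0 W) x = pd 0 (F 0) x + pd 1 (F 1) x - pd 1 (pd 1 W) x := by linarith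
    simp (disch := fun_prop) only [pd_add, pd_sub, pd_mul, pd_const, pd_coord]
    rw [p0, p1]
    simp
    ring

section
variable {K M : ℝ} {b v : Fin 2 → Plane → ℝ}

/-- The energy estimate for `ΔW = div F` localized by `θ`, with explicit constants. -/
theorem localized_energy_le (hb : IsBackground K b) (hv : IsPerturbation M v)
    {W θ : Plane → ℝ} {F : Fin 2 → Plane → ℝ} (hW : ContDiff ℝ ∞ W) (hθ : IsTest θ)
    (hF : ∀ j, ContDiff ℝ 1 (F j))
    (heq : ∀ x, pd 0 (pd 0 W) x + pd 1 (pd 1 W) x = pd 0 (F 0) x + pd 1 (F 1) x)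
    (hθ0 : ∀ x, 0 ≤ θ x) (hθ1 : ∀ x, θ x ≤ √(wt x)) {c A S Λ Q : ℝ} (hc : 0 ≤ c)
    (hθc : ∀ j x, |pd j θ x| ≤ c) (hWm : MemLp W 2) (hWA : l2 W ≤ A)
    (hwm : MemLp (fun x => √(wt x) * W x) 2) (hwA : l2 (fun x => √(wt x) * W x) ≤ A)
    (hS : ∀ j, l2 (fun x => θ x * (F j x - W x * total b v j x + (1 / 2) * (x j * W x))) ≤ S)
    (hΛ : ∀ j, l2 (fun x => v j x ^ 2) ≤ Λ) (hQ : l2 (fun x => (θ x * W x) ^ 2) ≤ Q) :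
    l2 (fun x => θ x * pd 0 W x) ^ 2 + l2 (fun x => θ x * pd 1 W x) ^ 2 ≤
      (2 * c * A + S) * (l2 (fun x => θ x * pd 0 W x) + l2 (fun x => θ x * pd 1 W x))
      + (2 * (c * K * A ^ 2 + c / 2 * A * (Q + Λ) + c / 2 * A ^ 2 + 2 * c * S * A) + A ^ 2 / 2) := by
  have hK := hb.nonneg
  have hA : 0 ≤ A := (l2_nonneg _).trans hWA
  have hS0 : 0 ≤ S := (l2_nonneg _).trans (hS 0)
  have z0 : ∀ x ∉ tsupport θ, θ x = 0 := fun x hx => image_eq_zero_of_notMem_tsupport hx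
  have cW := hW.continuous
  have cθ := hθ.contDiff.continuous
  have cdW : ∀ j, Continuous (pd j W) := fun j => (contDiff_pd hW j).continuous
  have cS : ∀ j, Continuous fun x => θ x * (F j x - W x * total b v j x + (1 / 2) * (x j * W x)) := fun j => by
    have := (hF j).continuous
    have := (contDiff_total hb hv j).continuous
    have := (contDiff_coord (n := 1) j).continuous
    fun_prop
  have mS : ∀ j, MemLp (fun x => θ x * (F j x - W x * total b v j x + (1 / 2) * (x j * W x))) 2 := fun j =>
    memLp_of_compact (cS j) hθ.compact.mul_right
  have mG : ∀ j, MemLp (fun x => θ x * pd j W x) 2 := fun j =>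
    memLp_of_compact (cθ.mul (cdW j)) hθ.compact.mul_right
  have mQ : MemLp (fun x => (θ x * W x) ^ 2) 2 := by
    refine memLp_of_compact (by fun_prop) (HasCompactSupport.intro hθ.compact fun x hx => by simp [z0 x hx])
  have mv := memLp_sq hv
  have hid := localized_energy_identity hW hθ hF (contDiff_total hb hv) (div_total hb hv) heq
  set Y : Fin 2 → Plane → ℝ := fun j x => θ x * (F j x - W x * total b v j x + (1 / 2) * (x j * W x)) with hY
  set G : Fin 2 → Plane → ℝ := fun j x => θ x * pd j W x with hG
  set Z : Plane → ℝ := fun x => √(wt x) * W x with hZ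
  rw [integral_add (mG 0).integrable_sq (mG 1).integrable_sq, ← l2_sq (mG 0), ← l2_sq (mG 1)] at hid
  have i1 : ∀ j, Integrable fun x => |W x| * |G j x| := fun j => integrable_mul_of_memLp hWm.abs (mG j).abs
  have i2 : Integrable fun x => |W x| * |W x| := integrable_mul_of_memLp hWm.abs hWm.abs
  have i3 : Integrable fun x => |W x| * |(θ x * W x) ^ 2| := integrable_mul_of_memLp hWm.abs mQ.abs
  have i4 : ∀ j, Integrable fun x => |W x| * |v j x ^ 2| := fun j => integrable_mul_of_memLp hWm.abs (mv j).abs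
  have i5 : Integrable fun x => |Z x| * |Z x| := integrable_mul_of_memLp hwm.abs hwm.abs
  have i6 : ∀ j, Integrable fun x => |Y j x| * |G j x| := fun j => integrable_mul_of_memLp (mS j).abs (mG j).abs
  have i7 : ∀ j, Integrable fun x => |Y j x| * |W x| := fun j => integrable_mul_of_memLp (mS j).abs hWm.abs
  have cs : ∀ {f g : Plane → ℝ}, MemLp f 2 → MemLp g 2 → ∫ x, |f x| * |g x| ≤ l2 f * l2 g := by
    intro f g hf hg
    rw [← l2_abs f, ← l2_abs g]
    exact (le_abs_self _).trans (abs_integral_mul_le hf.abs hg.abs)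
  set B : Fin 2 → Plane → ℝ := fun j x => 2 * c * (|W x| * |G j x|) + c * K * (|W x| * |W x|)
    + c / 2 * (|W x| * |(θ x * W x) ^ 2| + |W x| * |v j x ^ 2|) + c / 2 * (|Z x| * |Z x|)
    + (|Y j x| * |G j x| + 2 * c * (|Y j x| * |W x|)) with hB
  have iB : ∀ j, Integrable (B j) := fun j =>
    integrable_fun_add (integrable_fun_add (integrable_fun_add (integrable_fun_add ((i1 j).const_mul _)
      (i2.const_mul _)) ((integrable_fun_add i3 (i4 j)).const_mul _)) (i5.const_mul _))
      (integrable_fun_add (i6 j) ((i7 j).const_mul _))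
  have hBj : ∀ j, ∫ x, B j x ≤ 2 * c * (A * l2 (G j)) + c * K * (A * A) + c / 2 * (A * Q + A * Λ)
      + c / 2 * (A * A) + (S * l2 (G j) + 2 * c * (S * A)) := by
    intro j
    simp only [hB]
    rw [integral_add (integrable_fun_add (integrable_fun_add (integrable_fun_add ((i1 j).const_mul _)
      (i2.const_mul _)) ((integrable_fun_add i3 (i4 j)).const_mul _)) (i5.const_mul _))
      (integrable_fun_add (i6 j) ((i7 j).const_mul _)),
      integral_add (integrable_fun_add (integrable_fun_add ((i1 j).const_mul _)
      (i2.const_mul _)) ((integrable_fun_add i3 (i4 j)).const_mul _)) (i5.const_mul _),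
      integral_add (integrable_fun_add ((i1 j).const_mul _)
      (i2.const_mul _)) ((integrable_fun_add i3 (i4 j)).const_mul _),
      integral_add ((i1 j).const_mul _) (i2.const_mul _), integral_add (i6 j) ((i7 j).const_mul _)]
    simp only [integral_const_mul]
    rw [integral_add i3 (i4 j)]
    have n1 := l2_nonneg (G j)
    have n2 := l2_nonneg (Y j)
    have n3 := l2_nonneg W
    have n4 := l2_nonneg Z
    have n5 := l2_nonneg fun x => (θ x * W x) ^ 2
    have n6 := l2_nonneg fun x => v j x ^ 2
    gcongr
    · exact (cs hWm (mG j)).trans (by gcongr)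
    · exact (cs hWm hWm).trans (by gcongr)
    · exact (cs hWm mQ).trans (by gcongr)
    · exact (cs hWm (mv j)).trans (by gcongr; exact hΛ j)
    · exact (cs hwm hwm).trans (by gcongr)
    · exact (cs (mS j) (mG j)).trans (by gcongr; exact hS j)
    · exact (cs (mS j) hWm).trans (by gcongr; exact hS j)
  have hpt : ∀ j x, -(2 * (W x * pd j θ x * (θ x * pd j W x))) + θ x * W x ^ 2 * total b v j x * pd j θ x
        - (1 / 2) * (θ x * W x ^ 2 * (x j * pd j θ x))
        + (F j x - W x * total b v j x + (1 / 2) * (x j * W x))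
          * (θ x * (θ x * pd j W x) + 2 * (θ x * W x * pd j θ x)) ≤ B j x := by
    intro j x
    have h1 : -(2 * (W x * pd j θ x * (θ x * pd j W x))) ≤ 2 * c * (|W x| * |G j x|) := by
      have : |W x * pd j θ x * G j x| ≤ c * (|W x| * |G j x|) := by
        rw [abs_mul, abs_mul]
        calc |W x| * |pd j θ x| * |G j x| ≤ |W x| * c * |G j x| := by gcongr; exact hθc j x
          _ = _ := by ring
      have := neg_abs_le (W x * pd j θ x * G j x)
      simp only [hG] at *
      linarith
    have h2 : θ x * W x ^ 2 * total b v j x * pd j θ x ≤ c * K * (|W x| * |W x|)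
        + c / 2 * (|W x| * |(θ x * W x) ^ 2| + |W x| * |v j x ^ 2|) := by
      have e1 : θ x * |b j x| ≤ K := by
        nlinarith [hb.bound j x, mul_le_mul_of_nonneg_right (hθ1 x) (abs_nonneg (b j x))]
      have e2 : |θ x * total b v j x * W x| ≤ K * |W x| + |θ x * W x| * |v j x| := by
        rw [abs_mul, abs_mul, abs_mul, abs_of_nonneg (hθ0 x)]
        have e3 : θ x * |total b v j x| ≤ θ x * (|b j x| + |v j x|) := by
          gcongr
          · exact hθ0 x
          · exact abs_add_le _ _
        nlinarith [mul_le_mul_of_nonneg_right e3 (abs_nonneg (W x)),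
          mul_le_mul_of_nonneg_right e1 (abs_nonneg (W x))]
      have e4 : |θ x * W x| * |v j x| ≤ 1 / 2 * (|(θ x * W x) ^ 2| + |v j x ^ 2|) := by
        rw [abs_pow, abs_pow]; nlinarith [sq_nonneg (|θ x * W x| - |v j x|)]
      calc θ x * W x ^ 2 * total b v j x * pd j θ x
          = (θ x * total b v j x * W x) * W x * pd j θ x := by ring
        _ ≤ |θ x * total b v j x * W x| * |W x| * |pd j θ x| := by
          rw [← abs_mul, ← abs_mul]; exact le_abs_self _
        _ ≤ (K * |W x| + 1 / 2 * (|(θ x * W x) ^ 2| + |v j x ^ 2|)) * |W x| * c := by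
          gcongr
          · exact e2.trans (by gcongr)
          · exact hθc j x
        _ = _ := by ring
    have h3 : -((1 / 2) * (θ x * W x ^ 2 * (x j * pd j θ x))) ≤ c / 2 * (|Z x| * |Z x|) := by
      have e1 : |θ x * W x ^ 2 * (x j * pd j θ x)| ≤ c * (|Z x| * |Z x|) := by
        rw [abs_mul, abs_mul, abs_mul, abs_of_nonneg (hθ0 x), abs_pow]
        simp only [hZ]
        rw [abs_mul, abs_of_nonneg (Real.sqrt_nonneg _)]
        calc θ x * |W x| ^ 2 * (|x j| * |pd j θ x|) ≤ √(wt x) * |W x| ^ 2 * (√(wt x) * c) := by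
              gcongr
              · exact hθ1 x
              · exact abs_coord_le j x
              · exact hθc j x
          _ = _ := by ring
      linarith [neg_abs_le (θ x * W x ^ 2 * (x j * pd j θ x))]
    have h4 : (F j x - W x * total b v j x + (1 / 2) * (x j * W x))
          * (θ x * (θ x * pd j W x) + 2 * (θ x * W x * pd j θ x)) ≤
        |Y j x| * |G j x| + 2 * c * (|Y j x| * |W x|) := by
      have e1 : |Y j x * (W x * pd j θ x)| ≤ c * (|Y j x| * |W x|) := by
        rw [abs_mul (Y j x), abs_mul (W x)]
        calc |Y j x| * (|W x| * |pd j θ x|) ≤ |Y j x| * (|W x| * c) := by gcongr; exact hθc j x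
          _ = _ := by ring
      calc _ = Y j x * G j x + 2 * (Y j x * (W x * pd j θ x)) := by simp only [hY, hG]; ring
        _ ≤ |Y j x * G j x| + 2 * (c * (|Y j x| * |W x|)) :=
          add_le_add (le_abs_self _)
            (mul_le_mul_of_nonneg_left ((le_abs_self _).trans e1) (by norm_num))
        _ = _ := by rw [abs_mul (Y j x)]; ring
    simp only [hB]
    linarith
  have hmain : ∫ x, ((-(2 * (W x * pd 0 θ x * (θ x * pd 0 W x))) + θ x * W x ^ 2 * total b v 0 x * pd 0 θ x
        - (1 / 2) * (θ x * W x ^ 2 * (x 0 * pd 0 θ x))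
        + (F 0 x - W x * total b v 0 x + (1 / 2) * (x 0 * W x)) * (θ x * (θ x * pd 0 W x) + 2 * (θ x * W x * pd 0 θ x)))
      + (-(2 * (W x * pd 1 θ x * (θ x * pd 1 W x))) + θ x * W x ^ 2 * total b v 1 x * pd 1 θ x
        - (1 / 2) * (θ x * W x ^ 2 * (x 1 * pd 1 θ x))
        + (F 1 x - W x * total b v 1 x + (1 / 2) * (x 1 * W x)) * (θ x * (θ x * pd 1 W x) + 2 * (θ x * W x * pd 1 θ x)))
      + (1 / 2) * (θ x * W x) ^ 2) ≤ ∫ x, (B 0 x + B 1 x + (1 / 2) * (|Z x| * |Z x|)) := by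
    refine integral_mono ?_ (integrable_fun_add (integrable_fun_add (iB 0) (iB 1)) (i5.const_mul _)) fun x => ?_
    · have z1 : ∀ x ∉ tsupport θ, ∀ i, pd i θ x = 0 := fun x hx i => pd_eq_zero_of_notMem hx i
      refine integrable_of_eq_zero_off ?_ hθ.compact fun x hx => by simp [z0 x hx, z1 x hx]
      have := (hF 0).continuous
      have := (hF 1).continuous
      have := (contDiff_total hb hv 0).continuous
      have := (contDiff_total hb hv 1).continuous
      have := (contDiff_coord (n := 1) 0).continuous
      have := (contDiff_coord (n := 1) 1).continuous
      have := (hθ.pd 0).contDiff.continuous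
      have := (hθ.pd 1).contDiff.continuous
      have := cdW 0
      have := cdW 1
      fun_prop
    · have h5 : (θ x * W x) ^ 2 ≤ |Z x| * |Z x| := by
        rw [abs_mul_abs_self]
        simp only [hZ]
        have := mul_le_mul (hθ1 x) (hθ1 x) (hθ0 x) (Real.sqrt_nonneg _)
        nlinarith [mul_le_mul_of_nonneg_right this (sq_nonneg (W x))]
      have := hpt 0 x
      have := hpt 1 x
      simp only
      linarith
  rw [integral_add (integrable_fun_add (iB 0) (iB 1)) (i5.const_mul _), integral_add (iB 0) (iB 1),
    integral_const_mul] at hmain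
  have h6 : ∫ x, |Z x| * |Z x| ≤ A * A :=
    (cs hwm hwm).trans (mul_le_mul hwA hwA (l2_nonneg _) hA)
  rw [hid]
  linarith [hBj 0, hBj 1]

end

/-! ### Mollification of the vorticity equation -/

theorem sqrt_wt_le_two_mul {x y : Plane} (h : ‖y - x‖ ≤ 1) : √(wt x) ≤ 2 * √(wt y) := by
  have h1 : ‖x‖ ≤ ‖y‖ + 1 := by
    calc ‖x‖ = ‖y - (y - x)‖ := by simp
      _ ≤ ‖y‖ + ‖y - x‖ := norm_sub_le _ _
      _ ≤ _ := by linarith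
  have h2 : wt x ≤ 2 ^ 2 * wt y := by
    simp only [wt]
    nlinarith [norm_nonneg x, norm_nonneg y, sq_nonneg (‖y‖ - 1)]
  calc √(wt x) ≤ √(2 ^ 2 * wt y) := Real.sqrt_le_sqrt h2
    _ = 2 * √(wt y) := by
      rw [Real.sqrt_mul (by norm_num), Real.sqrt_sq (by norm_num)]

/-- Mollification is bounded in the weighted space, since the weight is comparable at distance one. -/
theorem memLp_sqrt_wt_mul_mollify {f : Plane → ℝ} (hf : Continuous f)
    (hm : MemLp (fun x => √(wt x) * f x) 2) (n : ℕ) :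
    MemLp (fun x => √(wt x) * conv (rho n) f x) 2 ∧
      l2 (fun x => √(wt x) * conv (rho n) f x) ≤ 2 * l2 (fun x => √(wt x) * f x) := by
  have h1 := memLp_mollify (f := fun x => |√(wt x) * f x|) n hm.abs
  rw [l2_abs] at h1
  have hg : Continuous fun x => |√(wt x) * f x| := (continuous_sqrt_wt.mul hf).abs
  have hcont : Continuous fun x => √(wt x) * conv (rho n) f x :=
    continuous_sqrt_wt.mul (contDiff_conv (isTest_rho n) hf.locallyIntegrable).continuous
  have hpt : ∀ x, |√(wt x) * conv (rho n) f x| ≤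
      |2 * conv (rho n) (fun x => |√(wt x) * f x|) x| := by
    intro x
    refine le_trans ?_ (le_abs_self _)
    rw [abs_mul, abs_of_nonneg (Real.sqrt_nonneg _), conv_apply', conv_apply', ← integral_const_mul,
      ← Real.norm_eq_abs, ← Real.norm_of_nonneg (Real.sqrt_nonneg (wt x)), ← norm_mul,
      ← integral_const_mul]
    refine norm_integral_le_of_norm_le ((integrable_conv (isTest_rho n).contDiff.continuous
      (isTest_rho n).compact hg.locallyIntegrable x).const_mul 2) (Eventually.of_forall fun z => ?_)
    rw [norm_mul, norm_mul, Real.norm_of_nonneg (rho_nonneg n _), Real.norm_of_nonneg (Real.sqrt_nonneg _),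
      Real.norm_eq_abs, abs_mul, abs_of_nonneg (Real.sqrt_nonneg _)]
    by_cases hz : rho n (x - z) = 0
    · simp [hz]
    · have h2 := norm_le_of_rho_ne_zero hz
      rw [norm_sub_rev] at h2
      have h3 := sqrt_wt_le_two_mul h2
      have h4 : 0 ≤ rho n (x - z) * |f z| := mul_nonneg (rho_nonneg n _) (abs_nonneg _)
      nlinarith [mul_le_mul_of_nonneg_right h3 h4]
  refine ⟨memLp_of_abs_le (h1.1.const_mul 2) hcont.aestronglyMeasurable hpt, ?_⟩
  refine (l2_mono (h1.1.const_mul 2) hpt).trans ?_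
  rw [l2_const_mul, abs_of_pos (by norm_num : (0 : ℝ) < 2)]
  linarith [h1.2]

section
variable {K M : ℝ} {b v : Fin 2 → Plane → ℝ}

/-- The mollified vorticity equation holds pointwise. -/
theorem mollified_vorticity_equation (hb : IsBackground K b) (hv : IsPerturbation M v) {q : Plane → ℝ}
    (hq : IsWeakSol b v q) (n : ℕ) (x : Plane) :
    pd 0 (pd 0 (conv (rho n) (curl v))) x + pd 1 (pd 1 (conv (rho n) (curl v))) x =
      pd 0 (conv (rho n) (vortFlux b v 0)) x + pd 1 (conv (rho n) (vortFlux b v 1)) x := by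
  have hr := isTest_rho n
  have cω := continuous_curl hv.contDiff
  have lω := cω.locallyIntegrable (μ := volume)
  have cF := continuous_vortFlux hb hv
  have lF := fun j => (cF j).locallyIntegrable (μ := volume)
  have e1 : ∀ i, pd i (conv (rho n) (curl v)) = conv (pd i (rho n)) (curl v) := fun i =>
    funext fun y => pd_conv hr lω i y
  rw [e1, e1, pd_conv (hr.pd 0) lω, pd_conv (hr.pd 1) lω, pd_conv hr (lF 0), pd_conv hr (lF 1)]
  simp only [conv_apply']
  have hζ := isTest_reflect hr x
  have h := vorticity_equation hb hv hq hζ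
  have p1 : ∀ i, pd i (fun z => rho n (x - z)) = fun z => -pd i (rho n) (x - z) := fun i =>
    funext fun z => pd_reflect hr x i z
  have p2 : ∀ i z, pd i (fun z => -pd i (rho n) (x - z)) z = pd i (pd i (rho n)) (x - z) := fun i z => by
    rw [pd_neg, pd_reflect (hr.pd i), neg_neg]
  simp_rw [p1, p2] at h
  have i2 : ∀ i, Integrable fun z => pd i (pd i (rho n)) (x - z) * curl v z := fun i =>
    integrable_conv ((hr.pd i).pd i).contDiff.continuous ((hr.pd i).pd i).compact lω x
  have i1 : ∀ i, Integrable fun z => pd i (rho n) (x - z) * vortFlux b v i z := fun i =>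
    integrable_conv (hr.pd i).contDiff.continuous (hr.pd i).compact (lF i) x
  rw [← sub_eq_zero, ← integral_add (i2 0) (i2 1), ← integral_add (i1 0) (i1 1),
    ← integral_sub (integrable_fun_add (i2 0) (i2 1)) (integrable_fun_add (i1 0) (i1 1))]
  refine Eq.trans ?_ h
  congr 1; ext z
  ring

theorem le_of_sq_add_sq_le {a c D E : ℝ} (ha : 0 ≤ a) (hc : 0 ≤ c) (hD : 0 ≤ D) (hE : 0 ≤ E)
    (h : a ^ 2 + c ^ 2 ≤ D * (a + c) + E) : a + c ≤ 2 * D + 2 * E + 1 := by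
  by_contra! hlt
  have h1 : (a + c) ^ 2 ≤ 2 * (D * (a + c) + E) := by nlinarith [sq_nonneg (a - c)]
  have h2 : 1 ≤ a + c := by linarith
  nlinarith

/-- Dominated convergence for `L²` norms localized by a test function. -/
theorem tendsto_l2_of_compact {f : ℕ → Plane → ℝ} {g θ : Plane → ℝ} (hθ : IsTest θ)
    (hf : ∀ n, Continuous (f n)) (hg : Continuous g) (hlim : ∀ x, Tendsto (fun n => f n x) atTop (𝓝 (g x)))
    {k : Plane → ℝ} (hk : Continuous k) (hfk : ∀ n x, |f n x| ≤ k x) :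
    Tendsto (fun n => l2 (fun x => θ x * f n x)) atTop (𝓝 (l2 fun x => θ x * g x)) := by
  have hc := hθ.contDiff.continuous
  have m : ∀ n, MemLp (fun x => θ x * f n x) 2 := fun n =>
    memLp_of_compact (hc.mul (hf n)) hθ.compact.mul_right
  have mg : MemLp (fun x => θ x * g x) 2 := memLp_of_compact (hc.mul hg) hθ.compact.mul_right
  have h1 : Tendsto (fun n => ∫ x, (θ x * f n x) ^ 2) atTop (𝓝 (∫ x, (θ x * g x) ^ 2)) := by
    have mk : MemLp (fun x => θ x * k x) 2 := memLp_of_compact (hc.mul hk) hθ.compact.mul_right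
    refine tendsto_integral_of_dominated_convergence (fun x => (θ x * k x) ^ 2)
      (fun n => (m n).integrable_sq.aestronglyMeasurable) mk.integrable_sq
      (fun n => Eventually.of_forall fun x => ?_) (Eventually.of_forall fun x => ?_)
    · rw [Real.norm_of_nonneg (sq_nonneg _), mul_pow, mul_pow, ← sq_abs (f n x)]
      have := hfk n x
      gcongr
    · exact ((hlim x).const_mul (θ x)).pow 2
  have h2 := (Real.continuous_sqrt.tendsto _).comp h1
  have e : ∀ {h : Plane → ℝ}, MemLp h 2 → √(∫ x, h x ^ 2) = l2 h := fun hh => by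
    rw [← l2_sq hh, Real.sqrt_sq (l2_nonneg _)]
  rw [e mg] at h2
  refine h2.congr fun n => ?_
  simp only [Function.comp]
  exact e (m n)

/-- The source `curl b · V` of the vorticity equation is square integrable with the weight `w`: in
`curl b · b` the factor `b` absorbs the weight, in `curl b · v` the factor `curl b` does. -/
theorem l2_cutoff_source_le (hb : IsBackground K b) (hv : IsPerturbation M v) {θ : Plane → ℝ}
    (hθ0 : ∀ x, 0 ≤ θ x) (hθ1 : ∀ x, θ x ≤ √(wt x)) (j : Fin 2) :
    l2 (fun x => θ x * (curl b x * total b v j x)) ≤ 2 * K ^ 2 + 2 * K * l2 (v j) := by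
  have hK := hb.nonneg
  have mc : MemLp (fun x => |curl b x|) 2 := ((hb.pd_memLp 0 1).sub (hb.pd_memLp 1 0)).abs
  have lc : l2 (fun x => |curl b x|) ≤ 2 * K := by
    rw [l2_abs]
    have h := l2_add_le (hb.pd_memLp 0 1) (hb.pd_memLp 1 0).neg
    have e : (fun x => pd 0 (b 1) x + (-pd 1 (b 0)) x) = curl b := by
      ext x; simp [curl, sub_eq_add_neg]
    rw [e] at h
    have h2 : l2 (-pd 1 (b 0)) = l2 (pd 1 (b 0)) := l2_neg _
    rw [h2] at h
    linarith [hb.pd_l2 0 1, hb.pd_l2 1 0]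
  have mv := (hv.memLp j).abs
  have m1 : MemLp (fun x => K * |curl b x|) 2 := mc.const_mul K
  have m2 : MemLp (fun x => 2 * K * |v j x|) 2 := mv.const_mul (2 * K)
  have h1 : l2 (fun x => θ x * (curl b x * total b v j x)) ≤
      l2 (fun x => K * |curl b x| + 2 * K * |v j x|) := by
    refine l2_mono (m1.add m2) fun x => ?_
    refine le_trans ?_ (le_abs_self _)
    have e1 : θ x * |b j x| ≤ K := by
      nlinarith [hb.bound j x, mul_le_mul_of_nonneg_right (hθ1 x) (abs_nonneg (b j x))]
    have e2 : θ x * |curl b x| ≤ 2 * K := by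
      have h3 : |curl b x| ≤ |pd 0 (b 1) x| + |pd 1 (b 0) x| := abs_sub _ _
      have h4 := hb.pd_bound 0 1 x
      have h5 := hb.pd_bound 1 0 x
      have h6 := mul_le_mul (hθ1 x) h3 (abs_nonneg _) (Real.sqrt_nonneg _)
      linarith
    have h7 : |total b v j x| ≤ |b j x| + |v j x| := abs_add_le _ _
    rw [abs_mul, abs_mul, abs_of_nonneg (hθ0 x)]
    have h8 : θ x * (|curl b x| * |total b v j x|) ≤ θ x * (|curl b x| * (|b j x| + |v j x|)) :=
      mul_le_mul_of_nonneg_left (mul_le_mul_of_nonneg_left h7 (abs_nonneg _)) (hθ0 x)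
    nlinarith [mul_le_mul_of_nonneg_right e1 (abs_nonneg (curl b x)),
      mul_le_mul_of_nonneg_right e2 (abs_nonneg (v j x))]
  refine h1.trans ((l2_add_le m1 m2).trans ?_)
  rw [l2_const_mul, l2_const_mul, l2_abs (v j), abs_of_nonneg hK, abs_of_nonneg (by positivity)]
  nlinarith [mul_le_mul_of_nonneg_left lc hK]

end

section
variable {K M : ℝ} {b v : Fin 2 → Plane → ℝ}

theorem abs_curl_le (hv : IsPerturbation M v) (x : Plane) : |curl v x| * wt x ≤ 2 * M := by
  have h : |curl v x| ≤ |pd 0 (v 1) x| + |pd 1 (v 0) x| := abs_sub _ _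
  nlinarith [mul_le_mul_of_nonneg_right h (wt_pos x).le, hv.pd_bound 0 1 x, hv.pd_bound 1 0 x]

/-- A qualitative bound, used only to pass to the limit in the mollification. -/
theorem exists_vortFlux_bound (hb : IsBackground K b) (hv : IsPerturbation M v) :
    ∃ B, ∀ j x, |vortFlux b v j x| ≤ B := by
  refine ⟨(2 * M + 2 * K) * (K + M) + M, fun j x => ?_⟩
  have hK := hb.nonneg
  have hM := hv.nonneg
  have h1 : |curl v x| ≤ 2 * M := by
    nlinarith [abs_curl_le hv x, one_le_wt x, abs_nonneg (curl v x)]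
  have h2 : |curl b x| ≤ 2 * K := by
    have h : |curl b x| ≤ |pd 0 (b 1) x| + |pd 1 (b 0) x| := abs_sub _ _
    linarith [hb.abs_pd_le 0 1 x, hb.abs_pd_le 1 0 x]
  have h3 := le_of_mul_sqrt_wt_le (total_bound hb hv j) x
  have h4 : |x j * curl v x| ≤ 2 * M := by
    rw [abs_mul]
    calc |x j| * |curl v x| ≤ wt x * |curl v x| := by
          gcongr; exact (abs_coord_le j x).trans (sqrt_wt_le_wt x)
      _ ≤ 2 * M := by rw [mul_comm]; exact abs_curl_le hv x
  calc |vortFlux b v j x| ≤ |(curl v x + curl b x) * total b v j x| + |(1 / 2) * (x j * curl v x)| :=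
        abs_sub _ _
    _ ≤ (2 * M + 2 * K) * (K + M) + M := by
      rw [abs_mul, abs_mul (1 / 2)]
      gcongr
      · exact (abs_add_le _ _).trans (add_le_add h1 h2)
      · rw [abs_of_pos (by norm_num : (0 : ℝ) < 1 / 2)]; linarith

theorem memLp_sqrt_wt_mul_curl {C : ℝ}
    (h : ∀ j k, MemLp (fun x => √(wt x) * pd j (v k) x) 2 ∧ l2 (fun x => √(wt x) * pd j (v k) x) ≤ C) :
    MemLp (fun x => √(wt x) * curl v x) 2 ∧ l2 (fun x => √(wt x) * curl v x) ≤ 2 * C := by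
  have e : (fun x => √(wt x) * curl v x) =
      fun x => √(wt x) * pd 0 (v 1) x + -(√(wt x) * pd 1 (v 0) x) := by
    ext x; simp only [curl]; ring
  have m : MemLp (fun x => -(√(wt x) * pd 1 (v 0) x)) 2 := (h 1 0).1.neg
  rw [e]
  refine ⟨(h 0 1).1.add m, (l2_add_le (h 0 1).1 m).trans ?_⟩
  rw [l2_neg]
  linarith [(h 0 1).2, (h 1 0).2]

theorem IsCutoff.abs_pd_mul_sqrt_wt_le {c : ℝ} {χ : ℕ → Plane → ℝ} (h : IsCutoff c χ) (n : ℕ)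
    (j : Fin 2) (x : Plane) : |pd j (fun x => χ n x * √(wt x)) x| ≤ c + 1 := by
  rw [pd_mul ((h.contDiff n).differentiable (by simp)) ((contDiff_sqrt_wt (n := 1)).differentiable one_ne_zero),
    pd_sqrt_wt]
  refine (abs_add_le _ _).trans (add_le_add ?_ ?_)
  · rw [abs_mul, abs_of_nonneg (Real.sqrt_nonneg _)]; exact h.pd_le n j x
  · rw [abs_mul, abs_of_nonneg (h.nonneg n x), abs_div, abs_of_nonneg (Real.sqrt_nonneg _)]
    exact mul_le_one₀ (h.le_one n x) (by positivity)
      ((div_le_one (sqrt_wt_pos x)).2 (abs_coord_le j x))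

/-- The closed form of the localized energy estimate for the mollified vorticity. -/
theorem localized_gradient_le (hb : IsBackground K b) (hv : IsPerturbation M v)
    {W θ : Plane → ℝ} {F : Fin 2 → Plane → ℝ} (hW : ContDiff ℝ ∞ W) (hθ : IsTest θ)
    (hF : ∀ j, ContDiff ℝ 1 (F j))
    (heq : ∀ x, pd 0 (pd 0 W) x + pd 1 (pd 1 W) x = pd 0 (F 0) x + pd 1 (F 1) x)
    (hθ0 : ∀ x, 0 ≤ θ x) (hθ1 : ∀ x, θ x ≤ √(wt x)) {c A S Λ L : ℝ} (hc : 0 ≤ c)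
    (hθc : ∀ j x, |pd j θ x| ≤ c) (hWm : MemLp W 2) (hWA : l2 W ≤ A)
    (hwm : MemLp (fun x => √(wt x) * W x) 2) (hwA : l2 (fun x => √(wt x) * W x) ≤ A)
    (hS : ∀ j, l2 (fun x => θ x * (F j x - W x * total b v j x + (1 / 2) * (x j * W x))) ≤ S)
    (hΛ : ∀ j, l2 (fun x => v j x ^ 2) ≤ Λ) (hL : 0 ≤ L)
    (lady : ∀ f : Plane → ℝ, ContDiff ℝ 1 f → MemLp f 2 → (∀ i, MemLp (pd i f) 2) →
      MemLp (fun x => f x ^ 2) 2 ∧ l2 (fun x => f x ^ 2) ≤ L * l2 f * (l2 (pd 0 f) + l2 (pd 1 f))) :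
    l2 (fun x => θ x * pd 0 W x) + l2 (fun x => θ x * pd 1 W x) ≤
      2 * (2 * c * A + S + c * A ^ 2 * L)
      + 2 * (2 * (c * K * A ^ 2 + c / 2 * A * (2 * c * L * A ^ 2 + Λ) + c / 2 * A ^ 2 + 2 * c * S * A)
        + A ^ 2 / 2) + 1 := by
  have hA : 0 ≤ A := (l2_nonneg _).trans hWA
  have hS0 : 0 ≤ S := (l2_nonneg _).trans (hS 0)
  have hΛ0 : 0 ≤ Λ := (l2_nonneg _).trans (hΛ 0)
  have hK := hb.nonneg
  have c1 : ContDiff ℝ 1 W := contDiff_infty.1 hW 1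
  have cf : ContDiff ℝ 1 fun x => θ x * W x := hθ.c1.mul c1
  have hc' : HasCompactSupport fun x => θ x * W x := hθ.compact.mul_right
  have mf : MemLp (fun x => θ x * W x) 2 := memLp_of_compact cf.continuous hc'
  have mdf : ∀ i, MemLp (pd i fun x => θ x * W x) 2 := fun i =>
    memLp_of_compact (continuous_pd cf i) (hc'.pd i)
  have h1 := (lady _ cf mf mdf).2
  have h2 : l2 (fun x => θ x * W x) ≤ A := by
    refine (l2_mono hwm fun x => ?_).trans hwA
    rw [abs_mul, abs_mul, abs_of_nonneg (hθ0 x), abs_of_nonneg (Real.sqrt_nonneg _)]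
    gcongr; exact hθ1 x
  have h3 : ∀ i, l2 (pd i fun x => θ x * W x) ≤ c * A + l2 (fun x => θ x * pd i W x) := by
    intro i
    have e : (pd i fun x => θ x * W x) = fun x => pd i θ x * W x + θ x * pd i W x :=
      funext fun x => pd_mul hθ.differentiable (c1.differentiable one_ne_zero) i x
    have m1 : MemLp (fun x => pd i θ x * W x) 2 :=
      memLp_bdd_mul (hθ.pd i).contDiff.continuous.aestronglyMeasurable hWm (hθc i)
    have m2 : MemLp (fun x => θ x * pd i W x) 2 :=
      memLp_of_compact (hθ.contDiff.continuous.mul (continuous_pd c1 i)) hθ.compact.mul_right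
    rw [e]
    refine (l2_add_le m1 m2).trans (add_le_add ?_ le_rfl)
    exact (l2_bdd_mul_le hWm (hθc i)).trans (by gcongr)
  set G0 := l2 (fun x => θ x * pd 0 W x)
  set G1 := l2 (fun x => θ x * pd 1 W x)
  have g0 : 0 ≤ G0 := l2_nonneg _
  have g1 : 0 ≤ G1 := l2_nonneg _
  have hQ : l2 (fun x => (θ x * W x) ^ 2) ≤ L * A * (G0 + G1 + 2 * c * A) := by
    refine h1.trans ?_
    have h0 := l2_nonneg (pd 0 fun x => θ x * W x)
    have h00 := l2_nonneg (pd 1 fun x => θ x * W x)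
    calc _ ≤ L * A * (c * A + G0 + (c * A + G1)) := by
          gcongr
          exacts [h3 0, h3 1]
      _ = _ := by ring
  have main := localized_energy_le hb hv hW hθ hF heq hθ0 hθ1 hc hθc hWm hWA hwm hwA hS hΛ hQ
  refine le_of_sq_add_sq_le g0 g1 (by positivity) (by positivity) (main.trans (le_of_eq ?_))
  ring

/-- The vorticity has a weak gradient that is square integrable with the weight `1 + |x|²`. -/
theorem exists_vorticity_gradient_bound (K : ℝ) (hK : 0 ≤ K) : ∃ C : ℝ, 0 ≤ C ∧
    ∀ (M : ℝ) (b v : Fin 2 → Plane → ℝ) (q : Plane → ℝ), IsBackground K b → IsPerturbation M v →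
      IsWeakSol b v q → ∀ ψ, IsTest ψ → ∀ j,
        |∫ x, curl v x * pd j ψ x| ≤ C * l2 (fun x => (√(wt x))⁻¹ * ψ x) := by
  obtain ⟨c, hc, χ, hχ⟩ := exists_cutoff
  obtain ⟨N, hN, hw⟩ := exists_weighted_bound K hK
  obtain ⟨a, ha, hsq⟩ := exists_l2_sq_le K hK
  obtain ⟨L, hL, lady⟩ := exists_ladyzhenskaya
  -- `S` exceeds the limit of the mollified sources by one; `A` has a factor `2` from the curl and
  -- a factor `2` from mollification
  set S : ℝ := 2 * K ^ 2 + 2 * K * N + 1 with hS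
  set A : ℝ := 4 * N with hA
  refine ⟨2 * (2 * (c + 1) * A + S + (c + 1) * A ^ 2 * L)
      + 2 * (2 * ((c + 1) * K * A ^ 2 + (c + 1) / 2 * A * (2 * (c + 1) * L * A ^ 2 + a * N)
        + (c + 1) / 2 * A ^ 2 + 2 * (c + 1) * S * A) + A ^ 2 / 2) + 1, by positivity,
    fun M b v q hb hv hq ψ hψ j => ?_⟩
  obtain ⟨hw0, hw1⟩ := hw M b v q hb hv hq
  obtain ⟨p, hp2, hp, -⟩ := exists_pressure hb hv hq
  have hM := hv.nonneg
  have hvN : ∀ k, l2 (v k) ≤ N := fun k => by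
    refine (l2_mono (hw0 k).1 fun x => ?_).trans (hw0 k).2
    rw [abs_mul, abs_of_nonneg (Real.sqrt_nonneg _)]
    exact le_mul_of_one_le_left (abs_nonneg _) (one_le_sqrt_wt x)
  have hΛ : ∀ k, l2 (fun x => v k x ^ 2) ≤ a * N := fun k =>
    (hsq M b v p hb hv hp hp2 k).trans (mul_le_mul_of_nonneg_left (hvN k) ha)
  have cω := continuous_curl hv.contDiff
  obtain ⟨mω, lω⟩ := memLp_sqrt_wt_mul_curl hw1
  have mω0 : MemLp (curl v) 2 := (hv.memLp_pd 0 1).sub (hv.memLp_pd 1 0)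
  have lω0 : l2 (curl v) ≤ 2 * N := by
    refine (l2_mono mω fun x => ?_).trans lω
    rw [abs_mul, abs_of_nonneg (Real.sqrt_nonneg _)]
    exact le_mul_of_one_le_left (abs_nonneg _) (one_le_sqrt_wt x)
  have cF := continuous_vortFlux hb hv
  obtain ⟨B, hB⟩ := exists_vortFlux_bound hb hv
  -- a cut-off that is one on the support of `ψ`
  obtain ⟨m, hm⟩ : ∃ m : ℕ, ∀ x, ψ x ≠ 0 → ‖x‖ < m + 1 := by
    obtain ⟨R, hR⟩ := hψ.compact.isCompact.isBounded.exists_norm_le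
    obtain ⟨m, hm⟩ := exists_nat_ge R
    exact ⟨m, fun x hx => by linarith [hR x (subset_tsupport ψ hx)]⟩
  set θ : Plane → ℝ := fun x => χ m x * √(wt x) with hθdef
  have hθ : IsTest θ := ⟨(hχ.contDiff m).mul contDiff_sqrt_wt, (hχ.compact m).mul_right⟩
  have hθ0 : ∀ x, 0 ≤ θ x := fun x => mul_nonneg (hχ.nonneg m x) (Real.sqrt_nonneg _)
  have hθ1 : ∀ x, θ x ≤ √(wt x) := fun x =>
    mul_le_of_le_one_left (Real.sqrt_nonneg _) (hχ.le_one m x)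
  have hθc : ∀ j x, |pd j θ x| ≤ c + 1 := fun j x => hχ.abs_pd_mul_sqrt_wt_le m j x
  set W : ℕ → Plane → ℝ := fun n => conv (rho n) (curl v) with hW
  set F : ℕ → Fin 2 → Plane → ℝ := fun n k => conv (rho n) (vortFlux b v k) with hF
  have cW : ∀ n, ContDiff ℝ ∞ (W n) := fun n => contDiff_conv (isTest_rho n) cω.locallyIntegrable
  have cFn : ∀ n k, ContDiff ℝ ∞ (F n k) := fun n k =>
    contDiff_conv (isTest_rho n) (cF k).locallyIntegrable
  have hcurlM : ∀ x, |curl v x| ≤ 2 * M := fun x => by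
    nlinarith [abs_curl_le hv x, one_le_wt x, abs_nonneg (curl v x)]
  have hlimS : ∀ k, Tendsto (fun n => l2 (fun x => θ x * (F n k x - W n x * total b v k x
      + (1 / 2) * (x k * W n x)))) atTop (𝓝 (l2 fun x => θ x * (curl b x * total b v k x))) := by
    intro k
    have cV := (contDiff_total hb hv k).continuous
    have cx := (contDiff_coord (n := 1) k).continuous
    have cb := continuous_curl hb.contDiff
    refine tendsto_l2_of_compact hθ (fun n => ?_) (cb.mul cV) (fun x => ?_)
      (k := fun x => B + 2 * M * |total b v k x| + (1 / 2) * (|x k| * (2 * M))) (by fun_prop) fun n x => ?_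
    · have := (cW n).continuous
      have := (cFn n k).continuous
      fun_prop
    · have t1 := tendsto_mollify (cF k) x
      have t2 := tendsto_mollify cω x
      have t3 := (t1.sub (t2.mul_const (total b v k x))).add ((t2.const_mul (x k)).const_mul (1 / 2))
      convert t3 using 2
      simp only [vortFlux]; ring
    · have h1 := abs_mollify_le (hB k) n x
      have h2 := abs_mollify_le hcurlM n x
      calc _ ≤ |F n k x - W n x * total b v k x| + |(1 / 2) * (x k * W n x)| := abs_add_le _ _
        _ ≤ |F n k x| + |W n x * total b v k x| + |(1 / 2) * (x k * W n x)| := by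
          gcongr; exact abs_sub _ _
        _ ≤ _ := by
          rw [abs_mul, abs_mul, abs_mul, abs_of_pos (by norm_num : (0 : ℝ) < 1 / 2)]
          gcongr
  have hSev : ∀ᶠ n in atTop, ∀ k, l2 (fun x => θ x * (F n k x - W n x * total b v k x
      + (1 / 2) * (x k * W n x))) ≤ S := by
    rw [eventually_all]
    intro k
    refine (hlimS k).eventually_le_const ?_
    have := l2_cutoff_source_le hb hv hθ0 hθ1 k
    have h2 := mul_le_mul_of_nonneg_left (hvN k) (by positivity : 0 ≤ 2 * K)
    rw [hS]; linarith
  have lim := (tendsto_integral_mollify_mul cω (hψ.pd j).contDiff.continuous (hψ.pd j).compact).abs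
  refine le_of_tendsto lim ?_
  filter_upwards [hSev] with n hn
  have hWm := memLp_mollify n mω0
  have hwm := memLp_sqrt_wt_mul_mollify cω mω n
  have hWA : l2 (W n) ≤ A := hWm.2.trans (by rw [hA]; linarith)
  have hwA : l2 (fun x => √(wt x) * W n x) ≤ A := hwm.2.trans (by rw [hA]; linarith)
  have hG := localized_gradient_le hb hv (cW n) hθ (fun k => contDiff_infty.1 (cFn n k) 1)
    (mollified_vorticity_equation hb hv hq n) hθ0 hθ1 (by linarith : 0 ≤ c + 1) hθc hWm.1
    hWA hwm.1 hwA hn hΛ hL lady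
  have c1 : ContDiff ℝ 1 (W n) := contDiff_infty.1 (cW n) 1
  have e : ∫ x, W n x * pd j ψ x = -∫ x, (θ x * pd j (W n) x) * ((√(wt x))⁻¹ * ψ x) := by
    rw [integral_mul_pd j c1 hψ.c1 hψ.compact]
    congr 2; ext x
    by_cases hx : ψ x = 0
    · simp [hx]
    · have := hχ.eq_one m x (hm x hx)
      have h0 := (sqrt_wt_pos x).ne'
      simp only [hθdef, this]
      field_simp
  rw [e, abs_neg]
  have mG : MemLp (fun x => θ x * pd j (W n) x) 2 :=
    memLp_of_compact (hθ.contDiff.continuous.mul (continuous_pd c1 j)) hθ.compact.mul_right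
  have mψ : MemLp (fun x => (√(wt x))⁻¹ * ψ x) 2 :=
    memLp_of_compact ((continuous_sqrt_wt.inv₀ fun x => (sqrt_wt_pos x).ne').mul hψ.contDiff.continuous)
      hψ.compact.mul_left
  refine (abs_integral_mul_le mG mψ).trans (mul_le_mul_of_nonneg_right ?_ (l2_nonneg _))
  refine le_trans ?_ hG
  have g0 := l2_nonneg fun x => θ x * pd 0 (W n) x
  have g1 := l2_nonneg fun x => θ x * pd 1 (W n) x
  fin_cases j <;> simp only [Fin.zero_eta, Fin.mk_one] <;> linarith

end

/-! ### Bounds in `H²` -/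

/-- A `C¹` function whose derivatives up to second order (the second ones in the weak sense) are
bounded by `C` in `L²`. -/
structure IsH2Bounded (C : ℝ) (f : Plane → ℝ) : Prop where
  contDiff : ContDiff ℝ 1 f
  memLp : MemLp f 2
  l2_le : l2 f ≤ C
  memLp_pd : ∀ i, MemLp (pd i f) 2
  l2_pd_le : ∀ i, l2 (pd i f) ≤ C
  weak_hessian : ∀ i j, ∃ h : Plane → ℝ, MemLp h 2 ∧ l2 h ≤ C ∧
    ∀ ψ, IsTest ψ → ∫ x, pd i f x * pd j ψ x = -∫ x, h x * ψ x

section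
variable {K M : ℝ} {b v : Fin 2 → Plane → ℝ}

/-- `-Δ v = (∂₁ ω, -∂₀ ω)` for divergence-free fields, in weak form. -/
theorem integral_grad_eq_curl (hv : IsPerturbation M v) {ψ : Plane → ℝ} (hψ : IsTest ψ) (k : Fin 2) :
    ∃ j, |∫ x, (pd 0 (v k) x * pd 0 ψ x + pd 1 (v k) x * pd 1 ψ x)| = |∫ x, curl v x * pd j ψ x| := by
  have hA := hψ.pd 0
  have hB := hψ.pd 1
  have v0 := hv.contDiff 0
  have v1 := hv.contDiff 1
  have dv0 := v0.differentiable one_ne_zero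
  have dv1 := v1.differentiable one_ne_zero
  have dA := hA.differentiable
  have dB := hB.differentiable
  have cA := hA.c1
  have cB := hB.c1
  have k1 := cA.continuous
  have k2 := cB.continuous
  have l1 := continuous_pd v0 0
  have l2 := continuous_pd v0 1
  have l3 := continuous_pd v1 0
  have l4 := continuous_pd v1 1
  have cω := continuous_curl hv.contDiff
  have zA : ∀ x ∉ tsupport ψ, ∀ i, pd i ψ x = 0 := fun x hx i => pd_eq_zero_of_notMem hx i
  have hcomm : ∀ x, pd 0 (pd 1 ψ) x = pd 1 (pd 0 ψ) x := fun x =>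
    pd_comm (contDiff_infty.1 hψ.contDiff 2) 0 1 x
  have hc : ∀ i j, HasCompactSupport fun x => v i x * pd j ψ x := fun i j =>
    HasCompactSupport.intro hψ.compact fun x hx => by simp [zA x hx]
  match k with
  | 0 =>
    refine ⟨1, ?_⟩
    rw [← abs_neg (∫ x, curl v x * pd 1 ψ x), ← integral_neg]
    congr 1
    refine integral_eq_of_sub_eq_div (H₀ := fun x => v 1 x * pd 1 ψ x) (H₁ := fun x => -(v 1 x * pd 0 ψ x))
      ?_ ?_ (by fun_prop) (by fun_prop) (hc 1 1) ((hc 1 0).neg) fun x => ?_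
    · exact integrable_of_eq_zero_off (by fun_prop) hψ.compact fun x hx => by simp [zA x hx]
    · exact integrable_of_eq_zero_off (by fun_prop) hψ.compact fun x hx => by simp [zA x hx]
    · have hd := hv.div x
      have p0 : pd 0 (v 0) x = -pd 1 (v 1) x := by linarith
      simp (disch := fun_prop) only [pd_neg, pd_mul, hcomm, curl]
      rw [p0]; ring
  | 1 =>
    refine ⟨0, ?_⟩
    congr 1
    refine integral_eq_of_sub_eq_div (H₀ := fun x => -(v 0 x * pd 1 ψ x)) (H₁ := fun x => v 0 x * pd 0 ψ x)
      ?_ ?_ (by fun_prop) (by fun_prop) ((hc 0 1).neg) (hc 0 0) fun x => ?_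
    · exact integrable_of_eq_zero_off (by fun_prop) hψ.compact fun x hx => by simp [zA x hx]
    · exact integrable_of_eq_zero_off (by fun_prop) hψ.compact fun x hx => by simp [zA x hx]
    · have hd := hv.div x
      have p0 : pd 0 (v 0) x = -pd 1 (v 1) x := by linarith
      simp (disch := fun_prop) only [pd_neg, pd_mul, hcomm, curl]
      rw [p0]; ring

theorem pd_unit_radial (i : Fin 2) (x : Plane) :
    pd i (fun x => x i * wt x ^ (-(1 / 2) : ℝ)) x =
      wt x ^ (-(1 / 2) : ℝ) - x i * x i * wt x ^ (-(1 / 2) - 1 : ℝ) := by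
  rw [pd_mul (differentiable_coord i) ((contDiff_wt_rpow _ (n := 1)).differentiable one_ne_zero),
    pd_coord, pd_wt_rpow]
  simp
  ring

theorem abs_pd_unit_radial_le (i : Fin 2) (x : Plane) :
    |pd i (fun x => x i * wt x ^ (-(1 / 2) : ℝ)) x| ≤ 2 := by
  rw [pd_unit_radial]
  have h1 : wt x ^ (-(1 / 2) : ℝ) ≤ 1 :=
    Real.rpow_le_one_of_one_le_of_nonpos (one_le_wt x) (by norm_num)
  have h0 : 0 ≤ wt x ^ (-(1 / 2) : ℝ) := Real.rpow_nonneg (wt_pos x).le _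
  have h2 : wt x ^ (-(1 / 2) - 1 : ℝ) * wt x = wt x ^ (-(1 / 2) : ℝ) := by
    rw [Real.rpow_sub (wt_pos x), Real.rpow_one, div_mul_cancel₀ _ (wt_pos x).ne']
  have h3 : 0 ≤ wt x ^ (-(1 / 2) - 1 : ℝ) := Real.rpow_nonneg (wt_pos x).le _
  have h4 : x i * x i ≤ wt x := by
    have := abs_coord_le i x
    have h5 := Real.sq_sqrt (wt_pos x).le
    rw [← abs_mul_abs_self]
    nlinarith [abs_nonneg (x i)]
  have h6 : x i * x i * wt x ^ (-(1 / 2) - 1 : ℝ) ≤ 1 := by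
    nlinarith [mul_le_mul_of_nonneg_right h4 h3]
  have h7 : 0 ≤ x i * x i * wt x ^ (-(1 / 2) - 1 : ℝ) := mul_nonneg (mul_self_nonneg _) h3
  rw [abs_le]
  constructor <;> linarith

theorem wt_rpow_neg_half (x : Plane) : wt x ^ (-(1 / 2) : ℝ) = (√(wt x))⁻¹ := by
  rw [Real.rpow_neg (wt_pos x).le, Real.sqrt_eq_rpow]

theorem abs_unit_radial_le (i : Fin 2) (x : Plane) : |x i * wt x ^ (-(1 / 2) : ℝ)| ≤ 1 := by
  rw [wt_rpow_neg_half, ← div_eq_mul_inv, abs_div, abs_of_nonneg (Real.sqrt_nonneg _)]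
  exact (div_le_one (sqrt_wt_pos x)).2 (abs_coord_le i x)

/-- Commutation of the weight `√(1+|x|²)` with the Dirichlet form. -/
theorem integral_grad_sqrt_wt_mul {f ψ : Plane → ℝ} (hf : ContDiff ℝ 1 f) (hψ : IsTest ψ) :
    ∫ x, (pd 0 (fun x => √(wt x) * f x) x * pd 0 ψ x + pd 1 (fun x => √(wt x) * f x) x * pd 1 ψ x) =
      (∫ x, (pd 0 f x * pd 0 (fun x => √(wt x) * ψ x) x + pd 1 f x * pd 1 (fun x => √(wt x) * ψ x) x))
      - (((2 * ∫ x, (x 0 * wt x ^ (-(1 / 2) : ℝ) * pd 0 f x) * ψ x)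
        + ∫ x, (pd 0 (fun x => x 0 * wt x ^ (-(1 / 2) : ℝ)) x * f x) * ψ x)
        + ((2 * ∫ x, (x 1 * wt x ^ (-(1 / 2) : ℝ) * pd 1 f x) * ψ x)
        + ∫ x, (pd 1 (fun x => x 1 * wt x ^ (-(1 / 2) : ℝ)) x * f x) * ψ x)) := by
  have cw := contDiff_sqrt_wt (n := 1)
  have dw := cw.differentiable one_ne_zero
  have df := hf.differentiable one_ne_zero
  have cr : ∀ i, ContDiff ℝ 1 fun x : Plane => x i * wt x ^ (-(1 / 2) : ℝ) := fun i =>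
    (contDiff_coord i).mul (contDiff_wt_rpow _)
  have z0 : ∀ x ∉ tsupport ψ, ψ x = 0 := fun x hx => image_eq_zero_of_notMem_tsupport hx
  have z1 : ∀ x ∉ tsupport ψ, ∀ i, pd i ψ x = 0 := fun x hx i => pd_eq_zero_of_notMem hx i
  have e1 : ∀ i x, pd i (fun x => √(wt x) * f x) x =
      x i * wt x ^ (-(1 / 2) : ℝ) * f x + √(wt x) * pd i f x := fun i x => by
    rw [pd_mul dw df, pd_sqrt_wt, wt_rpow_neg_half, div_eq_mul_inv]
  have e2 : ∀ i x, pd i (fun x => √(wt x) * ψ x) x =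
      x i * wt x ^ (-(1 / 2) : ℝ) * ψ x + √(wt x) * pd i ψ x := fun i x => by
    rw [pd_mul dw hψ.differentiable, pd_sqrt_wt, wt_rpow_neg_half, div_eq_mul_inv]
  have hcr : ∀ i, ContDiff ℝ 1 fun x : Plane => x i * wt x ^ (-(1 / 2) : ℝ) * f x := fun i => (cr i).mul hf
  have ibp : ∀ i, ∫ x, (x i * wt x ^ (-(1 / 2) : ℝ) * f x) * pd i ψ x =
      -∫ x, (pd i (fun x => x i * wt x ^ (-(1 / 2) : ℝ)) x * f x
        + x i * wt x ^ (-(1 / 2) : ℝ) * pd i f x) * ψ x := fun i => by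
    rw [integral_mul_pd i (hcr i) hψ.c1 hψ.compact]
    congr 2; ext x
    rw [pd_mul ((cr i).differentiable one_ne_zero) df]
  have k1 := hf.continuous
  have k2 := hψ.contDiff.continuous
  have k3 := fun i => continuous_pd hf i
  have k4 := fun i => (hψ.pd i).contDiff.continuous
  have k5 := fun i => (cr i).continuous
  have k6 := fun i => continuous_pd (cr i) i
  have k7 := continuous_sqrt_wt
  have j1 : ∀ i, Integrable fun x => (x i * wt x ^ (-(1 / 2) : ℝ) * f x) * pd i ψ x := fun i =>
    integrable_of_eq_zero_off (((k5 i).mul k1).mul (k4 i)) hψ.compact fun x hx => by simp [z1 x hx]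
  have j2 : ∀ i, Integrable fun x => (x i * wt x ^ (-(1 / 2) : ℝ) * pd i f x) * ψ x := fun i =>
    integrable_of_eq_zero_off (((k5 i).mul (k3 i)).mul k2) hψ.compact fun x hx => by simp [z0 x hx]
  have j3 : ∀ i, Integrable fun x => (pd i (fun x => x i * wt x ^ (-(1 / 2) : ℝ)) x * f x) * ψ x := fun i =>
    integrable_of_eq_zero_off (((k6 i).mul k1).mul k2) hψ.compact fun x hx => by simp [z0 x hx]
  have j4 : ∀ i, Integrable fun x => pd i f x * (√(wt x) * pd i ψ x) := fun i =>
    integrable_of_eq_zero_off ((k3 i).mul (k7.mul (k4 i))) hψ.compact fun x hx => by simp [z1 x hx]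
  have a1 : ∀ i, ∫ x, pd i (fun x => √(wt x) * f x) x * pd i ψ x =
      (∫ x, (x i * wt x ^ (-(1 / 2) : ℝ) * f x) * pd i ψ x) + ∫ x, pd i f x * (√(wt x) * pd i ψ x) := fun i => by
    rw [← integral_add (j1 i) (j4 i)]
    congr 1; ext x; rw [e1]; ring
  have a2 : ∀ i, ∫ x, pd i f x * pd i (fun x => √(wt x) * ψ x) x =
      (∫ x, (x i * wt x ^ (-(1 / 2) : ℝ) * pd i f x) * ψ x) + ∫ x, pd i f x * (√(wt x) * pd i ψ x) := fun i => by
    rw [← integral_add (j2 i) (j4 i)]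
    congr 1; ext x; rw [e2]; ring
  have a3 : ∀ i, ∫ x, (pd i (fun x => x i * wt x ^ (-(1 / 2) : ℝ)) x * f x
        + x i * wt x ^ (-(1 / 2) : ℝ) * pd i f x) * ψ x =
      (∫ x, (pd i (fun x => x i * wt x ^ (-(1 / 2) : ℝ)) x * f x) * ψ x)
        + ∫ x, (x i * wt x ^ (-(1 / 2) : ℝ) * pd i f x) * ψ x := fun i => by
    rw [← integral_add (j3 i) (j2 i)]
    congr 1; ext x; ring
  have i1 : ∀ i, Integrable fun x => pd i (fun x => √(wt x) * f x) x * pd i ψ x := fun i =>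
    (integrable_fun_add (j1 i) (j4 i)).congr (Eventually.of_forall fun x => by
      simp only; rw [e1]; ring)
  have i2 : ∀ i, Integrable fun x => pd i f x * pd i (fun x => √(wt x) * ψ x) x := fun i =>
    (integrable_fun_add (j2 i) (j4 i)).congr (Eventually.of_forall fun x => by
      simp only; rw [e2]; ring)
  rw [integral_add (i1 0) (i1 1), integral_add (i2 0) (i2 1), a1, a1, a2, a2, ibp, ibp, a3, a3]
  ring

/-- The `H²` bounds for `v` and `√(1+|x|²) v` in terms of the bound `K` for the background only. -/
theorem exists_h2_bound (K : ℝ) (hK : 0 ≤ K) : ∃ C : ℝ, 0 ≤ C ∧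
    ∀ (M : ℝ) (b v : Fin 2 → Plane → ℝ) (q : Plane → ℝ), IsBackground K b → IsPerturbation M v →
      IsWeakSol b v q → ∀ k, IsH2Bounded C (v k) ∧ IsH2Bounded C (fun x => √(wt x) * v k x) := by
  obtain ⟨N, hN, hw⟩ := exists_weighted_bound K hK
  obtain ⟨G, hG, hg⟩ := exists_vorticity_gradient_bound K hK
  refine ⟨G + 8 * N, by positivity, fun M b v q hb hv hq k => ?_⟩
  obtain ⟨hw0, hw1⟩ := hw M b v q hb hv hq
  have hg' := hg M b v q hb hv hq
  have unwt : ∀ {f : Plane → ℝ}, MemLp (fun x => √(wt x) * f x) 2 ∧ l2 (fun x => √(wt x) * f x) ≤ N →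
      l2 f ≤ N := fun {f} h => by
    refine (l2_mono h.1 fun x => ?_).trans h.2
    rw [abs_mul, abs_of_nonneg (Real.sqrt_nonneg _)]
    exact le_mul_of_one_le_left (abs_nonneg _) (one_le_sqrt_wt x)
  have hvN := unwt (hw0 k)
  have hdN := fun i => unwt (hw1 i k)
  have mv := hv.memLp k
  have md := fun i => hv.memLp_pd i k
  have cv := hv.contDiff k
  have grad : ∀ ψ, IsTest ψ → |∫ x, (pd 0 (v k) x * pd 0 ψ x + pd 1 (v k) x * pd 1 ψ x)| ≤
      G * l2 (fun x => (√(wt x))⁻¹ * ψ x) := fun ψ hψ => by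
    obtain ⟨j, hj⟩ := integral_grad_eq_curl hv hψ k
    rw [hj]; exact hg' ψ hψ j
  constructor
  · refine ⟨cv, mv, by linarith, md, fun i => by linarith [hdN i], fun i j => ?_⟩
    refine exists_weak_hessian cv md (by positivity) (fun ψ hψ => (grad ψ hψ).trans ?_) i j
    have h1 : l2 (fun x => (√(wt x))⁻¹ * ψ x) ≤ l2 ψ := by
      refine l2_mono hψ.memLp fun x => ?_
      rw [abs_mul, abs_of_nonneg (inv_nonneg.2 (Real.sqrt_nonneg _))]
      exact mul_le_of_le_one_left (abs_nonneg _) (inv_le_one_of_one_le₀ (one_le_sqrt_wt x))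
    have h2 := l2_nonneg ψ
    nlinarith [mul_le_mul_of_nonneg_left h1 hG, mul_nonneg hN h2]
  · have cf : ContDiff ℝ 1 fun x => √(wt x) * v k x := contDiff_sqrt_wt.mul cv
    have e1 : ∀ i, pd i (fun x => √(wt x) * v k x) = fun x =>
        x i * wt x ^ (-(1 / 2) : ℝ) * v k x + √(wt x) * pd i (v k) x := fun i => funext fun x => by
      rw [pd_mul (contDiff_sqrt_wt (n := 1) |>.differentiable one_ne_zero) (cv.differentiable one_ne_zero),
        pd_sqrt_wt, wt_rpow_neg_half, div_eq_mul_inv]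
    have cr : ∀ i, ContDiff ℝ 1 fun x : Plane => x i * wt x ^ (-(1 / 2) : ℝ) := fun i =>
      (contDiff_coord i).mul (contDiff_wt_rpow _)
    have m1 : ∀ i, MemLp (fun x : Plane => x i * wt x ^ (-(1 / 2) : ℝ) * v k x) 2 := fun i =>
      memLp_bdd_mul (cr i).continuous.aestronglyMeasurable mv (abs_unit_radial_le i)
    have l1 : ∀ i, l2 (fun x : Plane => x i * wt x ^ (-(1 / 2) : ℝ) * v k x) ≤ N := fun i =>
      (l2_bdd_mul_le mv (abs_unit_radial_le i)).trans (by linarith)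
    have m2 : ∀ i, MemLp (pd i (fun x => √(wt x) * v k x)) 2 := fun i => by
      rw [e1]; exact (m1 i).add (hw1 i k).1
    refine ⟨cf, (hw0 k).1, by linarith [(hw0 k).2], m2, fun i => ?_, fun i j => ?_⟩
    · rw [e1]
      refine (l2_add_le (m1 i) (hw1 i k).1).trans ?_
      linarith [l1 i, (hw1 i k).2]
    · refine exists_weak_hessian cf m2 (by positivity) (fun ψ hψ => ?_) i j
      rw [integral_grad_sqrt_wt_mul cv hψ]
      have hψ' : IsTest fun x => √(wt x) * ψ x :=
        ⟨contDiff_sqrt_wt.mul hψ.contDiff, hψ.compact.mul_left⟩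
      have b1 := grad _ hψ'
      have e2 : (fun x => (√(wt x))⁻¹ * (√(wt x) * ψ x)) = ψ := funext fun x => by
        rw [← mul_assoc, inv_mul_cancel₀ (sqrt_wt_pos x).ne', one_mul]
      rw [e2] at b1
      have m3 : ∀ i, MemLp (fun x : Plane => x i * wt x ^ (-(1 / 2) : ℝ) * pd i (v k) x) 2 := fun i =>
        memLp_bdd_mul (cr i).continuous.aestronglyMeasurable (md i) (abs_unit_radial_le i)
      have m4 : ∀ i, MemLp (fun x : Plane => pd i (fun x => x i * wt x ^ (-(1 / 2) : ℝ)) x * v k x) 2 := fun i =>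
        memLp_bdd_mul (continuous_pd (cr i) i).aestronglyMeasurable mv (abs_pd_unit_radial_le i)
      have n0 := l2_nonneg ψ
      have b2 : ∀ i, |∫ x, (x i * wt x ^ (-(1 / 2) : ℝ) * pd i (v k) x) * ψ x| ≤ N * l2 ψ := fun i => by
        refine (abs_integral_mul_le (m3 i) hψ.memLp).trans (mul_le_mul_of_nonneg_right ?_ n0)
        exact (l2_bdd_mul_le (md i) (abs_unit_radial_le i)).trans (by linarith [hdN i])
      have b3 : ∀ i, |∫ x, (pd i (fun x => x i * wt x ^ (-(1 / 2) : ℝ)) x * v k x) * ψ x| ≤ 2 * N * l2 ψ :=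
        fun i => by
        refine (abs_integral_mul_le (m4 i) hψ.memLp).trans (mul_le_mul_of_nonneg_right ?_ n0)
        exact (l2_bdd_mul_le mv (abs_pd_unit_radial_le i)).trans (by linarith)
      have c1 := abs_le.1 b1
      have c2 := abs_le.1 (b2 0)
      have c3 := abs_le.1 (b2 1)
      have c4 := abs_le.1 (b3 0)
      have c5 := abs_le.1 (b3 1)
      rw [abs_le]
      constructor <;> linarith [c1.1, c1.2, c2.1, c2.2, c3.1, c3.2, c4.1, c4.2, c5.1, c5.2]

end

/-! ### Convolution with functions of size `1/|z|` -/

theorem integrableOn_norm_inv : IntegrableOn (fun z : Plane => ‖z‖⁻¹) (Metric.ball 0 1) := by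
  rw [← integrable_indicator_iff measurableSet_ball]
  have e1 : (Metric.ball (0 : Plane) 1).indicator (fun z : Plane => ‖z‖⁻¹) =
      fun z => (Set.Iio (1 : ℝ)).indicator (fun t => t⁻¹) ‖z‖ := by
    ext z
    by_cases h : ‖z‖ < 1
    · rw [Set.indicator_of_mem (by simpa using h), Set.indicator_of_mem (Set.mem_Iio.2 h)]
    · rw [Set.indicator_of_notMem (by simpa using h), Set.indicator_of_notMem (by simpa using h)]
  rw [e1, integrable_fun_norm_addHaar (μ := (volume : Measure Plane))
    (f := (Set.Iio (1 : ℝ)).indicator fun t => t⁻¹)]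
  have hfr : Module.finrank ℝ Plane = 2 := by simp
  rw [hfr]
  have h1 : IntegrableOn (fun _ : ℝ => (1 : ℝ)) (Set.Ioo 0 1) := integrableOn_const (by simp)
  have h2 : IntegrableOn ((Set.Ioo (0 : ℝ) 1).indicator fun _ => (1 : ℝ)) (Set.Ioi 0) :=
    ((integrable_indicator_iff measurableSet_Ioo).2 h1).integrableOn
  refine h2.congr_fun (fun t ht => ?_) measurableSet_Ioi
  have ht0 : 0 < t := ht
  by_cases h : t < 1
  · simp [ht0, h, ht0.ne']
  · simp [h]

/-- The kernel `(1+|w|²)⁻²` that dominates all kernels below. -/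
noncomputable def decay (w : Plane) : ℝ := (wt w ^ 2)⁻¹

theorem decay_pos (w : Plane) : 0 < decay w := inv_pos.2 (pow_pos (wt_pos w) 2)

theorem decay_le_one (w : Plane) : decay w ≤ 1 :=
  inv_le_one_of_one_le₀ (one_le_pow₀ (one_le_wt w))

theorem continuous_decay : Continuous decay :=
  (continuous_wt.pow 2).inv₀ fun x => (pow_pos (wt_pos x) 2).ne'

theorem integrable_decay : Integrable decay := integrable_wt_inv_sq

theorem abs_le_mul_decay {y C : ℝ} {w : Plane} (h : |y| * wt w ^ 2 ≤ C) : |y| ≤ C * decay w := by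
  rw [decay, ← div_eq_mul_inv, le_div_iff₀ (pow_pos (wt_pos w) 2)]; exact h

theorem decay_le_of_norm_le {w w' : Plane} (h : ‖w - w'‖ ≤ 1) : decay w ≤ 16 * decay w' := by
  have h1 := sqrt_wt_le_two_mul h
  have h2 : wt w' ≤ 4 * wt w := by
    rw [← Real.sq_sqrt (wt_pos w).le, ← Real.sq_sqrt (wt_pos w').le]
    nlinarith [Real.sqrt_nonneg (wt w'), Real.sqrt_nonneg (wt w)]
  have h3 : wt w' ^ 2 ≤ 16 * wt w ^ 2 := by nlinarith [wt_pos w, wt_pos w']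
  rw [decay, decay, ← div_eq_mul_inv, inv_eq_one_div, div_le_div_iff₀ (pow_pos (wt_pos w) 2)
    (pow_pos (wt_pos w') 2)]
  linarith

/-- The singularity `1/|z|` is felt in the unit ball only. -/
theorem decay_mul_norm_inv_le (x z : Plane) :
    decay (x - z) * ‖z‖⁻¹ ≤ (Metric.ball (0 : Plane) 1).indicator (fun z : Plane => ‖z‖⁻¹) z
      + decay (x - z) := by
  have h1 := decay_pos (x - z)
  have h2 := decay_le_one (x - z)
  by_cases hz : z ∈ Metric.ball (0 : Plane) 1
  · rw [Set.indicator_of_mem hz]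
    have : 0 ≤ ‖z‖⁻¹ := by positivity
    nlinarith
  · rw [Set.indicator_of_notMem hz, zero_add]
    have : ‖z‖⁻¹ ≤ 1 := inv_le_one_of_one_le₀ (by simpa using hz)
    exact mul_le_of_le_one_right h1.le this

theorem integrable_decay_sub (x : Plane) : Integrable fun z => decay (x - z) :=
  integrable_decay.comp_sub_left x

theorem integrable_decay_mul_norm_inv (x : Plane) : Integrable fun z => decay (x - z) * ‖z‖⁻¹ := by
  have h1 := (integrable_indicator_iff measurableSet_ball).2 integrableOn_norm_inv
  refine (integrable_fun_add h1 (integrable_decay_sub x)).mono' ?_ (Eventually.of_forall fun z => ?_)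
  · exact (continuous_decay.comp (continuous_const.sub continuous_id)).aestronglyMeasurable.mul
      (measurable_norm.inv.aestronglyMeasurable)
  · rw [Real.norm_of_nonneg (mul_nonneg (decay_pos _).le (by positivity))]
    exact decay_mul_norm_inv_le x z

/-- A uniform bound for `∫ (1+|x-z|²)⁻² (1 + 1/|z|) dz`. -/
noncomputable def potentialBound : ℝ := (∫ z in Metric.ball (0 : Plane) 1, ‖z‖⁻¹) + 2 * ∫ z, decay z

theorem integrable_decay_potential (x : Plane) :
    Integrable fun z => decay (x - z) * (1 + ‖z‖⁻¹) := by
  refine (integrable_fun_add (integrable_decay_sub x) (integrable_decay_mul_norm_inv x)).congr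
    (Eventually.of_forall fun z => ?_)
  simp only; ring

theorem integral_decay_potential_le (x : Plane) :
    ∫ z, decay (x - z) * (1 + ‖z‖⁻¹) ≤ potentialBound := by
  have h1 := (integrable_indicator_iff measurableSet_ball).2 integrableOn_norm_inv
  have h2 := integrable_decay_sub x
  calc ∫ z, decay (x - z) * (1 + ‖z‖⁻¹) ≤
      ∫ z, ((Metric.ball (0 : Plane) 1).indicator (fun z : Plane => ‖z‖⁻¹) z + 2 * decay (x - z)) := by
        refine integral_mono (integrable_decay_potential x) (integrable_fun_add h1 (h2.const_mul 2))
          fun z => ?_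
        have := decay_mul_norm_inv_le x z
        simp only
        linarith
    _ = potentialBound := by
      rw [integral_add h1 (h2.const_mul 2), integral_const_mul, integral_indicator measurableSet_ball,
        potentialBound, integral_sub_left_eq_self decay volume x]

theorem potentialBound_nonneg : 0 ≤ potentialBound :=
  (integral_nonneg fun z => mul_nonneg (decay_pos _).le (by positivity)).trans
    (integral_decay_potential_le 0)

section
variable {A C : ℝ} {κ u : Plane → ℝ}

theorem abs_kernel_mul_le (hκ : ∀ w, |κ w| * wt w ^ 2 ≤ C)
    (hu : ∀ z, |u z| ≤ A * ‖z‖⁻¹) (x z : Plane) :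
    ‖κ (x - z) * u z‖ ≤ C * A * (decay (x - z) * ‖z‖⁻¹) := by
  rw [Real.norm_eq_abs, abs_mul]
  have h1 := abs_le_mul_decay (hκ (x - z))
  calc |κ (x - z)| * |u z| ≤ (C * decay (x - z)) * (A * ‖z‖⁻¹) :=
        mul_le_mul h1 (hu z) (abs_nonneg _) ((abs_nonneg _).trans h1)
    _ = _ := by ring

theorem integrable_kernel_mul (hκc : Continuous κ) (hκ : ∀ w, |κ w| * wt w ^ 2 ≤ C)
    (hum : AEStronglyMeasurable u) (hu : ∀ z, |u z| ≤ A * ‖z‖⁻¹) (x : Plane) :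
    Integrable fun z => κ (x - z) * u z :=
  ((integrable_decay_mul_norm_inv x).const_mul (C * A)).mono'
    ((hκc.comp (by fun_prop)).aestronglyMeasurable.mul hum)
    (Eventually.of_forall (abs_kernel_mul_le hκ hu x))

theorem continuous_conv_kernel (hκc : Continuous κ) (hκ : ∀ w, |κ w| * wt w ^ 2 ≤ C)
    (hum : AEStronglyMeasurable u) (hu : ∀ z, |u z| ≤ A * ‖z‖⁻¹) : Continuous (conv κ u) := by
  have hC : 0 ≤ C := (mul_nonneg (abs_nonneg _) (by positivity)).trans (hκ 0)
  have e : conv κ u = fun x => ∫ z, κ (x - z) * u z := funext fun x => conv_apply' κ u x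
  rw [e, continuous_iff_continuousAt]
  intro x₀
  refine continuousAt_of_dominated (bound := fun z => 16 * (C * |A|) * (decay (x₀ - z) * ‖z‖⁻¹))
    (Eventually.of_forall fun x => (integrable_kernel_mul hκc hκ hum hu x).aestronglyMeasurable)
    ?_ ((integrable_decay_mul_norm_inv x₀).const_mul _) (Eventually.of_forall fun z => ?_)
  · filter_upwards [Metric.ball_mem_nhds x₀ one_pos] with x hx
    refine Eventually.of_forall fun z => (abs_kernel_mul_le hκ hu x z).trans ?_
    have h1 : decay (x - z) ≤ 16 * decay (x₀ - z) := decay_le_of_norm_le (by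
      rw [sub_sub_sub_cancel_right, ← dist_eq_norm]; exact (Metric.mem_ball.1 hx).le)
    have h2 : 0 ≤ ‖z‖⁻¹ := by positivity
    have h3 := decay_pos (x - z)
    calc C * A * (decay (x - z) * ‖z‖⁻¹) ≤ C * |A| * ((16 * decay (x₀ - z)) * ‖z‖⁻¹) := by
          gcongr; exact le_abs_self A
      _ = _ := by ring
  · exact ((hκc.comp (by fun_prop : Continuous fun x : Plane => x - z)).mul continuous_const).continuousAt

/-- Differentiation under the integral, for kernels that together with their gradients decay like
`w⁻²` and functions `u` of size `1/|z|`. -/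
theorem hasFDerivAt_conv_kernel (hκ1 : ContDiff ℝ 1 κ) (hκ : ∀ w, |κ w| * wt w ^ 2 ≤ C)
    (hdκ : ∀ i w, |pd i κ w| * wt w ^ 2 ≤ C)
    (hum : AEStronglyMeasurable u) (hu : ∀ z, |u z| ≤ A * ‖z‖⁻¹) (x₀ : Plane) :
    HasFDerivAt (conv κ u) (∫ z, u z • fderiv ℝ κ (x₀ - z)) x₀ ∧
      Integrable fun z => u z • fderiv ℝ κ (x₀ - z) := by
  have hC : 0 ≤ C := (mul_nonneg (abs_nonneg _) (by positivity)).trans (hκ 0)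
  have e : conv κ u = fun x => ∫ z, κ (x - z) * u z := funext fun x => conv_apply' κ u x
  have hcf : Continuous (fderiv ℝ κ) := hκ1.continuous_fderiv one_ne_zero
  have hb : ∀ x ∈ Metric.ball x₀ 1, ∀ z, ‖u z • fderiv ℝ κ (x - z)‖ ≤
      16 * (2 * C * |A|) * (decay (x₀ - z) * ‖z‖⁻¹) := by
    intro x hx z
    have h1 : decay (x - z) ≤ 16 * decay (x₀ - z) := decay_le_of_norm_le (by
      rw [sub_sub_sub_cancel_right, ← dist_eq_norm]; exact (Metric.mem_ball.1 hx).le)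
    have h2 : 0 ≤ ‖z‖⁻¹ := by positivity
    have h3 := decay_pos (x - z)
    rw [norm_smul, Real.norm_eq_abs]
    have h4 : ‖fderiv ℝ κ (x - z)‖ ≤ 2 * C * decay (x - z) := by
      refine (norm_fderiv_le κ (x - z)).trans ?_
      linarith [abs_le_mul_decay (hdκ 0 (x - z)), abs_le_mul_decay (hdκ 1 (x - z))]
    calc |u z| * ‖fderiv ℝ κ (x - z)‖ ≤ (|A| * ‖z‖⁻¹) * (2 * C * (16 * decay (x₀ - z))) := by
          refine mul_le_mul ((hu z).trans ?_) (h4.trans ?_) (norm_nonneg _) (by positivity)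
          · gcongr; exact le_abs_self A
          · gcongr
      _ = _ := by ring
  have hm : AEStronglyMeasurable fun z => u z • fderiv ℝ κ (x₀ - z) :=
    hum.smul (hcf.comp (by fun_prop)).aestronglyMeasurable
  have hbi := (integrable_decay_mul_norm_inv x₀).const_mul (16 * (2 * C * |A|))
  rw [e]
  refine ⟨hasFDerivAt_integral_of_dominated_of_fderiv_le (Metric.ball_mem_nhds x₀ one_pos)
    (F' := fun x z => u z • fderiv ℝ κ (x - z))
    (Eventually.of_forall fun x => (integrable_kernel_mul hκ1.continuous hκ hum hu x).aestronglyMeasurable)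
    (integrable_kernel_mul hκ1.continuous hκ hum hu x₀) hm
    (Eventually.of_forall fun z x hx => hb x hx z) hbi
    (Eventually.of_forall fun z x _ => ?_), hbi.mono' hm (Eventually.of_forall fun z =>
      hb x₀ (Metric.mem_ball_self one_pos) z)⟩
  have h1 : HasFDerivAt (fun x => κ (x - z)) (fderiv ℝ κ (x - z)) x := by
    have := (hκ1.differentiable one_ne_zero (x - z)).hasFDerivAt.comp x ((hasFDerivAt_id x).sub_const z)
    rw [ContinuousLinearMap.comp_id] at this
    exact this
  exact h1.mul_const (u z)

theorem pd_conv_kernel (hκ1 : ContDiff ℝ 1 κ) (hκ : ∀ w, |κ w| * wt w ^ 2 ≤ C)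
    (hdκ : ∀ i w, |pd i κ w| * wt w ^ 2 ≤ C)
    (hum : AEStronglyMeasurable u) (hu : ∀ z, |u z| ≤ A * ‖z‖⁻¹) (i : Fin 2) :
    pd i (conv κ u) = conv (pd i κ) u := by
  ext x
  obtain ⟨h1, h2⟩ := hasFDerivAt_conv_kernel hκ1 hκ hdκ hum hu x
  rw [pd, h1.fderiv, ContinuousLinearMap.integral_apply h2, conv_apply']
  congr 1; ext z
  simp [pd, mul_comm]

theorem contDiff_one_of_continuous_pd {f : Plane → ℝ} (hd : Differentiable ℝ f)
    (hc : ∀ i, Continuous (pd i f)) : ContDiff ℝ 1 f := by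
  rw [contDiff_one_iff_fderiv]
  refine ⟨hd, ?_⟩
  have e : fderiv ℝ f = fun x => pd 0 f x • (EuclideanSpace.proj (𝕜 := ℝ) (0 : Fin 2) : Plane →L[ℝ] ℝ)
      + pd 1 f x • (EuclideanSpace.proj (𝕜 := ℝ) (1 : Fin 2) : Plane →L[ℝ] ℝ) := by
    ext x y
    rw [fderiv_apply_eq]
    simp [mul_comm]
  rw [e]
  exact ((hc 0).smul continuous_const).add ((hc 1).smul continuous_const)

theorem contDiff_conv_kernel (hκ1 : ContDiff ℝ 1 κ) (hκ : ∀ w, |κ w| * wt w ^ 2 ≤ C)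
    (hdκ : ∀ i w, |pd i κ w| * wt w ^ 2 ≤ C)
    (hum : AEStronglyMeasurable u) (hu : ∀ z, |u z| ≤ A * ‖z‖⁻¹) : ContDiff ℝ 1 (conv κ u) := by
  refine contDiff_one_of_continuous_pd
    (fun x => (hasFDerivAt_conv_kernel hκ1 hκ hdκ hum hu x).1.differentiableAt) fun i => ?_
  rw [pd_conv_kernel hκ1 hκ hdκ hum hu i]
  exact continuous_conv_kernel (continuous_pd hκ1 i) (hdκ i) hum hu

end

/-! ### The heat kernel -/

/-- The heat kernel at time one. -/
noncomputable def gauss (w : Plane) : ℝ := 1 / (4 * Real.pi) * Real.exp (-(‖w‖ ^ 2) / 4)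

theorem gauss_nonneg (w : Plane) : 0 ≤ gauss w := by unfold gauss; positivity

theorem contDiff_gauss : ContDiff ℝ ∞ gauss :=
  contDiff_const.mul ((contDiff_norm_sq ℝ).neg.div_const 4).exp

theorem pd_gauss (i : Fin 2) (w : Plane) : pd i gauss w = -(1 / 2) * (w i * gauss w) := by
  have h1 : HasFDerivAt wt (fderiv ℝ wt w) w :=
    ((contDiff_wt (n := 1)).differentiable one_ne_zero w).hasFDerivAt
  have h2 : HasFDerivAt gauss
      ((1 / (4 * Real.pi)) • (Real.exp ((1 - wt w) / 4) • ((1 / 4 : ℝ) • (-fderiv ℝ wt w)))) w := by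
    have h3 : HasFDerivAt (fun w : Plane => (1 - wt w) / 4) ((1 / 4 : ℝ) • (-fderiv ℝ wt w)) w := by
      have := (h1.const_sub 1).const_mul (1 / 4 : ℝ)
      refine this.congr_of_eventuallyEq (Eventually.of_forall fun y => ?_)
      simp only; ring
    have := h3.exp.const_mul (1 / (4 * Real.pi))
    refine this.congr_of_eventuallyEq (Eventually.of_forall fun y => ?_)
    simp only [gauss, wt]
    congr 3; ring
  rw [pd, h2.fderiv]
  have h4 := pd_wt i w
  unfold pd at h4
  simp only [FunLike.coe_smul, FunLike.coe_neg, Pi.smul_apply, Pi.neg_apply, smul_eq_mul, h4, gauss]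
  have : (1 - wt w) / 4 = -‖w‖ ^ 2 / 4 := by simp only [wt]; ring
  rw [this]; ring

theorem pd_pd_gauss (i j : Fin 2) (w : Plane) :
    pd j (pd i gauss) w = ((1 / 4) * (w i * w j) - (1 / 2) * (if i = j then 1 else 0)) * gauss w := by
  have e : pd i gauss = fun w => -(1 / 2) * (w i * gauss w) := funext fun w => pd_gauss i w
  have hg := contDiff_gauss.differentiable (by simp)
  rw [e, pd_const_mul ((differentiable_coord i).fun_mul hg), pd_mul (differentiable_coord i) hg, pd_coord,
    pd_gauss]
  fin_cases i <;> fin_cases j <;> simp <;> ring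

/-- From `exp t ≥ t⁴ / 4!` at `t = w / 4`. -/
theorem exists_gauss_decay : ∃ C, ∀ w, gauss w * wt w ^ 4 ≤ C := by
  refine ⟨1 / (4 * Real.pi) * (24 * 4 ^ 4 * Real.exp (1 / 4)), fun w => ?_⟩
  have h := Real.pow_div_factorial_le_exp (wt w / 4) (div_nonneg (wt_pos w).le (by norm_num)) 4
  have h1 : wt w ^ 4 ≤ 24 * 4 ^ 4 * Real.exp (wt w / 4) := by
    rw [div_le_iff₀ (by positivity), div_pow, div_le_iff₀ (by positivity)] at h
    norm_num [Nat.factorial] at h ⊢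
    linarith
  have h2 : Real.exp (wt w / 4) * Real.exp (-(‖w‖ ^ 2) / 4) = Real.exp (1 / 4) := by
    rw [← Real.exp_add]; congr 1; simp only [wt]; ring
  calc gauss w * wt w ^ 4 = 1 / (4 * Real.pi) * (Real.exp (-(‖w‖ ^ 2) / 4) * wt w ^ 4) := by
        simp only [gauss]; ring
    _ ≤ 1 / (4 * Real.pi) * (Real.exp (-(‖w‖ ^ 2) / 4) * (24 * 4 ^ 4 * Real.exp (wt w / 4))) := by
        gcongr
    _ = 1 / (4 * Real.pi) * (24 * 4 ^ 4 * (Real.exp (wt w / 4) * Real.exp (-(‖w‖ ^ 2) / 4))) := by ring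
    _ = _ := by rw [h2]

/-- The heat kernel and its derivatives up to second order decay faster than `(1+|w|²)⁻³`. -/
theorem exists_gauss_bounds : ∃ C, 0 ≤ C ∧ (∀ w, |gauss w| * wt w ^ 3 ≤ C) ∧
    (∀ i w, |pd i gauss w| * wt w ^ 3 ≤ C) ∧ ∀ i j w, |pd j (pd i gauss) w| * wt w ^ 3 ≤ C := by
  obtain ⟨C, hC⟩ := exists_gauss_decay
  have key : ∀ (a : ℝ) w, |a| ≤ wt w → |a * gauss w| * wt w ^ 3 ≤ C := fun a w ha => by
    rw [abs_mul, abs_of_nonneg (gauss_nonneg w)]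
    have h0 := wt_pos w
    have h1 := gauss_nonneg w
    calc |a| * gauss w * wt w ^ 3 ≤ wt w * gauss w * wt w ^ 3 := by gcongr
      _ = gauss w * wt w ^ 4 := by ring
      _ ≤ C := hC w
  have hx : ∀ (i : Fin 2) (w : Plane), |w i| ≤ √(wt w) := abs_coord_le
  refine ⟨C, ?_, fun w => ?_, fun i w => ?_, fun i j w => ?_⟩
  · exact (mul_nonneg (gauss_nonneg 0) (by positivity)).trans (hC 0)
  · have := key 1 w (by rw [abs_one]; exact one_le_wt w)
    rwa [one_mul] at this
  · have := key (-(1 / 2) * w i) w (by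
      rw [abs_mul, abs_neg, abs_of_pos (by norm_num : (0 : ℝ) < 1 / 2)]
      linarith [hx i w, sqrt_wt_le_wt w, abs_nonneg (w i)])
    rw [pd_gauss]
    rwa [mul_assoc] at this
  · rw [pd_pd_gauss]
    refine key _ w ?_
    have h1 : |w i * w j| ≤ wt w := by
      rw [abs_mul]
      calc |w i| * |w j| ≤ √(wt w) * √(wt w) :=
            mul_le_mul (hx i w) (hx j w) (abs_nonneg _) (Real.sqrt_nonneg _)
        _ = wt w := Real.mul_self_sqrt (wt_pos w).le
    have h2 := abs_le.1 h1
    have h3 := one_le_wt w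
    rw [abs_le]
    split_ifs <;> constructor <;> linarith

/-! ### The background field -/

/-- The properties of a self-similar, divergence-free, Hölder continuous initial field that are
used. By `bound`, with `0⁻¹ = 0`, the field is normalized to vanish at the origin. -/
structure IsHomField (A β : ℝ) (u : Fin 2 → Plane → ℝ) : Prop where
  meas : ∀ k, AEStronglyMeasurable (u k)
  bound : ∀ k z, |u k z| ≤ A * ‖z‖⁻¹
  homog : ∀ k z (lam : ℝ), 0 < lam → lam * u k (lam • z) = u k z
  holder : ∀ k x z, 1 ≤ ‖x‖ → z ≠ 0 →
    |u k z - u k x| ≤ A * ‖x‖ ^ (-(1 + β)) * (wt (x - z) * (1 + ‖z‖⁻¹))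
  div : ∀ ψ, IsTest ψ → ∫ x, (pd 0 ψ x * u 0 x + pd 1 ψ x * u 1 x) = 0

theorem IsHomField.nonneg {A β : ℝ} {u : Fin 2 → Plane → ℝ} (h : IsHomField A β u) : 0 ≤ A := by
  have := (abs_nonneg _).trans (h.bound 0 (e 0))
  simpa [norm_e] using this

theorem abs_mul_wt_le_mul_decay {y C : ℝ} {w : Plane} (h : |y| * wt w ^ 3 ≤ C) :
    |y| * wt w ≤ C * decay w := by
  have h0 := wt_pos w
  have := abs_le_mul_decay (y := y * wt w) (w := w) (C := C) (by
    rw [abs_mul, abs_of_pos h0]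
    calc |y| * wt w * wt w ^ 2 = |y| * wt w ^ 3 := by ring
      _ ≤ C := h)
  rwa [abs_mul, abs_of_pos h0] at this

theorem mul_wt_sq_le {y C : ℝ} {w : Plane} (h : |y| * wt w ^ 3 ≤ C) : |y| * wt w ^ 2 ≤ C := by
  refine le_trans ?_ h
  gcongr
  · exact one_le_wt w
  · norm_num

/-- Absolute convergence of all the potentials of functions of size `1 + 1/|z|`, uniformly in `x`. -/
theorem abs_integral_le_potential {f : Plane → ℝ} {B : ℝ} (x : Plane) (hB : 0 ≤ B)
    (h : ∀ᵐ z, |f z| ≤ B * (decay (x - z) * (1 + ‖z‖⁻¹))) : |∫ z, f z| ≤ B * potentialBound := by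
  rw [← Real.norm_eq_abs]
  refine (norm_integral_le_of_norm_le ((integrable_decay_potential x).const_mul B) h).trans ?_
  rw [integral_const_mul]
  exact mul_le_mul_of_nonneg_left (integral_decay_potential_le x) hB

theorem ae_ne_zero : ∀ᵐ z : Plane, z ≠ 0 := by
  simp [ae_iff]

theorem integral_pd_gauss (i : Fin 2) : ∫ w, pd i gauss w = 0 := by
  have h := integral_neg_eq_self (pd i gauss) volume
  have e : ∀ w, pd i gauss (-w) = -pd i gauss w := fun w => by
    rw [pd_gauss, pd_gauss]; simp [gauss]
  simp_rw [e] at h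
  rw [integral_neg] at h
  linarith

section
variable {A β C : ℝ} {u : Fin 2 → Plane → ℝ}

/-- The background decays like `|x|⁻¹`: `1 + |x| ≤ (1 + |x - z|) + |z|`, and `|z|` cancels the
singularity. -/
theorem background_bound (h : IsHomField A β u) (hC : 0 ≤ C) (hg : ∀ w, |gauss w| * wt w ^ 3 ≤ C)
    (k : Fin 2) (x : Plane) : |conv gauss (u k) x| * √(wt x) ≤ 2 * A * C * potentialBound := by
  have hA := h.nonneg
  have h1 : |∫ z, (1 + ‖x‖) * (gauss (x - z) * u k z)| ≤ 2 * A * C * potentialBound := by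
    refine abs_integral_le_potential x (by positivity) ?_
    filter_upwards [ae_ne_zero] with z hz
    have hz0 : 0 < ‖z‖ := norm_pos_iff.2 hz
    have h2 : ‖x‖ ≤ ‖x - z‖ + ‖z‖ := by simpa using norm_add_le (x - z) z
    have h3 : ‖x - z‖ ≤ wt (x - z) := (norm_le_sqrt_wt _).trans (sqrt_wt_le_wt _)
    have h4 := one_le_wt (x - z)
    have hi : 0 ≤ ‖z‖⁻¹ := by positivity
    have h5 : (1 + ‖x‖) * ‖z‖⁻¹ ≤ 2 * wt (x - z) * (1 + ‖z‖⁻¹) := by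
      calc (1 + ‖x‖) * ‖z‖⁻¹ ≤ (1 + (‖x - z‖ + ‖z‖)) * ‖z‖⁻¹ := by gcongr
        _ = (1 + ‖x - z‖) * ‖z‖⁻¹ + 1 := by
          linear_combination mul_inv_cancel₀ hz0.ne'
        _ ≤ (wt (x - z) + wt (x - z)) * ‖z‖⁻¹ + wt (x - z) := by gcongr
        _ ≤ _ := by nlinarith
    have h6 := abs_mul_wt_le_mul_decay (hg (x - z))
    rw [abs_mul, abs_mul, abs_of_nonneg (by positivity : 0 ≤ 1 + ‖x‖)]
    calc (1 + ‖x‖) * (|gauss (x - z)| * |u k z|) ≤ (1 + ‖x‖) * (|gauss (x - z)| * (A * ‖z‖⁻¹)) := by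
          gcongr; exact h.bound k z
      _ = A * |gauss (x - z)| * ((1 + ‖x‖) * ‖z‖⁻¹) := by ring
      _ ≤ A * |gauss (x - z)| * (2 * wt (x - z) * (1 + ‖z‖⁻¹)) := by gcongr
      _ = 2 * A * (|gauss (x - z)| * wt (x - z)) * (1 + ‖z‖⁻¹) := by ring
      _ ≤ 2 * A * (C * decay (x - z)) * (1 + ‖z‖⁻¹) := by gcongr
      _ = _ := by ring
  rw [integral_const_mul, ← conv_apply', abs_mul, abs_of_nonneg (by positivity : 0 ≤ 1 + ‖x‖)] at h1
  have := mul_le_mul_of_nonneg_left (sqrt_wt_le x) (abs_nonneg (conv gauss (u k) x))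
  linarith

/-- The gradient of the background field decays like `|x|^{-1-β}`; this uses the cancellation
`∫ ∇g = 0` and the Hölder continuity. -/
theorem background_gradient_bound (h : IsHomField A β u) (hβ : 0 ≤ β) (hβ1 : β ≤ 1) (hC : 0 ≤ C)
    (hg : ∀ i w, |pd i gauss w| * wt w ^ 3 ≤ C) (i k : Fin 2) (x : Plane) :
    |conv (pd i gauss) (u k) x| * wt x ^ ((1 + β) / 2) ≤ 2 * A * C * potentialBound := by
  have hA := h.nonneg
  have hJ := potentialBound_nonneg
  have hb2 : (2 : ℝ) ^ ((1 + β) / 2) ≤ 2 := by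
    calc (2 : ℝ) ^ ((1 + β) / 2) ≤ 2 ^ (1 : ℝ) :=
          Real.rpow_le_rpow_of_exponent_le (by norm_num) (by linarith)
      _ = 2 := Real.rpow_one 2
  rcases le_total ‖x‖ 1 with hx | hx
  · have h1 : |conv (pd i gauss) (u k) x| ≤ A * C * potentialBound := by
      rw [conv_apply']
      refine abs_integral_le_potential x (by positivity) (Eventually.of_forall fun z => ?_)
      have h6 := abs_mul_wt_le_mul_decay (hg i (x - z))
      have h7 := one_le_wt (x - z)
      have hi : 0 ≤ ‖z‖⁻¹ := by positivity
      rw [abs_mul]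
      calc |pd i gauss (x - z)| * |u k z| ≤ (|pd i gauss (x - z)| * wt (x - z)) * (A * (1 + ‖z‖⁻¹)) := by
            gcongr
            · exact le_mul_of_one_le_right (abs_nonneg _) h7
            · exact (h.bound k z).trans (by gcongr; linarith)
        _ ≤ (C * decay (x - z)) * (A * (1 + ‖z‖⁻¹)) := by gcongr
        _ = _ := by ring
    have h2 : wt x ^ ((1 + β) / 2) ≤ 2 := by
      refine le_trans (Real.rpow_le_rpow (wt_pos x).le ?_ (by linarith)) hb2
      simp only [wt]; nlinarith [norm_nonneg x]
    calc _ ≤ (A * C * potentialBound) * 2 :=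
          mul_le_mul h1 h2 (Real.rpow_nonneg (wt_pos x).le _) (by positivity)
      _ = _ := by ring
  · have hx0 : 0 < ‖x‖ := by linarith
    have cg : Continuous (pd i gauss) := (contDiff_pd contDiff_gauss i).continuous
    have hd : ∀ w, |pd i gauss w| * wt w ^ 2 ≤ C := fun w => mul_wt_sq_le (hg i w)
    have ig : Integrable (pd i gauss) := by
      refine (integrable_decay.const_mul C).mono' cg.aestronglyMeasurable
        (Eventually.of_forall fun w => abs_le_mul_decay (hd w))
    have e1 : conv (pd i gauss) (u k) x = ∫ z, pd i gauss (x - z) * (u k z - u k x) := by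
      have : ∀ z, pd i gauss (x - z) * (u k z - u k x) =
          pd i gauss (x - z) * u k z - pd i gauss (x - z) * u k x := fun z => by ring
      simp_rw [this]
      rw [integral_sub (integrable_kernel_mul cg hd (h.meas k) (h.bound k) x)
        ((ig.comp_sub_left x).mul_const _), integral_mul_const,
        integral_sub_left_eq_self (pd i gauss) volume x, integral_pd_gauss, conv_apply']
      ring
    have hr : 0 ≤ ‖x‖ ^ (-(1 + β)) := Real.rpow_nonneg hx0.le _
    have h1 : |conv (pd i gauss) (u k) x| ≤ A * ‖x‖ ^ (-(1 + β)) * C * potentialBound := by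
      rw [e1]
      refine abs_integral_le_potential x (by positivity) ?_
      filter_upwards [ae_ne_zero] with z hz
      have h6 := abs_mul_wt_le_mul_decay (hg i (x - z))
      have hi : 0 ≤ ‖z‖⁻¹ := by positivity
      rw [abs_mul]
      calc |pd i gauss (x - z)| * |u k z - u k x| ≤
          |pd i gauss (x - z)| * (A * ‖x‖ ^ (-(1 + β)) * (wt (x - z) * (1 + ‖z‖⁻¹))) := by
            gcongr; exact h.holder k x z hx hz
        _ = A * ‖x‖ ^ (-(1 + β)) * (|pd i gauss (x - z)| * wt (x - z)) * (1 + ‖z‖⁻¹) := by ring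
        _ ≤ A * ‖x‖ ^ (-(1 + β)) * (C * decay (x - z)) * (1 + ‖z‖⁻¹) := by gcongr
        _ = _ := by ring
    have h2 : wt x ^ ((1 + β) / 2) ≤ 2 * ‖x‖ ^ (1 + β) := by
      calc wt x ^ ((1 + β) / 2) ≤ (2 * ‖x‖ ^ 2) ^ ((1 + β) / 2) := by
            refine Real.rpow_le_rpow (wt_pos x).le ?_ (by linarith)
            simp only [wt]; nlinarith
        _ = 2 ^ ((1 + β) / 2) * ‖x‖ ^ (1 + β) := by
            rw [Real.mul_rpow (by norm_num) (by positivity), ← Real.rpow_natCast, ← Real.rpow_mul hx0.le]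
            congr 2; push_cast; ring
        _ ≤ _ := by gcongr
    have h3 : ‖x‖ ^ (-(1 + β)) * ‖x‖ ^ (1 + β) = 1 := by
      rw [← Real.rpow_add hx0]; simp
    calc _ ≤ (A * ‖x‖ ^ (-(1 + β)) * C * potentialBound) * (2 * ‖x‖ ^ (1 + β)) :=
          mul_le_mul h1 h2 (Real.rpow_nonneg (wt_pos x).le _) (by positivity)
      _ = 2 * A * C * potentialBound * (‖x‖ ^ (-(1 + β)) * ‖x‖ ^ (1 + β)) := by ring
      _ = _ := by rw [h3, mul_one]

/-- The weak divergence-freeness of `u`, tested with `g(x - ·)`. -/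
theorem background_div (h : IsHomField A β u) (hg : ∀ w, |gauss w| * wt w ^ 2 ≤ C)
    (hdg : ∀ i w, |pd i gauss w| * wt w ^ 2 ≤ C) (x : Plane) :
    conv (pd 0 gauss) (u 0) x + conv (pd 1 gauss) (u 1) x = 0 := by
  obtain ⟨c, hc, χ, hχ⟩ := exists_cutoff
  have cg : ∀ i, Continuous (pd i gauss) := fun i => (contDiff_pd contDiff_gauss i).continuous
  have id : ∀ i k, Integrable fun z => pd i gauss (x - z) * u k z := fun i k =>
    integrable_kernel_mul (cg i) (hdg i) (h.meas k) (h.bound k) x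
  have hpm : AEStronglyMeasurable fun z : Plane => A * ‖z‖⁻¹ :=
    (measurable_norm.inv.const_mul A).aestronglyMeasurable
  have hA := h.nonneg
  have ig : Integrable fun z => gauss (x - z) * (A * ‖z‖⁻¹) :=
    integrable_kernel_mul contDiff_gauss.continuous hg hpm
      (fun z => by rw [abs_of_nonneg (by positivity)]) x
  have cgx : ContDiff ℝ ∞ fun z => gauss (x - z) := contDiff_gauss.comp (by fun_prop)
  have pg : ∀ i z, pd i (fun z => gauss (x - z)) z = -pd i gauss (x - z) := fun i z => by
    have h1 : HasFDerivAt (fun y : Plane => x - y) (-ContinuousLinearMap.id ℝ Plane) z :=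
      (hasFDerivAt_id z).const_sub x
    have h2 : fderiv ℝ (fun y => gauss (x - y)) z = _ :=
      ((contDiff_gauss.differentiable (by simp) (x - z)).hasFDerivAt.comp z h1).fderiv
    rw [pd, h2]
    simp [pd]
  have key := hχ.integral_eq_zero (E := fun z => -(pd 0 gauss (x - z) * u 0 z + pd 1 gauss (x - z) * u 1 z))
    (R := fun j z => gauss (x - z) * u j z) (integrable_fun_add (id 0 0) (id 1 1)).neg ig
    (fun j => cgx.continuous.aestronglyMeasurable.mul (h.meas j)) (fun j z => ?_) (fun n _ => ?_)
  · rw [integral_neg, integral_add (id 0 0) (id 1 1), ← conv_apply', ← conv_apply'] at key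
    linarith
  · rw [abs_mul, abs_mul, abs_of_nonneg (by positivity : 0 ≤ A * ‖z‖⁻¹)]
    have h1 := h.bound j z
    have h2 := one_le_sqrt_wt z
    have h3 : 0 ≤ |gauss (x - z)| * (A * ‖z‖⁻¹) := by positivity
    calc |gauss (x - z)| * |u j z| ≤ 1 * (|gauss (x - z)| * (A * ‖z‖⁻¹)) := by rw [one_mul]; gcongr
      _ ≤ _ := by gcongr
  · have hψ : IsTest fun z => χ n z * gauss (x - z) :=
      ⟨(hχ.contDiff n).mul cgx, (hχ.compact n).mul_right⟩
    refine Eq.trans ?_ (h.div _ hψ)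
    congr 1; ext z
    have e : ∀ i, pd i (fun z => χ n z * gauss (x - z)) z =
        pd i (χ n) z * gauss (x - z) - χ n z * pd i gauss (x - z) := fun i => by
      rw [pd_mul ((hχ.contDiff n).differentiable (by simp)) (cgx.differentiable (by simp)), pg]; ring
    rw [e, e]; ring

/-- The scaling relation `λ b(λx) = ∫ λ² g(λ(x-z)) u(z) dz`. -/
theorem background_scaling (h : IsHomField A β u) (k : Fin 2) (x : Plane) {lam : ℝ} (hl : 0 < lam) :
    lam * conv gauss (u k) (lam • x) = ∫ z, lam ^ 2 * gauss (lam • (x - z)) * u k z := by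
  have h1 := Measure.integral_comp_smul_of_nonneg (volume : Measure Plane)
    (fun z => gauss (lam • x - z) * u k z) lam (hR := hl.le)
  have hfr : Module.finrank ℝ Plane = 2 := by simp
  rw [hfr, ← conv_apply', smul_eq_mul] at h1
  have h2 : conv gauss (u k) (lam • x) = lam ^ 2 * ∫ z, gauss (lam • x - lam • z) * u k (lam • z) := by
    rw [h1, ← mul_assoc, mul_inv_cancel₀ (by positivity), one_mul]
  rw [h2, ← integral_const_mul, ← integral_const_mul]
  congr 1; ext z
  rw [← h.homog k z lam hl, smul_sub]
  ring

end

section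
variable {A β C : ℝ} {u : Fin 2 → Plane → ℝ}

theorem gauss_smul (lam : ℝ) (w : Plane) :
    gauss (lam • w) = 1 / (4 * Real.pi) * Real.exp (-(lam ^ 2 * ‖w‖ ^ 2) / 4) := by
  rw [gauss, norm_smul, mul_pow, Real.norm_eq_abs, sq_abs]

theorem hasDerivAt_gauss_smul (w : Plane) (lam : ℝ) :
    HasDerivAt (fun s => s ^ 2 * gauss (s • w))
      ((2 * lam - lam ^ 3 * ‖w‖ ^ 2 / 2) * gauss (lam • w)) lam := by
  simp_rw [gauss_smul]
  have h1 : HasDerivAt (fun s : ℝ => s ^ 2) (2 * lam) lam := by simpa using hasDerivAt_pow 2 lam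
  have h2 := (((h1.mul_const (‖w‖ ^ 2)).fun_neg.div_const 4).exp.const_mul (1 / (4 * Real.pi)))
  refine (h1.fun_mul h2).congr_deriv ?_
  ring

/-- The domination for differentiating in the scaling parameter near `1`. -/
theorem abs_deriv_gauss_smul_le (hg : ∀ w, |gauss w| * wt w ^ 3 ≤ C) (w : Plane) {lam : ℝ}
    (h1 : 1 / 2 ≤ lam) (h2 : lam ≤ 3 / 2) :
    |(2 * lam - lam ^ 3 * ‖w‖ ^ 2 / 2) * gauss (lam • w)| * wt w ^ 2 ≤ 192 * C := by
  have h3 : wt w ≤ 4 * wt (lam • w) := by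
    simp only [wt, norm_smul, mul_pow, Real.norm_eq_abs, sq_abs]
    nlinarith [sq_nonneg ‖w‖, mul_nonneg (by nlinarith : 0 ≤ lam ^ 2 - 1 / 4) (sq_nonneg ‖w‖)]
  have h4 : |2 * lam - lam ^ 3 * ‖w‖ ^ 2 / 2| ≤ 3 * wt w := by
    have h5 : lam ^ 3 ≤ (3 / 2) ^ 3 := by gcongr
    have h6 : 0 ≤ lam ^ 3 := by positivity
    have h7 := sq_nonneg ‖w‖
    have h8 : lam ^ 3 * ‖w‖ ^ 2 ≤ (3 / 2) ^ 3 * ‖w‖ ^ 2 := by gcongr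
    have h9 : 0 ≤ lam ^ 3 * ‖w‖ ^ 2 := by positivity
    simp only [wt]
    rw [abs_le]; constructor <;> linarith
  have hw := wt_pos w
  have hg0 := abs_nonneg (gauss (lam • w))
  rw [abs_mul]
  calc |2 * lam - lam ^ 3 * ‖w‖ ^ 2 / 2| * |gauss (lam • w)| * wt w ^ 2
      ≤ 3 * wt w * |gauss (lam • w)| * wt w ^ 2 := by gcongr
    _ = 3 * |gauss (lam • w)| * wt w ^ 3 := by ring
    _ ≤ 3 * |gauss (lam • w)| * (4 * wt (lam • w)) ^ 3 := by gcongr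
    _ = 192 * (|gauss (lam • w)| * wt (lam • w) ^ 3) := by ring
    _ ≤ 192 * C := by gcongr; exact hg _

/-- Differentiating the scaling relation at `λ = 1` gives the equation
`b + x·∇b = -2Δb` in integrated form. -/
theorem background_add_euler (h : IsHomField A β u) (hg : ∀ w, |gauss w| * wt w ^ 3 ≤ C)
    (hdg : ∀ i w, |pd i gauss w| * wt w ^ 3 ≤ C)
    (hddg : ∀ i j w, |pd j (pd i gauss) w| * wt w ^ 3 ≤ C) (k : Fin 2) (x : Plane) :
    conv gauss (u k) x + (x 0 * pd 0 (conv gauss (u k)) x + x 1 * pd 1 (conv gauss (u k)) x) =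
      -2 * (conv (pd 0 (pd 0 gauss)) (u k) x + conv (pd 1 (pd 1 gauss)) (u k) x) := by
  have hg1 : ContDiff ℝ 1 gauss := contDiff_gauss.of_le (by simp)
  have hd1 : ∀ i, ContDiff ℝ ∞ (pd i gauss) := fun i => contDiff_pd contDiff_gauss i
  have hc2 : ∀ i, Continuous (pd i (pd i gauss)) := fun i => (contDiff_pd (hd1 i) i).continuous
  have hb := contDiff_conv_kernel hg1 (fun w => mul_wt_sq_le (hg w)) (fun i w => mul_wt_sq_le (hdg i w))
    (h.meas k) (h.bound k)
  have hC : 0 ≤ C := (mul_nonneg (abs_nonneg _) (pow_nonneg (wt_pos 0).le 3)).trans (hg 0)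
  have hA := h.nonneg
  have i2 : ∀ i, Integrable fun z => pd i (pd i gauss) (x - z) * u k z := fun i =>
    integrable_kernel_mul (hc2 i) (fun w => mul_wt_sq_le (hddg i i w)) (h.meas k) (h.bound k) x
  -- the left side of the scaling relation
  have hL : HasDerivAt (fun lam : ℝ => lam * conv gauss (u k) (lam • x))
      (conv gauss (u k) x + (x 0 * pd 0 (conv gauss (u k)) x + x 1 * pd 1 (conv gauss (u k)) x)) 1 := by
    have h1 : HasDerivAt (fun lam : ℝ => lam • x) x 1 := by
      simpa using (hasDerivAt_id (1 : ℝ)).smul_const x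
    have h2 : HasFDerivAt (conv gauss (u k)) (fderiv ℝ (conv gauss (u k)) x) ((1 : ℝ) • x) := by
      rw [one_smul]; exact (hb.differentiable one_ne_zero x).hasFDerivAt
    have h3 := (hasDerivAt_id (1 : ℝ)).fun_mul (h2.comp_hasDerivAt 1 h1)
    refine h3.congr_deriv ?_
    simp only [id, Function.comp, one_smul, one_mul, fderiv_apply_eq]
  have hm : ∀ lam : ℝ, AEStronglyMeasurable fun z => lam ^ 2 * gauss (lam • (x - z)) * u k z :=
    fun lam => ((contDiff_gauss.continuous.comp
      (by fun_prop : Continuous fun z : Plane => lam • (x - z))).const_smul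
        (lam ^ 2)).aestronglyMeasurable.mul (h.meas k)
  have hR := (hasDerivAt_integral_of_dominated_loc_of_deriv_le (μ := (volume : Measure Plane))
    (F := fun lam z => lam ^ 2 * gauss (lam • (x - z)) * u k z)
    (F' := fun lam z => (2 * lam - lam ^ 3 * ‖x - z‖ ^ 2 / 2) * gauss (lam • (x - z)) * u k z)
    (x₀ := (1 : ℝ)) (s := Metric.ball 1 (1 / 2))
    (bound := fun z => 192 * C * A * (decay (x - z) * ‖z‖⁻¹))
    (Metric.ball_mem_nhds _ (by norm_num)) (Eventually.of_forall hm) ?_ ?_ ?_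
    ((integrable_decay_mul_norm_inv x).const_mul _) ?_).2
  · have hLR := hL.unique (hR.congr_of_eventuallyEq (by
      filter_upwards [Ioi_mem_nhds (zero_lt_one' ℝ)] with lam hl
      exact background_scaling h k x hl))
    rw [hLR, conv_apply', conv_apply', ← integral_add (i2 0) (i2 1), ← integral_const_mul]
    congr 1; ext z
    rw [pd_pd_gauss, pd_pd_gauss, one_smul, EuclideanSpace.norm_sq_eq, Fin.sum_univ_two]
    simp only [Real.norm_eq_abs, sq_abs, if_true]
    ring
  · have := integrable_kernel_mul contDiff_gauss.continuous (fun w => mul_wt_sq_le (hg w)) (h.meas k)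
      (h.bound k) x
    simpa using this
  · exact (by fun_prop : Continuous fun z : Plane => 2 * 1 - 1 ^ 3 * ‖x - z‖ ^ 2 / 2).aestronglyMeasurable.mul
      (contDiff_gauss.continuous.comp (by fun_prop : Continuous fun z : Plane =>
        (1 : ℝ) • (x - z))).aestronglyMeasurable |>.mul (h.meas k)
  · refine Eventually.of_forall fun z lam hl => ?_
    rw [Metric.mem_ball, Real.dist_eq, abs_lt] at hl
    have h1 := abs_le_mul_decay (abs_deriv_gauss_smul_le hg (x - z) (lam := lam)
      (by linarith [hl.1]) (by linarith [hl.2]))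
    rw [Real.norm_eq_abs, abs_mul]
    calc _ ≤ (192 * C * decay (x - z)) * (A * ‖z‖⁻¹) :=
          mul_le_mul h1 (h.bound k z) (abs_nonneg _) ((abs_nonneg _).trans h1)
      _ = _ := by ring
  · exact Eventually.of_forall fun z lam _ => (hasDerivAt_gauss_smul (x - z) lam).mul_const _

end

/-- The heat flow of a self-similar field is a background field, with constants depending only on
the size of the data and on the Hölder exponent. -/
theorem exists_isBackground {A β : ℝ} (hA : 0 ≤ A) (hβ : 0 < β) (hβ1 : β ≤ 1) :
    ∃ K, 0 ≤ K ∧ ∀ u, IsHomField A β u → IsBackground K fun k => conv gauss (u k) := by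
  obtain ⟨C, hC, hg, hdg, hddg⟩ := exists_gauss_bounds
  have hJ := potentialBound_nonneg
  set D := 2 * A * C * potentialBound with hD
  have hD0 : 0 ≤ D := by positivity
  have hlp : MemLp (fun x => wt x ^ (-((1 + β) / 2))) 2 := memLp_wt_rpow (by linarith)
  have hl0 : 0 ≤ l2 fun x => wt x ^ (-((1 + β) / 2)) := l2_nonneg _
  refine ⟨D * (1 + l2 fun x => wt x ^ (-((1 + β) / 2))), by positivity, fun u h => ?_⟩
  have hDK : D ≤ D * (1 + l2 fun x => wt x ^ (-((1 + β) / 2))) := by nlinarith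
  have hg1 : ContDiff ℝ 1 gauss := contDiff_gauss.of_le (by simp)
  have hd1 : ∀ i, ContDiff ℝ ∞ (pd i gauss) := fun i => contDiff_pd contDiff_gauss i
  have hd11 : ∀ i, ContDiff ℝ 1 (pd i gauss) := fun i => (hd1 i).of_le (by simp)
  have qg : ∀ w, |gauss w| * wt w ^ 2 ≤ C := fun w => mul_wt_sq_le (hg w)
  have qdg : ∀ i w, |pd i gauss w| * wt w ^ 2 ≤ C := fun i w => mul_wt_sq_le (hdg i w)
  have qddg : ∀ i j w, |pd j (pd i gauss) w| * wt w ^ 2 ≤ C := fun i j w => mul_wt_sq_le (hddg i j w)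
  have hcd : ∀ k, ContDiff ℝ 1 (conv gauss (u k)) := fun k =>
    contDiff_conv_kernel hg1 qg qdg (h.meas k) (h.bound k)
  have hpd : ∀ i k, pd i (conv gauss (u k)) = conv (pd i gauss) (u k) := fun i k =>
    pd_conv_kernel hg1 qg qdg (h.meas k) (h.bound k) i
  have hcd2 : ∀ i k, ContDiff ℝ 1 (conv (pd i gauss) (u k)) := fun i k =>
    contDiff_conv_kernel (hd11 i) (qdg i) (qddg i) (h.meas k) (h.bound k)
  have hpd2 : ∀ i k, pd i (conv (pd i gauss) (u k)) = conv (pd i (pd i gauss)) (u k) := fun i k =>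
    pd_conv_kernel (hd11 i) (qdg i) (qddg i) (h.meas k) (h.bound k) i
  have hbd : ∀ i k x, |conv (pd i gauss) (u k) x| * wt x ^ ((1 + β) / 2) ≤ D := fun i k x =>
    background_gradient_bound h hβ.le hβ1 hC hdg i k x
  have hbd' : ∀ i k x, |conv (pd i gauss) (u k) x| ≤ D * wt x ^ (-((1 + β) / 2)) := fun i k x => by
    have := hbd i k x
    rwa [← le_div_iff₀ (Real.rpow_pos_of_pos (wt_pos x) _), div_eq_mul_inv,
      ← Real.rpow_neg (wt_pos x).le] at this
  have hdl : ∀ i k x, |conv (pd i gauss) (u k) x| ≤ |D * wt x ^ (-((1 + β) / 2))| := fun i k x =>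
    (hbd' i k x).trans (le_abs_self _)
  refine ⟨hcd, fun k x => (background_bound h hC hg k x).trans hDK, fun i k x => ?_, fun i k => ?_,
    fun i k => ?_, fun x => ?_, fun k φ hφ hφc => ?_⟩
  · rw [hpd]
    refine le_trans ?_ ((hbd i k x).trans hDK)
    refine mul_le_mul_of_nonneg_left ?_ (abs_nonneg _)
    rw [Real.sqrt_eq_rpow]
    exact Real.rpow_le_rpow_of_exponent_le (one_le_wt x) (by linarith)
  · rw [hpd]
    exact memLp_of_abs_le (hlp.const_mul D) (hcd2 i k).continuous.aestronglyMeasurable (hdl i k)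
  · rw [hpd]
    refine (l2_mono (hlp.const_mul D) (hdl i k)).trans ?_
    rw [l2_const_mul, abs_of_nonneg hD0]
    linarith
  · rw [hpd, hpd]
    exact background_div h qg qdg x
  · have ic : ∀ i, Integrable fun x => conv (pd i (pd i gauss)) (u k) x * φ x := fun i =>
      ((continuous_conv_kernel (contDiff_pd (hd1 i) i).continuous (qddg i i) (h.meas k)
        (h.bound k)).mul hφ.continuous).integrable_of_hasCompactSupport hφc.mul_left
    have id : ∀ i, Integrable fun x => conv (pd i gauss) (u k) x * pd i φ x := fun i =>
      ((hcd2 i k).continuous.mul (continuous_pd hφ i)).integrable_of_hasCompactSupport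
        (hφc.pd i).mul_left
    have e : ∀ i, ∫ x, conv (pd i gauss) (u k) x * pd i φ x =
        -∫ x, conv (pd i (pd i gauss)) (u k) x * φ x := fun i => by
      rw [integral_mul_pd i (hcd2 i k) hφ hφc, hpd2]
    simp_rw [background_add_euler h hg hdg hddg k, hpd]
    rw [integral_add (id 0) (id 1), e, e, ← neg_add, ← integral_add (ic 0) (ic 1), ← integral_neg,
      ← integral_const_mul]
    congr 1; ext x
    ring

/-! ### Self-similar initial data -/

section
variable {A β : ℝ≥0} {u₀ : Plane → Plane}

theorem norm_le_of_circleHolderNorm_le (h : circleHolderNorm β u₀ ≤ A) {x : Plane} (hx : ‖x‖ = 1) :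
    ‖u₀ x‖ ≤ A := by
  have h1 : ‖u₀ x‖ₑ ≤ A := by
    refine le_trans ?_ (le_self_add.trans h)
    exact le_iSup (fun x : Metric.sphere (0 : Plane) 1 => ‖u₀ x‖ₑ) ⟨x, by simpa using hx⟩
  exact_mod_cast (show ‖u₀ x‖₊ ≤ A by exact_mod_cast h1)

theorem holderWith_of_circleHolderNorm_le (h : circleHolderNorm β u₀ ≤ A) :
    HolderWith A β fun x : Metric.sphere (0 : Plane) 1 => u₀ x := by
  have h1 : eHolderNorm β (fun x : Metric.sphere (0 : Plane) 1 => u₀ x) ≤ A := le_add_self.trans h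
  have h2 : MemHolder β fun x : Metric.sphere (0 : Plane) 1 => u₀ x :=
    eHolderNorm_lt_top.1 (h1.trans_lt ENNReal.coe_lt_top)
  rw [← h2.coe_nnHolderNorm_eq_eHolderNorm] at h1
  intro x y
  refine (h2.holderWith x y).trans ?_
  gcongr

theorem norm_sub_le_of_circleHolderNorm_le (h : circleHolderNorm β u₀ ≤ A) {x y : Plane}
    (hx : ‖x‖ = 1) (hy : ‖y‖ = 1) : ‖u₀ x - u₀ y‖ ≤ A * ‖x - y‖ ^ (β : ℝ) := by
  have := (holderWith_of_circleHolderNorm_le h).dist_le ⟨x, by simpa using hx⟩ ⟨y, by simpa using hy⟩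
  simpa [dist_eq_norm, Subtype.dist_eq] using this

theorem IsSelfSimilar.eq_smul (h : IsSelfSimilar u₀) {x : Plane} (hx : x ≠ 0) :
    u₀ x = ‖x‖⁻¹ • u₀ (‖x‖⁻¹ • x) :=
  (h _ (inv_pos.2 (norm_pos_iff.2 hx)) x hx).symm

theorem norm_normalize {x : Plane} (hx : x ≠ 0) : ‖‖x‖⁻¹ • x‖ = 1 := by
  rw [norm_smul, norm_inv, norm_norm, inv_mul_cancel₀ (norm_ne_zero_iff.2 hx)]

theorem IsSelfSimilar.norm_le (h : IsSelfSimilar u₀) (hA : circleHolderNorm β u₀ ≤ A) {x : Plane}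
    (hx : x ≠ 0) : ‖u₀ x‖ ≤ A * ‖x‖⁻¹ := by
  rw [h.eq_smul hx, norm_smul, norm_inv, norm_norm, mul_comm]
  exact mul_le_mul_of_nonneg_right (norm_le_of_circleHolderNorm_le hA (norm_normalize hx)) (by positivity)

theorem IsSelfSimilar.continuousOn (h : IsSelfSimilar u₀) (hβ : 0 < β)
    (hA : circleHolderNorm β u₀ ≤ A) : ContinuousOn u₀ {0}ᶜ := by
  have hU := (holderWith_of_circleHolderNorm_le hA).continuous hβ
  rw [continuousOn_iff_continuous_domRestrict]
  have hne : ∀ x : ({0}ᶜ : Set Plane), (x : Plane) ≠ 0 := fun x => x.2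
  have e : Set.domRestrict {0}ᶜ u₀ = fun x : ({0}ᶜ : Set Plane) => ‖(x : Plane)‖⁻¹ •
      (fun x : Metric.sphere (0 : Plane) 1 => u₀ x)
        ⟨‖(x : Plane)‖⁻¹ • (x : Plane), by simpa using norm_normalize (hne x)⟩ :=
    funext fun x => h.eq_smul (hne x)
  have hi : Continuous fun x : ({0}ᶜ : Set Plane) => ‖(x : Plane)‖⁻¹ :=
    (continuous_norm.comp continuous_subtype_val).inv₀ fun x => norm_ne_zero_iff.2 (hne x)
  rw [e]
  exact hi.smul (hU.comp ((hi.smul continuous_subtype_val).subtype_mk _))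

theorem IsSelfSimilar.aestronglyMeasurable (h : IsSelfSimilar u₀) (hβ : 0 < β)
    (hA : circleHolderNorm β u₀ ≤ A) : AEStronglyMeasurable u₀ := by
  have := (h.continuousOn hβ hA).aestronglyMeasurable (μ := volume)
    (measurableSet_singleton (0 : Plane)).compl
  rwa [restrict_compl_singleton] at this

theorem norm_normalize_sub_le {x z : Plane} (hx : x ≠ 0) (hz : z ≠ 0) :
    ‖‖z‖⁻¹ • z - ‖x‖⁻¹ • x‖ ≤ 2 * ‖x - z‖ / ‖x‖ := by
  have hx0 := norm_pos_iff.2 hx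
  have hz0 := norm_pos_iff.2 hz
  have e : ‖z‖⁻¹ • z - ‖x‖⁻¹ • x = (‖z‖⁻¹ - ‖x‖⁻¹) • z + ‖x‖⁻¹ • (z - x) := by
    rw [sub_smul, smul_sub]; abel
  have h1 : ‖(‖z‖⁻¹ - ‖x‖⁻¹) • z‖ = |‖x‖ - ‖z‖| / ‖x‖ := by
    have : ‖z‖⁻¹ - ‖x‖⁻¹ = (‖x‖ - ‖z‖) / (‖z‖ * ‖x‖) := by field_simp
    rw [norm_smul, this, Real.norm_eq_abs, abs_div, abs_of_pos (by positivity : 0 < ‖z‖ * ‖x‖)]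
    field_simp
  have h2 : ‖‖x‖⁻¹ • (z - x)‖ = ‖x - z‖ / ‖x‖ := by
    rw [norm_smul, norm_inv, norm_norm, norm_sub_rev, div_eq_inv_mul]
  rw [e]
  refine (norm_add_le _ _).trans ?_
  rw [h1, h2, ← add_div]
  gcongr
  linarith [abs_norm_sub_norm_le x z]

theorem rpow_le_one_add {t b : ℝ} (ht : 0 ≤ t) (hb : 0 ≤ b) (hb1 : b ≤ 1) : t ^ b ≤ 1 + t := by
  rcases le_total t 1 with h | h
  · linarith [Real.rpow_le_one ht h hb]
  · have := Real.rpow_le_rpow_of_exponent_le h hb1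
    rw [Real.rpow_one] at this
    linarith

/-- The difference is split into the variation of the direction and that of the modulus. -/
theorem IsSelfSimilar.norm_sub_le (h : IsSelfSimilar u₀) (hβ1 : β ≤ 1)
    (hA : circleHolderNorm β u₀ ≤ A) {x z : Plane} (hx : 1 ≤ ‖x‖) (hz : z ≠ 0) :
    ‖u₀ z - u₀ x‖ ≤ 4 * A * ‖x‖ ^ (-(1 + (β : ℝ))) * (wt (x - z) * (1 + ‖z‖⁻¹)) := by
  have hx0 : 0 < ‖x‖ := by linarith
  have hxn : x ≠ 0 := norm_pos_iff.1 hx0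
  have hz0 := norm_pos_iff.2 hz
  have hβ1' : (β : ℝ) ≤ 1 := by exact_mod_cast hβ1
  have hw0 := norm_nonneg (x - z)
  have hw1 : 2 * ‖x - z‖ ≤ wt (x - z) := by simp only [wt]; nlinarith [sq_nonneg (‖x - z‖ - 1)]
  have hw2 := one_le_wt (x - z)
  have hi : 0 ≤ ‖z‖⁻¹ := by positivity
  set r := ‖x‖ ^ (-(1 + (β : ℝ))) with hr
  have hr0 : 0 ≤ r := Real.rpow_nonneg hx0.le _
  have e : u₀ z - u₀ x = ‖x‖⁻¹ • (u₀ (‖z‖⁻¹ • z) - u₀ (‖x‖⁻¹ • x))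
      + (‖z‖⁻¹ - ‖x‖⁻¹) • u₀ (‖z‖⁻¹ • z) := by
    rw [h.eq_smul hz, h.eq_smul hxn, smul_sub, sub_smul]; abel
  have h1 : ‖‖x‖⁻¹ • (u₀ (‖z‖⁻¹ • z) - u₀ (‖x‖⁻¹ • x))‖ ≤ 2 * A * r * wt (x - z) := by
    rw [norm_smul, norm_inv, norm_norm]
    have h2 := norm_sub_le_of_circleHolderNorm_le hA (norm_normalize hz) (norm_normalize hxn)
    have h3 : ‖‖z‖⁻¹ • z - ‖x‖⁻¹ • x‖ ^ (β : ℝ) ≤ (2 * wt (x - z)) * ‖x‖ ^ (-(β : ℝ)) := by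
      calc _ ≤ (2 * ‖x - z‖ / ‖x‖) ^ (β : ℝ) :=
            Real.rpow_le_rpow (norm_nonneg _) (norm_normalize_sub_le hxn hz) β.2
        _ = (2 * ‖x - z‖) ^ (β : ℝ) * ‖x‖ ^ (-(β : ℝ)) := by
            rw [Real.div_rpow (by positivity) hx0.le, Real.rpow_neg hx0.le, div_eq_mul_inv]
        _ ≤ _ := by
            refine mul_le_mul_of_nonneg_right ?_ (Real.rpow_nonneg hx0.le _)
            linarith [rpow_le_one_add (t := 2 * ‖x - z‖) (by positivity) β.coe_nonneg hβ1']
    have h4 : ‖x‖⁻¹ * ‖x‖ ^ (-(β : ℝ)) = r := by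
      rw [hr, ← Real.rpow_neg_one, ← Real.rpow_add hx0]; congr 1; ring
    calc _ ≤ ‖x‖⁻¹ * (A * ((2 * wt (x - z)) * ‖x‖ ^ (-(β : ℝ)))) := by
          gcongr; exact h2.trans (by gcongr)
      _ = 2 * A * (‖x‖⁻¹ * ‖x‖ ^ (-(β : ℝ))) * wt (x - z) := by ring
      _ = _ := by rw [h4]
  have h5 : ‖(‖z‖⁻¹ - ‖x‖⁻¹) • u₀ (‖z‖⁻¹ • z)‖ ≤ 2 * A * r * (wt (x - z) * (1 + ‖z‖⁻¹)) := by
    have h6 : |‖z‖⁻¹ - ‖x‖⁻¹| ≤ ‖x - z‖ * (1 + ‖x - z‖ * ‖z‖⁻¹) * (‖x‖⁻¹ * ‖x‖⁻¹) := by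
      have e1 : ‖z‖⁻¹ - ‖x‖⁻¹ = (‖x‖ - ‖z‖) * (‖x‖ * ‖z‖⁻¹) * (‖x‖⁻¹ * ‖x‖⁻¹) := by field_simp
      have h7 : ‖x‖ * ‖z‖⁻¹ ≤ 1 + ‖x - z‖ * ‖z‖⁻¹ := by
        have h8 : ‖x‖ ≤ ‖x - z‖ + ‖z‖ := by simpa using norm_add_le (x - z) z
        calc ‖x‖ * ‖z‖⁻¹ ≤ (‖x - z‖ + ‖z‖) * ‖z‖⁻¹ := by gcongr
          _ = _ := by linear_combination mul_inv_cancel₀ hz0.ne'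
      rw [e1, abs_mul, abs_mul, abs_of_nonneg (by positivity : 0 ≤ ‖x‖ * ‖z‖⁻¹),
        abs_of_nonneg (by positivity : 0 ≤ ‖x‖⁻¹ * ‖x‖⁻¹)]
      gcongr
      exact abs_norm_sub_norm_le x z
    have h9 : ‖x‖⁻¹ * ‖x‖⁻¹ ≤ r := by
      rw [hr, ← Real.rpow_neg_one, ← Real.rpow_add hx0]
      exact Real.rpow_le_rpow_of_exponent_le hx (by linarith)
    have h10 : ‖x - z‖ * (1 + ‖x - z‖ * ‖z‖⁻¹) ≤ wt (x - z) * (1 + ‖z‖⁻¹) := by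
      have : ‖x - z‖ * ‖x - z‖ ≤ wt (x - z) := by simp only [wt]; nlinarith
      nlinarith
    rw [norm_smul, Real.norm_eq_abs]
    have hq : 0 ≤ wt (x - z) * (1 + ‖z‖⁻¹) := by have := wt_pos (x - z); positivity
    calc _ ≤ (wt (x - z) * (1 + ‖z‖⁻¹) * r) * A := by
          refine mul_le_mul (h6.trans ?_) (norm_le_of_circleHolderNorm_le hA (norm_normalize hz))
            (norm_nonneg _) (by positivity)
          exact mul_le_mul h10 h9 (by positivity) hq
      _ = 1 * (A * r * (wt (x - z) * (1 + ‖z‖⁻¹))) := by ring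
      _ ≤ 2 * (A * r * (wt (x - z) * (1 + ‖z‖⁻¹))) := by
          refine mul_le_mul_of_nonneg_right (by norm_num) (by positivity)
      _ = _ := by ring
  rw [e]
  refine (norm_add_le _ _).trans ((add_le_add h1 h5).trans ?_)
  have : 2 * A * r * wt (x - z) ≤ 2 * A * r * (wt (x - z) * (1 + ‖z‖⁻¹)) := by
    have := wt_pos (x - z)
    refine mul_le_mul_of_nonneg_left ?_ (by positivity)
    exact le_mul_of_one_le_right this.le (by linarith)
  linarith

/-- The components of a vector field, set to zero at the origin, where self-similarity says nothing
about the value. -/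
noncomputable def puncture (u₀ : Plane → Plane) (k : Fin 2) (z : Plane) : ℝ := if z = 0 then 0 else u₀ z k

theorem puncture_of_ne {z : Plane} (hz : z ≠ 0) (k : Fin 2) : puncture u₀ k z = u₀ z k := if_neg hz

theorem puncture_ae_eq (k : Fin 2) : puncture u₀ k =ᵐ[volume] fun z => u₀ z k := by
  filter_upwards [ae_ne_zero] with z hz
  exact puncture_of_ne hz k

theorem abs_apply_le (x : Plane) (k : Fin 2) : |x k| ≤ ‖x‖ := by
  simpa using PiLp.norm_apply_le x k

theorem isHomField_puncture (h : IsSelfSimilar u₀) (hd : IsWeaklyDivFree u₀) (hβ : 0 < β)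
    (hβ1 : β ≤ 1) (hA : circleHolderNorm β u₀ ≤ A) : IsHomField (4 * A) β (puncture u₀) where
  meas k := by
    refine AEStronglyMeasurable.congr ?_ (puncture_ae_eq k).symm
    exact (EuclideanSpace.proj (𝕜 := ℝ) k : Plane →L[ℝ] ℝ).continuous.comp_aestronglyMeasurable
      (h.aestronglyMeasurable hβ hA)
  bound k z := by
    by_cases hz : z = 0
    · simp [puncture, hz]
    · rw [puncture_of_ne hz]
      refine (abs_apply_le _ k).trans ((h.norm_le hA hz).trans ?_)
      gcongr
      linarith [A.2]
  homog k z lam hl := by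
    by_cases hz : z = 0
    · simp [puncture, hz]
    · have hz' : lam • z ≠ 0 := smul_ne_zero hl.ne' hz
      rw [puncture_of_ne hz, puncture_of_ne hz', ← h lam hl z hz]
      simp
  holder k x z hx hz := by
    have hxn : x ≠ 0 := norm_pos_iff.1 (by linarith)
    rw [puncture_of_ne hz, puncture_of_ne hxn]
    exact (abs_apply_le (u₀ z - u₀ x) k).trans (h.norm_sub_le hβ1 hA hx hz)
  div ψ hψ := by
    refine Eq.trans (integral_congr_ae ?_) (hd ψ hψ.contDiff hψ.compact)
    filter_upwards [ae_ne_zero] with x hx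
    rw [puncture_of_ne hx, puncture_of_ne hx, fderiv_apply_eq]
    ring

/-- The value at the origin does not matter for the heat flow. -/
theorem heatFlow_apply (h : IsSelfSimilar u₀) (hβ : 0 < β) (hA : circleHolderNorm β u₀ ≤ A)
    (x : Plane) (k : Fin 2) : heatFlow 1 u₀ x k = conv gauss (puncture u₀ k) x := by
  obtain ⟨C, hC, hg, -, -⟩ := exists_gauss_bounds
  have hm := h.aestronglyMeasurable hβ hA
  have hc : Continuous fun z : Plane => gauss (x - z) := contDiff_gauss.continuous.comp (by fun_prop)
  have e1 : heatFlow 1 u₀ x = ∫ z, gauss (x - z) • u₀ z := by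
    simp only [heatFlow, gauss, mul_one]
  have hi : Integrable fun z => gauss (x - z) • u₀ z := by
    refine ((integrable_decay_mul_norm_inv x).const_mul (C * A)).mono'
      (hc.aestronglyMeasurable.smul hm) ?_
    filter_upwards [ae_ne_zero] with z hz
    rw [norm_smul, Real.norm_eq_abs]
    calc |gauss (x - z)| * ‖u₀ z‖ ≤ (C * decay (x - z)) * (A * ‖z‖⁻¹) :=
          mul_le_mul (abs_le_mul_decay (mul_wt_sq_le (hg _))) (h.norm_le hA hz) (norm_nonneg _)
            (mul_nonneg hC (decay_pos _).le)
      _ = _ := by ring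
  have e2 := (EuclideanSpace.proj (𝕜 := ℝ) k : Plane →L[ℝ] ℝ).integral_comp_comm hi
  rw [e1, conv_apply']
  refine Eq.trans e2.symm (integral_congr_ae ?_)
  filter_upwards [ae_ne_zero] with z hz
  rw [puncture_of_ne hz]
  simp

end

/-! ### Passage to components -/

section
variable {v w v₀ φ : Plane → Plane} {q ψ : Plane → ℝ} {K M C : ℝ}

theorem fderiv_apply_comp {x : Plane} (hv : DifferentiableAt ℝ v x) (y : Plane) (k : Fin 2) :
    fderiv ℝ v x y k = fderiv ℝ (fun z => v z k) x y := by
  have h := ((EuclideanSpace.proj (𝕜 := ℝ) k : Plane →L[ℝ] ℝ).hasFDerivAt.comp x hv.hasFDerivAt).fderiv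
  have e : (⇑(EuclideanSpace.proj (𝕜 := ℝ) k : Plane →L[ℝ] ℝ) ∘ v) = fun z => v z k := rfl
  rw [e] at h
  rw [h]
  simp

theorem convect_apply {x : Plane} (hv : DifferentiableAt ℝ v x) (a : Plane → Plane) (k : Fin 2) :
    convect a v x k = a x 0 * pd 0 (fun z => v z k) x + a x 1 * pd 1 (fun z => v z k) x := by
  rw [convect, fderiv_apply_comp hv, fderiv_apply_eq]

theorem divergence_eq {x : Plane} (hv : DifferentiableAt ℝ v x) :
    divergence v x = pd 0 (fun z => v z 0) x + pd 1 (fun z => v z 1) x := by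
  simp [divergence, fderiv_apply_comp hv, pd]

theorem contDiff_apply (hv : ContDiff ℝ 1 v) (k : Fin 2) : ContDiff ℝ 1 fun x => v x k :=
  (EuclideanSpace.proj (𝕜 := ℝ) k : Plane →L[ℝ] ℝ).contDiff.comp hv

/-- The components of a field of the class `X`. -/
theorem MemX.exists_isPerturbation (h : MemX v) : ∃ M, IsPerturbation M fun k x => v x k := by
  obtain ⟨M, hM⟩ := h.bounded
  have hd := h.contDiff.differentiable one_ne_zero
  refine ⟨M, fun k => contDiff_apply h.contDiff k, fun k x => ?_, fun i k x => ?_, fun x => ?_⟩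
  · refine le_trans ?_ (hM x).1
    rw [mul_comm]
    exact mul_le_mul_of_nonneg_left (abs_apply_le _ k) (wt_pos x).le
  · refine le_trans ?_ (hM x).2
    rw [mul_comm]
    refine mul_le_mul_of_nonneg_left ?_ (wt_pos x).le
    rw [pd, ← fderiv_apply_comp (hd x)]
    refine (abs_apply_le _ k).trans (((fderiv ℝ v x).le_opNorm (e i)).trans ?_)
    rw [norm_e, mul_one]
  · rw [← divergence_eq (hd x)]; exact h.div_eq_zero x

theorem inner_smul_e (a : Plane) (c : ℝ) (k : Fin 2) : inner ℝ a (c • e k) = c * a k := by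
  simp [e, inner_smul_right, EuclideanSpace.inner_single_right]

theorem fderiv_smul_e (hψ : Differentiable ℝ ψ) (x y : Plane) (k : Fin 2) :
    fderiv ℝ (fun z => ψ z • e k) x y = fderiv ℝ ψ x y • e k := by
  rw [((hψ x).hasFDerivAt.smul_const (e k)).fderiv]
  simp

/-- Testing with `ψ e_k` gives the weak equation for the `k`-th component; the right-hand side is the
part `(v₀ · ∇) v₀` of `(V · ∇) V`. -/
theorem SolvesMomentum.isWeakSol (h : SolvesMomentum v₀ v q) (hv : ContDiff ℝ 1 v)
    (hv₀ : ContDiff ℝ 1 v₀) : IsWeakSol (fun k x => v₀ x k) (fun k x => v x k) q := by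
  refine ⟨h.1, fun k ψ hψ => ?_⟩
  have hvd := hv.differentiable one_ne_zero
  have hvd₀ := hv₀.differentiable one_ne_zero
  have hψd : Differentiable ℝ ψ := hψ.contDiff.differentiable (by simp)
  have hvc : ∀ j, Continuous fun x => v x j := fun j => (contDiff_apply hv j).continuous
  have hvc₀ : ∀ j, Continuous fun x => v₀ x j := fun j => (contDiff_apply hv₀ j).continuous
  have hp : ∀ i j, Continuous (pd i fun x => v x j) := fun i j => continuous_pd (contDiff_apply hv j) i
  have hp₀ : ∀ i j, Continuous (pd i fun x => v₀ x j) := fun i j =>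
    continuous_pd (contDiff_apply hv₀ j) i
  have hψ1 : ContDiff ℝ 1 ψ := hψ.contDiff.of_le (by simp)
  have hpψ : ∀ i, Continuous (pd i ψ) := continuous_pd hψ1
  have hx : ∀ i : Fin 2, Continuous fun x : Plane => x i := fun i => (differentiable_coord i).continuous
  have key := h.2 (fun x => ψ x • e k) (hψ.contDiff.smul contDiff_const) hψ.compact.smul_right
  have e1 : ∀ y, gradInner v (fun x => ψ x • e k) y
        - (1 / 2) * inner ℝ (v y) (ψ y • e k)
        - (1 / 2) * inner ℝ (convect (fun z => z) v y) (ψ y • e k)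
        + inner ℝ (convect v₀ v y + convect v v₀ y + convect v v y) (ψ y • e k)
        - q y * divergence (fun x => ψ x • e k) y =
      (pd 0 ψ y * pd 0 (fun x => v x k) y + pd 1 ψ y * pd 1 (fun x => v x k) y
        + ψ y * (-(1 / 2) * v y k
          - (1 / 2) * (y 0 * pd 0 (fun x => v x k) y + y 1 * pd 1 (fun x => v x k) y)
          + ((v₀ y 0 * pd 0 (fun x => v x k) y + v₀ y 1 * pd 1 (fun x => v x k) y)
            + (v y 0 * pd 0 (fun x => v₀ x k) y + v y 1 * pd 1 (fun x => v₀ x k) y)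
            + (v y 0 * pd 0 (fun x => v x k) y + v y 1 * pd 1 (fun x => v x k) y))))
        - q y * pd k ψ y := fun y => by
    have h1 : divergence (fun x => ψ x • e k) y = pd k ψ y := by
      simp only [divergence, fderiv_smul_e hψd, Fin.sum_univ_two]
      fin_cases k <;> simp [e, pd]
    have h2 : gradInner v (fun x => ψ x • e k) y =
        pd 0 ψ y * pd 0 (fun x => v x k) y + pd 1 ψ y * pd 1 (fun x => v x k) y := by
      simp only [gradInner, fderiv_smul_e hψd, inner_smul_e, Fin.sum_univ_two,
        fderiv_apply_comp (hvd y)]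
      rfl
    rw [h1, h2, inner_smul_e, inner_smul_e, inner_smul_e, PiLp.add_apply, PiLp.add_apply,
      convect_apply (hvd y), convect_apply (hvd y), convect_apply (hvd y), convect_apply (hvd₀ y)]
    ring
  have e2 : ∀ y, inner ℝ (convect v₀ v₀ y) (ψ y • e k) =
      ψ y * (v₀ y 0 * pd 0 (fun x => v₀ x k) y + v₀ y 1 * pd 1 (fun x => v₀ x k) y) := fun y => by
    rw [inner_smul_e, convect_apply (hvd₀ y)]
  simp_rw [e1, e2] at key
  have iq : Integrable fun y => q y * pd k ψ y := by
    have := h.1.integrable_smul_left_of_hasCompactSupport (hpψ k) (hψ.compact.pd k)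
    refine this.congr (Eventually.of_forall fun y => ?_)
    simp [mul_comm]
  have hs : ∀ i, HasCompactSupport (pd i ψ) := hψ.compact.pd
  have i1 : ∀ i, Integrable fun y => pd i ψ y * pd i (fun x => v x k) y := fun i =>
    ((hpψ i).mul (hp i k)).integrable_of_hasCompactSupport (hs i).mul_right
  have i2 : ∀ f : Plane → ℝ, Continuous f → Integrable fun y => ψ y * f y := fun f hf =>
    (hψ1.continuous.mul hf).integrable_of_hasCompactSupport hψ.compact.mul_right
  have iA := integrable_fun_sub (integrable_fun_add (integrable_fun_add (i1 0) (i1 1))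
    (i2 (fun y => -(1 / 2) * v y k
          - (1 / 2) * (y 0 * pd 0 (fun x => v x k) y + y 1 * pd 1 (fun x => v x k) y)
          + ((v₀ y 0 * pd 0 (fun x => v x k) y + v₀ y 1 * pd 1 (fun x => v x k) y)
            + (v y 0 * pd 0 (fun x => v₀ x k) y + v y 1 * pd 1 (fun x => v₀ x k) y)
            + (v y 0 * pd 0 (fun x => v x k) y + v y 1 * pd 1 (fun x => v x k) y)))
      (by fun_prop))) iq
  have iB := i2 (fun y => v₀ y 0 * pd 0 (fun x => v₀ x k) y + v₀ y 1 * pd 1 (fun x => v₀ x k) y)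
    (by fun_prop)
  rw [eq_neg_iff_add_eq_zero, ← integral_add iA iB] at key
  refine Eq.trans (integral_congr_ae (Eventually.of_forall fun y => ?_)) key
  have et : ∀ i, pd i (total (fun k x => v₀ x k) (fun k x => v x k) k) y =
      pd i (fun x => v₀ x k) y + pd i (fun x => v x k) y := fun i =>
    pd_add ((contDiff_apply hv₀ k).differentiable one_ne_zero)
      ((contDiff_apply hv k).differentiable one_ne_zero) i y
  simp only [force, et]
  simp only [total]
  ring

end

/-! ### The `H²` norm -/

theorem eLpNorm_le_of_components {f : Plane → Plane} {C : ℝ} (h : ∀ k, MemLp (fun x => f x k) 2)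
    (hC : ∀ k, l2 (fun x => f x k) ≤ C) : MemLp f 2 ∧ eLpNorm f 2 volume ≤ ENNReal.ofReal (2 * C) := by
  have hm : AEStronglyMeasurable f := by
    have : f = fun x => f x 0 • e 0 + f x 1 • e 1 := funext fun x => decomp (f x)
    rw [this]
    exact ((h 0).1.smul_const _).add ((h 1).1.smul_const _)
  have hb : ∀ x, ‖f x‖ ≤ |f x 0| + |f x 1| := fun x => by
    conv_lhs => rw [decomp (f x)]
    refine (norm_add_le _ _).trans ?_
    simp [norm_smul, norm_e]
  have ha : ∀ k, MemLp (fun x => |f x k|) 2 := fun k => (h k).abs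
  have hs := (ha 0).add (ha 1)
  have hk : ∀ k, eLpNorm (fun x => |f x k|) 2 volume ≤ ENNReal.ofReal C := fun k => by
    rw [← ENNReal.ofReal_toReal (ha k).eLpNorm_ne_top]
    refine ENNReal.ofReal_le_ofReal ?_
    have := l2_abs fun x => f x k
    rw [l2] at this
    rw [this]
    exact hC k
  refine ⟨hs.of_le hm (Eventually.of_forall fun x => ?_), ?_⟩
  · exact (hb x).trans (le_abs_self _)
  · refine (eLpNorm_mono (g := (fun x => |f x 0|) + fun x => |f x 1|) fun x =>
      (hb x).trans (le_abs_self _)).trans ?_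
    refine (eLpNorm_add_le (ha 0).1 (ha 1).1 (by norm_num)).trans ?_
    refine (add_le_add (hk 0) (hk 1)).trans ?_
    have hC0 : 0 ≤ C := (l2_nonneg _).trans (hC 0)
    rw [← ENNReal.ofReal_add hC0 hC0, two_mul]

/-- Weak derivatives of vector fields are taken componentwise. -/
theorem isWeakPartial_of_components {f g : Plane → Plane} {i : Fin 2} (hf : MemLp f 2)
    (hg : MemLp g 2) (h : ∀ k ψ, IsTest ψ → ∫ x, f x k * pd i ψ x = -∫ x, g x k * ψ x) :
    IsWeakPartial i f g := by
  intro ψ h1 h2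
  have hψ : IsTest ψ := ⟨h1, h2⟩
  have hfi : Integrable fun x => fderiv ℝ ψ x (e i) • f x :=
    (hf.locallyIntegrable (by norm_num)).integrable_smul_left_of_hasCompactSupport
      (continuous_pd (h1.of_le (by simp)) i) (h2.pd i)
  have hgi : Integrable fun x => ψ x • g x :=
    (hg.locallyIntegrable (by norm_num)).integrable_smul_left_of_hasCompactSupport h1.continuous h2
  ext k
  have e1 := (EuclideanSpace.proj (𝕜 := ℝ) k : Plane →L[ℝ] ℝ).integral_comp_comm hfi
  have e2 := (EuclideanSpace.proj (𝕜 := ℝ) k : Plane →L[ℝ] ℝ).integral_comp_comm hgi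
  have hp : ∀ y : Plane, (EuclideanSpace.proj (𝕜 := ℝ) k : Plane →L[ℝ] ℝ) y = y k := fun _ => rfl
  simp only [hp, PiLp.smul_apply, smul_eq_mul] at e1 e2
  rw [PiLp.neg_apply, ← e1, ← e2]
  refine Eq.trans (integral_congr_ae (Eventually.of_forall fun x => mul_comm _ _)) ((h k ψ hψ).trans ?_)
  exact congrArg Neg.neg (integral_congr_ae (Eventually.of_forall fun x => mul_comm _ _))

theorem eH2Norm_le {f : Plane → Plane} {C : ℝ} (hC : 0 ≤ C)
    (h : ∀ k, IsH2Bounded C fun x => f x k) : eH2Norm f ≤ ENNReal.ofReal (6 * C) := by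
  choose H hH hHC hHw using fun k => (h k).weak_hessian
  set g : Fin 2 → Plane → Plane := fun i x => WithLp.toLp 2 fun k => pd i (fun x => f x k) x with hg
  set hh : Fin 2 → Fin 2 → Plane → Plane := fun i j x => WithLp.toLp 2 fun k => H k i j x with hhh
  have b0 := eLpNorm_le_of_components (f := f) (fun k => (h k).memLp) fun k => (h k).l2_le
  have b1 : ∀ i, _ := fun i => eLpNorm_le_of_components (f := g i) (C := C)
    (fun k => (h k).memLp_pd i) fun k => (h k).l2_pd_le i
  have b2 : ∀ i j, _ := fun i j => eLpNorm_le_of_components (f := hh i j) (C := C)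
    (fun k => hH k i j) fun k => hHC k i j
  have hjet : IsH2Jet f g hh := by
    refine ⟨b0.1, fun i => (b1 i).1, fun i j => (b2 i j).1, fun i => ?_, fun i j => ?_⟩
    · refine isWeakPartial_of_components b0.1 (b1 i).1 fun k ψ hψ => ?_
      exact integral_mul_pd i (h k).contDiff (hψ.contDiff.of_le (by simp)) hψ.compact
    · exact isWeakPartial_of_components (b1 i).1 (b2 i j).1 fun k ψ hψ => hHw k i j ψ hψ
  unfold eH2Norm
  refine iInf_le_of_le g ?_
  refine iInf_le_of_le hh ?_
  refine iInf_le_of_le hjet ?_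
  have hs : ∀ {a : ENNReal}, a ≤ ENNReal.ofReal (2 * C) → a ^ 2 ≤ ENNReal.ofReal ((2 * C) ^ 2) :=
    fun {a} ha => by
      rw [ENNReal.ofReal_pow (by positivity)]
      gcongr
  have hsum : eLpNorm f 2 volume ^ 2 + ∑ i, eLpNorm (g i) 2 volume ^ 2
      + ∑ i, ∑ j, eLpNorm (hh i j) 2 volume ^ 2 ≤ ENNReal.ofReal ((6 * C) ^ 2) := by
    calc _ ≤ ENNReal.ofReal ((2 * C) ^ 2) + ∑ _i : Fin 2, ENNReal.ofReal ((2 * C) ^ 2)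
          + ∑ _i : Fin 2, ∑ _j : Fin 2, ENNReal.ofReal ((2 * C) ^ 2) :=
          add_le_add (add_le_add (hs b0.2) (Finset.sum_le_sum fun i _ => hs (b1 i).2))
            (Finset.sum_le_sum fun i _ => Finset.sum_le_sum fun j _ => hs (b2 i j).2)
      _ = ENNReal.ofReal (7 * (2 * C) ^ 2) := by
          simp only [Finset.sum_const, Finset.card_univ, Fintype.card_fin, nsmul_eq_mul]
          rw [ENNReal.ofReal_mul (by norm_num)]
          have : ENNReal.ofReal 7 = 7 := by norm_num
          rw [this]; push_cast; ring
      _ ≤ _ := ENNReal.ofReal_le_ofReal (by nlinarith [sq_nonneg C])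
  calc _ ≤ ENNReal.ofReal ((6 * C) ^ 2) ^ (1 / 2 : ℝ) := ENNReal.rpow_le_rpow hsum (by norm_num)
    _ = ENNReal.ofReal (6 * C) := by
      rw [ENNReal.ofReal_rpow_of_nonneg (by positivity) (by norm_num), ← Real.sqrt_eq_rpow,
        Real.sqrt_sq (by positivity)]

end PerturbedLeray

theorem proposition3p3 (β : ℝ≥0) (hβ_pos : 0 < β) (hβ_le : β ≤ 1) (A : ℝ≥0) :
    ∃ C : ℝ≥0, ∀ (u₀ v_re : PerturbedLeray.Plane → PerturbedLeray.Plane)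
      (q : PerturbedLeray.Plane → ℝ),
      PerturbedLeray.IsSelfSimilar u₀ →
      PerturbedLeray.IsWeaklyDivFree u₀ →
      PerturbedLeray.circleHolderNorm β u₀ ≤ A →
      PerturbedLeray.MemX v_re →
      PerturbedLeray.SolvesMomentum (PerturbedLeray.heatFlow 1 u₀) v_re q →
      PerturbedLeray.eH2Norm v_re ≤ C ∧
      PerturbedLeray.eH2Norm (fun y => Real.sqrt (1 + ‖y‖ ^ 2) • v_re y) ≤ C := by
  obtain ⟨K, hK0, hK⟩ := PerturbedLeray.exists_isBackground (A := 4 * A) (β := β) (by positivity)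
    (by exact_mod_cast hβ_pos) (by exact_mod_cast hβ_le)
  obtain ⟨C, hC0, hC⟩ := PerturbedLeray.exists_h2_bound K hK0
  refine ⟨Real.toNNReal (6 * C), fun u₀ v q hu hdiv hA hv hq => ?_⟩
  have hb := hK _ (PerturbedLeray.isHomField_puncture hu hdiv hβ_pos hβ_le hA)
  have e : (fun k => PerturbedLeray.conv PerturbedLeray.gauss (PerturbedLeray.puncture u₀ k)) =
      fun k x => PerturbedLeray.heatFlow 1 u₀ x k := by
    ext k x
    exact (PerturbedLeray.heatFlow_apply hu hβ_pos hA x k).symm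
  rw [e] at hb
  have h0 : ContDiff ℝ 1 (PerturbedLeray.heatFlow 1 u₀) := contDiff_euclidean.2 hb.contDiff
  obtain ⟨M, hM⟩ := hv.exists_isPerturbation
  have hH := hC M _ _ q hb hM (hq.isWeakSol hv.contDiff h0)
  exact ⟨PerturbedLeray.eH2Norm_le hC0 fun k => (hH k).1,
    PerturbedLeray.eH2Norm_le hC0 fun k => (hH k).2⟩
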